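/- We work over $\mathbb{C}$; points are closed points. Let $X$ be a smooth quasi-projective surface, $L$ a line bundle on $X$ and $n\ge 3$. Let $\pi:X^n\to S^nX=X^n/\mathfrak{S}_n$ be the quotient map, $p_i:X^n\to X$ the projections, $\Delta_{ij}\subset X^n$ the diagonal $\{x_i=x_j\}$ with ideal sheaf $\mathcal{I}_{\Delta_{ij}}$, and $w_3:X\times S^{n-3}X\to S^nX$ the map $(x,t)\mapsto 3x+t$. Put $L^{(2,1,1)}=p_1^*L^{\otimes 2}\otimes p_2^*L\otimes p_3^*L$ and, for $l\in\mathbb{N}$, $$\mathcal{L}^{2,1,1}(-l\Delta)=\pi_*\Big(L^{(2,1,1)}\otimes\bigcap_{1\le i<j\le 3}\mathcal{I}_{\Delta_{ij}}^{\,l}\Big)^{\mathfrak{S}(\{2,3\})\times\mathfrak{S}(\{4,\dots,n\})},$$ $$\mathcal{K}^1_{(1)(1)}(-l\Delta)=\pi_*\Big((\Omega^1_X\otimes L^{3})_{\{12\}}\otimes p_3^*L\otimes\mathcal{I}_{\Delta_{23}}^{\,l}\Big)^{\mathfrak{S}(\{4,\dots,n\})},$$ where $F_{\{12\}}$ denotes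 the pull-back of a sheaf $F$ on $X$ to $\Delta_{12}$ by $p_1|_{\Delta_{12}}=p_2|_{\Delta_{12}}$, extended by zero to $X^n$. Then there is an exact sequence of $\mathcal{O}_{S^nX}$-modules $$0\to\mathcal{L}^{2,1,1}(-2\Delta)\to\mathcal{L}^{2,1,1}(-\Delta)\xrightarrow{\,d^1_\Delta\,}\mathcal{K}^1_{(1)(1)}(-2\Delta)\xrightarrow{\,\psi\,}w_{3*}\big((S^3\Omega^1_X\otimes L^4)\boxtimes\mathcal{O}_{S^{n-3}X}\big)\to 0 .$$ Here the first map is the inclusion. The map $d^1_\Delta$ is induced by $$L^{(2,1,1)}\otimes\mathcal{I}_{\Delta_{12}}\to L^{(2,1,1)}\otimes\mathcal{I}_{\Delta_{12}}/\mathcal{I}_{\Delta_{12}}^2\simeq(\Omega^1_X\otimes L^3)_{\{12\}}\otimes p_3^*L,$$ so that a section of the form $f\cdot p_1^*(ab)\,p_2^*c\,p_3^*d$, with $f$ in the ideal of $\Delta_{12}$ and $a,b,c,d$ local sections of $L$, is sent at the point $(x,x,w,z)$, $z\in X^{n-3}$, to $d_x\big(f(x,\cdot,w,z)\big)\,(abc)(x)\,d(w)$.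 The map $\psi$ is induced by $$(\Omega^1_X\otimes L^3)_{\{12\}}\otimes p_3^*L\otimes\mathcal{I}_{\Delta_{23}}^2\to(\Omega^1_X\otimes L^3)_{\{12\}}\otimes p_3^*L\otimes\mathcal{I}_{\Delta_{23}}^2/\mathcal{I}_{\Delta_{23}}^3,$$ by the identification of the invariant direct image of the latter sheaf with $w_{3*}\big((\Omega^1_X\otimes S^2\Omega^1_X\otimes L^4)\boxtimes\mathcal{O}_{S^{n-3}X}\big)$, and by the symmetrisation $\Omega^1_X\otimes S^2\Omega^1_X\to S^3\Omega^1_X$. -/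

import Mathlib

open Filter Topology TopologicalSpace
open scoped TensorProduct LinearAlgebra.Projectivization

noncomputable section

namespace ClassicalVariety

/-! ### Spaces with functions (classical varieties over `ℂ`: points are closed points) -/

/-- Germs of complex valued functions form a `ℂ`-algebra. -/
instance germAlgebra {X : Type} (l : Filter X) : Algebra ℂ (Germ l ℂ) :=
  Algebra.ofModule
    (fun c a b => Germ.inductionOn₂ a b fun f g =>
      congrArg _ (funext fun x => smul_mul_assoc c (f x) (g x)))
    (fun c a b => Germ.inductionOn₂ a b fun f g =>
      congrArg _ (funext fun x => mul_smul_comm c (f x) (g x)))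

/-- A topological space with a sheaf `𝒪` of `ℂ`-algebras of complex valued functions, given by its
stalks: the sections of `𝒪` over an open set `U` are the functions on `U` whose germ at each
`x ∈ U` lies in `stalk x`. -/
class FunctionSpace (X : Type) extends TopologicalSpace X where
  /-- the germs at `x` of regular functions -/
  stalk (x : X) : Subalgebra ℂ (Germ (𝓝 x) ℂ)
  eventually_mem_stalk (f : X → ℂ) (x : X) : (f : Germ (𝓝 x) ℂ) ∈ stalk x →
    ∀ᶠ y in 𝓝 x, (f : Germ (𝓝 y) ℂ) ∈ stalk y

open FunctionSpace (stalk)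

section Basic

variable {X : Type} [FunctionSpace X]

/-- `f` is a regular function in a neighbourhood of `x`. -/
def IsRegularAt (f : X → ℂ) (x : X) : Prop := (f : Germ (𝓝 x) ℂ) ∈ stalk x

/-- `f` is a regular function on `U` (its values outside the open set `U` do not matter). -/
def IsRegularOn (f : X → ℂ) (U : Opens X) : Prop := ∀ x ∈ U, IsRegularAt f x

/-- Evaluation `𝒪_x → ℂ`. -/
def evalAt (x : X) : stalk x →+* ℂ :=
  (Germ.valueRingHom (x := x) (E := ℂ)).comp (stalk x).subtype

/-- The ideal `𝔪_x` of germs vanishing at `x`. -/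
abbrev maxIdeal (x : X) : Ideal (stalk x) := RingHom.ker (evalAt x)

/-- The cotangent space `𝔪_x / 𝔪_x²`, which is the fibre at `x` of `Ω¹_X`. -/
abbrev CotSpace (x : X) : Type := (maxIdeal x).Cotangent

/-- For `f` regular at `x`, the germ of `f - f(x)`, as an element of `𝔪_x`. -/
def subValue (f : X → ℂ) (x : X) (h : IsRegularAt f x) : maxIdeal x :=
  ⟨(⟨(f : Germ (𝓝 x) ℂ), h⟩ : stalk x) - algebraMap ℂ (stalk x) (f x), by
    rw [RingHom.mem_ker, map_sub, sub_eq_zero]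
    change f x = f x • (1 : ℂ)
    simp⟩

open Classical in
/-- The differential `d_x f ∈ 𝔪_x / 𝔪_x²` of a function `f` which is regular at `x`:
the class of `f - f(x)`. (By convention `0` if `f` is not regular at `x`.) -/
def dAt (f : X → ℂ) (x : X) : CotSpace x :=
  if h : IsRegularAt f x then (maxIdeal x).toCotangent (subValue f x h) else 0

/-- The germ of `f` at `p` belongs to the ideal `J` of `𝒪_p`. -/
def InIdeal (f : X → ℂ) (p : X) (J : Ideal (stalk p)) : Prop :=
  ∃ h : IsRegularAt f p, (⟨(f : Germ (𝓝 p) ℂ), h⟩ : stalk p) ∈ J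

end Basic

/-! ### Smooth quasi-projective surfaces and line bundles -/

/-- Common zeros in `ℙ^N` of a set of homogeneous polynomials. -/
def zeroLocus {N : ℕ} (S : Set (MvPolynomial (Fin (N + 1)) ℂ)) : Set (ℙ ℂ (Fin (N + 1) → ℂ)) :=
  {p | ∀ F ∈ S, MvPolynomial.eval p.rep F = 0}

/-- All members of `S` are homogeneous. -/
def AllHomogeneous {N : ℕ} (S : Set (MvPolynomial (Fin (N + 1)) ℂ)) : Prop :=
  ∀ F ∈ S, ∃ d, F.IsHomogeneous d

/-- `X` is (isomorphic to) a quasi-projective variety: a Zariski locally closed subset of some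
`ℙ^N`, with the Zariski topology and with the functions which are locally quotients of homogeneous
polynomials of the same degree. -/
def IsQuasiProjective (X : Type) [FunctionSpace X] : Prop :=
  ∃ (N : ℕ) (i : X → ℙ ℂ (Fin (N + 1) → ℂ)), Function.Injective i ∧
    (∃ S T, AllHomogeneous S ∧ AllHomogeneous T ∧ Set.range i = zeroLocus S \ zeroLocus T) ∧
    (∀ C : Set X, IsClosed C ↔ ∃ S, AllHomogeneous S ∧ C = i ⁻¹' zeroLocus S) ∧
    (∀ (x : X) (γ : Germ (𝓝 x) ℂ), γ ∈ stalk x ↔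
      ∃ (d : ℕ) (F G : MvPolynomial (Fin (N + 1)) ℂ), F.IsHomogeneous d ∧ G.IsHomogeneous d ∧
        MvPolynomial.eval (i x).rep G ≠ 0 ∧
        γ = ((fun y => MvPolynomial.eval (i y).rep F / MvPolynomial.eval (i y).rep G : X → ℂ) :
          Germ (𝓝 x) ℂ))

/-- All local rings are regular of dimension two. -/
def IsSmoothSurface (X : Type) [FunctionSpace X] : Prop :=
  ∀ x : X, IsRegularLocalRing (stalk x) ∧ ringKrullDim (stalk x) = 2

/-- A line bundle: a family of one-dimensional vector spaces together with the notion of a regular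
section, such that locally there is a nowhere vanishing frame `e` for which the regular sections
are exactly the `f • e` with `f` a regular function. -/
structure LineBundle (X : Type) [FunctionSpace X] where
  /-- the fibres -/
  Fib : X → Type
  [addCommGroup : ∀ x, AddCommGroup (Fib x)]
  [module : ∀ x, Module ℂ (Fib x)]
  finrank_fib : ∀ x, Module.finrank ℂ (Fib x) = 1
  /-- the section is regular in a neighbourhood of the point -/
  IsRegularSectionAt : (∀ x, Fib x) → X → Prop
  exists_frame : ∀ x, ∃ U : Opens X, x ∈ U ∧ ∃ e : ∀ y, Fib y, (∀ y ∈ U, e y ≠ 0) ∧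
    ∀ y ∈ U, ∀ s : ∀ y, Fib y, IsRegularSectionAt s y ↔
      ∃ f : X → ℂ, IsRegularAt f y ∧ ∀ᶠ y' in 𝓝 y, s y' = f y' • e y'

attribute [instance] LineBundle.addCommGroup LineBundle.module

/-! ### Products and symmetric powers -/

section Generated

variable {Z J : Type} [SemilatticeInf J] [OrderTop J] (W : J → Set Z)
  (A : J → Subalgebra ℂ (Z → ℂ))

/-- The topology with basis the sets `{z ∈ W j | h z ≠ 0}`, `h ∈ A j`. -/
@[reducible] def generatedTopology : TopologicalSpace Z :=
  generateFrom {D | ∃ j, ∃ h ∈ A j, D = {z | z ∈ W j ∧ h z ≠ 0}}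

/-- The space with functions on `Z` whose regular functions are locally the quotients `g / h` with
`g, h ∈ A j`, on the sets `{z ∈ W j | h z ≠ 0}`, which form a basis of the topology. -/
@[reducible] def FunctionSpace.generated (hW : ∀ i j, W (i ⊓ j) = W i ∩ W j) (hA : ∀ i j, i ≤ j → A j ≤ A i)
    (hT : W ⊤ = Set.univ) : FunctionSpace Z :=
  letI := generatedTopology W A
  have hopen : ∀ j, ∀ h ∈ A j, IsOpen {z | z ∈ W j ∧ h z ≠ 0} :=
    fun j h hh => isOpen_generateFrom_of_mem ⟨j, h, hh, rfl⟩
  { stalk := fun z =>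
      { carrier := {γ | ∃ j, z ∈ W j ∧ ∃ g ∈ A j, ∃ h ∈ A j, h z ≠ 0 ∧
          γ = ((fun y => g y / h y : Z → ℂ) : Germ (𝓝 z) ℂ)}
        mul_mem' := by
          rintro _ _ ⟨j, hj, g, hg, h, hh, h0, rfl⟩ ⟨j', hj', g', hg', h', hh', h0', rfl⟩
          refine ⟨j ⊓ j', by rw [hW]; exact ⟨hj, hj'⟩, g * g',
            mul_mem (hA _ _ inf_le_left hg) (hA _ _ inf_le_right hg'), h * h',
            mul_mem (hA _ _ inf_le_left hh) (hA _ _ inf_le_right hh'), mul_ne_zero h0 h0', ?_⟩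
          exact congrArg _ (funext fun y => div_mul_div_comm _ _ _ _)
        add_mem' := by
          rintro _ _ ⟨j, hj, g, hg, h, hh, h0, rfl⟩ ⟨j', hj', g', hg', h', hh', h0', rfl⟩
          refine ⟨j ⊓ j', by rw [hW]; exact ⟨hj, hj'⟩, g * h' + h * g',
            add_mem (mul_mem (hA _ _ inf_le_left hg) (hA _ _ inf_le_right hh'))
              (mul_mem (hA _ _ inf_le_left hh) (hA _ _ inf_le_right hg')), h * h',
            mul_mem (hA _ _ inf_le_left hh) (hA _ _ inf_le_right hh'), mul_ne_zero h0 h0', ?_⟩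
          refine Germ.coe_eq.mpr ?_
          filter_upwards [(hopen j h hh).mem_nhds ⟨hj, h0⟩,
            (hopen j' h' hh').mem_nhds ⟨hj', h0'⟩] with y hy hy'
          exact div_add_div _ _ hy.2 hy'.2
        algebraMap_mem' := fun c =>
          ⟨⊤, by simp [hT], algebraMap ℂ _ c, Subalgebra.algebraMap_mem _ _, 1, one_mem _,
            one_ne_zero, by
              rw [Algebra.algebraMap_eq_smul_one]
              exact congrArg _ (funext fun y => by simp)⟩ }
    eventually_mem_stalk := by
      rintro f z ⟨j, hj, g, hg, h, hh, h0, e⟩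
      filter_upwards [(Germ.coe_eq.mp e).eventually_nhds,
        (hopen j h hh).mem_nhds ⟨hj, h0⟩] with y hy hy'
      exact ⟨j, hy'.1, g, hg, h, hh, hy'.2, Germ.coe_eq.mpr hy⟩ }

end Generated

/-- The points of the product variety `X^n`. -/
def Pow (X : Type) (n : ℕ) : Type := Fin n → X

/-- The product variety `X^n`: the regular functions are locally quotients of polynomial
expressions in the `a (z i)`, with `a` regular on an open subset of `X`. -/
instance (X : Type) [FunctionSpace X] (n : ℕ) : FunctionSpace (Pow X n) :=
  FunctionSpace.generated (J := Fin n → Opens X) (fun V => {z | ∀ i, z i ∈ V i})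
    (fun V => Algebra.adjoin ℂ {g | ∃ i a, IsRegularOn a (V i) ∧ g = fun z => a (z i)})
    (fun V V' => by ext z; exact forall_and)
    (fun V V' h => Algebra.adjoin_mono (by
      rintro _ ⟨i, a, ha, rfl⟩
      exact ⟨i, a, fun x hx => ha x (h i hx), rfl⟩))
    (by ext; simp)

/-- The points of the product variety `X × Y`. -/
structure ProdVar (X Y : Type) where
  /-- first component -/
  fst : X
  /-- second component -/
  snd : Y

/-- The product variety `X × Y`. -/
instance (X Y : Type) [FunctionSpace X] [FunctionSpace Y] : FunctionSpace (ProdVar X Y) :=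
  FunctionSpace.generated (J := Opens X × Opens Y) (fun V => {p | p.fst ∈ V.1 ∧ p.snd ∈ V.2})
    (fun V => Algebra.adjoin ℂ ({g | ∃ a, IsRegularOn a V.1 ∧ g = fun p => a p.fst} ∪
      {g | ∃ b, IsRegularOn b V.2 ∧ g = fun p => b p.snd}))
    (fun V V' => by ext p; exact and_and_and_comm)
    (fun V V' h => Algebra.adjoin_mono (by
      rintro _ (⟨a, ha, rfl⟩ | ⟨a, ha, rfl⟩)
      · exact Or.inl ⟨a, fun x hx => ha x (h.1 hx), rfl⟩
      · exact Or.inr ⟨a, fun x hx => ha x (h.2 hx), rfl⟩))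
    (by ext; simp)

/-- The points of the symmetric variety `S^n X`: effective zero-cycles of degree `n`. -/
def SymPow (X : Type) (n : ℕ) : Type := Sym X n

/-- The quotient map `π : X^n → S^n X`. -/
def toSym {X : Type} {n : ℕ} (z : Pow X n) : SymPow X n :=
  ⟨Finset.univ.val.map (fun i => z i), by simp⟩

/-- The symmetric variety `S^n X = X^n / 𝔖_n`, with the quotient topology; a function `f` on an
open set `U` is regular if and only if `f ∘ π` is regular on `π⁻¹(U)`. -/
instance (X : Type) [FunctionSpace X] (n : ℕ) : FunctionSpace (SymPow X n) :=
  letI : TopologicalSpace (SymPow X n) := .coinduced toSym inferInstance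
  { stalk := fun t =>
      { carrier := {γ | ∃ f : SymPow X n → ℂ, γ = (f : Germ (𝓝 t) ℂ) ∧
          ∃ U : Opens (SymPow X n), t ∈ U ∧ ∀ z, toSym z ∈ U → IsRegularAt (fun y => f (toSym y)) z}
        mul_mem' := by
          rintro _ _ ⟨f, rfl, U, hU, h⟩ ⟨f', rfl, U', hU', h'⟩
          exact ⟨f * f', rfl, U ⊓ U', ⟨hU, hU'⟩, fun z hz => mul_mem (h z hz.1) (h' z hz.2)⟩
        add_mem' := by
          rintro _ _ ⟨f, rfl, U, hU, h⟩ ⟨f', rfl, U', hU', h'⟩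
          exact ⟨f + f', rfl, U ⊓ U', ⟨hU, hU'⟩, fun z hz => add_mem (h z hz.1) (h' z hz.2)⟩
        algebraMap_mem' := fun c =>
          ⟨c • 1, by rw [Algebra.algebraMap_eq_smul_one]; rfl, ⊤, trivial, fun z _ => by
            have := (stalk z).algebraMap_mem c
            rwa [Algebra.algebraMap_eq_smul_one] at this⟩ }
    eventually_mem_stalk := by
      rintro f t ⟨f', e, U, hU, h⟩
      filter_upwards [(Germ.coe_eq.mp e).eventually_nhds, U.isOpen.mem_nhds hU] with y hy hy'
      exact ⟨f', Germ.coe_eq.mpr hy, U, hy', h⟩ }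

/-- The map `w₃ : X × S^m X → S^{m+3} X`, `(x, t) ↦ 3 x + t`. -/
def w₃ {X : Type} {m : ℕ} (p : ProdVar X (SymPow X m)) : SymPow X (m + 3) :=
  Sym.cons p.fst (Sym.cons p.fst (Sym.cons p.fst p.snd))

/-- The stalk at `p` of the ideal sheaf of the diagonal `Δ_{ij} = {z | z i = z j} ⊆ X^n`. -/
def diagIdeal {X : Type} [FunctionSpace X] {n : ℕ} (i j : Fin n) (p : Pow X n) :
    Ideal (stalk p) where
  carrier := {γ | ∃ f : Pow X n → ℂ, (γ : Germ (𝓝 p) ℂ) = (f : Germ (𝓝 p) ℂ) ∧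
    ∀ᶠ q in 𝓝 p, q i = q j → f q = 0}
  zero_mem' := ⟨0, rfl, Eventually.of_forall fun _ _ => rfl⟩
  add_mem' := by
    rintro a b ⟨f, hf, hf0⟩ ⟨g, hg, hg0⟩
    refine ⟨f + g, by rw [Subalgebra.coe_add, hf, hg]; rfl, ?_⟩
    filter_upwards [hf0, hg0] with q h h' e
    simp [h e, h' e]
  smul_mem' := by
    rintro ⟨c, hc⟩ b ⟨g, hg, hg0⟩
    induction c using Germ.inductionOn with
    | h f =>
      refine ⟨f * g, by rw [smul_eq_mul, Subalgebra.coe_mul, hg]; rfl, ?_⟩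
      filter_upwards [hg0] with q h' e
      simp [h' e]

/-! ### Sheaves of modules over a space with functions -/

/-- Restriction to `V ⊆ U` of a family `s p ∈ Fib p`, `p` lying over `U`. -/
def restrictFamily {S : Type} [FunctionSpace S] {Pt : Type} {proj : Pt → S} {Fib : Pt → Type}
    {U V : Opens S} (h : V ≤ U) (s : ∀ p : {p // proj p ∈ U}, Fib p.1) :
    ∀ p : {p // proj p ∈ V}, Fib p.1 :=
  fun p => s ⟨p.1, h p.2⟩

/-- A sheaf on `S` whose sections over `U` are families `s p ∈ Fib p`, indexed by the points `p`
of a set over `S` lying over `U`. Restriction is restriction of families; `glue` is the sheaf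
axiom (two families agreeing locally agree, and a compatible collection of families always
comes from a unique family). -/
structure SectionSheaf (S : Type) [FunctionSpace S] where
  /-- the indexing set -/
  Pt : Type
  /-- its projection to `S` -/
  proj : Pt → S
  /-- the fibres -/
  Fib : Pt → Type
  [addCommGroup : ∀ p, AddCommGroup (Fib p)]
  [module : ∀ p, Module ℂ (Fib p)]
  /-- the sections over `U` -/
  sec (U : Opens S) : Submodule ℂ (∀ p : {p // proj p ∈ U}, Fib p.1)
  res_mem : ∀ {U V : Opens S} (h : V ≤ U), ∀ s ∈ sec U, restrictFamily h s ∈ sec V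
  glue : ∀ (U : Opens S) (s : ∀ p : {p // proj p ∈ U}, Fib p.1),
    (∀ t ∈ U, ∃ (V : Opens S) (h : V ≤ U), t ∈ V ∧ restrictFamily h s ∈ sec V) → s ∈ sec U

attribute [instance] SectionSheaf.addCommGroup SectionSheaf.module

namespace SectionSheaf

variable {S : Type} [FunctionSpace S]

/-- Restriction of sections. -/
def res (F : SectionSheaf S) {U V : Opens S} (h : V ≤ U) (s : F.sec U) : F.sec V :=
  ⟨restrictFamily h s.1, F.res_mem h s.1 s.2⟩

/-- The product `f s` of a function and a family. -/
def smulFun (F : SectionSheaf S) (U : Opens S) (f : S → ℂ) (s : ∀ p : {p // F.proj p ∈ U}, F.Fib p.1) :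
    ∀ p : {p // F.proj p ∈ U}, F.Fib p.1 :=
  fun p => f (F.proj p.1) • s p

/-- The sheaf is a sheaf of `𝒪_S`-modules for pointwise multiplication. -/
def IsOModule (F : SectionSheaf S) : Prop :=
  ∀ (U : Opens S) (f : S → ℂ), IsRegularOn f U → ∀ s ∈ F.sec U, F.smulFun U f s ∈ F.sec U

/-- An `𝒪_S`-linear morphism of sheaves. -/
structure Hom (F G : SectionSheaf S) where
  /-- the map on sections over `U` -/
  app (U : Opens S) : F.sec U →ₗ[ℂ] G.sec U
  app_res : ∀ {U V : Opens S} (h : V ≤ U) (s : F.sec U), app V (F.res h s) = G.res h (app U s)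
  app_smul : ∀ (U : Opens S) (f : S → ℂ), IsRegularOn f U → ∀ s s' : F.sec U,
    s'.1 = F.smulFun U f s.1 → (app U s').1 = G.smulFun U f (app U s).1

variable {F G H : SectionSheaf S}

/-- Injectivity of a morphism of sheaves. -/
def Hom.IsInjective (φ : Hom F G) : Prop := ∀ U, Function.Injective (φ.app U)

/-- The section `s` is locally in the image of `φ`. -/
def Hom.LocallyInImage (φ : Hom F G) {U : Opens S} (s : G.sec U) : Prop :=
  ∀ t ∈ U, ∃ (V : Opens S) (h : V ≤ U), t ∈ V ∧ ∃ r : F.sec V, φ.app V r = G.res h s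

/-- Surjectivity of a morphism of sheaves. -/
def Hom.IsSurjective (φ : Hom F G) : Prop := ∀ (U : Opens S) (s : G.sec U), φ.LocallyInImage s

/-- Exactness of `F → G → H` at `G`: the kernel sheaf of `ψ` is the image sheaf of `φ`. -/
def IsExactAt (φ : Hom F G) (ψ : Hom G H) : Prop :=
  ∀ (U : Opens S) (s : G.sec U), ψ.app U s = 0 ↔ φ.LocallyInImage s

end SectionSheaf

section LocalSections

variable {S : Type} [FunctionSpace S] {Pt : Type} (proj : Pt → S) (N : Pt → Filter Pt)
  {Fib : Pt → Type} [∀ p, AddCommGroup (Fib p)] [∀ p, Module ℂ (Fib p)]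
  (gen : Pt → Set (∀ q, Fib q))

/-- The families `s` over `U` that near each point `p` coincide with a linear combination of the
local generators `gen p`. Here `N p` is the filter of neighbourhoods of `p`; we moreover allow to
shrink to a neighbourhood of `proj p`, which changes nothing when `proj` is continuous. -/
def localSec (U : Opens S) : Submodule ℂ (∀ p : {p // proj p ∈ U}, Fib p.1) where
  carrier := {s | ∀ p, proj p ∈ U → ∃ t ∈ Submodule.span ℂ (gen p),
    ∀ᶠ q in N p ⊓ comap proj (𝓝 (proj p)), ∀ hq : proj q ∈ U, s ⟨q, hq⟩ = t q}
  zero_mem' := fun _ _ => ⟨0, zero_mem _, Eventually.of_forall fun _ _ => rfl⟩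
  add_mem' := by
    intro s s' hs hs' p hp
    obtain ⟨t, ht, e⟩ := hs p hp
    obtain ⟨t', ht', e'⟩ := hs' p hp
    refine ⟨t + t', add_mem ht ht', ?_⟩
    filter_upwards [e, e'] with q h h' hq
    simp [h hq, h' hq]
  smul_mem' := by
    intro c s hs p hp
    obtain ⟨t, ht, e⟩ := hs p hp
    refine ⟨c • t, Submodule.smul_mem _ _ ht, ?_⟩
    filter_upwards [e] with q h hq
    simp [h hq]

theorem localSec_res {U V : Opens S} (h : V ≤ U) {s : ∀ p : {p // proj p ∈ U}, Fib p.1}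
    (hs : s ∈ localSec proj N gen U) : restrictFamily h s ∈ localSec proj N gen V := by
  intro p hp
  obtain ⟨t, ht, e⟩ := hs p (h hp)
  exact ⟨t, ht, e.mono fun q hq hqV => hq (h hqV)⟩

theorem localSec_glue (U : Opens S)
    (s : ∀ p : {p // proj p ∈ U}, Fib p.1)
    (hs : ∀ t ∈ U, ∃ (V : Opens S) (h : V ≤ U), t ∈ V ∧
      restrictFamily h s ∈ localSec proj N gen V) :
    s ∈ localSec proj N gen U := by
  intro p hp
  obtain ⟨V, h, hV, hsV⟩ := hs _ hp
  obtain ⟨t, ht, e⟩ := hsV p hV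
  refine ⟨t, ht, ?_⟩
  filter_upwards [e, mem_inf_of_right (preimage_mem_comap (V.isOpen.mem_nhds hV))] with q hq hqV _
  exact hq hqV

end LocalSections

/-! ### The sheaves of the sequence

We write `n = m + 3` and split a point of `X^n` as `(x₁, x₂, x₃, z)` with `z ∈ X^m`. -/

/-- The points `(x₁, x₂, x₃, z)` of `X^{m+3}`. -/
structure Triple (X : Type) (m : ℕ) where
  /-- first coordinate -/
  x₁ : X
  /-- second coordinate -/
  x₂ : X
  /-- third coordinate -/
  x₃ : X
  /-- the remaining coordinates -/
  z : Fin m → X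

/-- The points `(x, x, w, z)` of the diagonal `Δ₁₂ ⊆ X^{m+3}`. -/
structure DiagPt (X : Type) (m : ℕ) where
  /-- common value of the first two coordinates -/
  x : X
  /-- third coordinate -/
  w : X
  /-- the remaining coordinates -/
  z : Fin m → X

/-- The tuple `(x₁, x₂, x₃, z)`. -/
def Triple.toPow {X : Type} {m : ℕ} (p : Triple X m) : Pow X (m + 3) :=
  Matrix.vecCons p.x₁ (Matrix.vecCons p.x₂ (Matrix.vecCons p.x₃ p.z))

/-- The tuple `(x, x, w, z)`. -/
def DiagPt.toPow {X : Type} {m : ℕ} (p : DiagPt X m) : Pow X (m + 3) :=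
  Triple.toPow ⟨p.x, p.x, p.w, p.z⟩

theorem toSym_toPow {X : Type} {m : ℕ} (x₁ x₂ x₃ : X) (z : Fin m → X) :
    (toSym (Triple.toPow ⟨x₁, x₂, x₃, z⟩)).1 =
      x₁ ::ₘ x₂ ::ₘ x₃ ::ₘ (Finset.univ.val.map z) := by
  change Multiset.map (Matrix.vecCons x₁ (Matrix.vecCons x₂ (Matrix.vecCons x₃ z)))
    Finset.univ.val = _
  rw [Fin.univ_val_map, Fin.univ_val_map]
  simp only [List.ofFn_succ]
  rfl

theorem toSym_swap {X : Type} {m : ℕ} (x₁ x₂ x₃ : X) (z : Fin m → X) :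
    toSym (Triple.toPow ⟨x₁, x₃, x₂, z⟩) = toSym (Triple.toPow ⟨x₁, x₂, x₃, z⟩) := by
  refine Subtype.ext ?_
  rw [toSym_toPow, toSym_toPow, Multiset.cons_swap x₃ x₂]

theorem toSym_perm {X : Type} {m : ℕ} (x₁ x₂ x₃ : X) (z : Fin m → X) (σ : Equiv.Perm (Fin m)) :
    toSym (Triple.toPow ⟨x₁, x₂, x₃, fun i => z (σ i)⟩) =
      toSym (Triple.toPow ⟨x₁, x₂, x₃, z⟩) := by
  refine Subtype.ext ?_
  have h := congrArg (fun s => Multiset.map z s.val) (Finset.map_univ_equiv σ)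
  simp only [Finset.map_val, Multiset.map_map] at h
  rw [toSym_toPow, toSym_toPow, ← h]
  rfl

/-- `w₃(x, π(z)) = π(x, x, x, z)`. -/
theorem w₃_toSym {X : Type} {m : ℕ} (x : X) (z : Fin m → X) :
    w₃ ⟨x, toSym (z : Pow X m)⟩ = toSym (DiagPt.toPow ⟨x, x, z⟩) :=
  Subtype.ext (toSym_toPow x x x z).symm

section Sheaves

variable {X : Type} [FunctionSpace X] (L : LineBundle X) (m : ℕ)

/-- The fibre of `L^{(2,1,1)} = p₁^*L^{⊗2} ⊗ p₂^*L ⊗ p₃^*L` at `(x₁, x₂, x₃, z)`. -/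
abbrev FibL (p : Triple X m) : Type :=
  (L.Fib p.x₁ ⊗[ℂ] L.Fib p.x₁) ⊗[ℂ] (L.Fib p.x₂ ⊗[ℂ] L.Fib p.x₃)

/-- The fibre of `(Ω¹_X ⊗ L³)_{12} ⊗ p₃^*L` at `(x, x, w, z)`. -/
abbrev FibK (p : DiagPt X m) : Type :=
  CotSpace p.x ⊗[ℂ] ((L.Fib p.x ⊗[ℂ] L.Fib p.x) ⊗[ℂ] (L.Fib p.x ⊗[ℂ] L.Fib p.w))

/-- The fibre of `(S^• Ω¹_X ⊗ L⁴) ⊠ 𝒪_{S^m X}` at `(x, t)`. Only its part of degree `3` is used. -/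
abbrev FibW (p : ProdVar X (SymPow X m)) : Type :=
  SymmetricAlgebra ℂ (CotSpace p.fst) ⊗[ℂ]
    ((L.Fib p.fst ⊗[ℂ] L.Fib p.fst) ⊗[ℂ] (L.Fib p.fst ⊗[ℂ] L.Fib p.fst))

/-- The stalk at `p` of `I_{Δ₁₂}^l ∩ I_{Δ₁₃}^l ∩ I_{Δ₂₃}^l`. -/
def tripleIdeal {m : ℕ} (l : ℕ) (p : Pow X (m + 3)) : Ideal (stalk p) :=
  diagIdeal 0 1 p ^ l ⊓ diagIdeal 0 2 p ^ l ⊓ diagIdeal 1 2 p ^ l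

/-- The local sections `f • (a b)(x₁) c(x₂) d(x₃)` of
`L^{(2,1,1)} ⊗ (I_{Δ₁₂}^l ∩ I_{Δ₁₃}^l ∩ I_{Δ₂₃}^l)` near `p`. -/
def genL (l : ℕ) (p : Triple X m) : Set (∀ q, FibL L m q) :=
  {t | ∃ (f : Pow X (m + 3) → ℂ) (a b c d : ∀ x, L.Fib x),
    InIdeal f p.toPow (tripleIdeal l p.toPow) ∧
    L.IsRegularSectionAt a p.x₁ ∧ L.IsRegularSectionAt b p.x₁ ∧
    L.IsRegularSectionAt c p.x₂ ∧ L.IsRegularSectionAt d p.x₃ ∧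
    t = fun q : Triple X m => f q.toPow • ((a q.x₁ ⊗ₜ b q.x₁) ⊗ₜ (c q.x₂ ⊗ₜ d q.x₃))}

/-- The families invariant under `𝔖({2,3}) × 𝔖({4,…,n})`, the stabiliser of `(2,1,1,0,…,0)`. -/
def invL (U : Opens (SymPow X (m + 3))) :
    Submodule ℂ (∀ p : {p : Triple X m // toSym p.toPow ∈ U}, FibL L m p.1) where
  carrier := {s |
    (∀ x₁ x₂ x₃ z h h', s ⟨⟨x₁, x₃, x₂, z⟩, h'⟩ =
      (TensorProduct.comm ℂ (L.Fib x₂) (L.Fib x₃)).toLinearMap.lTensor _ (s ⟨⟨x₁, x₂, x₃, z⟩, h⟩)) ∧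
    (∀ x₁ x₂ x₃ z (σ : Equiv.Perm (Fin m)) h h', s ⟨⟨x₁, x₂, x₃, fun i => z (σ i)⟩, h'⟩ =
      s ⟨⟨x₁, x₂, x₃, z⟩, h⟩)}
  zero_mem' := by
    refine ⟨?_, ?_⟩
    · intros; exact (map_zero _).symm
    · intros; rfl
  add_mem' := by
    rintro s s' ⟨h1, h2⟩ ⟨h1', h2'⟩
    refine ⟨?_, ?_⟩
    · intro x₁ x₂ x₃ z h h'
      simp only [Pi.add_apply, map_add, h1 x₁ x₂ x₃ z h h', h1' x₁ x₂ x₃ z h h']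
    · intro x₁ x₂ x₃ z σ h h'
      simp only [Pi.add_apply, h2 x₁ x₂ x₃ z σ h h', h2' x₁ x₂ x₃ z σ h h']
  smul_mem' := by
    rintro r s ⟨h1, h2⟩
    refine ⟨?_, ?_⟩
    · intro x₁ x₂ x₃ z h h'
      simp only [Pi.smul_apply, map_smul, h1 x₁ x₂ x₃ z h h']
    · intro x₁ x₂ x₃ z σ h h'
      simp only [Pi.smul_apply, h2 x₁ x₂ x₃ z σ h h']

/-- The sheaf `𝓛^{2,1,1}(-lΔ) = π_*(L^{(2,1,1)} ⊗ ⋂_{1≤i<j≤3} I_{Δ_{ij}}^l)^{Stab(2,1,1)}` on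
`S^{m+3} X`. -/
def sheafL (l : ℕ) : SectionSheaf (SymPow X (m + 3)) where
  Pt := Triple X m
  proj p := toSym p.toPow
  Fib := FibL L m
  sec U := localSec (fun p : Triple X m => toSym p.toPow)
    (fun p => comap Triple.toPow (𝓝 p.toPow)) (genL L m l) U ⊓ invL L m U
  res_mem h s hs := ⟨localSec_res _ _ _ h hs.1,
    fun _ _ _ _ _ _ => hs.2.1 _ _ _ _ _ _, fun _ _ _ _ _ _ _ => hs.2.2 _ _ _ _ _ _ _⟩
  glue U s hs := by
    refine ⟨localSec_glue _ _ _ U s fun t ht => ?_, ?_, ?_⟩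
    · obtain ⟨V, h, hV, hsV⟩ := hs t ht
      exact ⟨V, h, hV, hsV.1⟩
    · intro x₁ x₂ x₃ z h h'
      have e := toSym_swap x₁ x₂ x₃ z
      obtain ⟨V, hVU, hV, hsV⟩ := hs _ h
      exact hsV.2.1 x₁ x₂ x₃ z hV (e ▸ hV)
    · intro x₁ x₂ x₃ z σ h h'
      have e := toSym_perm x₁ x₂ x₃ z σ
      obtain ⟨V, hVU, hV, hsV⟩ := hs _ h
      exact hsV.2.2 x₁ x₂ x₃ z σ hV (e ▸ hV)

/-- The local sections `f • dα(x) (a b c)(x) d(w)` of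
`(Ω¹_X ⊗ L³)_{12} ⊗ p₃^*L ⊗ I_{Δ₂₃}^l` near `p ∈ Δ₁₂`. -/
def genK (l : ℕ) (p : DiagPt X m) : Set (∀ q, FibK L m q) :=
  {t | ∃ (f : Pow X (m + 3) → ℂ) (α : X → ℂ) (a b c d : ∀ x, L.Fib x),
    InIdeal f p.toPow (diagIdeal 1 2 p.toPow ^ l) ∧ IsRegularAt α p.x ∧
    L.IsRegularSectionAt a p.x ∧ L.IsRegularSectionAt b p.x ∧
    L.IsRegularSectionAt c p.x ∧ L.IsRegularSectionAt d p.w ∧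
    t = fun q : DiagPt X m => f q.toPow • (dAt α q.x ⊗ₜ ((a q.x ⊗ₜ b q.x) ⊗ₜ (c q.x ⊗ₜ d q.w)))}

/-- The families invariant under `𝔖({4,…,n})`. -/
def invK (U : Opens (SymPow X (m + 3))) :
    Submodule ℂ (∀ p : {p : DiagPt X m // toSym p.toPow ∈ U}, FibK L m p.1) where
  carrier := {s | ∀ x w z (σ : Equiv.Perm (Fin m)) h h',
    s ⟨⟨x, w, fun i => z (σ i)⟩, h'⟩ = s ⟨⟨x, w, z⟩, h⟩}
  zero_mem' := by intros x w z σ h h'; rfl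
  add_mem' := by
    intro s s' h1 h1' x w z σ h h'
    simp only [Pi.add_apply, h1 x w z σ h h', h1' x w z σ h h']
  smul_mem' := by
    intro r s h1 x w z σ h h'
    simp only [Pi.smul_apply, h1 x w z σ h h']

/-- The sheaf `𝒦¹_{(1)(1)}(-lΔ) = π_*((Ω¹_X ⊗ L³)_{12} ⊗ p₃^*L ⊗ I_{Δ₂₃}^l)^{𝔖({4,…,n})}` on
`S^{m+3} X`. -/
def sheafK (l : ℕ) : SectionSheaf (SymPow X (m + 3)) where
  Pt := DiagPt X m
  proj p := toSym p.toPow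
  Fib := FibK L m
  sec U := localSec (fun p : DiagPt X m => toSym p.toPow)
    (fun p => comap DiagPt.toPow (𝓝 p.toPow)) (genK L m l) U ⊓ invK L m U
  res_mem h s hs := ⟨localSec_res _ _ _ h hs.1, fun _ _ _ _ _ _ => hs.2 _ _ _ _ _ _⟩
  glue U s hs := by
    refine ⟨localSec_glue _ _ _ U s fun t ht => ?_, ?_⟩
    · obtain ⟨V, h, hV, hsV⟩ := hs t ht
      exact ⟨V, h, hV, hsV.1⟩
    · intro x w z σ h h'
      have e := toSym_perm x x w z σ
      obtain ⟨V, hVU, hV, hsV⟩ := hs _ h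
      exact hsV.2 x w z σ hV (e ▸ hV)

/-- The local sections `f • (dα · dβ · dγ)(x) (a b c d)(x)` of `(S³Ω¹_X ⊗ L⁴) ⊠ 𝒪_{S^m X}`. -/
def genW (p : ProdVar X (SymPow X m)) : Set (∀ q, FibW L m q) :=
  {t | ∃ (f : ProdVar X (SymPow X m) → ℂ) (α β γ : X → ℂ) (a b c d : ∀ x, L.Fib x),
    IsRegularAt f p ∧ IsRegularAt α p.fst ∧ IsRegularAt β p.fst ∧ IsRegularAt γ p.fst ∧
    L.IsRegularSectionAt a p.fst ∧ L.IsRegularSectionAt b p.fst ∧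
    L.IsRegularSectionAt c p.fst ∧ L.IsRegularSectionAt d p.fst ∧
    t = fun q : ProdVar X (SymPow X m) => f q •
      ((SymmetricAlgebra.ι ℂ _ (dAt α q.fst) * SymmetricAlgebra.ι ℂ _ (dAt β q.fst) *
          SymmetricAlgebra.ι ℂ _ (dAt γ q.fst)) ⊗ₜ
        ((a q.fst ⊗ₜ b q.fst) ⊗ₜ (c q.fst ⊗ₜ d q.fst)))}

/-- The sheaf `w₃_*((S³Ω¹_X ⊗ L⁴) ⊠ 𝒪_{S^m X})` on `S^{m+3} X`. -/
def sheafW : SectionSheaf (SymPow X (m + 3)) where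
  Pt := ProdVar X (SymPow X m)
  proj := w₃
  Fib := FibW L m
  sec U := localSec w₃ (fun p => 𝓝 p) (genW L m) U
  res_mem h _ hs := localSec_res _ _ _ h hs
  glue U s hs := localSec_glue _ _ _ U s hs

variable {L m}

/-- The morphism is the inclusion `𝓛^{2,1,1}(-2Δ) ⊆ 𝓛^{2,1,1}(-Δ)`. -/
def IsInclusion (ι : SectionSheaf.Hom (sheafL L m 2) (sheafL L m 1)) : Prop :=
  ∀ (U : Opens (SymPow X (m + 3))) (s : (sheafL L m 2).sec U), (ι.app U s).1 = s.1

/-- The morphism is the differential `d¹_Δ`, that is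
`L^{(2,1,1)} ⊗ I_{Δ₁₂} → L^{(2,1,1)} ⊗ I_{Δ₁₂}/I_{Δ₁₂}² ≃ (Ω¹_X ⊗ L³)_{12} ⊗ p₃^*L`.
If near `(x, x, w, z)` a section `s` equals `∑ f_k (a_k b_k)(x₁) c_k(x₂) d_k(x₃)`, with `f_k` in the
ideal of `Δ₁₂`, its image at this point is `∑ d_x(f_k(x, ·, w, z)) (a_k b_k c_k)(x) d_k(w)`. -/
def IsDiagDifferential (δ : SectionSheaf.Hom (sheafL L m 1) (sheafK L m 2)) : Prop :=
  ∀ (U : Opens (SymPow X (m + 3))) (s : (sheafL L m 1).sec U) (x w : X) (z : Fin m → X)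
    (h : toSym (DiagPt.toPow ⟨x, w, z⟩) ∈ U)
    (r : ℕ) (f : Fin r → Pow X (m + 3) → ℂ) (a b c d : Fin r → ∀ y, L.Fib y),
    (∀ k, InIdeal (f k) (DiagPt.toPow ⟨x, w, z⟩) (diagIdeal 0 1 (DiagPt.toPow ⟨x, w, z⟩))) →
    (∀ k, L.IsRegularSectionAt (a k) x ∧ L.IsRegularSectionAt (b k) x ∧
      L.IsRegularSectionAt (c k) x ∧ L.IsRegularSectionAt (d k) w) →
    (∀ᶠ q : Triple X m in comap Triple.toPow (𝓝 (DiagPt.toPow ⟨x, w, z⟩)),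
      ∀ hq : toSym q.toPow ∈ U, s.1 ⟨q, hq⟩ =
        ∑ k, f k q.toPow • ((a k q.x₁ ⊗ₜ b k q.x₁) ⊗ₜ (c k q.x₂ ⊗ₜ d k q.x₃))) →
    (δ.app U s).1 ⟨⟨x, w, z⟩, h⟩ =
      ∑ k, dAt (fun y => f k (Triple.toPow ⟨x, y, w, z⟩)) x ⊗ₜ[ℂ]
        ((a k x ⊗ₜ[ℂ] b k x) ⊗ₜ[ℂ] (c k x ⊗ₜ[ℂ] d k w))

/-- The morphism is the second order differential followed by the symmetrisation, that is
`(Ω¹_X ⊗ L³)_{12} ⊗ p₃^*L ⊗ I_{Δ₂₃}² → (Ω¹_X ⊗ L³)_{12} ⊗ p₃^*L ⊗ I_{Δ₂₃}²/I_{Δ₂₃}³ ≃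
Ω¹_X ⊗ S²Ω¹_X ⊗ L⁴ → S³Ω¹_X ⊗ L⁴`.
If near `(x, x, x, z)` a section `τ` equals `∑ f_k g_k h_k • dα_k (a_k b_k c_k)(x) d_k(w)`, with
`g_k`, `h_k` in the ideal of `Δ₂₃`, its image at `(x, π(z))` is
`∑ f_k • dα_k · d_x(g_k(x, x, ·, z)) · d_x(h_k(x, x, ·, z)) (a_k b_k c_k d_k)(x)`. -/
def IsSymSecondDifferential (ψ : SectionSheaf.Hom (sheafK L m 2) (sheafW L m)) : Prop :=
  ∀ (U : Opens (SymPow X (m + 3))) (τ : (sheafK L m 2).sec U) (x : X) (z : Fin m → X)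
    (hx : w₃ ⟨x, toSym z⟩ ∈ U)
    (r : ℕ) (f g h : Fin r → Pow X (m + 3) → ℂ) (α : Fin r → X → ℂ)
    (a b c d : Fin r → ∀ y, L.Fib y),
    (∀ k, IsRegularAt (f k) (DiagPt.toPow ⟨x, x, z⟩) ∧
      InIdeal (g k) (DiagPt.toPow ⟨x, x, z⟩) (diagIdeal 1 2 (DiagPt.toPow ⟨x, x, z⟩)) ∧
      InIdeal (h k) (DiagPt.toPow ⟨x, x, z⟩) (diagIdeal 1 2 (DiagPt.toPow ⟨x, x, z⟩))) →
    (∀ k, IsRegularAt (α k) x ∧ L.IsRegularSectionAt (a k) x ∧ L.IsRegularSectionAt (b k) x ∧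
      L.IsRegularSectionAt (c k) x ∧ L.IsRegularSectionAt (d k) x) →
    (∀ᶠ q : DiagPt X m in comap DiagPt.toPow (𝓝 (DiagPt.toPow ⟨x, x, z⟩)),
      ∀ hq : toSym q.toPow ∈ U, τ.1 ⟨q, hq⟩ =
        ∑ k, (f k q.toPow * g k q.toPow * h k q.toPow) •
          (dAt (α k) q.x ⊗ₜ ((a k q.x ⊗ₜ b k q.x) ⊗ₜ (c k q.x ⊗ₜ d k q.w)))) →
    (ψ.app U τ).1 ⟨⟨x, toSym z⟩, hx⟩ =
      ∑ k, f k (DiagPt.toPow ⟨x, x, z⟩) •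
        ((SymmetricAlgebra.ι ℂ (CotSpace x) (dAt (α k) x) *
            SymmetricAlgebra.ι ℂ (CotSpace x)
              (dAt (fun y => g k (DiagPt.toPow ⟨x, y, z⟩)) x) *
            SymmetricAlgebra.ι ℂ (CotSpace x)
              (dAt (fun y => h k (DiagPt.toPow ⟨x, y, z⟩)) x)) ⊗ₜ[ℂ]
          ((a k x ⊗ₜ[ℂ] b k x) ⊗ₜ[ℂ] (c k x ⊗ₜ[ℂ] d k x)))

end Sheaves

end ClassicalVariety

open ClassicalVariety

/-!
The whole sequence is computed with functions on `X^n`, `n = m + 3`. Let `e` be a frame of `L` and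
`u = (u_1, u_2)` parameters at a point of `X`, and put `U_i = u_i(x₂) - u_i(x₁)` and
`W_i = u_i(x₃) - u_i(x₂)`. These differences generate the ideals of `Δ₁₂` and `Δ₂₃`
(`inSpan_diag`, by Nakayama's lemma). A section of `𝓛^{2,1,1}(-Δ)` is `F` times the frame, where
`F` is symmetric in `x₂, x₃` and vanishes on the three diagonals, and a section of
`𝒦¹_{(1)(1)}(-2Δ)` is `∑ T_i du_i` times the frame, with `T_i = ∑ W_j W_k H_ijk`.

*The differential.* Symmetry forces `F` to vanish to second order on `Δ₂₃`
(`inIdeal_sq_of_swap`), and then `F = ∑ U_i W_j W_k R_ijk` near a point of the triple diagonal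
(`exists_factor`), so that `d¹_Δ(F) = ∑ W_j W_k R_ijk du_i` lies in `𝒦¹_{(1)(1)}(-2Δ)`. It vanishes
if and only if `F` is of second order on `Δ₁₂`, hence by symmetry on `Δ₁₃`, and `F` is always of
second order on `Δ₂₃`; this is exactness at `𝓛^{2,1,1}(-Δ)`.

*The map `ψ`.* It maps `∑ W_j W_k H_ijk du_i` to the cubic form `∑ H_ijk du_i du_j du_k`, which is
the leading form at `w = x` of `w ↦ ∑ (u_i(w) - u_i(x)) T_i(x, w, z)` (`psiFam_of_isCubicAt`). The
leading form is well defined because the associated graded ring of a two-dimensional regular local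
ring is a polynomial ring (`coeff_mem_of_form_mem`). For `H = R` coming from `F` this form is also
the leading form of the restriction of `F` to `x₁ = x₃`, which is zero; so `ψ ∘ d¹_Δ = 0`
(`psiFam_deltaFam`).

*Exactness at `𝒦¹_{(1)(1)}(-2Δ)`.* If the cubic form of `T` vanishes along the triple diagonal,
extend `T_i` off `Δ₁₂` as `∑ V_j V_k H_ijk` with `V_j = u_j(x₃) - u_j(x₁)`. Then `∑ U_i T_i` vanishes
to second order on `Δ₁₃`, and on `Δ₂₃` it is a cubic form in the `V_j`, whose symmetrised coefficients
vanish on the triple diagonal; a correction by a function of second order on `Δ₁₂` and on `Δ₁₃` makes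
it vanish on `Δ₂₃` (`eventually_isLift_of_eq`). Symmetrising the result in `x₂, x₃` and
averaging over the remaining points gives a preimage (`isLift_symmetrize`).

*From `X^n` to `S^n X`.* Local constructions have to be carried out simultaneously near all the
points of a fibre of `π : X^n → S^n X`. A finite subset of a quasi-projective variety lies in an
affine chart (`exists_chart`) on which `L` has a frame (`exists_frame_of_finite`), and functions
given near the points of a fibre are glued with a partition of unity `∑ a_p b_p = 1` of regular
functions on the preimage of a neighbourhood (`exists_partition`). The same partition gives
surjectivity of `ψ`, the coefficients `H_ijk` being prescribed near each point of the fibre. That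
the values of `ψ` are regular along `X × S^m X` follows from descent along
`X × X^m → X × S^m X` (`isRegularAt_of_headTail`).
-/

namespace ClassicalVariety

open ClassicalVariety.FunctionSpace (stalk)

/-! ### Calculus of regular functions -/

section Regular

variable {X : Type} [FunctionSpace X] {x : X} {f g : X → ℂ}

theorem IsRegularAt.congr (hf : IsRegularAt f x) (h : f =ᶠ[𝓝 x] g) : IsRegularAt g x := by
  unfold IsRegularAt at *
  rwa [← Germ.coe_eq.mpr h]

theorem isRegularAt_const (c : ℂ) : IsRegularAt (fun _ : X => c) x := by
  have h := (stalk x).algebraMap_mem c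
  rw [Algebra.algebraMap_eq_smul_one] at h
  have e : ((fun _ : X => c : X → ℂ) : Germ (𝓝 x) ℂ) = c • (1 : Germ (𝓝 x) ℂ) := by
    change _ = ((fun _ : X => c • (1 : ℂ) : X → ℂ) : Germ (𝓝 x) ℂ)
    simp
  unfold IsRegularAt
  rw [e]
  exact h

theorem IsRegularAt.add (hf : IsRegularAt f x) (hg : IsRegularAt g x) :
    IsRegularAt (fun y => f y + g y) x := (stalk x).add_mem hf hg

theorem IsRegularAt.mul (hf : IsRegularAt f x) (hg : IsRegularAt g x) :
    IsRegularAt (fun y => f y * g y) x := (stalk x).mul_mem hf hg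

theorem IsRegularAt.neg (hf : IsRegularAt f x) : IsRegularAt (fun y => - f y) x :=
  (stalk x).neg_mem hf

theorem IsRegularAt.sub (hf : IsRegularAt f x) (hg : IsRegularAt g x) :
    IsRegularAt (fun y => f y - g y) x := (stalk x).sub_mem hf hg

theorem IsRegularAt.const_mul (c : ℂ) (hf : IsRegularAt f x) : IsRegularAt (fun y => c * f y) x :=
  (isRegularAt_const c).mul hf

theorem IsRegularAt.pow (hf : IsRegularAt f x) (k : ℕ) : IsRegularAt (fun y => f y ^ k) x :=
  (stalk x).pow_mem hf k

theorem IsRegularAt.sum {ι : Type*} (s : Finset ι) {F : ι → X → ℂ}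
    (h : ∀ i ∈ s, IsRegularAt (F i) x) : IsRegularAt (fun y => ∑ i ∈ s, F i y) x := by
  classical
  induction s using Finset.induction_on with
  | empty => simpa using isRegularAt_const 0
  | insert a s ha ih =>
    simp only [Finset.sum_insert ha]
    exact (h a (Finset.mem_insert_self _ _)).add
      (ih fun i hi => h i (Finset.mem_insert_of_mem hi))

theorem IsRegularAt.eventually (hf : IsRegularAt f x) : ∀ᶠ y in 𝓝 x, IsRegularAt f y :=
  FunctionSpace.eventually_mem_stalk f x hf

/-- Regular functions which do not vanish at a point are invertible there. -/
def HasInverses (X : Type) [FunctionSpace X] : Prop :=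
  ∀ (f : X → ℂ) (x : X), IsRegularAt f x → f x ≠ 0 →
    (∀ᶠ y in 𝓝 x, f y ≠ 0) ∧ IsRegularAt (fun y => (f y)⁻¹) x

theorem exists_isRegularAt (a : stalk x) :
    ∃ (f : X → ℂ) (h : IsRegularAt f x), a = ⟨(f : Germ (𝓝 x) ℂ), h⟩ := by
  obtain ⟨γ, hγ⟩ := a
  induction γ using Germ.inductionOn with
  | h f => exact ⟨f, hγ, rfl⟩

instance maxIdeal_isMaximal (x : X) : (maxIdeal x).IsMaximal :=
  RingHom.ker_isMaximal_of_surjective _ fun c =>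
    ⟨⟨_, isRegularAt_const c⟩, rfl⟩

theorem maxIdeal_eq [IsLocalRing (stalk x)] : maxIdeal x = IsLocalRing.maximalIdeal (stalk x) :=
  IsLocalRing.eq_maximalIdeal inferInstance

/-- The evaluation ideal at `x` is maximal, hence the maximal ideal of a local stalk; so a germ
which does not vanish at `x` is a unit. -/
theorem hasInverses_of_isLocalRing (h : ∀ x : X, IsLocalRing (stalk x)) : HasInverses X := by
  intro f x hf hx
  have := h x
  have hu : IsUnit (⟨(f : Germ (𝓝 x) ℂ), hf⟩ : stalk x) := by
    by_contra hu
    have h1 := (IsLocalRing.mem_maximalIdeal _).2 hu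
    rw [← maxIdeal_eq, RingHom.mem_ker] at h1
    exact hx h1
  obtain ⟨b, hb⟩ := hu.exists_right_inv
  obtain ⟨g, hg, rfl⟩ := exists_isRegularAt b
  have e : (fun y => f y * g y) =ᶠ[𝓝 x] fun _ => 1 := Germ.coe_eq.mp (congrArg Subtype.val hb)
  refine ⟨e.mono fun y hy h0 => by simp [h0] at hy, hg.congr (e.mono fun y hy => ?_)⟩
  exact eq_inv_of_mul_eq_one_right hy

theorem HasInverses.div (hX : HasInverses X) (hf : IsRegularAt f x) (hg : IsRegularAt g x)
    (h : g x ≠ 0) : IsRegularAt (fun y => f y / g y) x := by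
  simp only [div_eq_mul_inv]
  exact hf.mul (hX g x hg h).2

/-! ### Ideals of the stalks -/

variable {J K : Ideal (stalk x)}

theorem InIdeal.congr (hf : InIdeal f x J) (h : f =ᶠ[𝓝 x] g) : InIdeal g x J := by
  obtain ⟨h1, h2⟩ := hf
  refine ⟨h1.congr h, ?_⟩
  convert h2 using 2
  exact Subtype.ext (Germ.coe_eq.mpr h).symm

theorem InIdeal.add (hf : InIdeal f x J) (hg : InIdeal g x J) :
    InIdeal (fun y => f y + g y) x J := ⟨hf.1.add hg.1, J.add_mem hf.2 hg.2⟩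

theorem InIdeal.neg (hf : InIdeal f x J) :
    InIdeal (fun y => - f y) x J := ⟨hf.1.neg, J.neg_mem hf.2⟩

theorem InIdeal.mul_left (hg : IsRegularAt g x) (hf : InIdeal f x J) :
    InIdeal (fun y => g y * f y) x J := ⟨hg.mul hf.1, J.mul_mem_left ⟨_, hg⟩ hf.2⟩

theorem InIdeal.mul_right (hf : InIdeal f x J) (hg : IsRegularAt g x) :
    InIdeal (fun y => f y * g y) x J := ⟨hf.1.mul hg, J.mul_mem_right ⟨_, hg⟩ hf.2⟩

theorem InIdeal.const_mul (c : ℂ) (hf : InIdeal f x J) :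
    InIdeal (fun y => c * f y) x J := hf.mul_left (isRegularAt_const c)

theorem InIdeal.mul (hf : InIdeal f x J) (hg : InIdeal g x K) :
    InIdeal (fun y => f y * g y) x (J * K) := ⟨hf.1.mul hg.1, Ideal.mul_mem_mul hf.2 hg.2⟩

theorem InIdeal.mono (hf : InIdeal f x J) (h : J ≤ K) : InIdeal f x K := ⟨hf.1, h hf.2⟩

theorem inIdeal_zero : InIdeal (fun _ => 0) x J :=
  ⟨isRegularAt_const 0, J.zero_mem⟩

theorem InIdeal.sum {ι : Type*} (s : Finset ι) {F : ι → X → ℂ}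
    (h : ∀ i ∈ s, InIdeal (F i) x J) : InIdeal (fun y => ∑ i ∈ s, F i y) x J := by
  classical
  induction s using Finset.induction_on with
  | empty => simpa using inIdeal_zero
  | insert a s ha ih =>
    simp only [Finset.sum_insert ha]
    exact (h a (Finset.mem_insert_self _ _)).add
      (ih fun i hi => h i (Finset.mem_insert_of_mem hi))

theorem inIdeal_top : InIdeal f x ⊤ ↔ IsRegularAt f x := ⟨fun h => h.1, fun h => ⟨h, trivial⟩⟩

theorem inIdeal_inf : InIdeal f x (J ⊓ K) ↔ InIdeal f x J ∧ InIdeal f x K :=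
  ⟨fun h => ⟨⟨h.1, h.2.1⟩, ⟨h.1, h.2.2⟩⟩, fun h => ⟨h.1.1, h.1.2, h.2.2⟩⟩

theorem inIdeal_maxIdeal : InIdeal f x (maxIdeal x) ↔ IsRegularAt f x ∧ f x = 0 :=
  ⟨fun h => ⟨h.1, RingHom.mem_ker.1 h.2⟩, fun h => ⟨h.1, RingHom.mem_ker.2 h.2⟩⟩

/-- Induction on membership in a product of ideals, for functions instead of germs. -/
theorem InIdeal.mul_induction {C : (X → ℂ) → Prop} (h : InIdeal f x (J * K))
    (hC : ∀ f g : X → ℂ, f =ᶠ[𝓝 x] g → C f → C g)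
    (hmul : ∀ a b, InIdeal a x J → InIdeal b x K → C (fun y => a y * b y))
    (hadd : ∀ a b, IsRegularAt a x → IsRegularAt b x → C a → C b → C (fun y => a y + b y)) :
    C f := by
  obtain ⟨h1, h2⟩ := h
  suffices H : ∀ a ∈ J * K, ∀ f : X → ℂ, (a : Germ (𝓝 x) ℂ) = f → C f from H _ h2 f rfl
  intro a ha
  refine Submodule.mul_induction_on ha ?_ ?_
  · intro a ha b hb f hf
    obtain ⟨u, hu, rfl⟩ := exists_isRegularAt a
    obtain ⟨v, hv, rfl⟩ := exists_isRegularAt b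
    exact hC _ _ (Germ.coe_eq.mp hf) (hmul u v ⟨hu, ha⟩ ⟨hv, hb⟩)
  · intro a b ha hb f hf
    obtain ⟨u, hu, rfl⟩ := exists_isRegularAt a
    obtain ⟨v, hv, rfl⟩ := exists_isRegularAt b
    exact hC _ _ (Germ.coe_eq.mp hf) (hadd u v hu hv (ha u rfl) (hb v rfl))

/-! ### The differential -/

theorem dAt_of_isRegularAt (h : IsRegularAt f x) :
    dAt f x = (maxIdeal x).toCotangent (subValue f x h) := dif_pos h

theorem dAt_congr (h : f =ᶠ[𝓝 x] g) : dAt f x = dAt g x := by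
  by_cases hf : IsRegularAt f x
  · rw [dAt_of_isRegularAt hf, dAt_of_isRegularAt (hf.congr h)]
    congr 1
    refine Subtype.ext (Subtype.ext ?_)
    change (f : Germ (𝓝 x) ℂ) - algebraMap ℂ (stalk x) (f x) =
      (g : Germ (𝓝 x) ℂ) - algebraMap ℂ (stalk x) (g x)
    rw [Germ.coe_eq.mpr h, h.eq_of_nhds]
  · have hg : ¬ IsRegularAt g x := fun hg => hf (hg.congr h.symm)
    rw [dAt, dif_neg hf, dAt, dif_neg hg]

theorem coe_algebraMap_stalk (c : ℂ) :
    ((algebraMap ℂ (stalk x) c : stalk x) : Germ (𝓝 x) ℂ) = ((fun _ => c : X → ℂ)) := by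
  rw [Algebra.algebraMap_eq_smul_one]
  change ((fun _ : X => c • (1 : ℂ) : X → ℂ) : Germ (𝓝 x) ℂ) = _
  simp

/-- The rule from which additivity and the Leibniz formula follow: a congruence modulo `𝔪_x²`
gives a linear relation between differentials. -/
theorem dAt_eq_of_inIdeal {h : X → ℂ} (hf : IsRegularAt f x) (hg : IsRegularAt g x) (c d : ℂ)
    (H : InIdeal (fun y => h y - h x - (c * (f y - f x) + d * (g y - g x))) x (maxIdeal x ^ 2)) :
    dAt h x = c • dAt f x + d • dAt g x := by
  have hh : IsRegularAt h x := by
    refine ((H.1.add (((hf.sub (isRegularAt_const (f x))).const_mul c).add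
      ((hg.sub (isRegularAt_const (g x))).const_mul d))).add (isRegularAt_const (h x))).congr ?_
    exact Eventually.of_forall fun y => by simp
  rw [dAt_of_isRegularAt hh, dAt_of_isRegularAt hf, dAt_of_isRegularAt hg,
    ← LinearMap.map_smul_of_tower, ← LinearMap.map_smul_of_tower, ← map_add, Ideal.toCotangent_eq]
  convert H.2 using 1
  refine Subtype.ext ?_
  change ((h : Germ (𝓝 x) ℂ) - algebraMap ℂ (stalk x) (h x)) -
    (c • ((f : Germ (𝓝 x) ℂ) - algebraMap ℂ (stalk x) (f x)) +
      d • ((g : Germ (𝓝 x) ℂ) - algebraMap ℂ (stalk x) (g x))) = _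
  simp only [coe_algebraMap_stalk]
  rfl

theorem dAt_eq_zero_iff (hf : IsRegularAt f x) :
    dAt f x = 0 ↔ InIdeal (fun y => f y - f x) x (maxIdeal x ^ 2) := by
  rw [dAt_of_isRegularAt hf, Ideal.toCotangent_eq_zero]
  have e : ((subValue f x hf : maxIdeal x) : stalk x) =
      ⟨((fun y => f y - f x : X → ℂ) : Germ (𝓝 x) ℂ), hf.sub (isRegularAt_const _)⟩ := by
    refine Subtype.ext ?_
    change (f : Germ (𝓝 x) ℂ) - algebraMap ℂ (stalk x) (f x) = _
    simp only [coe_algebraMap_stalk]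
    rfl
  rw [e]
  exact ⟨fun h => ⟨_, h⟩, fun h => h.2⟩

theorem dAt_const (c : ℂ) : dAt (fun _ : X => c) x = 0 :=
  (dAt_eq_zero_iff (isRegularAt_const c)).2
    (inIdeal_zero.congr (Eventually.of_forall fun y => by simp))

theorem dAt_add (hf : IsRegularAt f x) (hg : IsRegularAt g x) :
    dAt (fun y => f y + g y) x = dAt f x + dAt g x := by
  rw [dAt_eq_of_inIdeal hf hg 1 1 (inIdeal_zero.congr (Eventually.of_forall fun y => by ring)),
    one_smul, one_smul]

theorem dAt_mul (hf : IsRegularAt f x) (hg : IsRegularAt g x) :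
    dAt (fun y => f y * g y) x = g x • dAt f x + f x • dAt g x := by
  refine dAt_eq_of_inIdeal hf hg _ _ ?_
  have h1 : InIdeal (fun y => f y - f x) x (maxIdeal x) :=
    inIdeal_maxIdeal.2 ⟨hf.sub (isRegularAt_const _), sub_self _⟩
  have h2 : InIdeal (fun y => g y - g x) x (maxIdeal x) :=
    inIdeal_maxIdeal.2 ⟨hg.sub (isRegularAt_const _), sub_self _⟩
  rw [pow_two]
  exact (h1.mul h2).congr (Eventually.of_forall fun y => by ring)

theorem dAt_const_mul (c : ℂ) (hf : IsRegularAt f x) :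
    dAt (fun y => c * f y) x = c • dAt f x := by
  rw [dAt_mul (isRegularAt_const c) hf, dAt_const, smul_zero, zero_add]

theorem dAt_sub (hf : IsRegularAt f x) (hg : IsRegularAt g x) :
    dAt (fun y => f y - g y) x = dAt f x - dAt g x := by
  have e : (fun y => f y - g y) = fun y => f y + (-1) * g y := by ext; ring
  rw [e, dAt_add hf (hg.const_mul _), dAt_const_mul _ hg, neg_one_smul, sub_eq_add_neg]

theorem dAt_sum {ι : Type*} (s : Finset ι) {F : ι → X → ℂ}
    (h : ∀ i ∈ s, IsRegularAt (F i) x) :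
    dAt (fun y => ∑ i ∈ s, F i y) x = ∑ i ∈ s, dAt (F i) x := by
  classical
  induction s using Finset.induction_on with
  | empty => simpa using dAt_const 0
  | insert a s ha ih =>
    simp only [Finset.sum_insert ha]
    rw [dAt_add (h a (Finset.mem_insert_self _ _))
      (IsRegularAt.sum s fun i hi => h i (Finset.mem_insert_of_mem hi)),
      ih fun i hi => h i (Finset.mem_insert_of_mem hi)]

theorem dAt_eq_zero_of_inIdeal (h : InIdeal f x (maxIdeal x ^ 2)) : dAt f x = 0 := by
  rw [dAt_eq_zero_iff h.1]
  have h0 : f x = 0 := (inIdeal_maxIdeal.1 (h.mono (Ideal.pow_le_self two_ne_zero))).2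
  simpa [h0] using h

end Regular

/-! ### Two-dimensional regular local rings -/

section RegularLocal

open IsLocalRing

/-- A Noetherian local ring whose maximal ideal is generated by one non nilpotent element is a
domain, since every nonzero element is a unit times a power of the generator. -/
theorem isDomain_of_maximalIdeal_eq_span_singleton {R : Type*} [CommRing R] [IsLocalRing R]
    [IsNoetherianRing R] {b : R} (hb : maximalIdeal R = Ideal.span {b}) (hn : ¬ IsNilpotent b) :
    IsDomain R := by
  have key : ∀ c : R, c ≠ 0 → ∃ (u : Rˣ) (k : ℕ), c = u * b ^ k := by
    intro c h0
    have h1 : ∃ k, c ∉ (maximalIdeal R) ^ k := by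
      by_contra! h
      have h2 : c ∈ ⨅ k, (maximalIdeal R) ^ k := (Submodule.mem_iInf _).2 h
      rw [Ideal.iInf_pow_eq_bot_of_isLocalRing _ (Ideal.IsPrime.ne_top inferInstance)] at h2
      exact h0 h2
    classical
    have h3 := Nat.find_spec h1
    have h4 : Nat.find h1 ≠ 0 := by
      intro h
      rw [h, pow_zero, Ideal.one_eq_top] at h3
      exact h3 trivial
    obtain ⟨k, hk⟩ := Nat.exists_eq_succ_of_ne_zero h4
    have h5 : c ∈ (maximalIdeal R) ^ k := by
      by_contra h
      have := Nat.find_min' h1 h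
      omega
    rw [hk] at h3
    rw [hb, Ideal.span_singleton_pow, Ideal.mem_span_singleton] at h5 h3
    obtain ⟨u, rfl⟩ := h5
    have hu : IsUnit u := by
      by_contra hu
      have := (mem_maximalIdeal u).2 hu
      rw [hb, Ideal.mem_span_singleton] at this
      obtain ⟨v, rfl⟩ := this
      exact h3 ⟨v, by rw [Nat.succ_eq_add_one]; ring⟩
    obtain ⟨u, rfl⟩ := hu
    exact ⟨u, k, mul_comm _ _⟩
  have : NoZeroDivisors R := by
    refine ⟨fun {x y} hxy => ?_⟩
    by_contra! h
    obtain ⟨u, k, hu⟩ := key x h.1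
    obtain ⟨v, l, hv⟩ := key y h.2
    apply hn
    refine ⟨k + l, ?_⟩
    have : ((u * v : Rˣ) : R) * b ^ (k + l) = 0 := by
      rw [← hxy, hu, hv, Units.val_mul]
      ring
    exact (u * v).mul_right_eq_zero.1 this
  exact NoZeroDivisors.to_isDomain R

variable {R : Type*} [CommRing R] [IsLocalRing R] [IsNoetherianRing R] {a b : R}

/-- In a two-dimensional local ring with `𝔪 = (a, b)`, the ideal `(a)` is prime and does not
contain `b`. -/
theorem isPrime_span_parameter (h : maximalIdeal R = Ideal.span {a, b})
    (hd : ringKrullDim R = 2) : (Ideal.span {a}).IsPrime ∧ b ∉ Ideal.span {a} := by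
  have ha : a ∈ maximalIdeal R := h ▸ Ideal.subset_span (by simp)
  have hle : Ideal.span {a} ≤ maximalIdeal R := by rwa [Ideal.span_singleton_le_iff_mem]
  have hne : Ideal.span {a} ≠ ⊤ := fun h' => (maximalIdeal.isMaximal R).ne_top
    (top_le_iff.1 (h' ▸ hle))
  have : Nontrivial (R ⧸ Ideal.span {a}) := Ideal.Quotient.nontrivial_iff.2 hne
  have : IsLocalRing (R ⧸ Ideal.span {a}) :=
    IsLocalRing.of_surjective' (Ideal.Quotient.mk _) Ideal.Quotient.mk_surjective
  have hm : maximalIdeal (R ⧸ Ideal.span {a}) =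
      Ideal.span {Ideal.Quotient.mk (Ideal.span {a}) b} := by
    have h1 : (maximalIdeal R).map (Ideal.Quotient.mk (Ideal.span {a})) =
        maximalIdeal (R ⧸ Ideal.span {a}) := by
      refine IsLocalRing.eq_maximalIdeal ?_
      refine (Ideal.map_eq_top_or_isMaximal_of_surjective _ Ideal.Quotient.mk_surjective
        (maximalIdeal.isMaximal R)).resolve_left fun h' => ?_
      have h2 := congrArg (Ideal.comap (Ideal.Quotient.mk (Ideal.span {a}))) h'
      rw [Ideal.comap_map_of_surjective _ Ideal.Quotient.mk_surjective, ← RingHom.ker_eq_comap_bot,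
        Ideal.mk_ker, sup_eq_left.2 hle, Ideal.comap_top] at h2
      exact (maximalIdeal.isMaximal R).ne_top h2
    rw [← h1, h, Ideal.map_span, Set.image_pair,
      Ideal.Quotient.eq_zero_iff_mem.2 (Ideal.mem_span_singleton_self a), Ideal.span_insert_zero]
  have hnil : ¬ IsNilpotent (Ideal.Quotient.mk (Ideal.span {a}) b) := by
    intro hnil
    -- if `b` were nilpotent modulo `a`, the quotient would have dimension zero
    have h0 : ringKrullDim (R ⧸ Ideal.span {a}) ≤ 0 := by
      have : Ring.KrullDimLE 0 (R ⧸ Ideal.span {a}) := by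
        rw [Ring.krullDimLE_zero_iff]
        intro P hP
        have : maximalIdeal (R ⧸ Ideal.span {a}) ≤ P := by
          rw [hm, Ideal.span_singleton_le_iff_mem]
          obtain ⟨k, hk⟩ := hnil
          exact hP.mem_of_pow_mem k (hk ▸ P.zero_mem)
        rw [← (maximalIdeal.isMaximal _).eq_of_le hP.ne_top this]
        exact maximalIdeal.isMaximal _
      exact Order.krullDimLE_iff _ _ |>.1 this
    have h1 := ringKrullDim_le_ringKrullDim_quotient_add_card (R := R) {a} (by
      rw [IsLocalRing.ringJacobson_eq_maximalIdeal]
      simpa using ha)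
    rw [Finset.coe_singleton, Finset.card_singleton, hd] at h1
    have h2 : (2 : WithBot ℕ∞) ≤ 0 + (1 : ℕ) := h1.trans (by gcongr)
    norm_num at h2
  have hdom := isDomain_of_maximalIdeal_eq_span_singleton hm hnil
  exact ⟨(Ideal.Quotient.isDomain_iff_prime _).1 hdom, fun hb => hnil
    (by rw [Ideal.Quotient.eq_zero_iff_mem.2 hb]; exact IsNilpotent.zero)⟩

/-- A two-dimensional Noetherian local ring with `𝔪 = (a, b)` is a domain. The ideal `𝔪` is generated
by two elements `x`, `y` such that `x` lies in no minimal prime. The prime ideal `(x)` contains a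
minimal prime `q`; as `x ∉ q`, every element of `q` is `x` times an element of `q`, and `q = 0` by
Nakayama's lemma. -/
theorem isDomain_of_dim_two (h : maximalIdeal R = Ideal.span {a, b})
    (hd : ringKrullDim R = 2) : IsDomain R := by
  have hm0 : maximalIdeal R ∉ minimalPrimes R := by
    intro hmin
    have h1 := IsLocalRing.maximalIdeal_height_eq_ringKrullDim (R := R)
    rw [hd, Ideal.height_eq_zero_iff.2 hmin] at h1
    norm_num at h1
  -- an element of `𝔪` outside `𝔪²` and all minimal primes
  obtain ⟨x, hx, hx2⟩ : ∃ x ∈ maximalIdeal R, x ∉ maximalIdeal R ^ 2 ∧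
      ∀ P ∈ minimalPrimes R, x ∉ P := by
    by_contra! hcon
    classical
    let s : Finset (Ideal R) :=
      insert (maximalIdeal R ^ 2) (minimalPrimes.finite_of_isNoetherianRing R).toFinset
    have hsub : (maximalIdeal R : Set R) ⊆ ⋃ I ∈ (s : Set (Ideal R)), (id I : Ideal R) := by
      intro x hx
      simp only [Set.mem_iUnion]
      by_cases h2 : x ∈ maximalIdeal R ^ 2
      · exact ⟨_, by simp [s], h2⟩
      · obtain ⟨P, hP, hxP⟩ := hcon x hx h2
        exact ⟨P, by simp [s, hP], hxP⟩
    obtain ⟨I, hI, hle⟩ := (Ideal.subset_union_prime (maximalIdeal R ^ 2) (maximalIdeal R ^ 2)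
      (fun I hI h1 _ => by
        have : I ∈ minimalPrimes R := by simpa [s, h1] using hI
        exact this.1.1)).1 hsub
    rcases Finset.mem_insert.1 hI with rfl | hI
    · have hbot : maximalIdeal R = ⊥ := by
        refine Submodule.eq_bot_of_le_smul_of_le_jacobson_bot (maximalIdeal R) _
          (IsNoetherian.noetherian _) ?_ (IsLocalRing.maximalIdeal_le_jacobson _)
        simpa [pow_two] using hle
      exact hm0 (by
        refine ⟨⟨inferInstance, bot_le⟩, fun _ _ _ => ?_⟩
        rw [hbot]
        exact bot_le)
    · have hI' : I ∈ minimalPrimes R := by simpa using hI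
      have := (maximalIdeal.isMaximal R).eq_of_le hI'.1.1.ne_top hle
      exact hm0 (this ▸ hI')
  -- `x = α a + β b`, where `α` or `β` is a unit because `x ∉ 𝔪²`
  obtain ⟨y, hy⟩ : ∃ y, maximalIdeal R = Ideal.span {x, y} := by
    obtain ⟨α, β, hαβ⟩ := Ideal.mem_span_pair.1 (h ▸ hx)
    have ha : a ∈ maximalIdeal R := h ▸ Ideal.subset_span (by simp)
    have hb : b ∈ maximalIdeal R := h ▸ Ideal.subset_span (by simp)
    have hle : ∀ y ∈ maximalIdeal R, Ideal.span {x, y} ≤ maximalIdeal R := by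
      intro y hy
      rw [Ideal.span_le]
      rintro z (rfl | rfl)
      exacts [hx, hy]
    by_cases hα : IsUnit α
    · refine ⟨b, le_antisymm ?_ (hle b hb)⟩
      rw [h, Ideal.span_le]
      obtain ⟨u, rfl⟩ := hα
      rintro z (rfl | rfl)
      · refine Ideal.mem_span_pair.2 ⟨(↑u⁻¹ : R), -(↑u⁻¹ * β), ?_⟩
        rw [← hαβ]
        linear_combination z * u.inv_mul
      · exact Ideal.subset_span (by simp)
    · by_cases hβ : IsUnit β
      · refine ⟨a, le_antisymm ?_ (hle a ha)⟩
        rw [h, Ideal.span_le]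
        obtain ⟨u, rfl⟩ := hβ
        rintro z (rfl | rfl)
        · exact Ideal.subset_span (by simp)
        · refine Ideal.mem_span_pair.2 ⟨(↑u⁻¹ : R), -(↑u⁻¹ * α), ?_⟩
          rw [← hαβ]
          linear_combination z * u.inv_mul
      · refine absurd ?_ hx2.1
        rw [← hαβ, pow_two]
        exact add_mem (Ideal.mul_mem_mul ((mem_maximalIdeal _).2 hα) ha)
          (Ideal.mul_mem_mul ((mem_maximalIdeal _).2 hβ) hb)
  have hP := (isPrime_span_parameter hy hd).1
  obtain ⟨q, hq, hqP⟩ := Ideal.exists_minimalPrimes_le (bot_le : ⊥ ≤ Ideal.span {x})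
  have hxq : x ∉ q := hx2.2 q hq
  have hqbot : q = ⊥ := by
    refine Submodule.eq_bot_of_le_smul_of_le_jacobson_bot (maximalIdeal R) _
      (IsNoetherian.noetherian _) ?_ (IsLocalRing.maximalIdeal_le_jacobson _)
    intro z hz
    obtain ⟨w, rfl⟩ := Ideal.mem_span_singleton.1 (hqP hz)
    exact Submodule.smul_mem_smul hx ((hq.1.1.mem_or_mem hz).resolve_left hxq)
  have := hq.1.1
  rw [hqbot] at this
  exact IsDomain.of_bot_isPrime R

/-- In a two-dimensional regular local ring with `𝔪 = (a, b)`, a homogeneous form of degree `d` in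
`a`, `b` which lies in `𝔪 ^ (d + 1)` has all its coefficients in `𝔪`. -/
theorem coeff_mem_of_form_mem (h : maximalIdeal R = Ideal.span {a, b})
    (hd : ringKrullDim R = 2) (d : ℕ) : ∀ (c : ℕ → R),
    ∑ i ∈ Finset.range (d + 1), c i * a ^ i * b ^ (d - i) ∈ maximalIdeal R ^ (d + 1) →
    ∀ i ≤ d, c i ∈ maximalIdeal R := by
  have hdom := isDomain_of_dim_two h hd
  obtain ⟨hP, hb⟩ := isPrime_span_parameter h hd
  have ha : a ∈ maximalIdeal R := h ▸ Ideal.subset_span (by simp)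
  have hle : Ideal.span {a} ≤ maximalIdeal R := by rwa [Ideal.span_singleton_le_iff_mem]
  have ha0 : a ≠ 0 := by
    rintro rfl
    rw [Ideal.span_insert_zero] at h
    have h1 := ringKrullDim_le_spanFinrank_maximalIdeal R
    have h2 : (maximalIdeal R).spanFinrank ≤ 1 := by
      rw [h]
      exact (Submodule.spanFinrank_span_le_ncard_of_finite (Set.finite_singleton b)).trans (by simp)
    rw [hd] at h1
    have h3 : (2 : WithBot ℕ∞) ≤ (1 : ℕ) := h1.trans (by exact_mod_cast h2)
    norm_num at h3
  -- `𝔪 ^ (k + 1) = a 𝔪 ^ k + (b ^ (k + 1))`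
  have hpow : ∀ k : ℕ, ∀ z ∈ maximalIdeal R ^ (k + 1),
      ∃ w ∈ maximalIdeal R ^ k, ∃ e, z = a * w + e * b ^ (k + 1) := by
    intro k
    induction k with
    | zero =>
      intro z hz
      rw [zero_add, pow_one, h] at hz
      obtain ⟨α, β, rfl⟩ := Ideal.mem_span_pair.1 hz
      exact ⟨α, by simp, β, by ring⟩
    | succ k ih =>
      intro z hz
      rw [pow_succ] at hz
      refine Submodule.mul_induction_on hz ?_ ?_
      · intro s hs t ht
        obtain ⟨w, hw, e, rfl⟩ := ih s hs
        obtain ⟨α, β, rfl⟩ := Ideal.mem_span_pair.1 (h ▸ ht)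
        refine ⟨w * (α * a + β * b) + e * b ^ (k + 1) * α, ?_, e * β, by ring⟩
        refine add_mem ?_ ?_
        · rw [pow_succ]
          exact Ideal.mul_mem_mul hw ht
        · refine Ideal.mul_mem_right _ _ (Ideal.mul_mem_left _ _ (Ideal.pow_mem_pow ?_ _))
          exact h ▸ Ideal.subset_span (by simp)
      · rintro s t ⟨w, hw, e, rfl⟩ ⟨w', hw', e', rfl⟩
        exact ⟨w + w', add_mem hw hw', e + e', by ring⟩
  have hbk : ∀ {x : R} (k : ℕ), x * b ^ k ∈ Ideal.span {a} → x ∈ Ideal.span {a} := fun k hx =>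
    (hP.mem_or_mem hx).resolve_right fun h' => hb (hP.mem_of_pow_mem k h')
  induction d with
  | zero =>
    intro c hc i hi
    obtain rfl : i = 0 := by omega
    simpa using hc
  | succ d ih =>
    intro c hc
    obtain ⟨w, hw, e, hwe⟩ := hpow _ _ hc
    rw [Finset.sum_range_succ'] at hwe
    have e1 : ∑ k ∈ Finset.range (d + 1), c (k + 1) * a ^ (k + 1) * b ^ (d + 1 - (k + 1)) =
        a * ∑ k ∈ Finset.range (d + 1), c (k + 1) * a ^ k * b ^ (d - k) := by
      rw [Finset.mul_sum]
      refine Finset.sum_congr rfl fun k _ => ?_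
      rw [Nat.add_sub_add_right]
      ring
    rw [e1, pow_zero, mul_one, Nat.sub_zero] at hwe
    set Q := ∑ k ∈ Finset.range (d + 1), c (k + 1) * a ^ k * b ^ (d - k)
    have h0 : c 0 - e * b ∈ Ideal.span {a} := by
      refine hbk (d + 1) (Ideal.mem_span_singleton.2 ⟨w - Q, ?_⟩)
      linear_combination hwe
    obtain ⟨v, hv⟩ := Ideal.mem_span_singleton.1 h0
    have hbm : b ∈ maximalIdeal R := h ▸ Ideal.subset_span (by simp)
    have hc0 : c 0 ∈ maximalIdeal R := by
      have : c 0 = e * b + a * v := by linear_combination hv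
      rw [this]
      exact add_mem (Ideal.mul_mem_left _ _ hbm) (Ideal.mul_mem_right _ _ ha)
    have hQ : Q = w - v * b ^ (d + 1) := by
      apply mul_left_cancel₀ ha0
      linear_combination hwe - b ^ (d + 1) * hv
    have hQm : Q ∈ maximalIdeal R ^ (d + 1) := by
      rw [hQ]
      exact sub_mem hw (Ideal.mul_mem_left _ _ (Ideal.pow_mem_pow hbm _))
    intro i hi
    rcases i with _ | i
    · exact hc0
    · exact ih (fun k => c (k + 1)) hQm i (by omega)

end RegularLocal

/-! ### Morphisms, products and symmetric powers -/

section Morphisms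

variable {X Y Z : Type} [FunctionSpace X] [FunctionSpace Y] [FunctionSpace Z]

/-- The map `φ` is continuous at `y`, and pulls back functions which are regular at `φ y` to
functions which are regular at `y`. -/
structure IsMorphismAt (φ : Y → X) (y : Y) : Prop where
  continuousAt : ContinuousAt φ y
  comp : ∀ f : X → ℂ, IsRegularAt f (φ y) → IsRegularAt (fun y => f (φ y)) y

theorem isMorphismAt_id (x : X) : IsMorphismAt (fun x => x) x := ⟨continuousAt_id, fun _ h => h⟩

theorem isMorphismAt_const (x : X) (y : Y) : IsMorphismAt (fun _ : Y => x) y :=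
  ⟨continuousAt_const, fun f _ => isRegularAt_const (f x)⟩

theorem IsMorphismAt.trans {φ : Y → X} {χ : Z → Y} {z : Z} (h : IsMorphismAt φ (χ z))
    (h' : IsMorphismAt χ z) : IsMorphismAt (fun z => φ (χ z)) z :=
  ⟨h.continuousAt.comp h'.continuousAt, fun f hf => h'.comp _ (h.comp f hf)⟩

/-- The projections from `X^n` are morphisms. -/
theorem isMorphismAt_proj {n : ℕ} (i : Fin n) (p : Pow X n) :
    IsMorphismAt (fun q : Pow X n => q i) p := by
  classical
  have key : ∀ V : Opens X, p i ∈ V → p ∈ {z : Pow X n | ∀ j, z j ∈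
      (Function.update (fun _ => ⊤) i V : Fin n → Opens X) j} := by
    intro V hV j
    by_cases hj : j = i
    · subst hj
      simpa using hV
    · simp [hj]
  constructor
  · intro s hs
    obtain ⟨V, hVs, hV, hx⟩ := mem_nhds_iff.1 hs
    refine mem_map.2 ?_
    have h1 : IsOpen {z : Pow X n | z ∈ {z : Pow X n | ∀ j, z j ∈
        (Function.update (fun _ => ⊤) i ⟨V, hV⟩ : Fin n → Opens X) j} ∧
        (1 : Pow X n → ℂ) z ≠ 0} :=
      isOpen_generateFrom_of_mem ⟨_, 1, one_mem _, rfl⟩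
    filter_upwards [h1.mem_nhds ⟨key ⟨V, hV⟩ hx, one_ne_zero⟩] with z hz
    have := hz.1 i
    rw [Function.update_self] at this
    exact hVs this
  · intro f hf
    obtain ⟨V, hV, hVo, hx⟩ := eventually_nhds_iff.1 hf.eventually
    refine ⟨Function.update (fun _ => ⊤) i ⟨V, hVo⟩, key ⟨V, hVo⟩ hx, fun q => f (q i),
      Algebra.subset_adjoin ⟨i, f, ?_, rfl⟩, 1, one_mem _, one_ne_zero, ?_⟩
    · intro x hx
      rw [Function.update_self] at hx
      exact hV x hx
    · exact congrArg _ (funext fun y => by simp)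

/-- The inverse of a local quotient `g / h` with `g z ≠ 0` is the local quotient `h / g`. -/
theorem hasInverses_generated {Z J : Type} [SemilatticeInf J] [OrderTop J] (W : J → Set Z)
    (A : J → Subalgebra ℂ (Z → ℂ)) (hW : ∀ i j, W (i ⊓ j) = W i ∩ W j)
    (hA : ∀ i j, i ≤ j → A j ≤ A i) (hT : W ⊤ = Set.univ) :
    @HasInverses Z (FunctionSpace.generated W A hW hA hT) := by
  let := FunctionSpace.generated W A hW hA hT
  rintro f z ⟨j, hj, g, hg, h, hh, h0, e⟩ hz
  have e' := Germ.coe_eq.mp e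
  have hg0 : g z ≠ 0 := by
    rintro hg0
    have := e'.eq_of_nhds
    simp only [hg0, zero_div] at this
    exact hz this
  have h1 : ∀ᶠ y in 𝓝 z, y ∈ W j ∧ g y ≠ 0 :=
    (isOpen_generateFrom_of_mem ⟨j, g, hg, rfl⟩ : IsOpen {z | z ∈ W j ∧ g z ≠ 0}).mem_nhds ⟨hj, hg0⟩
  have h2 : ∀ᶠ y in 𝓝 z, y ∈ W j ∧ h y ≠ 0 :=
    (isOpen_generateFrom_of_mem ⟨j, h, hh, rfl⟩ : IsOpen {z | z ∈ W j ∧ h z ≠ 0}).mem_nhds ⟨hj, h0⟩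
  refine ⟨?_, j, hj, h, hh, g, hg, hg0, Germ.coe_eq.mpr ?_⟩
  · filter_upwards [e', h1, h2] with y hy hy1 hy2
    rw [hy]
    exact div_ne_zero hy1.2 hy2.2
  · filter_upwards [e'] with y hy
    rw [hy, inv_div]

theorem pow_box_inf (n : ℕ) (V V' : Fin n → Opens X) : {z : Pow X n | ∀ i, z i ∈ (V ⊓ V') i} =
    {z : Pow X n | ∀ i, z i ∈ V i} ∩ {z | ∀ i, z i ∈ V' i} := by
  ext z
  exact forall_and

theorem pow_adjoin_mono (n : ℕ) (V V' : Fin n → Opens X) (h : V ≤ V') :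
    Algebra.adjoin ℂ {g : Pow X n → ℂ | ∃ i a, IsRegularOn a (V' i) ∧ g = fun z => a (z i)} ≤
      Algebra.adjoin ℂ {g | ∃ i a, IsRegularOn a (V i) ∧ g = fun z => a (z i)} :=
  Algebra.adjoin_mono (by
    rintro _ ⟨i, a, ha, rfl⟩
    exact ⟨i, a, fun x hx => ha x (h i hx), rfl⟩)

theorem prodVar_box_inf (V V' : Opens X × Opens Y) :
    {p : ProdVar X Y | p.fst ∈ (V ⊓ V').1 ∧ p.snd ∈ (V ⊓ V').2} =
      {p | p.fst ∈ V.1 ∧ p.snd ∈ V.2} ∩ {p | p.fst ∈ V'.1 ∧ p.snd ∈ V'.2} := by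
  ext p
  exact and_and_and_comm

theorem prodVar_adjoin_mono (V V' : Opens X × Opens Y) (h : V ≤ V') :
    Algebra.adjoin ℂ ({g : ProdVar X Y → ℂ | ∃ a, IsRegularOn a V'.1 ∧ g = fun p => a p.fst} ∪
        {g | ∃ b, IsRegularOn b V'.2 ∧ g = fun p => b p.snd}) ≤
      Algebra.adjoin ℂ ({g | ∃ a, IsRegularOn a V.1 ∧ g = fun p => a p.fst} ∪
        {g | ∃ b, IsRegularOn b V.2 ∧ g = fun p => b p.snd}) :=
  Algebra.adjoin_mono (by
    rintro _ (⟨a, ha, rfl⟩ | ⟨a, ha, rfl⟩)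
    · exact Or.inl ⟨a, fun x hx => ha x (h.1 hx), rfl⟩
    · exact Or.inr ⟨a, fun x hx => ha x (h.2 hx), rfl⟩)

theorem hasInverses_pow (n : ℕ) : HasInverses (Pow X n) :=
  hasInverses_generated _ _ (pow_box_inf n) (pow_adjoin_mono n) (by ext; simp)

/-- A map into a space with functions generated by algebras `A j` is a morphism as soon as it pulls
back the generators to regular functions. -/
theorem isMorphismAt_generated {Z J : Type} [SemilatticeInf J] [OrderTop J] {W : J → Set Z}
    {A : J → Subalgebra ℂ (Z → ℂ)} {hW : ∀ i j, W (i ⊓ j) = W i ∩ W j}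
    {hA : ∀ i j, i ≤ j → A j ≤ A i} {hT : W ⊤ = Set.univ} (hY : HasInverses Y) {φ : Y → Z} {y : Y}
    (h1 : ∀ j, φ y ∈ W j → ∀ᶠ y' in 𝓝 y, φ y' ∈ W j)
    (h2 : ∀ j, φ y ∈ W j → ∀ h ∈ A j, IsRegularAt (fun y => h (φ y)) y) :
    @IsMorphismAt Z Y (FunctionSpace.generated W A hW hA hT) _ φ y := by
  let := FunctionSpace.generated W A hW hA hT
  have hc : ContinuousAt φ y := by
    rw [ContinuousAt, tendsto_nhds_generateFrom_iff]
    rintro s ⟨j, h, hh, rfl⟩ ⟨hs1, hs2⟩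
    filter_upwards [h1 j hs1, (hY _ _ (h2 j hs1 h hh) hs2).1] with y' hy hy'
    exact ⟨hy, hy'⟩
  refine ⟨hc, ?_⟩
  rintro f ⟨j, hj, g, hg, h, hh, h0, e⟩
  refine (hY.div (h2 j hj g hg) (h2 j hj h hh) h0).congr ?_
  filter_upwards [hc.eventually (Germ.coe_eq.mp e)] with y' hy'
  exact hy'.symm

theorem isRegularAt_of_mem_adjoin {Z : Type} {φ : Y → Z} {y : Y} {s : Set (Z → ℂ)}
    (hs : ∀ g ∈ s, IsRegularAt (fun y => g (φ y)) y) {h : Z → ℂ} (hh : h ∈ Algebra.adjoin ℂ s) :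
    IsRegularAt (fun y => h (φ y)) y := by
  induction hh using Algebra.adjoin_induction with
  | mem x hx => exact hs x hx
  | algebraMap r => exact isRegularAt_const r
  | add a b _ _ ha hb => exact ha.add hb
  | mul a b _ _ ha hb => exact ha.mul hb

/-- A map into `X^n` is a morphism if its components are. -/
theorem isMorphismAt_pow {n : ℕ} (hY : HasInverses Y) {φ : Y → Pow X n} {y : Y}
    (h : ∀ i, IsMorphismAt (fun y => φ y i) y) : IsMorphismAt φ y := by
  refine isMorphismAt_generated (hW := pow_box_inf n) (hA := pow_adjoin_mono n)
    (hT := by ext; simp) hY (fun V hV => ?_) (fun V hV g hg => ?_)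
  · exact eventually_all.2 fun i => (h i).continuousAt.eventually ((V i).isOpen.mem_nhds (hV i))
  · refine isRegularAt_of_mem_adjoin ?_ hg
    rintro _ ⟨i, a, ha, rfl⟩
    exact (h i).comp a (ha _ (hV i))

/-- A map into `X × Y` is a morphism if its components are. -/
theorem isMorphismAt_prodVar (hZ : HasInverses Z) {φ : Z → ProdVar X Y} {z : Z}
    (h1 : IsMorphismAt (fun z => (φ z).fst) z) (h2 : IsMorphismAt (fun z => (φ z).snd) z) :
    IsMorphismAt φ z := by
  refine isMorphismAt_generated (hW := prodVar_box_inf) (hA := prodVar_adjoin_mono)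
    (hT := by ext; simp) hZ (fun V hV => ?_) (fun V hV g hg => ?_)
  · exact (h1.continuousAt.eventually (V.1.isOpen.mem_nhds hV.1)).and
      (h2.continuousAt.eventually (V.2.isOpen.mem_nhds hV.2))
  · refine isRegularAt_of_mem_adjoin ?_ hg
    rintro _ (⟨a, ha, rfl⟩ | ⟨a, ha, rfl⟩)
    · exact h1.comp a (ha _ hV.1)
    · exact h2.comp a (ha _ hV.2)

theorem isMorphismAt_fst (p : ProdVar X Y) : IsMorphismAt ProdVar.fst p := by
  constructor
  · intro s hs
    obtain ⟨V, hVs, hV, hx⟩ := mem_nhds_iff.1 hs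
    have h1 : IsOpen {z : ProdVar X Y | (z.fst ∈ (⟨V, hV⟩ : Opens X) ∧ z.snd ∈ (⊤ : Opens Y)) ∧
        (1 : ProdVar X Y → ℂ) z ≠ 0} :=
      isOpen_generateFrom_of_mem ⟨(⟨V, hV⟩, ⊤), 1, one_mem _, rfl⟩
    refine mem_map.2 ?_
    filter_upwards [h1.mem_nhds ⟨⟨hx, trivial⟩, one_ne_zero⟩] with z hz
    exact hVs hz.1.1
  · intro f hf
    obtain ⟨V, hV, hVo, hx⟩ := eventually_nhds_iff.1 hf.eventually
    refine ⟨(⟨V, hVo⟩, ⊤), ⟨hx, trivial⟩, fun q => f q.fst,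
      Algebra.subset_adjoin (Or.inl ⟨f, fun x hx => hV x hx, rfl⟩), 1, one_mem _, one_ne_zero, ?_⟩
    exact congrArg _ (funext fun y => by simp)

theorem continuous_toSym {n : ℕ} : Continuous (toSym : Pow X n → SymPow X n) :=
  continuous_coinduced_rng

theorem isOpen_symPow_iff {n : ℕ} {U : Set (SymPow X n)} :
    IsOpen U ↔ IsOpen (toSym ⁻¹' U : Set (Pow X n)) := isOpen_coinduced

/-- The quotient map `X^n → S^n X` is a morphism. -/
theorem isMorphismAt_toSym {n : ℕ} (p : Pow X n) : IsMorphismAt toSym p := by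
  refine ⟨continuous_toSym.continuousAt, ?_⟩
  rintro f ⟨f', e, U, hU, h⟩
  refine (h p hU).congr ?_
  filter_upwards [continuous_toSym.continuousAt.eventually (Germ.coe_eq.mp e)] with y hy
  exact hy.symm

theorem map_univ_perm {α : Type*} {n : ℕ} (p : Fin n → α) (σ : Equiv.Perm (Fin n)) :
    Finset.univ.val.map (fun i => p (σ i)) = Finset.univ.val.map p := by
  have h := congrArg (fun s => Multiset.map p s.val) (Finset.map_univ_equiv σ)
  rw [Finset.map_val, Multiset.map_map] at h
  exact h

/-- Reindexing of the coordinates. -/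
def reindex {X : Type} {n k : ℕ} (σ : Fin k → Fin n) (q : Pow X n) : Pow X k := fun i => q (σ i)

/-- The fibres of `X^n → S^n X` are the orbits of the symmetric group. -/
theorem toSym_eq_iff {X : Type} {n : ℕ} {p q : Pow X n} :
    toSym p = toSym q ↔ ∃ σ : Equiv.Perm (Fin n), q = reindex σ p := by
  constructor
  · intro h
    have h1 : Multiset.map (fun i => p i) Finset.univ.val =
        Multiset.map (fun i => q i) Finset.univ.val := congrArg Subtype.val h
    classical
    have h2 : ∀ x, Nonempty ({i // q i = x} ≃ {i // p i = x}) := by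
      intro x
      refine ⟨Fintype.equivOfCardEq ?_⟩
      have h3 := congrArg (Multiset.count x) h1
      rw [Multiset.count_map, Multiset.count_map] at h3
      rw [Fintype.card_subtype, Fintype.card_subtype]
      simp only [Finset.card, Finset.filter_val, eq_comm (b := x)]
      exact h3.symm
    let σ : Equiv.Perm (Fin n) := (Equiv.sigmaFiberEquiv q).symm.trans
      ((Equiv.sigmaCongrRight fun x => (h2 x).some).trans (Equiv.sigmaFiberEquiv p))
    refine ⟨σ, funext fun i => ?_⟩
    exact ((h2 (q i)).some ⟨i, rfl⟩).2.symm
  · rintro ⟨σ, rfl⟩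
    refine Subtype.ext ?_
    exact (map_univ_perm p σ).symm

theorem toSym_surjective {X : Type} {n : ℕ} :
    Function.Surjective (toSym : Pow X n → SymPow X n) := by
  rintro ⟨s, hs⟩
  obtain ⟨l, rfl⟩ := Quot.exists_rep s
  have hl : l.length = n := hs
  subst hl
  refine ⟨fun i => l.get i, Subtype.ext ?_⟩
  change Multiset.map (fun i => l.get i) Finset.univ.val = _
  rw [Fin.univ_val_map, List.ofFn_get]
  rfl

theorem finite_toSym_fibre {X : Type} {n : ℕ} (t : SymPow X n) :
    {p : Pow X n | toSym p = t}.Finite := by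
  obtain ⟨p, rfl⟩ := toSym_surjective t
  refine (Set.finite_range fun σ : Equiv.Perm (Fin n) => reindex σ p).subset ?_
  intro q hq
  obtain ⟨σ, rfl⟩ := toSym_eq_iff.1 (Eq.symm hq : toSym p = toSym q)
  exact ⟨σ, rfl⟩

theorem isMorphismAt_reindex {n k : ℕ} (σ : Fin k → Fin n) (p : Pow X n) :
    IsMorphismAt (reindex σ : Pow X n → Pow X k) p :=
  isMorphismAt_pow (hasInverses_pow n) fun i => isMorphismAt_proj (σ i) p

/-- A neighbourhood of a whole fibre of `X^n → S^n X` contains the preimage of a neighbourhood. -/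
theorem eventually_nhds_symPow {n : ℕ} {t : SymPow X n} {C : Pow X n → Prop}
    (h : ∀ p, toSym p = t → ∀ᶠ q in 𝓝 p, C q) : ∀ᶠ t' in 𝓝 t, ∀ q, toSym q = t' → C q := by
  let O : Set (Pow X n) := interior {q | C q}
  let U : Set (SymPow X n) := {t' | ∀ q, toSym q = t' → q ∈ O}
  have hU : IsOpen U := by
    rw [isOpen_symPow_iff]
    have : (toSym ⁻¹' U : Set (Pow X n)) =
        ⋂ σ : Equiv.Perm (Fin n), (reindex σ : Pow X n → Pow X n) ⁻¹' O := by
      ext p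
      simp only [Set.mem_preimage, Set.mem_iInter, U, Set.mem_ofPred_eq]
      constructor
      · intro h σ
        exact h _ (toSym_eq_iff.2 ⟨σ, rfl⟩).symm
      · intro h q hq
        obtain ⟨σ, rfl⟩ := toSym_eq_iff.1 hq.symm
        exact h σ
    rw [this]
    refine isOpen_iInter_of_finite fun σ => IsOpen.preimage ?_ isOpen_interior
    exact continuous_iff_continuousAt.2 fun p => (isMorphismAt_reindex σ p).continuousAt
  filter_upwards [hU.mem_nhds (fun q hq => mem_interior_iff_mem_nhds.2 (h q hq))] with t' ht' q hq
  exact interior_subset (s := {q | C q}) (ht' q hq)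

end Morphisms

/-! ### Affine coordinates near finitely many points -/

section Charts

/-- Affine coordinates `y` on an open subset `V` of `X`: the regular functions are locally the
quotients of polynomials in the coordinates, the topology is the Zariski topology of the
coordinates, and the Nullstellensatz holds at the points of `V`. -/
structure Chart (X : Type) [FunctionSpace X] where
  /-- the number of coordinates -/
  N : ℕ
  /-- the domain -/
  V : Opens X
  /-- the coordinates -/
  y : X → Fin N → ℂ
  regular : ∀ k, ∀ x ∈ V, IsRegularAt (fun x => y x k) x
  injective : ∀ x ∈ V, ∀ x' ∈ V, y x = y x' → x = x'
  quot : ∀ x ∈ V, ∀ f, IsRegularAt f x → ∃ G H : MvPolynomial (Fin N) ℂ,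
    MvPolynomial.eval (y x) H ≠ 0 ∧
      f =ᶠ[𝓝 x] fun x => MvPolynomial.eval (y x) G / MvPolynomial.eval (y x) H
  basis : ∀ x ∈ V, ∀ O ∈ 𝓝 x, ∃ H : MvPolynomial (Fin N) ℂ, MvPolynomial.eval (y x) H ≠ 0 ∧
    ∀ x' ∈ V, MvPolynomial.eval (y x') H ≠ 0 → x' ∈ O
  nullstellensatz : ∀ P : Ideal (MvPolynomial (Fin N) ℂ), P.IsPrime →
    (∀ G, (∀ x ∈ V, MvPolynomial.eval (y x) G = 0) → G ∈ P) →
    (∃ p ∈ V, ∀ G ∈ P, MvPolynomial.eval (y p) G = 0) →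
    ∀ H ∉ P, ∃ r ∈ V, (∀ G ∈ P, MvPolynomial.eval (y r) G = 0) ∧ MvPolynomial.eval (y r) H ≠ 0

theorem eval_smul_of_isHomogeneous {σ : Type*} [Fintype σ] {F : MvPolynomial σ ℂ} {d : ℕ}
    (hF : F.IsHomogeneous d) (c : ℂ) (v : σ → ℂ) :
    MvPolynomial.eval (c • v) F = c ^ d * MvPolynomial.eval v F := by
  rw [MvPolynomial.eval_eq', MvPolynomial.eval_eq', Finset.mul_sum]
  refine Finset.sum_congr rfl fun e he => ?_
  have h1 : ∑ i, e i = d := by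
    have := hF (MvPolynomial.mem_support_iff.1 he)
    rw [Finsupp.weight_apply, Finsupp.sum_fintype _ _ (by simp)] at this
    simpa using this
  simp only [Pi.smul_apply, smul_eq_mul, mul_pow, Finset.prod_mul_distrib]
  rw [Finset.prod_pow_eq_pow_sum, h1]
  ring

variable {X : Type} [FunctionSpace X]

/-- Finitely many points of a quasi-projective variety lie in a common affine coordinate chart: the
complement of a hyperplane which avoids them. -/
theorem exists_chart (hX : IsQuasiProjective X) {A : Set X} (hA : A.Finite) :
    ∃ c : Chart X, A ⊆ c.V := by
  obtain ⟨N, i, hi, ⟨S, T, hS, hT, hST⟩, hcl, hst⟩ := hX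
  have := hA.to_subtype
  -- a linear form `l` which vanishes at no point of `A`; the chart is `{l ≠ 0}`, with the
  -- homogeneous coordinates divided by `l`
  obtain ⟨l, hl⟩ := Module.exists_dual_forall_apply_ne_zero (K := ℂ) (fun a : A => (i a).rep)
    fun a => (i a).rep_nonzero
  let Lp : MvPolynomial (Fin (N + 1)) ℂ :=
    ∑ k, MvPolynomial.C (l (Pi.single k 1)) * MvPolynomial.X k
  have hLp : ∀ v, MvPolynomial.eval v Lp = l v := by
    intro v
    simp only [Lp, map_sum, map_mul, MvPolynomial.eval_C, MvPolynomial.eval_X]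
    conv_rhs => rw [← Finset.univ_sum_single v, map_sum]
    refine Finset.sum_congr rfl fun k _ => ?_
    have : Pi.single k (v k) = v k • (Pi.single k 1 : Fin (N + 1) → ℂ) := by
      rw [← Pi.single_smul, smul_eq_mul, mul_one]
    rw [this, map_smul, smul_eq_mul, mul_comm]
  have hLhom : Lp.IsHomogeneous 1 := by
    refine MvPolynomial.IsHomogeneous.sum _ _ _ fun k _ => ?_
    simpa using (MvPolynomial.isHomogeneous_C (Fin (N + 1)) _).mul
      (MvPolynomial.isHomogeneous_X ℂ k)
  have hsub : ∀ S : Set (MvPolynomial (Fin (N + 1)) ℂ), AllHomogeneous S →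
      IsClosed (i ⁻¹' ClassicalVariety.zeroLocus S) := fun S hS => (hcl _).2 ⟨S, hS, rfl⟩
  let V : Opens X := ⟨{x | l (i x).rep ≠ 0}, by
    rw [← isClosed_compl_iff]
    convert! hsub {Lp} (by rintro _ rfl; exact ⟨1, hLhom⟩) using 1
    ext x
    simp [ClassicalVariety.zeroLocus, hLp]⟩
  let y : X → Fin (N + 1) → ℂ := fun x => (l (i x).rep)⁻¹ • (i x).rep
  have hy : ∀ (F : MvPolynomial (Fin (N + 1)) ℂ) (d : ℕ), F.IsHomogeneous d → ∀ x,
      MvPolynomial.eval (y x) F = ((l (i x).rep)⁻¹) ^ d * MvPolynomial.eval (i x).rep F :=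
    fun F d hF x => eval_smul_of_isHomogeneous hF _ _
  have hy0 : ∀ (F : MvPolynomial (Fin (N + 1)) ℂ) (d : ℕ), F.IsHomogeneous d → ∀ x ∈ V,
      (MvPolynomial.eval (y x) F = 0 ↔ MvPolynomial.eval (i x).rep F = 0) := by
    intro F d hF x hx
    rw [hy F d hF, mul_eq_zero, or_iff_right (pow_ne_zero _ (inv_ne_zero hx))]
  refine ⟨⟨N + 1, V, y, ?_, ?_, ?_, ?_, ?_⟩, fun a ha => hl ⟨a, ha⟩⟩
  · intro k x hx
    refine (hst x _).2 ⟨1, MvPolynomial.X k, Lp, MvPolynomial.isHomogeneous_X ℂ k, hLhom,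
      by rwa [hLp], congrArg _ (funext fun z => ?_)⟩
    rw [hLp, MvPolynomial.eval_X, div_eq_inv_mul]
    rfl
  · intro x hx x' hx' h
    apply hi
    rw [← (i x).mk_rep, ← (i x').mk_rep, Projectivization.mk_eq_mk_iff']
    refine ⟨l (i x).rep * (l (i x').rep)⁻¹, ?_⟩
    have h1 : (i x).rep = l (i x).rep • y x := by
      rw [smul_smul, mul_inv_cancel₀ hx, one_smul]
    rw [mul_smul]
    conv_rhs => rw [h1, h]
  · intro x hx f hf
    obtain ⟨d, F, G, hF, hG, hG0, e⟩ := (hst x _).1 hf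
    refine ⟨F, G, fun h => hG0 ((hy0 G d hG x hx).1 h), ?_⟩
    filter_upwards [Germ.coe_eq.mp e, V.isOpen.mem_nhds hx] with z hz hzV
    rw [hz, hy F d hF, hy G d hG, mul_div_mul_left _ _ (pow_ne_zero _ (inv_ne_zero hzV))]
  · intro x hx O hO
    obtain ⟨O', hO', hop, hxO⟩ := mem_nhds_iff.1 hO
    obtain ⟨S', hS', hC⟩ := (hcl (O'ᶜ)).1 hop.isClosed_compl
    have h1 : x ∉ i ⁻¹' ClassicalVariety.zeroLocus S' := by
      rw [← hC]
      simpa using hxO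
    simp only [ClassicalVariety.zeroLocus, Set.mem_preimage, Set.mem_ofPred_eq, not_forall] at h1
    obtain ⟨F, hF, hF0⟩ := h1
    obtain ⟨d, hd⟩ := hS' F hF
    refine ⟨F, fun h => hF0 ((hy0 F d hd x hx).1 h), fun x' hx' h => hO' ?_⟩
    by_contra hx2
    have : x' ∈ i ⁻¹' ClassicalVariety.zeroLocus S' := by rw [← hC]; exact hx2
    exact h ((hy0 F d hd x' hx').2 (this F hF))
  -- The image of `X` is `S = 0` minus `T = 0`. Some `F ∈ T` does not vanish at `p`, so `F ∉ P`, and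
  -- Hilbert's Nullstellensatz gives a zero `r` of `P` with `H F ≠ 0`. It lies on `l = 1`, as
  -- `l - 1 ∈ P`, and the corresponding point of the projective space is in the image of `X`.
  · rintro P hP hPV ⟨p, hp, hpP⟩ H hH
    have hpST : i p ∈ ClassicalVariety.zeroLocus S \ ClassicalVariety.zeroLocus T :=
      hST ▸ Set.mem_range_self p
    have h1 := hpST.2
    simp only [ClassicalVariety.zeroLocus, Set.mem_ofPred_eq, not_forall] at h1
    obtain ⟨F, hF, hF0⟩ := h1
    obtain ⟨d, hd⟩ := hT F hF
    have hFP : F ∉ P := fun h => hF0 ((hy0 F d hd p hp).1 (hpP F h))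
    have hHF : H * F ∉ MvPolynomial.vanishingIdeal ℂ (MvPolynomial.zeroLocus ℂ P) := by
      rw [MvPolynomial.IsPrime.vanishingIdeal_zeroLocus]
      exact fun h => (hP.mem_or_mem h).elim hH hFP
    rw [MvPolynomial.mem_vanishingIdeal_iff] at hHF
    push Not at hHF
    obtain ⟨r, hr, hHFr⟩ := hHF
    simp only [MvPolynomial.mem_zeroLocus_iff, MvPolynomial.aeval_eq_eval] at hr hHFr
    rw [map_mul] at hHFr
    have hlr : l r = 1 := by
      have h2 : Lp - 1 ∈ P := by
        refine hPV _ fun x hx => ?_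
        rw [map_sub, map_one, hLp, map_smul, smul_eq_mul, inv_mul_cancel₀ hx, sub_self]
      have h3 := hr _ h2
      rw [map_sub, map_one] at h3
      rw [← hLp]
      exact sub_eq_zero.1 h3
    have hr0 : r ≠ 0 := by
      rintro rfl
      simp at hlr
    obtain ⟨u, hu⟩ := Projectivization.exists_smul_eq_mk_rep ℂ r hr0
    have hu' : (Projectivization.mk ℂ r hr0).rep = (u : ℂ) • r := hu.symm
    have hmem : Projectivization.mk ℂ r hr0 ∈ Set.range i := by
      rw [hST]
      constructor
      · intro G hG
        obtain ⟨e, he⟩ := hS G hG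
        rw [hu', eval_smul_of_isHomogeneous he, hr G, mul_zero]
        refine hPV G fun x hx => (hy0 G e he x hx).2 ?_
        have : i x ∈ ClassicalVariety.zeroLocus S \ ClassicalVariety.zeroLocus T :=
          hST ▸ Set.mem_range_self x
        exact this.1 G hG
      · intro h
        have h2 := h F hF
        rw [hu', eval_smul_of_isHomogeneous hd] at h2
        exact (mul_ne_zero (pow_ne_zero _ u.ne_zero) (right_ne_zero_of_mul hHFr)) h2
    obtain ⟨x, hx⟩ := hmem
    have hlx : l (i x).rep = u := by
      rw [hx, hu', map_smul, hlr, smul_eq_mul, mul_one]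
    have hyx : y x = r := by
      change (l (i x).rep)⁻¹ • (i x).rep = r
      rw [hlx, hx, hu', smul_smul, inv_mul_cancel₀ u.ne_zero, one_smul]
    refine ⟨x, ?_, ?_, ?_⟩
    · change l (i x).rep ≠ 0
      rw [hlx]
      exact u.ne_zero
    · intro G hG
      rw [hyx]
      exact hr G hG
    · rw [hyx]
      exact left_ne_zero_of_mul hHFr

end Charts

/-! ### Semi-local functions on `X^n` -/

section SemiLocal

variable {X : Type} [FunctionSpace X] (c : Chart X) (n : ℕ)

/-- The functions on `X^n` which are polynomials in the coordinates of the points. -/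
def polyAlg : Subalgebra ℂ (Pow X n → ℂ) :=
  Algebra.adjoin ℂ {g | ∃ i k, g = fun q => c.y (q i) k}

/-- The points of `X^n` with all components in the chart. -/
def InChart (q : Pow X n) : Prop := ∀ i, q i ∈ c.V

variable {c n}

theorem InChart.eventually {p : Pow X n} (hp : InChart c n p) : ∀ᶠ q in 𝓝 p, InChart c n q :=
  eventually_all.2 fun i =>
    (isMorphismAt_proj i p).continuousAt.eventually (c.V.isOpen.mem_nhds (hp i))

theorem InChart.reindex {k : ℕ} {p : Pow X n} (hp : InChart c n p) (σ : Fin k → Fin n) :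
    InChart c k (reindex σ p) := fun i => hp (σ i)

theorem eval_mem_polyAlg (i : Fin n) (G : MvPolynomial (Fin c.N) ℂ) :
    (fun q : Pow X n => MvPolynomial.eval (c.y (q i)) G) ∈ polyAlg c n := by
  induction G using MvPolynomial.induction_on with
  | C a =>
    simp only [MvPolynomial.eval_C]
    exact (polyAlg c n).algebraMap_mem a
  | add p q hp hq =>
    simp only [map_add]
    exact add_mem hp hq
  | mul_X p k hp =>
    simp only [map_mul, MvPolynomial.eval_X]
    exact mul_mem hp (Algebra.subset_adjoin ⟨i, k, rfl⟩)

theorem isRegularAt_of_mem_polyAlg {g : Pow X n → ℂ} (hg : g ∈ polyAlg c n) {p : Pow X n}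
    (hp : InChart c n p) : IsRegularAt g p := by
  refine isRegularAt_of_mem_adjoin (φ := fun q => q) ?_ hg
  rintro _ ⟨i, k, rfl⟩
  exact (isMorphismAt_proj i p).comp _ (c.regular k _ (hp i))

theorem reindex_mem_polyAlg {k : ℕ} (σ : Fin k → Fin n) {g : Pow X k → ℂ}
    (hg : g ∈ polyAlg c k) : (fun q => g (reindex σ q)) ∈ polyAlg c n := by
  induction hg using Algebra.adjoin_induction with
  | mem x hx =>
    obtain ⟨i, k, rfl⟩ := hx
    exact Algebra.subset_adjoin ⟨σ i, k, rfl⟩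
  | algebraMap r => exact (polyAlg c n).algebraMap_mem r
  | add a b _ _ ha hb => exact add_mem ha hb
  | mul a b _ _ ha hb => exact mul_mem ha hb

theorem exists_separating {p p' : Pow X n} (hp : InChart c n p) (hp' : InChart c n p')
    (h : p' ≠ p) : ∃ g ∈ polyAlg c n, g p ≠ 0 ∧ g p' = 0 := by
  obtain ⟨i, hi⟩ := Function.ne_iff.1 h
  have h1 : c.y (p i) ≠ c.y (p' i) := fun e => hi (c.injective _ (hp i) _ (hp' i) e).symm
  obtain ⟨k, hk⟩ := Function.ne_iff.1 h1
  refine ⟨fun q => c.y (q i) k - c.y (p' i) k, ?_, sub_ne_zero.2 hk, sub_self _⟩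
  exact sub_mem (Algebra.subset_adjoin ⟨i, k, rfl⟩) ((polyAlg c n).algebraMap_mem _)

/-- Polynomial expressions in regular functions of the components are quotients of polynomial
functions on a basic open neighbourhood. -/
theorem exists_quot_of_mem_adjoin {p : Pow X n} (hp : InChart c n p) {W : Fin n → Opens X}
    (hpW : ∀ i, p i ∈ W i) {g : Pow X n → ℂ}
    (hg : g ∈ Algebra.adjoin ℂ {g : Pow X n → ℂ |
      ∃ i a, IsRegularOn a (W i) ∧ g = fun z => a (z i)}) :
    ∃ u ∈ polyAlg c n, ∃ v ∈ polyAlg c n, v p ≠ 0 ∧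
      ∀ q, InChart c n q → v q ≠ 0 → g q = u q / v q := by
  induction hg using Algebra.adjoin_induction with
  | mem x hx =>
    obtain ⟨i, a, ha, rfl⟩ := hx
    obtain ⟨G, K, hK, e⟩ := c.quot _ (hp i) a (ha _ (hpW i))
    obtain ⟨M, hM, hM'⟩ := c.basis _ (hp i) _ e
    refine ⟨_, eval_mem_polyAlg i (G * M), _, eval_mem_polyAlg i (K * M), ?_, ?_⟩
    · rw [map_mul]
      exact mul_ne_zero hK hM
    · intro q hq hv
      rw [map_mul] at hv
      rw [map_mul, map_mul, mul_div_mul_right _ _ (right_ne_zero_of_mul hv)]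
      exact hM' _ (hq i) (right_ne_zero_of_mul hv)
  | algebraMap r =>
    exact ⟨_, (polyAlg c n).algebraMap_mem r, 1, one_mem _, one_ne_zero, fun q _ _ => by simp⟩
  | add a b _ _ ha hb =>
    obtain ⟨u, hu, v, hv, hv0, e⟩ := ha
    obtain ⟨u', hu', v', hv', hv0', e'⟩ := hb
    refine ⟨u * v' + v * u', add_mem (mul_mem hu hv') (mul_mem hv hu'), v * v',
      mul_mem hv hv', mul_ne_zero hv0 hv0', fun q hq h0 => ?_⟩
    have h1 := left_ne_zero_of_mul h0
    have h2 := right_ne_zero_of_mul h0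
    rw [Pi.add_apply, e q hq h1, e' q hq h2, div_add_div _ _ h1 h2]
    rfl
  | mul a b _ _ ha hb =>
    obtain ⟨u, hu, v, hv, hv0, e⟩ := ha
    obtain ⟨u', hu', v', hv', hv0', e'⟩ := hb
    refine ⟨u * u', mul_mem hu hu', v * v', mul_mem hv hv', mul_ne_zero hv0 hv0',
      fun q hq h0 => ?_⟩
    have h1 := left_ne_zero_of_mul h0
    have h2 := right_ne_zero_of_mul h0
    rw [Pi.mul_apply, e q hq h1, e' q hq h2, div_mul_div_comm]
    rfl

/-- The topology of `X^n` on the chart is the Zariski topology of the polynomial functions. -/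
theorem exists_polyAlg_basis {p : Pow X n} (hp : InChart c n p) {O : Set (Pow X n)}
    (hO : O ∈ 𝓝 p) : ∃ h ∈ polyAlg c n, h p ≠ 0 ∧ ∀ q, InChart c n q → h q ≠ 0 → q ∈ O := by
  obtain ⟨O', hO', hop, hpO⟩ := mem_nhds_iff.1 hO
  have hop' : GenerateOpen {D : Set (Pow X n) | ∃ W : Fin n → Opens X, ∃ h ∈ Algebra.adjoin ℂ
      {g : Pow X n → ℂ | ∃ i a, IsRegularOn a (W i) ∧ g = fun z => a (z i)},
      D = {z | z ∈ {z : Pow X n | ∀ i, z i ∈ W i} ∧ h z ≠ 0}} O' := hop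
  suffices h : ∃ h ∈ polyAlg c n, h p ≠ 0 ∧ ∀ q, InChart c n q → h q ≠ 0 → q ∈ O' by
    obtain ⟨g, hg, h1, h2⟩ := h
    exact ⟨g, hg, h1, fun q hq hgq => hO' (h2 q hq hgq)⟩
  clear hop hO' hO
  induction hop' with
  | basic s hs =>
    obtain ⟨W, h, hh, rfl⟩ := hs
    obtain ⟨hpW, hp0⟩ := hpO
    have h1 : ∀ i, ∃ H : MvPolynomial (Fin c.N) ℂ, MvPolynomial.eval (c.y (p i)) H ≠ 0 ∧
        ∀ x' ∈ c.V, MvPolynomial.eval (c.y x') H ≠ 0 → x' ∈ W i :=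
      fun i => c.basis _ (hp i) _ ((W i).isOpen.mem_nhds (hpW i))
    choose H hH1 hH2 using h1
    obtain ⟨u, hu, v, hv, hv0, e⟩ := exists_quot_of_mem_adjoin hp hpW hh
    obtain ⟨K, hK⟩ : ∃ K : Fin n → Pow X n → ℂ,
        ∀ i, K i = fun q => MvPolynomial.eval (c.y (q i)) (H i) := ⟨_, fun _ => rfl⟩
    have hKm : ∀ i, K i ∈ polyAlg c n := fun i => hK i ▸ eval_mem_polyAlg i (H i)
    refine ⟨u * v * ∏ i, K i, mul_mem (mul_mem hu hv) (prod_mem fun i _ => hKm i), ?_, ?_⟩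
    · simp only [Pi.mul_apply, Finset.prod_apply]
      refine mul_ne_zero (mul_ne_zero ?_ hv0) (Finset.prod_ne_zero_iff.2 fun i _ => ?_)
      swap
      · rw [hK]
        exact hH1 i
      intro h0
      rw [e p hp hv0, h0, zero_div] at hp0
      exact hp0 rfl
    · intro q hq hq0
      simp only [Pi.mul_apply, Finset.prod_apply] at hq0
      have h1 := right_ne_zero_of_mul (left_ne_zero_of_mul hq0)
      have h2 := fun i => Finset.prod_ne_zero_iff.1 (right_ne_zero_of_mul hq0) i (Finset.mem_univ _)
      simp only [hK] at h2
      refine ⟨fun i => hH2 i _ (hq i) (h2 i), ?_⟩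
      rw [e q hq h1]
      exact div_ne_zero (left_ne_zero_of_mul (left_ne_zero_of_mul hq0)) h1
  | univ => exact ⟨1, one_mem _, one_ne_zero, fun _ _ _ => Set.mem_univ _⟩
  | inter s t _ _ hs ht =>
    obtain ⟨g, hg, hg1, hg2⟩ := hs hpO.1
    obtain ⟨g', hg', hg1', hg2'⟩ := ht hpO.2
    exact ⟨g * g', mul_mem hg hg', mul_ne_zero hg1 hg1', fun q hq h => Set.mem_inter
      (hg2 q hq (left_ne_zero_of_mul h)) (hg2' q hq (right_ne_zero_of_mul h))⟩
  | sUnion S _ hS =>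
    obtain ⟨s, hs, hps⟩ := hpO
    obtain ⟨g, hg, hg1, hg2⟩ := hS s hs hps
    exact ⟨g, hg, hg1, fun q hq h => Set.mem_sUnion_of_mem (hg2 q hq h) hs⟩

/-- The regular functions on `X^n` are locally quotients of polynomial functions. -/
theorem exists_polyAlg_quot {p : Pow X n} (hp : InChart c n p) {f : Pow X n → ℂ}
    (hf : IsRegularAt f p) : ∃ g ∈ polyAlg c n, ∃ h ∈ polyAlg c n, h p ≠ 0 ∧
      f =ᶠ[𝓝 p] fun q => g q / h q := by
  obtain ⟨W, hpW, g, hg, h, hh, h0, e⟩ := hf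
  have key : ∀ g ∈ Algebra.adjoin ℂ {g : Pow X n → ℂ |
      ∃ i a, IsRegularOn a (W i) ∧ g = fun z => a (z i)},
      ∃ u ∈ polyAlg c n, ∃ v ∈ polyAlg c n, v p ≠ 0 ∧ g =ᶠ[𝓝 p] fun q => u q / v q := by
    intro g hg
    obtain ⟨u, hu, v, hv, hv0, e⟩ := exists_quot_of_mem_adjoin hp hpW hg
    refine ⟨u, hu, v, hv, hv0, ?_⟩
    filter_upwards [hp.eventually, (hasInverses_pow n v p (isRegularAt_of_mem_polyAlg hv hp) hv0).1]
      with q hq h0 using e q hq h0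
  obtain ⟨u, hu, v, hv, hv0, e1⟩ := key g hg
  obtain ⟨u', hu', v', hv', hv0', e2⟩ := key h hh
  have hu0 : u' p ≠ 0 := by
    intro h
    have := e2.eq_of_nhds
    simp only [h, zero_div] at this
    exact h0 this
  refine ⟨u * v', mul_mem hu hv', v * u', mul_mem hv hu', mul_ne_zero hv0 hu0, ?_⟩
  filter_upwards [Germ.coe_eq.mp e, e1, e2] with q h1 h2 h3
  rw [h1, h2, h3, div_div_div_eq]
  rfl

/-- Clearing denominators: functions which are regular at a point `p` become, after multiplication
by a suitable `h` with `h p ≠ 0`, polynomial functions on the whole chart. Moreover `h` may be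
supported in a given neighbourhood of `p`, and vanish at finitely many given points. -/
theorem exists_clear_denominators {P : Set (Pow X n)} (hP : P.Finite)
    (hPc : ∀ p ∈ P, InChart c n p) {p : Pow X n} (hp : InChart c n p) {O : Set (Pow X n)}
    (hO : O ∈ 𝓝 p) {ι : Type} [Fintype ι] {f : ι → Pow X n → ℂ} (hf : ∀ i, IsRegularAt (f i) p) :
    ∃ h ∈ polyAlg c n, h p ≠ 0 ∧ (∀ p' ∈ P, p' ≠ p → h p' = 0) ∧
      (∀ q, InChart c n q → h q ≠ 0 → q ∈ O) ∧
      ∀ i, ∃ g ∈ polyAlg c n, ∀ q, InChart c n q → g q = h q * f i q := by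
  classical
  have h1 : ∀ i, ∃ h ∈ polyAlg c n, h p ≠ 0 ∧
      ∃ g ∈ polyAlg c n, ∀ q, InChart c n q → g q = h q * f i q := by
    intro i
    obtain ⟨g, hg, h, hh, h0, e⟩ := exists_polyAlg_quot hp (hf i)
    obtain ⟨k, hk, hk0, hk'⟩ := exists_polyAlg_basis hp e
    -- `f i = g / h` holds only where `k ≠ 0`; the factor `k` makes the identity hold everywhere, and
    -- the second factor `h` does so at the zeros of `h`
    refine ⟨h * h * k, mul_mem (mul_mem hh hh) hk, mul_ne_zero (mul_ne_zero h0 h0) hk0,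
      h * k * g, mul_mem (mul_mem hh hk) hg, fun q hq => ?_⟩
    simp only [Pi.mul_apply]
    by_cases hkq : k q = 0
    · simp [hkq]
    · have h2 := hk' q hq hkq
      simp only [Set.mem_ofPred_eq] at h2
      by_cases hhq : h q = 0
      · simp [hhq]
      · rw [h2]
        field_simp
  choose h hh hp0 hg using h1
  obtain ⟨k, hk, hk0, hk'⟩ := exists_polyAlg_basis hp hO
  -- `k` restricts the support to `O`, the `s p'` vanish at the other points of `P`, and the `h i` are
  -- denominators
  have h2 : ∀ p' : P, ∃ g ∈ polyAlg c n, g p ≠ 0 ∧ (p'.1 ≠ p → g p' = 0) := by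
    intro p'
    by_cases h : p'.1 = p
    · exact ⟨1, one_mem _, one_ne_zero, fun h' => absurd h h'⟩
    · obtain ⟨g, hg, hg0, hg1⟩ := exists_separating hp (hPc _ p'.2) h
      exact ⟨g, hg, hg0, fun _ => hg1⟩
  choose s hs hs0 hs1 using h2
  have := hP.fintype
  refine ⟨(k * ∏ p', s p') * ∏ i, h i,
    mul_mem (mul_mem hk (prod_mem fun p' _ => hs p')) (prod_mem fun i _ => hh i), ?_, ?_, ?_, ?_⟩
  · simp only [Pi.mul_apply, Finset.prod_apply]
    exact mul_ne_zero (mul_ne_zero hk0 (Finset.prod_ne_zero_iff.2 fun i _ => hs0 i))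
      (Finset.prod_ne_zero_iff.2 fun i _ => hp0 i)
  · intro p' hp' hne
    simp only [Pi.mul_apply, Finset.prod_apply]
    rw [Finset.prod_eq_zero (Finset.mem_univ (⟨p', hp'⟩ : P)) (hs1 ⟨p', hp'⟩ hne)]
    simp
  · intro q hq h0
    simp only [Pi.mul_apply] at h0
    exact hk' q hq (left_ne_zero_of_mul (left_ne_zero_of_mul h0))
  · intro i
    obtain ⟨g, hg, e⟩ := hg i
    refine ⟨(k * ∏ p', s p') * (∏ j ∈ Finset.univ.erase i, h j) * g,
      mul_mem (mul_mem (mul_mem hk (prod_mem fun p' _ => hs p')) (prod_mem fun i _ => hh i)) hg,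
      fun q hq => ?_⟩
    rw [← Finset.mul_prod_erase Finset.univ h (Finset.mem_univ i)]
    simp only [Pi.mul_apply, e q hq]
    ring

/-- A function which is regular at finitely many points is near them the quotient of two polynomial
functions. -/
theorem exists_semilocal_quot {P : Set (Pow X n)} (hP : P.Finite)
    (hPc : ∀ p ∈ P, InChart c n p) {O : Set (Pow X n)}
    (hO : ∀ p ∈ P, O ∈ 𝓝 p) {f : Pow X n → ℂ} (hf : ∀ p ∈ P, IsRegularAt f p) :
    ∃ g ∈ polyAlg c n, ∃ h ∈ polyAlg c n, (∀ p ∈ P, h p ≠ 0) ∧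
      (∀ q, InChart c n q → h q ≠ 0 → q ∈ O) ∧ ∀ q, InChart c n q → g q = h q * f q := by
  classical
  have h1 : ∀ p : P, _ := fun p => exists_clear_denominators hP hPc (hPc p p.2) (hO p p.2)
    (ι := Unit) (f := fun _ => f) fun _ => hf p p.2
  choose h hh hp hp' hO' hg using h1
  choose g hg e using fun p => hg p ()
  have := hP.fintype
  refine ⟨∑ p, g p, sum_mem fun p _ => hg p, ∑ p, h p, sum_mem fun p _ => hh p, ?_, ?_, ?_⟩
  · intro p hpP
    rw [Finset.sum_apply, Finset.sum_eq_single (⟨p, hpP⟩ : P)]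
    · exact hp ⟨p, hpP⟩
    · intro p' _ hne
      exact hp' p' p hpP fun h => hne (Subtype.ext h.symm)
    · simp
  · intro q hq h0
    rw [Finset.sum_apply] at h0
    obtain ⟨p, _, hp⟩ := Finset.exists_ne_zero_of_sum_ne_zero h0
    exact hO' p q hq hp
  · intro q hq
    simp only [Finset.sum_apply, Finset.sum_mul]
    exact Finset.sum_congr rfl fun p _ => e p q hq

end SemiLocal

/-! ### Descent from `X × X^m` to `X × S^m X` -/

section Descent

variable {X : Type} {m : ℕ}

/-- The quotient map `X^{m+1} → X × S^m X`. -/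
def headTail (q : Pow X (m + 1)) : ProdVar X (SymPow X m) := ⟨q 0, toSym (reindex Fin.succ q)⟩

/-- The action of a permutation on the last `m` of `m + 1` indices. -/
def permTail (σ : Equiv.Perm (Fin m)) : Fin (m + 1) → Fin (m + 1) :=
  Fin.cons 0 fun i => (σ i).succ

theorem headTail_permTail (σ : Equiv.Perm (Fin m)) (q : Pow X (m + 1)) :
    headTail (reindex (permTail σ) q) = headTail q := by
  have h : toSym (reindex Fin.succ q) = toSym (reindex Fin.succ (reindex (permTail σ) q)) :=
    toSym_eq_iff.2 ⟨σ, rfl⟩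
  exact congrArg (ProdVar.mk (q 0)) h.symm

theorem headTail_eq_iff {q q' : Pow X (m + 1)} :
    headTail q = headTail q' ↔ ∃ σ, q' = reindex (permTail σ) q := by
  constructor
  · intro h
    obtain ⟨σ, hσ⟩ := toSym_eq_iff.1 (congrArg ProdVar.snd h)
    refine ⟨σ, funext fun i => ?_⟩
    refine Fin.cases ?_ (fun i => ?_) i
    · exact (congrArg ProdVar.fst h).symm
    · exact congrFun hσ i
  · rintro ⟨σ, rfl⟩
    exact (headTail_permTail σ q).symm

theorem headTail_surjective : Function.Surjective (headTail : Pow X (m + 1) → _) := by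
  rintro ⟨x, t⟩
  obtain ⟨z, rfl⟩ := toSym_surjective t
  exact ⟨(Fin.cons x z : Fin (m + 1) → X), rfl⟩

/-- A section of `X^m → S^m X`. -/
def symLift (t : SymPow X m) : Pow X m := (toSym_surjective t).choose

theorem toSym_symLift (t : SymPow X m) : toSym (symLift t) = t := (toSym_surjective t).choose_spec

/-- A section of `X^{m+1} → X × S^m X`. -/
def prodLift (P : ProdVar X (SymPow X m)) : Pow X (m + 1) := 
  (Fin.cons P.fst (symLift P.snd) : Fin (m + 1) → X)

theorem headTail_prodLift (P : ProdVar X (SymPow X m)) : headTail (prodLift P) = P := by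
  change ProdVar.mk P.fst (toSym (symLift P.snd)) = P
  rw [toSym_symLift]

/-- The average over the permutations of a function on `X^m`, as a function on `S^m X`. -/
def symAvg (b : Pow X m → ℂ) (t : SymPow X m) : ℂ :=
  (Fintype.card (Equiv.Perm (Fin m)) : ℂ)⁻¹ * ∑ σ : Equiv.Perm (Fin m), b (reindex σ (symLift t))

/-- The average over the permutations of the last components of a function on `X^{m+1}`, as a
function on `X × S^m X`. -/
def prodAvg (g : Pow X (m + 1) → ℂ) (P : ProdVar X (SymPow X m)) : ℂ :=
  (Fintype.card (Equiv.Perm (Fin m)) : ℂ)⁻¹ *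
    ∑ σ : Equiv.Perm (Fin m), g (reindex (permTail σ) (prodLift P))

theorem card_perm_ne_zero : (Fintype.card (Equiv.Perm (Fin m)) : ℂ) ≠ 0 :=
  Nat.cast_ne_zero.2 Fintype.card_ne_zero

theorem symAvg_toSym (b : Pow X m → ℂ) (z : Pow X m) :
    symAvg b (toSym z) = (Fintype.card (Equiv.Perm (Fin m)) : ℂ)⁻¹ *
      ∑ σ : Equiv.Perm (Fin m), b (reindex σ z) := by
  obtain ⟨τ, hτ⟩ := toSym_eq_iff.1 (toSym_symLift (toSym z)).symm
  rw [symAvg, hτ]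
  congr 1
  exact Equiv.sum_comp (Equiv.mulLeft τ) fun σ => b (reindex σ z)

theorem prodAvg_headTail {g : Pow X (m + 1) → ℂ} {q : Pow X (m + 1)}
    (h : ∀ σ, g (reindex (permTail σ) q) = g q) : prodAvg g (headTail q) = g q := by
  obtain ⟨τ, hτ⟩ := headTail_eq_iff.1 (headTail_prodLift (headTail q)).symm
  have h1 : ∀ σ : Equiv.Perm (Fin m), g (reindex (permTail σ) (prodLift (headTail q))) = g q := by
    intro σ
    rw [hτ, ← h (τ * σ)]
    congr 1
    funext i
    refine Fin.cases ?_ (fun i => ?_) i <;> rfl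
  rw [prodAvg, Finset.sum_congr rfl fun σ _ => h1 σ, Finset.sum_const, Finset.card_univ,
    nsmul_eq_mul, inv_mul_cancel_left₀ card_perm_ne_zero]

variable [FunctionSpace X] (c : Chart X)

/-- The cycles supported in the chart. -/
def symChart (m : ℕ) : Opens (SymPow X m) :=
  ⟨{t | ∀ z, toSym z = t → InChart c m z}, by
    rw [isOpen_symPow_iff]
    have : (toSym ⁻¹' {t | ∀ z, toSym z = t → InChart c m z} : Set (Pow X m)) =
        {z | InChart c m z} := by
      ext z
      refine ⟨fun h => h z rfl, fun h z' hz' => ?_⟩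
      obtain ⟨σ, rfl⟩ := toSym_eq_iff.1 hz'.symm
      exact InChart.reindex h σ
    rw [this]
    exact isOpen_iff_mem_nhds.2 fun z hz => InChart.eventually hz⟩

variable {c}

theorem isRegularAt_symAvg {b : Pow X m → ℂ} (hb : b ∈ polyAlg c m) {t : SymPow X m}
    (ht : t ∈ symChart c m) : IsRegularAt (symAvg b) t := by
  refine ⟨symAvg b, rfl, symChart c m, ht, fun z hz => ?_⟩
  simp only [symAvg_toSym]
  refine IsRegularAt.const_mul _ (IsRegularAt.sum _ fun σ _ => ?_)
  exact isRegularAt_of_mem_polyAlg (reindex_mem_polyAlg σ hb) (hz z rfl)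

/-- The polynomial functions on `X^{m+1}` are sums of products of a function of the first component
and a function of the others. -/
theorem mem_span_of_mem_polyAlg {g : Pow X (m + 1) → ℂ} (hg : g ∈ polyAlg c (m + 1)) :
    g ∈ Submodule.span ℂ {g : Pow X (m + 1) → ℂ | ∃ (a : X → ℂ) (b : Pow X m → ℂ),
      IsRegularOn a c.V ∧ b ∈ polyAlg c m ∧ g = fun q => a (q 0) * b (reindex Fin.succ q)} := by
  have h1 : g ∈ Subalgebra.toSubmodule (polyAlg c (m + 1)) := hg
  rw [polyAlg, Algebra.adjoin_eq_span] at h1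
  refine Submodule.span_mono ?_ h1
  intro g hg
  induction hg using Submonoid.closure_induction with
  | mem x hx =>
    obtain ⟨i, k, rfl⟩ := hx
    refine Fin.cases ?_ (fun i => ?_) i
    · exact ⟨fun x => c.y x k, 1, fun x hx => c.regular k x hx, one_mem _, by simp⟩
    · exact ⟨fun _ => 1, fun q => c.y (q i) k, fun x _ => isRegularAt_const 1,
        Algebra.subset_adjoin ⟨i, k, rfl⟩, by ext; simp [reindex]⟩
  | one => exact ⟨fun _ => 1, 1, fun x _ => isRegularAt_const 1, one_mem _, by ext; simp⟩
  | mul x y _ _ hx hy =>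
    obtain ⟨a, b, ha, hb, rfl⟩ := hx
    obtain ⟨a', b', ha', hb', rfl⟩ := hy
    refine ⟨fun x => a x * a' x, b * b', fun x hx => (ha x hx).mul (ha' x hx), mul_mem hb hb', ?_⟩
    ext q
    simp only [Pi.mul_apply]
    ring

/-- The average of a polynomial function is a sum of products of regular functions on `X` and
`S^m X`. -/
theorem prodAvg_mem_adjoin {g : Pow X (m + 1) → ℂ} (hg : g ∈ polyAlg c (m + 1)) :
    prodAvg g ∈ Algebra.adjoin ℂ
      ({g : ProdVar X (SymPow X m) → ℂ | ∃ a, IsRegularOn a c.V ∧ g = fun p => a p.fst} ∪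
        {g | ∃ b, IsRegularOn b (symChart c m) ∧ g = fun p => b p.snd}) := by
  have hg' := mem_span_of_mem_polyAlg hg
  clear hg
  induction hg' using Submodule.span_induction with
  | mem x hx =>
    obtain ⟨a, b, ha, hb, rfl⟩ := hx
    have e : (prodAvg fun q : Pow X (m + 1) => a (q 0) * b (reindex Fin.succ q)) =
        (fun P => a P.fst) * fun P => symAvg b P.snd := by
      ext P
      simp only [prodAvg, Pi.mul_apply, symAvg]
      rw [mul_left_comm, Finset.mul_sum (a := a P.fst)]
      rfl
    rw [e]
    exact mul_mem (Algebra.subset_adjoin (Or.inl ⟨a, ha, rfl⟩))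
      (Algebra.subset_adjoin (Or.inr ⟨_, fun t ht => isRegularAt_symAvg hb ht, rfl⟩))
  | zero =>
    have e : prodAvg (0 : Pow X (m + 1) → ℂ) = 0 := by ext; simp [prodAvg]
    rw [e]
    exact zero_mem _
  | add x y _ _ hx hy =>
    have e : prodAvg (x + y) = prodAvg x + prodAvg y := by
      ext
      simp [prodAvg, Finset.sum_add_distrib, mul_add]
    rw [e]
    exact add_mem hx hy
  | smul r x _ hx =>
    have e : prodAvg (r • x) = r • prodAvg x := by
      ext
      simp only [prodAvg, Pi.smul_apply, smul_eq_mul]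
      rw [← Finset.mul_sum]
      ring
    rw [e]
    exact Subalgebra.smul_mem _ hx r

/-- A function on `X × S^m X` whose pull-back to `X^{m+1}` is regular along a fibre is near this
fibre a quotient of averages of polynomial functions; the neighbourhood can be chosen to lie below a
given neighbourhood of the fibre. -/
theorem exists_quot_prodVar (hX : IsQuasiProjective X) {f : ProdVar X (SymPow X m) → ℂ}
    {P₀ : ProdVar X (SymPow X m)} {O : Set (Pow X (m + 1))}
    (hO : ∀ q, headTail q = P₀ → O ∈ 𝓝 q)
    (hf : ∀ q, headTail q = P₀ → IsRegularAt (fun q => f (headTail q)) q) :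
    ∃ V : Opens X × Opens (SymPow X m), (P₀.fst ∈ V.1 ∧ P₀.snd ∈ V.2) ∧
      ∃ G ∈ Algebra.adjoin ℂ
        ({g : ProdVar X (SymPow X m) → ℂ | ∃ a, IsRegularOn a V.1 ∧ g = fun p => a p.fst} ∪
          {g | ∃ b, IsRegularOn b V.2 ∧ g = fun p => b p.snd}),
      ∃ H ∈ Algebra.adjoin ℂ
        ({g : ProdVar X (SymPow X m) → ℂ | ∃ a, IsRegularOn a V.1 ∧ g = fun p => a p.fst} ∪
          {g | ∃ b, IsRegularOn b V.2 ∧ g = fun p => b p.snd}),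
      H P₀ ≠ 0 ∧ ∀ P : ProdVar X (SymPow X m), (P.fst ∈ V.1 ∧ P.snd ∈ V.2) → H P ≠ 0 →
        (∀ q, headTail q = P → q ∈ O) ∧ f P = G P / H P := by
  obtain ⟨q₀, rfl⟩ := headTail_surjective P₀
  set F : Set (Pow X (m + 1)) := {q | headTail q = headTail q₀} with hF
  have hFfin : F.Finite := by
    refine (Set.finite_range fun σ : Equiv.Perm (Fin m) => reindex (permTail σ) q₀).subset ?_
    intro q hq
    obtain ⟨σ, rfl⟩ := headTail_eq_iff.1 (Eq.symm hq : headTail q₀ = headTail q)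
    exact ⟨σ, rfl⟩
  obtain ⟨c, hc⟩ := exists_chart hX (Set.finite_range (q₀ : Fin (m + 1) → X))
  have hq₀ : InChart c (m + 1) q₀ := fun i => hc ⟨i, rfl⟩
  have hFc : ∀ q ∈ F, InChart c (m + 1) q := by
    intro q hq
    obtain ⟨σ, rfl⟩ := headTail_eq_iff.1 (Eq.symm hq : headTail q₀ = headTail q)
    exact hq₀.reindex _
  obtain ⟨g, hg, h, hh, h0, hO', e⟩ := exists_semilocal_quot hFfin hFc hO hf
  have hinv : ∀ (P : ProdVar X (SymPow X m)), (P.fst ∈ c.V ∧ P.snd ∈ symChart c m) →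
      ∀ q, headTail q = P → InChart c (m + 1) q := by
    rintro _ ⟨h1, h2⟩ q rfl i
    refine Fin.cases h1 (fun i => ?_) i
    exact h2 _ rfl i
  -- the norms of denominator and numerator
  let H' : Pow X (m + 1) → ℂ := ∏ σ : Equiv.Perm (Fin m), fun q => h (reindex (permTail σ) q)
  let K' : Pow X (m + 1) → ℂ := ∏ σ ∈ Finset.univ.erase (1 : Equiv.Perm (Fin m)),
    fun q => h (reindex (permTail σ) q)
  have hperm1 : ∀ q : Pow X (m + 1), reindex (permTail 1) q = q := by
    intro q
    funext i
    refine Fin.cases ?_ (fun i => ?_) i <;> rfl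
  have hHK : ∀ q, H' q = h q * K' q := by
    intro q
    have := Finset.mul_prod_erase Finset.univ
      (fun (σ : Equiv.Perm (Fin m)) (q : Pow X (m + 1)) => h (reindex (permTail σ) q))
      (Finset.mem_univ 1)
    have := congrFun this q
    rw [Pi.mul_apply, hperm1] at this
    exact this.symm
  have hH'm : H' ∈ polyAlg c (m + 1) := prod_mem fun σ _ => reindex_mem_polyAlg _ hh
  have hK'm : K' ∈ polyAlg c (m + 1) := prod_mem fun σ _ => reindex_mem_polyAlg _ hh
  have hH'inv : ∀ q τ, H' (reindex (permTail τ) q) = H' q := by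
    intro q τ
    simp only [H', Finset.prod_apply]
    rw [← Equiv.prod_comp (Equiv.mulLeft τ) fun σ => h (reindex (permTail σ) q)]
    refine Finset.prod_congr rfl fun σ _ => ?_
    congr 1
    funext i
    refine Fin.cases ?_ (fun i => ?_) i <;> rfl
  have hG' : ∀ q, InChart c (m + 1) q → (K' * g) q = H' q * f (headTail q) := by
    intro q hq
    rw [Pi.mul_apply, e q hq, hHK]
    ring
  have hG'inv : ∀ q, InChart c (m + 1) q → ∀ τ, (K' * g) (reindex (permTail τ) q) = (K' * g) q := by
    intro q hq τ
    rw [hG' q hq, hG' _ (hq.reindex _), hH'inv, headTail_permTail]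
  refine ⟨(c.V, symChart c m), ?_, prodAvg (K' * g), prodAvg_mem_adjoin (mul_mem hK'm hg),
    prodAvg H', prodAvg_mem_adjoin hH'm, ?_, ?_⟩
  · refine ⟨hq₀ 0, fun z hz => ?_⟩
    obtain ⟨σ, rfl⟩ := toSym_eq_iff.1 hz.symm
    exact (hq₀.reindex Fin.succ).reindex σ
  · rw [prodAvg_headTail (hH'inv q₀)]
    simp only [H', Finset.prod_apply]
    exact Finset.prod_ne_zero_iff.2 fun σ _ => h0 _ (headTail_permTail σ q₀)
  · intro P hP hHP
    obtain ⟨q, rfl⟩ := headTail_surjective P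
    have hq := hinv _ hP q rfl
    rw [prodAvg_headTail (hH'inv q)] at hHP ⊢
    rw [prodAvg_headTail (hG'inv q hq), hG' q hq, mul_div_cancel_left₀ _ hHP]
    refine ⟨fun q' hq' => ?_, rfl⟩
    obtain ⟨σ, rfl⟩ := headTail_eq_iff.1 hq'.symm
    refine hO' _ (hq.reindex _) fun h1 => ?_
    apply hHP
    rw [← hH'inv q σ, hHK, h1, zero_mul]

/-- Regular functions descend along `X^{m+1} → X × S^m X`. -/
theorem isRegularAt_of_headTail (hX : IsQuasiProjective X) {f : ProdVar X (SymPow X m) → ℂ}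
    {P : ProdVar X (SymPow X m)}
    (hf : ∀ q, headTail q = P → IsRegularAt (fun q => f (headTail q)) q) : IsRegularAt f P := by
  obtain ⟨V, hV, G, hG, H, hH, hH0, h⟩ :=
    exists_quot_prodVar hX (O := Set.univ) (fun _ _ => univ_mem) hf
  refine ⟨V, hV, G, hG, H, hH, hH0, Germ.coe_eq.mpr ?_⟩
  have h1 : ∀ᶠ y in 𝓝 P, (y.fst ∈ V.1 ∧ y.snd ∈ V.2) ∧ H y ≠ 0 :=
    (isOpen_generateFrom_of_mem ⟨V, H, hH, rfl⟩ : IsOpen {z : ProdVar X (SymPow X m) |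
      z ∈ {p : ProdVar X (SymPow X m) | p.fst ∈ V.1 ∧ p.snd ∈ V.2} ∧ H z ≠ 0}).mem_nhds ⟨hV, hH0⟩
  filter_upwards [h1] with y hy
  exact (h y hy.1 hy.2).2

/-- A neighbourhood of a fibre of `X^{m+1} → X × S^m X` contains the preimage of a
neighbourhood. -/
theorem eventually_nhds_prodVar (hX : IsQuasiProjective X) {C : Pow X (m + 1) → Prop}
    {P : ProdVar X (SymPow X m)} (h : ∀ q, headTail q = P → ∀ᶠ q' in 𝓝 q, C q') :
    ∀ᶠ P' in 𝓝 P, ∀ q, headTail q = P' → C q := by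
  obtain ⟨V, hV, G, hG, H, hH, hH0, h⟩ :=
    exists_quot_prodVar hX (f := fun _ => 0) h (fun _ _ => isRegularAt_const 0)
  have h1 : ∀ᶠ y in 𝓝 P, (y.fst ∈ V.1 ∧ y.snd ∈ V.2) ∧ H y ≠ 0 :=
    (isOpen_generateFrom_of_mem ⟨V, H, hH, rfl⟩ : IsOpen {z : ProdVar X (SymPow X m) |
      z ∈ {p : ProdVar X (SymPow X m) | p.fst ∈ V.1 ∧ p.snd ∈ V.2} ∧ H z ≠ 0}).mem_nhds ⟨hV, hH0⟩
  filter_upwards [h1] with y hy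
  exact (h y hy.1 hy.2).1

end Descent

/-! ### Frames of a line bundle near finitely many points -/

section Frames

variable {X : Type} [FunctionSpace X] {L : LineBundle X}

variable (L) in
/-- The section `e` does not vanish at `x`, and the sections which are regular at `x` are the
multiples of `e` by regular functions. -/
def IsFrameAt (e : ∀ y, L.Fib y) (x : X) : Prop :=
  e x ≠ 0 ∧ ∀ s, L.IsRegularSectionAt s x ↔
    ∃ f : X → ℂ, IsRegularAt f x ∧ ∀ᶠ y in 𝓝 x, s y = f y • e y

theorem exists_isFrameAt (x : X) : ∃ e, ∀ᶠ y in 𝓝 x, IsFrameAt L e y := by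
  obtain ⟨U, hx, e, h1, h2⟩ := L.exists_frame x
  exact ⟨e, by filter_upwards [U.isOpen.mem_nhds hx] with y hy using ⟨h1 y hy, h2 y hy⟩⟩

theorem IsFrameAt.isRegularSectionAt {e : ∀ y, L.Fib y} {x : X} (h : IsFrameAt L e x) :
    L.IsRegularSectionAt e x :=
  (h.2 e).2 ⟨fun _ => 1, isRegularAt_const 1, Eventually.of_forall fun _ => (one_smul _ _).symm⟩

theorem isRegularSectionAt_smul {s : ∀ y, L.Fib y} {x : X} {f : X → ℂ} (hf : IsRegularAt f x)
    (hs : L.IsRegularSectionAt s x) : L.IsRegularSectionAt (fun y => f y • s y) x := by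
  obtain ⟨e, he⟩ := exists_isFrameAt (L := L) x
  obtain ⟨g, hg, hg'⟩ := (he.self_of_nhds.2 s).1 hs
  refine (he.self_of_nhds.2 _).2 ⟨fun y => f y * g y, hf.mul hg, ?_⟩
  filter_upwards [hg'] with y hy
  rw [hy, mul_smul]

theorem isRegularSectionAt_add {s t : ∀ y, L.Fib y} {x : X}
    (hs : L.IsRegularSectionAt s x) (ht : L.IsRegularSectionAt t x) :
    L.IsRegularSectionAt (fun y => s y + t y) x := by
  obtain ⟨e, he⟩ := exists_isFrameAt (L := L) x
  obtain ⟨g, hg, hg'⟩ := (he.self_of_nhds.2 s).1 hs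
  obtain ⟨g₁, hg₁, hg₁'⟩ := (he.self_of_nhds.2 t).1 ht
  refine (he.self_of_nhds.2 _).2 ⟨fun y => g y + g₁ y, hg.add hg₁, ?_⟩
  filter_upwards [hg', hg₁'] with y hy hy'
  rw [hy, hy', add_smul]

theorem isRegularSectionAt_congr {s t : ∀ y, L.Fib y} {x : X}
    (hs : L.IsRegularSectionAt s x) (h : ∀ᶠ y in 𝓝 x, s y = t y) : L.IsRegularSectionAt t x := by
  obtain ⟨e, he⟩ := exists_isFrameAt (L := L) x
  obtain ⟨g, hg, hg'⟩ := (he.self_of_nhds.2 s).1 hs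
  refine (he.self_of_nhds.2 _).2 ⟨g, hg, ?_⟩
  filter_upwards [hg', h] with y hy hy'
  rw [← hy', hy]

theorem isRegularSectionAt_zero (x : X) : L.IsRegularSectionAt (fun _ => 0) x := by
  obtain ⟨e, he⟩ := exists_isFrameAt (L := L) x
  exact (he.self_of_nhds.2 _).2
    ⟨fun _ => 0, isRegularAt_const 0, Eventually.of_forall fun y => (zero_smul _ _).symm⟩

theorem isRegularSectionAt_sum {ι : Type*} (A : Finset ι) {s : ι → ∀ y, L.Fib y} {x : X}
    (hs : ∀ i ∈ A, L.IsRegularSectionAt (s i) x) :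
    L.IsRegularSectionAt (fun y => ∑ i ∈ A, s i y) x := by
  classical
  induction A using Finset.induction_on with
  | empty => simpa using isRegularSectionAt_zero x
  | insert a A ha ih =>
    simp only [Finset.sum_insert ha]
    exact isRegularSectionAt_add (hs a (Finset.mem_insert_self _ _))
      (ih fun i hi => hs i (Finset.mem_insert_of_mem hi))

/-- A regular section is a frame where it does not vanish. -/
theorem eventually_isFrameAt (hX : HasInverses X) {s : ∀ y, L.Fib y} {x : X}
    (hs : L.IsRegularSectionAt s x) (h0 : s x ≠ 0) : ∀ᶠ y in 𝓝 x, IsFrameAt L s y := by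
  obtain ⟨e, he⟩ := exists_isFrameAt (L := L) x
  obtain ⟨g, hg, hg'⟩ := (he.self_of_nhds.2 s).1 hs
  have hg0 : g x ≠ 0 := by
    intro h
    have := hg'.self_of_nhds
    rw [h, zero_smul] at this
    exact h0 this
  filter_upwards [he, hg'.eventually_nhds, hg.eventually, (hX g x hg hg0).1] with y hy hgy hry hy0
  refine ⟨?_, fun t => ?_⟩
  · rw [hgy.self_of_nhds]
    exact smul_ne_zero hy0 hy.1
  · rw [hy.2 t]
    constructor
    · rintro ⟨f, hf, hf'⟩
      refine ⟨fun y => f y / g y, hX.div hf hry hy0, ?_⟩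
      filter_upwards [hgy, hf', (hX g y hry hy0).1] with z h1 h2 h3
      rw [h1, h2, smul_smul, div_mul_cancel₀ _ h3]
    · rintro ⟨f, hf, hf'⟩
      refine ⟨fun y => f y * g y, hf.mul hry, ?_⟩
      filter_upwards [hgy, hf'] with z h1 h2
      rw [h2, h1, smul_smul]

variable {c : Chart X}

theorem isRegularAt_eval (G : MvPolynomial (Fin c.N) ℂ) {x : X} (hx : x ∈ c.V) :
    IsRegularAt (fun x => MvPolynomial.eval (c.y x) G) x := by
  induction G using MvPolynomial.induction_on with
  | C a =>
    simp only [MvPolynomial.eval_C]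
    exact isRegularAt_const a
  | add p q hp hq =>
    simp only [map_add]
    exact hp.add hq
  | mul_X p k hp =>
    simp only [map_mul, MvPolynomial.eval_X]
    exact hp.mul (c.regular k x hx)

variable (c L) in
/-- The ideal of polynomials `h` such that `h e`, defined where `h₁` does not vanish, extends
to a section which is regular at `q`. -/
def denominators (e : ∀ y, L.Fib y) (h₁ : MvPolynomial (Fin c.N) ℂ) {q : X} (hq : q ∈ c.V) :
    Ideal (MvPolynomial (Fin c.N) ℂ) where
  carrier := {h | ∃ s, L.IsRegularSectionAt s q ∧ ∀ᶠ y in 𝓝 q, MvPolynomial.eval (c.y y) h₁ ≠ 0 →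
    s y = MvPolynomial.eval (c.y y) h • e y}
  zero_mem' := ⟨_, isRegularSectionAt_zero q, Eventually.of_forall fun y _ => by simp⟩
  add_mem' := by
    rintro h h' ⟨s, hs, hs'⟩ ⟨t, ht, ht'⟩
    refine ⟨_, isRegularSectionAt_add hs ht, ?_⟩
    filter_upwards [hs', ht'] with y h1 h2 h0
    rw [h1 h0, h2 h0, map_add, add_smul]
  smul_mem' := by
    rintro k h ⟨s, hs, hs'⟩
    refine ⟨_, isRegularSectionAt_smul (isRegularAt_eval k hq) hs, ?_⟩
    filter_upwards [hs'] with y h1 h0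
    rw [h1 h0, smul_eq_mul, map_mul, mul_smul]

/-- The denominators at `q` of a local frame `e` at `p` do not all vanish at `p`. Otherwise a
minimal prime of the ideal of denominators would vanish at `p` and at `q`, and a general point of
its zero set would be a point where `e` differs from a local frame at `q` by a unit. -/
theorem exists_denominator (hX : HasInverses X) {e : ∀ y, L.Fib y}
    {h₁ : MvPolynomial (Fin c.N) ℂ} {p q : X} (hp : p ∈ c.V) (hq : q ∈ c.V)
    (h₁p : MvPolynomial.eval (c.y p) h₁ ≠ 0)
    (he : ∀ y ∈ c.V, MvPolynomial.eval (c.y y) h₁ ≠ 0 → IsFrameAt L e y) :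
    ∃ h ∈ denominators L c e h₁ hq, MvPolynomial.eval (c.y p) h ≠ 0 := by
  by_contra! hcon
  have hle : denominators L c e h₁ hq ≤ RingHom.ker (MvPolynomial.eval (c.y p)) := hcon
  have : (RingHom.ker (MvPolynomial.eval (c.y p))).IsPrime := RingHom.ker_isPrime _
  obtain ⟨P, hPmin, hPp⟩ := Ideal.exists_minimalPrimes_le hle
  have hPprime : P.IsPrime := hPmin.1.1
  -- `P` vanishes at `q`, since functions which are invertible at `q` can be cancelled from a
  -- denominator
  have hPq : ∀ G ∈ P, MvPolynomial.eval (c.y q) G = 0 := by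
    intro G hG
    by_contra hG0
    obtain ⟨k, hk, hGk⟩ := Ideal.exists_mul_mem_of_mem_minimalPrimes hPmin hG
    apply hk
    obtain ⟨s, hs, hs'⟩ := hGk
    have hGi := hX _ q (isRegularAt_eval G hq) hG0
    refine ⟨_, isRegularSectionAt_smul hGi.2 hs, ?_⟩
    filter_upwards [hs', hGi.1] with y h1 h2 h0
    rw [h1 h0, map_mul, smul_smul, inv_mul_cancel_left₀ h2]
  obtain ⟨eq, heq⟩ := exists_isFrameAt (L := L) q
  obtain ⟨h₂, h₂q, h₂'⟩ := c.basis q hq _ heq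
  have hV : ∀ G : MvPolynomial (Fin c.N) ℂ, (∀ x ∈ c.V, MvPolynomial.eval (c.y x) G = 0) →
      G ∈ P := by
    intro G hG
    refine hPmin.1.2 ⟨_, isRegularSectionAt_zero q, ?_⟩
    filter_upwards [c.V.isOpen.mem_nhds hq] with y hy _
    rw [hG y hy, zero_smul]
  have hH : h₁ * h₂ ∉ P := fun h =>
    (hPprime.mem_or_mem h).elim (fun h => h₁p (hPp h)) fun h => h₂q (hPq _ h)
  -- at the zero `r` of `P` both `e` and the frame `eq` at `q` are frames
  obtain ⟨r, hr, hrP, hrH⟩ := c.nullstellensatz P hPprime hV ⟨p, hp, fun G hG => hPp hG⟩ _ hH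
  rw [map_mul] at hrH
  have her := he r hr (left_ne_zero_of_mul hrH)
  have heqr : IsFrameAt L eq r := h₂' r hr (right_ne_zero_of_mul hrH)
  obtain ⟨φ, hφ, hφ'⟩ := (heqr.2 e).1 her.isRegularSectionAt
  obtain ⟨G, H, hH0, hGH⟩ := c.quot r hr φ hφ
  obtain ⟨M, hM0, hM⟩ := c.basis r hr _
    (hGH.and (hφ'.and (hX _ r (isRegularAt_eval H hr) hH0).1))
  -- `e = (G / H) eq` where `M ≠ 0`, so that `H M` is a denominator; but it does not vanish at `r`
  have hmem : H * M ∈ denominators L c e h₁ hq := by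
    refine ⟨_, isRegularSectionAt_smul (isRegularAt_eval (M * G) hq)
      heq.self_of_nhds.isRegularSectionAt, ?_⟩
    filter_upwards [c.V.isOpen.mem_nhds hq] with y hy _
    by_cases hMy : MvPolynomial.eval (c.y y) M = 0
    · simp [hMy]
    · obtain ⟨h1, h2, h3⟩ := hM y hy hMy
      rw [h2, h1, smul_smul, map_mul, map_mul]
      congr 1
      field_simp
  have := hrP _ (hPmin.1.2 hmem)
  rw [map_mul] at this
  exact mul_ne_zero hH0 hM0 this

/-- The product of a local frame at `p` and of denominators at the points of `A`, extended by zero. -/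
theorem exists_section_ne_zero (hX : HasInverses X) {A : Set X} (hA : A.Finite)
    (hAc : A ⊆ c.V) {p : X} (hp : p ∈ c.V) :
    ∃ s : ∀ y, L.Fib y, s p ≠ 0 ∧ ∀ q ∈ A, L.IsRegularSectionAt s q := by
  classical
  -- the factor `h₁` makes the section regular also where the frame is not defined
  obtain ⟨e, he⟩ := exists_isFrameAt (L := L) p
  obtain ⟨h₁, h₁p, h₁'⟩ := c.basis p hp _ he
  have := hA.fintype
  choose h hh hp0 using fun q : A => exists_denominator (L := L) hX hp (hAc q.2) h₁p h₁'
  choose s hs hs' using hh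
  refine ⟨fun y => if MvPolynomial.eval (c.y y) h₁ ≠ 0 then
    (MvPolynomial.eval (c.y y) (h₁ * ∏ q, h q)) • e y else 0, ?_, ?_⟩
  · simp only [if_pos h₁p]
    refine smul_ne_zero ?_ he.self_of_nhds.1
    rw [map_mul, map_prod]
    exact mul_ne_zero h₁p (Finset.prod_ne_zero_iff.2 fun q _ => hp0 q)
  · intro q hq
    refine isRegularSectionAt_congr (isRegularSectionAt_smul (isRegularAt_eval
      (h₁ * ∏ q' ∈ Finset.univ.erase (⟨q, hq⟩ : A), h q') (hAc hq)) (hs ⟨q, hq⟩)) ?_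
    filter_upwards [hs' ⟨q, hq⟩] with y hy
    by_cases h0 : MvPolynomial.eval (c.y y) h₁ = 0
    · simp [h0]
    · rw [if_pos h0, hy h0, smul_smul, ← map_mul,
        ← Finset.mul_prod_erase Finset.univ h (Finset.mem_univ (⟨q, hq⟩ : A))]
      congr 2
      ring

/-- A line bundle on a quasi-projective variety is trivial near any finite set. -/
theorem exists_frame_of_finite (hX : HasInverses X) (hXq : IsQuasiProjective X)
    {A : Set X} (hA : A.Finite) : ∃ e, ∀ x ∈ A, ∀ᶠ y in 𝓝 x, IsFrameAt L e y := by
  classical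
  obtain ⟨c, hc⟩ := exists_chart hXq hA
  have := hA.fintype
  choose s hs hs' using fun p : A => exists_section_ne_zero (L := L) hX hA hc (hc p.2)
  have h1 : ∀ p q : A, ∃ G : MvPolynomial (Fin c.N) ℂ, MvPolynomial.eval (c.y p) G ≠ 0 ∧
      (q ≠ p → MvPolynomial.eval (c.y q) G = 0) := by
    intro p q
    by_cases h : q = p
    · exact ⟨1, by simp, fun h' => absurd h h'⟩
    · have h2 : c.y p ≠ c.y q := fun e => h (Subtype.ext (c.injective _ (hc p.2) _ (hc q.2) e).symm)
      obtain ⟨k, hk⟩ := Function.ne_iff.1 h2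
      refine ⟨MvPolynomial.X k - MvPolynomial.C (c.y q k), ?_, fun _ => ?_⟩
      · simpa [sub_eq_zero] using hk
      · simp
  choose G hG hG' using h1
  refine ⟨fun y => ∑ p : A, MvPolynomial.eval (c.y y) (∏ q, G p q) • s p y, fun x hx => ?_⟩
  refine eventually_isFrameAt hX ?_ ?_
  · exact isRegularSectionAt_sum _ fun p _ =>
      isRegularSectionAt_smul (isRegularAt_eval _ (hc hx)) (hs' p x hx)
  · rw [Finset.sum_eq_single (⟨x, hx⟩ : A)]
    · refine smul_ne_zero ?_ (hs ⟨x, hx⟩)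
      rw [map_prod]
      exact Finset.prod_ne_zero_iff.2 fun q _ => hG ⟨x, hx⟩ q
    · intro p _ hne
      rw [map_prod, Finset.prod_eq_zero (Finset.mem_univ (⟨x, hx⟩ : A)) (hG' p ⟨x, hx⟩ hne.symm),
        zero_smul]
    · simp

end Frames

/-! ### Local parameters and equations of the diagonals -/

section Span

variable {X Y : Type} [FunctionSpace X] [FunctionSpace Y]

/-- Near `p`, the function `f` is a linear combination of the `w i` with regular coefficients. -/
def InSpan {ι : Type} [Fintype ι] (w : ι → X → ℂ) (f : X → ℂ) (p : X) : Prop :=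
  ∃ g : ι → X → ℂ, (∀ i, IsRegularAt (g i) p) ∧ f =ᶠ[𝓝 p] fun q => ∑ i, g i q * w i q

variable {ι κ : Type} [Fintype ι] [Fintype κ] {w : ι → X → ℂ} {f g : X → ℂ} {p : X}

theorem InSpan.congr (h : InSpan w f p) (e : f =ᶠ[𝓝 p] g) : InSpan w g p := by
  obtain ⟨a, ha, h⟩ := h
  exact ⟨a, ha, e.symm.trans h⟩

theorem InSpan.zero : InSpan w (fun _ => 0) p :=
  ⟨fun _ _ => 0, fun _ => isRegularAt_const 0, Eventually.of_forall fun q => by simp⟩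

theorem InSpan.add (hf : InSpan w f p) (hg : InSpan w g p) :
    InSpan w (fun q => f q + g q) p := by
  obtain ⟨a, ha, h⟩ := hf
  obtain ⟨b, hb, h'⟩ := hg
  refine ⟨fun i q => a i q + b i q, fun i => (ha i).add (hb i), ?_⟩
  filter_upwards [h, h'] with q h1 h2
  simp only [h1, h2, add_mul, Finset.sum_add_distrib]

theorem InSpan.mul_left (hg : IsRegularAt g p) (hf : InSpan w f p) :
    InSpan w (fun q => g q * f q) p := by
  obtain ⟨a, ha, h⟩ := hf
  refine ⟨fun i q => g q * a i q, fun i => hg.mul (ha i), ?_⟩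
  filter_upwards [h] with q h1
  simp only [h1, Finset.mul_sum, mul_assoc]

theorem InSpan.sub (hf : InSpan w f p) (hg : InSpan w g p) :
    InSpan w (fun q => f q - g q) p :=
  (hf.add (hg.mul_left (isRegularAt_const (-1)))).congr
    (Eventually.of_forall fun q => by ring)

theorem InSpan.self (i : ι) : InSpan w (w i) p := by
  classical
  refine ⟨fun j _ => if j = i then 1 else 0, fun j => isRegularAt_const _,
    Eventually.of_forall fun q => by simp⟩

theorem InSpan.sum {κ : Type*} (s : Finset κ) {F : κ → X → ℂ} (h : ∀ k ∈ s, InSpan w (F k) p) :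
    InSpan w (fun q => ∑ k ∈ s, F k q) p := by
  classical
  induction s using Finset.induction_on with
  | empty => simpa using InSpan.zero
  | insert a s ha ih =>
    simp only [Finset.sum_insert ha]
    exact (h a (Finset.mem_insert_self _ _)).add
      (ih fun i hi => h i (Finset.mem_insert_of_mem hi))

theorem InSpan.trans {v : κ → X → ℂ} (hf : InSpan v f p) (hv : ∀ k, InSpan w (v k) p) :
    InSpan w f p := by
  obtain ⟨a, ha, h⟩ := hf
  exact (InSpan.sum _ fun k _ => (hv k).mul_left (ha k)).congr h.symm

theorem mk_sum {F : ι → X → ℂ} (h : ∀ i, IsRegularAt (F i) p) :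
    (∑ i, (⟨(F i : Germ (𝓝 p) ℂ), h i⟩ : stalk p)) =
      ⟨((fun q => ∑ i, F i q : X → ℂ) : Germ (𝓝 p) ℂ), IsRegularAt.sum _ fun i _ => h i⟩ := by
  classical
  refine Subtype.ext ?_
  rw [AddSubmonoidClass.coe_finsetSum]
  change ∑ i, (F i : Germ (𝓝 p) ℂ) = ((fun q => ∑ i, F i q : X → ℂ) : Germ (𝓝 p) ℂ)
  generalize (Finset.univ : Finset ι) = s
  induction s using Finset.induction_on with
  | empty => simp only [Finset.sum_empty]; rfl
  | insert a s ha ih => simp only [Finset.sum_insert ha, ih]; rfl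

/-- For regular `w`, membership in the span means that the germ is in the ideal generated by the
germs of the `w i`. -/
theorem inSpan_iff_inIdeal (hw : ∀ i, IsRegularAt (w i) p) :
    InSpan w f p ↔ InIdeal f p
      (Ideal.span (Set.range fun i => (⟨(w i : Germ (𝓝 p) ℂ), hw i⟩ : stalk p))) := by
  constructor
  · rintro ⟨g, hg, e⟩
    refine InIdeal.congr (InIdeal.sum _ fun i _ => InIdeal.mul_left (hg i) ⟨hw i, ?_⟩) e.symm
    exact Ideal.subset_span ⟨i, rfl⟩
  · rintro ⟨h1, h2⟩
    obtain ⟨c, hc⟩ := Ideal.mem_span_range_iff_exists_fun.1 h2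
    choose g hg hgc using fun i => exists_isRegularAt (c i)
    refine ⟨g, hg, ?_⟩
    have h3 : (∑ i, (⟨((fun q => g i q * w i q : X → ℂ) : Germ (𝓝 p) ℂ), (hg i).mul (hw i)⟩ :
        stalk p)) = ⟨(f : Germ (𝓝 p) ℂ), h1⟩ := by
      rw [← hc]
      refine Finset.sum_congr rfl fun i _ => ?_
      rw [hgc i]
      rfl
    rw [mk_sum] at h3
    exact (Germ.coe_eq.mp (congrArg Subtype.val h3)).symm

/-- Nakayama's lemma. -/
theorem inSpan_of_nakayama (hX : HasInverses X) (hw : ∀ i, IsRegularAt (w i) p)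
    {v : κ → X → ℂ} (hv : ∀ k, IsRegularAt (v k) p)
    (h : ∀ k, ∃ r : κ → X → ℂ, (∀ l, IsRegularAt (r l) p ∧ r l p = 0) ∧
      InSpan w (fun q => v k q - ∑ l, r l q * v l q) p) (k : κ) : InSpan w (v k) p := by
  rw [inSpan_iff_inIdeal hw]
  refine ⟨hv k, ?_⟩
  -- germs of the form `1 + a b` with `a p = 0` are invertible
  have hjac : maxIdeal p ≤ Ideal.jacobson ⊥ := by
    intro a ha
    rw [Ideal.mem_jacobson_bot]
    intro b
    obtain ⟨f, hf, e⟩ := exists_isRegularAt (a * b + 1)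
    have hf1 : f p = 1 := by
      have : evalAt p (a * b + 1) = 1 := by
        rw [map_add, map_mul, RingHom.mem_ker.1 ha, map_one, zero_mul, zero_add]
      rw [e] at this
      exact this
    have hf0 : f p ≠ 0 := by rw [hf1]; exact one_ne_zero
    obtain ⟨h1, h2⟩ := hX f p hf hf0
    rw [e]
    refine IsUnit.of_mul_eq_one ⟨_, h2⟩ (Subtype.ext (Germ.coe_eq.mpr ?_))
    filter_upwards [h1] with q hq
    exact mul_inv_cancel₀ hq
  have hle := Submodule.le_of_le_smul_of_le_jacobson_bot
    (N := Ideal.span (Set.range fun i => (⟨(w i : Germ (𝓝 p) ℂ), hw i⟩ : stalk p)))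
    (N' := Ideal.span (Set.range fun k => (⟨(v k : Germ (𝓝 p) ℂ), hv k⟩ : stalk p)))
    (Submodule.fg_span (Set.finite_range _)) hjac (by
      rw [Ideal.span_le]
      rintro _ ⟨k, rfl⟩
      obtain ⟨r, hr, hk⟩ := h k
      obtain ⟨h1, h2⟩ := (inSpan_iff_inIdeal hw).1 hk
      have h3 : InIdeal (fun q => ∑ l, r l q * v l q) p (maxIdeal p •
          Ideal.span (Set.range fun k => (⟨(v k : Germ (𝓝 p) ℂ), hv k⟩ : stalk p))) :=
        InIdeal.sum _ fun l _ => InIdeal.mul (inIdeal_maxIdeal.2 (hr l))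
          ⟨hv l, Ideal.subset_span ⟨l, rfl⟩⟩
      have h4 := add_mem (Submodule.mem_sup_left h2) (Submodule.mem_sup_right h3.2)
      have e : (⟨(v k : Germ (𝓝 p) ℂ), hv k⟩ : stalk p) = ⟨_, h1⟩ + ⟨_, h3.1⟩ :=
        Subtype.ext (congrArg (fun f : X → ℂ => (f : Germ (𝓝 p) ℂ))
          (funext fun q => (sub_add_cancel (v k q) (∑ l, r l q * v l q)).symm))
      change (⟨(v k : Germ (𝓝 p) ℂ), hv k⟩ : stalk p) ∈ _
      rw [e]
      exact h4)
  exact hle (Ideal.subset_span ⟨k, rfl⟩)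

end Span

section Param

variable {X : Type} [FunctionSpace X] {x : X} {u : Fin 2 → X → ℂ} {c : Chart X}

/-- The functions `u i - u i x` generate the maximal ideal at `x`. -/
def IsParamAt (u : Fin 2 → X → ℂ) (x : X) : Prop :=
  (∀ i, IsRegularAt (u i) x) ∧
    ∀ f, IsRegularAt f x → f x = 0 → InSpan (fun i y => u i y - u i x) f x

theorem IsParamAt.isRegularAt_sub (hu : IsParamAt u x) (i : Fin 2) :
    IsRegularAt (fun y => u i y - u i x) x := (hu.1 i).sub (isRegularAt_const _)

theorem IsParamAt.maxIdeal_eq_span (hu : IsParamAt u x) : maxIdeal x =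
    Ideal.span {(⟨_, hu.isRegularAt_sub 0⟩ : stalk x), ⟨_, hu.isRegularAt_sub 1⟩} := by
  have e : ({(⟨_, hu.isRegularAt_sub 0⟩ : stalk x), ⟨_, hu.isRegularAt_sub 1⟩} : Set (stalk x)) =
      Set.range fun i : Fin 2 => (⟨_, hu.isRegularAt_sub i⟩ : stalk x) := by
    ext a
    simp only [Set.mem_insert_iff, Set.mem_singleton_iff, Set.mem_range, Fin.exists_fin_two,
      eq_comm]
  rw [e]
  refine le_antisymm ?_ ?_
  · intro a ha
    obtain ⟨f, hf, rfl⟩ := exists_isRegularAt a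
    exact ((inSpan_iff_inIdeal hu.isRegularAt_sub).1 (hu.2 f hf (RingHom.mem_ker.1 ha))).2
  · rw [Ideal.span_le]
    rintro _ ⟨i, rfl⟩
    exact RingHom.mem_ker.2 (sub_self _)

/-- Local parameters at a point which are regular on the whole chart: the numerators of two
generators of the maximal ideal. -/
theorem exists_isParamAt (hX : IsSmoothSurface X) (hx : x ∈ c.V) :
    ∃ u : Fin 2 → X → ℂ, (∀ i, ∀ x' ∈ c.V, IsRegularAt (u i) x') ∧ IsParamAt u x := by
  classical
  obtain ⟨hreg, hdim⟩ := hX x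
  have hinv : HasInverses X := hasInverses_of_isLocalRing fun x => (hX x).1.toIsLocalRing
  obtain ⟨s, hs, hspan⟩ := Submodule.FG.exists_span_finset_card_eq_spanFinrank
    (IsNoetherian.noetherian (IsLocalRing.maximalIdeal (stalk x)))
  have hcard : s.card = 2 := by
    have := hreg.spanFinrank_maximalIdeal
    rw [hdim, ← hs] at this
    exact_mod_cast this
  obtain ⟨a, b, -, rfl⟩ := Finset.card_eq_two.1 hcard
  rw [← maxIdeal_eq, Finset.coe_insert, Finset.coe_singleton] at hspan
  have hpoly : ∀ a ∈ maxIdeal x, ∃ f : X → ℂ, (∀ x' ∈ c.V, IsRegularAt f x') ∧ f x = 0 ∧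
      ∃ v : X → ℂ, IsRegularAt v x ∧ ∃ h : IsRegularAt (fun y => v y * f y) x, a = ⟨_, h⟩ := by
    intro a ha
    obtain ⟨f, hf, rfl⟩ := exists_isRegularAt a
    obtain ⟨G, H, hH, e⟩ := c.quot x hx f hf
    have hHi := (hinv _ x (isRegularAt_eval H hx) hH)
    have hGx : MvPolynomial.eval (c.y x) G = 0 := by
      have h1 : f x = 0 := RingHom.mem_ker.1 ha
      rw [e.eq_of_nhds, div_eq_zero_iff] at h1
      exact h1.resolve_right hH
    have e' : f =ᶠ[𝓝 x] fun y => (MvPolynomial.eval (c.y y) H)⁻¹ * MvPolynomial.eval (c.y y) G :=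
      e.trans (Eventually.of_forall fun y => div_eq_inv_mul _ _)
    exact ⟨_, fun x' hx' => isRegularAt_eval G hx', hGx, _, hHi.2, hf.congr e',
      Subtype.ext (Germ.coe_eq.mpr e')⟩
  have ham : a ∈ maxIdeal x := hspan ▸ Ideal.subset_span (by simp)
  have hbm : b ∈ maxIdeal x := hspan ▸ Ideal.subset_span (by simp)
  obtain ⟨f₀, hf₀, hf₀x, v₀, hv₀, h₀, ha⟩ := hpoly a ham
  obtain ⟨f₁, hf₁, hf₁x, v₁, hv₁, h₁, hb⟩ := hpoly b hbm
  refine ⟨![f₀, f₁], ?_, ?_, ?_⟩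
  · intro i
    fin_cases i
    exacts [hf₀, hf₁]
  · intro i
    fin_cases i
    exacts [hf₀ x hx, hf₁ x hx]
  · intro f hf hfx
    have hmem : (⟨(f : Germ (𝓝 x) ℂ), hf⟩ : stalk x) ∈ Ideal.span {a, b} := by
      have h2 : (⟨(f : Germ (𝓝 x) ℂ), hf⟩ : stalk x) ∈ maxIdeal x := RingHom.mem_ker.2 hfx
      rw [← hspan] at h2
      exact h2
    obtain ⟨α, β, hαβ⟩ := Ideal.mem_span_pair.1 hmem
    obtain ⟨p, hp, rfl⟩ := exists_isRegularAt α
    obtain ⟨q, hq, rfl⟩ := exists_isRegularAt β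
    rw [ha, hb] at hαβ
    have e : (fun y => p y * (v₀ y * f₀ y) + q y * (v₁ y * f₁ y)) =ᶠ[𝓝 x] f :=
      Germ.coe_eq.mp (congrArg Subtype.val hαβ)
    refine ⟨![fun y => p y * v₀ y, fun y => q y * v₁ y], ?_, ?_⟩
    · intro i
      fin_cases i
      exacts [hp.mul hv₀, hq.mul hv₁]
    · filter_upwards [e] with y hy
      rw [← hy, Fin.sum_univ_two]
      simp only [Matrix.cons_val_zero, Matrix.cons_val_one, hf₀x, hf₁x, sub_zero]
      ring

/-- Homogeneous forms of degree `d` in local parameters are linearly independent modulo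
`𝔪_x ^ (d + 1)`. -/
theorem IsParamAt.coeff_eq_zero (hX : IsSmoothSurface X) (hu : IsParamAt u x) (d : ℕ) (C : ℕ → ℂ)
    (h : InIdeal (fun y => ∑ i ∈ Finset.range (d + 1),
      C i * (u 0 y - u 0 x) ^ i * (u 1 y - u 1 x) ^ (d - i)) x (maxIdeal x ^ (d + 1))) :
    ∀ i ≤ d, C i = 0 := by
  obtain ⟨hreg, hdim⟩ := hX x
  intro i hi
  have hm := hu.maxIdeal_eq_span
  rw [maxIdeal_eq] at hm
  have h1 := coeff_mem_of_form_mem hm hdim d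
    (fun i => (⟨_, isRegularAt_const (C i)⟩ : stalk x)) ?_ i hi
  · rw [← maxIdeal_eq] at h1
    exact RingHom.mem_ker.1 h1
  · rw [← maxIdeal_eq]
    convert h.2 using 1
    refine Subtype.ext ?_
    rw [AddSubmonoidClass.coe_finsetSum]
    change ∑ i ∈ Finset.range (d + 1), ((fun y => C i * (u 0 y - u 0 x) ^ i *
      (u 1 y - u 1 x) ^ (d - i) : X → ℂ) : Germ (𝓝 x) ℂ) = ((_ : X → ℂ) : Germ (𝓝 x) ℂ)
    generalize Finset.range (d + 1) = s
    induction s using Finset.induction_on with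
    | empty => simp only [Finset.sum_empty]; rfl
    | insert a s ha ih => simp only [Finset.sum_insert ha, ih]; rfl

end Param

section Diagonal

variable {X : Type} [FunctionSpace X] {x : X} {u : Fin 2 → X → ℂ} {c : Chart X} {n : ℕ}

/-- If `p i = p j = x` and `f` is regular at `x`, then `f (q j) - f (q i)` is a combination of the
differences of the coordinates. -/
theorem inSpan_sub_coord (hX : HasInverses X) {p : Pow X n} {i j : Fin n} (hi : p i ∈ c.V)
    (hij : p i = p j) {f : X → ℂ} (hf : IsRegularAt f (p i)) :
    InSpan (fun (k : Fin c.N) (q : Pow X n) => c.y (q j) k - c.y (q i) k)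
      (fun q => f (q j) - f (q i)) p := by
  have hpi := isMorphismAt_proj i p
  have hpj := isMorphismAt_proj j p
  have hj : p j ∈ c.V := hij ▸ hi
  have hpoly : ∀ G : MvPolynomial (Fin c.N) ℂ,
      InSpan (fun (k : Fin c.N) (q : Pow X n) => c.y (q j) k - c.y (q i) k)
        (fun q => MvPolynomial.eval (c.y (q j)) G - MvPolynomial.eval (c.y (q i)) G) p := by
    intro G
    induction G using MvPolynomial.induction_on with
    | C a =>
      simp only [MvPolynomial.eval_C, sub_self]
      exact InSpan.zero
    | add P Q hP hQ =>
      refine (hP.add hQ).congr (Eventually.of_forall fun q => ?_)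
      simp only [map_add]
      ring
    | mul_X P k hP =>
      have h1 : InSpan (fun (k : Fin c.N) (q : Pow X n) => c.y (q j) k - c.y (q i) k)
        (fun q => c.y (q j) k - c.y (q i) k) p := InSpan.self k
      refine ((hP.mul_left (hpj.comp _ (c.regular k _ hj))).add
        (h1.mul_left (hpi.comp _ (isRegularAt_eval P hi)))).congr
        (Eventually.of_forall fun q => ?_)
      simp only [map_mul, MvPolynomial.eval_X]
      ring
  obtain ⟨G, H, hH, e⟩ := c.quot _ hi f hf
  have hHinv := hX _ _ (isRegularAt_eval H hi) hH
  have ej := hpj.continuousAt.eventually (hij ▸ e)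
  have hHj := hpj.continuousAt.eventually (hij ▸ hHinv.1)
  refine ((((hpoly G).mul_left (hpi.comp _ (isRegularAt_eval H hi))).sub
    ((hpoly H).mul_left (hpi.comp _ (isRegularAt_eval G hi)))).mul_left
    ((hpi.comp _ hHinv.2).mul (hpj.comp _ (hij ▸ hHinv.2)))).congr ?_
  filter_upwards [hpi.continuousAt.eventually e, ej, hpi.continuousAt.eventually hHinv.1, hHj]
    with q h1 h2 h3 h4
  rw [h1, h2]
  field_simp
  ring

/-- The ideal of the diagonal `Δ_{ij}` is generated at a point `p` with `p i = p j = x` by the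
differences `u k (q j) - u k (q i)` of local parameters at `x`. -/
theorem inSpan_diag (hX : HasInverses X) (hXq : IsQuasiProjective X) {p : Pow X n} {i j : Fin n}
    (hij : p i = p j) (hu : IsParamAt u (p i)) {f : Pow X n → ℂ} (hf : IsRegularAt f p)
    (hv : ∀ᶠ q in 𝓝 p, q i = q j → f q = 0) :
    InSpan (fun k (q : Pow X n) => u k (q j) - u k (q i)) f p := by
  obtain ⟨c, hc⟩ := exists_chart hXq (Set.finite_range (p : Fin n → X))
  have hp : InChart c n p := fun i => hc ⟨i, rfl⟩
  have hpi := isMorphismAt_proj i p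
  have hpj := isMorphismAt_proj j p
  have huj : ∀ k, IsRegularAt (u k) (p j) := fun k => hij ▸ hu.1 k
  -- the ideal is generated by the differences of all the coordinates
  have h1 : InSpan (fun (k : Fin c.N) (q : Pow X n) => c.y (q j) k - c.y (q i) k) f p := by
    classical
    let ρ : Fin n → Fin n := Function.update id j i
    have hρp : reindex ρ p = p := by
      funext l
      change p (ρ l) = p l
      by_cases hl : l = j
      · subst hl
        simp only [ρ, Function.update_self]
        exact hij
      · simp [ρ, Function.update_of_ne hl]
    have hρ : IsMorphismAt (reindex ρ : Pow X n → Pow X n) p := isMorphismAt_reindex ρ p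
    have hfρ : ∀ᶠ q in 𝓝 p, f (reindex ρ q) = 0 := by
      have h2 := hρ.continuousAt.eventually (hρp.symm ▸ hv)
      filter_upwards [h2] with q hq
      apply hq
      change q (ρ i) = q (ρ j)
      by_cases hl : i = j
      · rw [hl]
      · simp [ρ, Function.update_of_ne hl]
    obtain ⟨g, hg, h, hh, h0, e⟩ := exists_polyAlg_quot hp hf
    have hgρ : InSpan (fun (k : Fin c.N) (q : Pow X n) => c.y (q j) k - c.y (q i) k)
        (fun q => g q - g (reindex ρ q)) p := by
      have hreg : ∀ g ∈ polyAlg c n, IsRegularAt (fun q => g (reindex ρ q)) p := fun g hg =>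
        hρ.comp g (hρp.symm ▸ isRegularAt_of_mem_polyAlg hg hp)
      clear e
      induction hg using Algebra.adjoin_induction with
      | mem x hx =>
        obtain ⟨l, k, rfl⟩ := hx
        by_cases hl : l = j
        · subst hl
          have e2 : ∀ q : Pow X n, reindex ρ q l = q i := fun q => by simp [reindex, ρ]
          simp only [e2]
          exact InSpan.self (w := fun (k : Fin c.N) (q : Pow X n) => c.y (q l) k - c.y (q i) k) k
        · have e2 : ∀ q : Pow X n, reindex ρ q l = q l := fun q => by
            simp [reindex, ρ, Function.update_of_ne hl]
          simp only [e2, sub_self]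
          exact InSpan.zero
      | algebraMap r =>
        simp only [Pi.algebraMap_apply, sub_self]
        exact InSpan.zero
      | add a b _ _ ha hb =>
        exact (ha.add hb).congr (Eventually.of_forall fun q => by simp only [Pi.add_apply]; ring)
      | mul a b ham hbm ha hb =>
        exact ((ha.mul_left (isRegularAt_of_mem_polyAlg hbm hp)).add
          (hb.mul_left (hreg a ham))).congr
          (Eventually.of_forall fun q => by simp only [Pi.mul_apply]; ring)
    have hhi := hasInverses_pow n h p (isRegularAt_of_mem_polyAlg hh hp) h0
    refine (hgρ.mul_left hhi.2).congr ?_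
    have e3 := hρ.continuousAt.eventually (hρp.symm ▸ e)
    have e4 := hρ.continuousAt.eventually (hρp.symm ▸ hhi.1)
    filter_upwards [e, e3, e4, hhi.1, hfρ] with q h1 h2 h3 h4 h5
    rw [h5, eq_comm, div_eq_zero_iff, or_iff_left h3] at h2
    rw [h1, h2, sub_zero, div_eq_inv_mul]
  refine h1.trans (inSpan_of_nakayama
    (w := fun k (q : Pow X n) => u k (q j) - u k (q i))
    (v := fun k (q : Pow X n) => c.y (q j) k - c.y (q i) k) (hasInverses_pow n) ?_ ?_ ?_)
  · exact fun k => (hpj.comp _ (huj k)).sub (hpi.comp _ (hu.1 k))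
  · exact fun k => (hpj.comp _ (c.regular k _ (hp j))).sub (hpi.comp _ (c.regular k _ (hp i)))
  · -- express the coordinates through the parameters at `x`, and take differences
    intro k
    obtain ⟨g, hg, e⟩ := hu.2 (fun y => c.y y k - c.y (p i) k)
      ((c.regular k _ (hp i)).sub (isRegularAt_const _)) (sub_self _)
    choose r hr hr' using fun l => inSpan_sub_coord hX (hp i) hij (hg l)
    have hupj : ∀ l, IsRegularAt (fun q : Pow X n => u l (q j) - u l (p i)) p :=
      fun l => (hpj.comp _ (huj l)).sub (isRegularAt_const _)
    refine ⟨fun s q => ∑ l, (u l (q j) - u l (p i)) * r l s q, fun s => ⟨?_, ?_⟩, ?_⟩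
    · exact IsRegularAt.sum _ fun l _ => (hupj l).mul (hr l s)
    · exact Finset.sum_eq_zero fun l _ => by rw [hij, sub_self, zero_mul]
    · refine InSpan.congr (InSpan.sum Finset.univ fun l _ => InSpan.mul_left (hpi.comp _ (hg l))
        (InSpan.self (w := fun k (q : Pow X n) => u k (q j) - u k (q i)) l)) ?_
      have ej := hpj.continuousAt.eventually (hij ▸ e)
      filter_upwards [hpi.continuousAt.eventually e, ej, hr' 0, hr' 1] with q h1 h2 h3 h4
      have h5 : c.y (q j) k - c.y (q i) k = ∑ l, g l (q j) * (u l (q j) - u l (p i)) -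
          ∑ l, g l (q i) * (u l (q i) - u l (p i)) := by
        rw [← h1]
        rw [← hij] at h2
        rw [← h2]
        ring
      rw [h5]
      simp only [Finset.sum_mul]
      rw [Finset.sum_comm]
      simp only [mul_assoc, ← Finset.mul_sum, Fin.sum_univ_two, ← h3, ← h4]
      ring

/-- Local parameters at a point are local parameters at the points nearby. -/
theorem IsParamAt.eventually (hX : HasInverses X) (hXq : IsQuasiProjective X) (hu : IsParamAt u x) :
    ∀ᶠ x' in 𝓝 x, IsParamAt u x' := by
  obtain ⟨c, hc⟩ := exists_chart hXq (Set.finite_singleton x)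
  have hx : x ∈ c.V := hc rfl
  let pr : X → X → Pow X 2 := fun a b => (![a, b] : Fin 2 → X)
  have h1 : ∀ k, InSpan (fun l (q : Pow X 2) => u l (q 1) - u l (q 0))
      (fun q => c.y (q 1) k - c.y (q 0) k) (pr x x) := by
    intro k
    refine inSpan_diag hX hXq (i := 0) (j := 1) rfl hu ?_ ?_
    · exact ((isMorphismAt_proj 1 (pr x x)).comp _ (c.regular k x hx)).sub
        ((isMorphismAt_proj 0 (pr x x)).comp _ (c.regular k x hx))
    · exact Eventually.of_forall fun q hq => by rw [hq, sub_self]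
  choose g hg e using h1
  have hdiag : IsMorphismAt (fun a => pr a a) x := isMorphismAt_pow hX fun i => by
    fin_cases i <;> exact isMorphismAt_id x
  have h2 : ∀ᶠ x' in 𝓝 x, ∀ k l, IsRegularAt (g k l) (pr x' x') :=
    eventually_all.2 fun k => eventually_all.2 fun l =>
      hdiag.continuousAt.eventually (hg k l).eventually
  have h3 : ∀ᶠ x' in 𝓝 x, ∀ k, ∀ᶠ q in 𝓝 (pr x' x'),
      c.y (q 1) k - c.y (q 0) k = ∑ l, g k l q * (u l (q 1) - u l (q 0)) :=
    eventually_all.2 fun k => hdiag.continuousAt.eventually (e k).eventually_nhds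
  filter_upwards [h2, h3, c.V.isOpen.mem_nhds hx, (hu.1 0).eventually, (hu.1 1).eventually]
    with x' h2 h3 hx' hu0 hu1
  have hcurve : IsMorphismAt (fun b => pr x' b) x' := isMorphismAt_pow hX fun i => by
    fin_cases i
    exacts [isMorphismAt_const x' x', isMorphismAt_id x']
  have hureg : ∀ i, IsRegularAt (u i) x' := by
    intro i
    fin_cases i
    exacts [hu0, hu1]
  refine ⟨hureg, fun f hf hfx => ?_⟩
  -- the differences of the coordinates generate the maximal ideal
  have h4 : ∀ k, InSpan (fun i y => u i y - u i x') (fun y => c.y y k - c.y x' k) x' := fun k =>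
    ⟨fun l y => g k l (pr x' y), fun l => hcurve.comp _ (h2 k l),
      hcurve.continuousAt.eventually (h3 k)⟩
  have h5 : InSpan (fun (k : Fin c.N) (q : Pow X 2) => c.y (q 1) k - c.y (q 0) k)
      (fun q => f (q 1) - f (q 0)) (pr x' x') :=
    inSpan_sub_coord hX (i := 0) (j := 1) hx' rfl hf
  obtain ⟨a, ha, ea⟩ := h5
  have h6 : InSpan (fun (k : Fin c.N) y => c.y y k - c.y x' k) f x' := by
    refine ⟨fun k y => a k (pr x' y), fun k => hcurve.comp _ (ha k), ?_⟩
    filter_upwards [hcurve.continuousAt.eventually ea] with y hy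
    have h7 : f y - f x' = ∑ i, a i (pr x' y) * (c.y y i - c.y x' i) := hy
    rwa [hfx, sub_zero] at h7
  exact h6.trans h4

theorem IsParamAt.dAt_eq (hu : IsParamAt u x) {f : X → ℂ} {g : Fin 2 → X → ℂ}
    (hg : ∀ i, IsRegularAt (g i) x)
    (e : ∀ᶠ y in 𝓝 x, f y - f x = ∑ i, g i y * (u i y - u i x)) :
    dAt f x = ∑ i, g i x • dAt (u i) x := by
  have e1 : f =ᶠ[𝓝 x] fun y => ∑ i, g i y * (u i y - u i x) + f x := by
    filter_upwards [e] with y hy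
    rw [← hy, sub_add_cancel]
  have h1 : ∀ i, IsRegularAt (fun y => g i y * (u i y - u i x)) x :=
    fun i => (hg i).mul (hu.isRegularAt_sub i)
  rw [dAt_congr e1, dAt_add (IsRegularAt.sum _ fun i _ => h1 i) (isRegularAt_const _), dAt_const,
    add_zero, dAt_sum _ fun i _ => h1 i]
  refine Finset.sum_congr rfl fun i _ => ?_
  rw [dAt_mul (hg i) (hu.isRegularAt_sub i), sub_self, zero_smul, zero_add,
    dAt_sub (hu.1 i) (isRegularAt_const _), dAt_const, sub_zero]

/-- The first order expansion of a regular function in local parameters. -/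
theorem IsParamAt.exists_coeff (hu : IsParamAt u x) {f : X → ℂ} (hf : IsRegularAt f x) :
    ∃ C : Fin 2 → ℂ, dAt f x = ∑ i, C i • dAt (u i) x ∧
      InIdeal (fun y => f y - f x - ∑ i, C i * (u i y - u i x)) x (maxIdeal x ^ 2) := by
  obtain ⟨g, hg, e⟩ := hu.2 (fun y => f y - f x) (hf.sub (isRegularAt_const _)) (sub_self _)
  refine ⟨fun i => g i x, hu.dAt_eq hg e, ?_⟩
  have h1 : ∀ i, InIdeal (fun y => (g i y - g i x) * (u i y - u i x)) x (maxIdeal x ^ 2) := by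
    intro i
    rw [pow_two]
    exact InIdeal.mul (inIdeal_maxIdeal.2 ⟨(hg i).sub (isRegularAt_const _), sub_self _⟩)
      (inIdeal_maxIdeal.2 ⟨hu.isRegularAt_sub i, sub_self _⟩)
  refine (InIdeal.sum Finset.univ fun i _ => h1 i).congr ?_
  filter_upwards [e] with y hy
  rw [hy, ← Finset.sum_sub_distrib]
  exact Finset.sum_congr rfl fun i _ => by ring

/-- The differentials of local parameters are linearly independent. -/
theorem IsParamAt.eq_zero_of_sum_dAt (hX : IsSmoothSurface X) (hu : IsParamAt u x)
    {C : Fin 2 → ℂ} (h : ∑ i, C i • dAt (u i) x = 0) : C = 0 := by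
  have h1 : InIdeal (fun y => C 0 * (u 0 y - u 0 x) + C 1 * (u 1 y - u 1 x)) x
      (maxIdeal x ^ 2) := by
    have h2 : IsRegularAt (fun y => C 0 * u 0 y + C 1 * u 1 y) x :=
      ((hu.1 0).const_mul _).add ((hu.1 1).const_mul _)
    have h3 : dAt (fun y => C 0 * u 0 y + C 1 * u 1 y) x = 0 := by
      rw [dAt_add ((hu.1 0).const_mul _) ((hu.1 1).const_mul _), dAt_const_mul _ (hu.1 0),
        dAt_const_mul _ (hu.1 1), ← h, Fin.sum_univ_two]
    refine ((dAt_eq_zero_iff h2).1 h3).congr (Eventually.of_forall fun y => ?_)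
    ring
  have h2 := hu.coeff_eq_zero hX 1 (fun k => if k = 0 then C 1 else C 0) (by
    refine h1.congr (Eventually.of_forall fun y => ?_)
    simp [Finset.sum_range_succ]
    ring)
  funext i
  fin_cases i
  · exact h2 1 le_rfl
  · exact h2 0 zero_le_one

end Diagonal

/-! ### Cubic forms and leading terms -/

section LinearAlgebra

variable {ι M N : Type*} [AddCommGroup M] [Module ℂ M] [AddCommGroup N] [Module ℂ N]

open Classical in
/-- Linear functionals dual to the linearly independent family `v`
(by convention `0` if `v` is linearly dependent). -/
def dualFamily (v : ι → M) : ι → Module.Dual ℂ M :=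
  if h : ∃ φ : ι → Module.Dual ℂ M, ∀ i j, φ i (v j) = if i = j then 1 else 0 then h.choose else 0

open Classical in
theorem dualFamily_apply {v : ι → M} (hv : LinearIndependent ℂ v) (i j : ι) :
    dualFamily v i (v j) = if i = j then 1 else 0 := by
  have h : ∃ φ : ι → Module.Dual ℂ M, ∀ i j, φ i (v j) = if i = j then 1 else 0 := by
    refine ⟨fun i => (Module.Basis.extend hv.linearIndepOn_id).coord
      ⟨v i, hv.linearIndepOn_id.subset_extend _ ⟨i, rfl⟩⟩, fun i j => ?_⟩
    have e : v j = Module.Basis.extend hv.linearIndepOn_id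
      ⟨v j, hv.linearIndepOn_id.subset_extend _ ⟨j, rfl⟩⟩ := by simp
    rw [e, Module.Basis.coord_apply, Module.Basis.repr_self, Finsupp.single_apply]
    simp only [Subtype.mk.injEq, hv.injective.eq_iff, eq_comm]
  rw [dualFamily, dif_pos h]
  exact h.choose_spec i j

/-- A linear functional with value `1` at the vector `v`
(by convention `0` if `v = 0`). -/
def unitDual (v : M) : Module.Dual ℂ M := dualFamily (fun _ : Unit => v) ()

theorem unitDual_self {v : M} (hv : v ≠ 0) : unitDual v v = 1 := by
  have h : LinearIndependent ℂ (fun _ : Unit => v) := LinearIndependent.of_subsingleton () hv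
  rw [unitDual, dualFamily_apply h () (), if_pos rfl]

theorem tmul_ne_zero_of_ne_zero {v : M} {w : N} (hv : v ≠ 0) (hw : w ≠ 0) : v ⊗ₜ[ℂ] w ≠ 0 := by
  intro h
  have h1 := congrArg (TensorProduct.lid ℂ ℂ ∘ TensorProduct.map (unitDual v) (unitDual w)) h
  simp [unitDual_self hv, unitDual_self hw] at h1

variable {A B : Type*} [CommRing A] [Algebra ℂ A] [CommRing B] [Algebra ℂ B]

/-- The value `∑ C_ijk a_i a_j a_k` of the cubic form with coefficients `C`. -/
def cubic (C : Fin 2 → Fin 2 → Fin 2 → ℂ) (a : Fin 2 → A) : A :=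
  ∑ i, ∑ j, ∑ k, C i j k • (a i * a j * a k)

theorem map_cubic (F : A →ₐ[ℂ] B) (C : Fin 2 → Fin 2 → Fin 2 → ℂ) (a : Fin 2 → A) :
    F (cubic C a) = cubic C fun i => F (a i) := by
  simp only [cubic, map_sum, map_smul, map_mul]

theorem cubic_eq (C : Fin 2 → Fin 2 → Fin 2 → ℂ) (a : Fin 2 → A) :
    cubic C a = C 0 0 0 • a 0 ^ 3 + (C 0 0 1 + C 0 1 0 + C 1 0 0) • (a 0 ^ 2 * a 1) +
      (C 0 1 1 + C 1 0 1 + C 1 1 0) • (a 0 * a 1 ^ 2) + C 1 1 1 • a 1 ^ 3 := by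
  simp only [cubic, Fin.sum_univ_two, Algebra.smul_def, map_add]
  ring

/-- The coefficients of the symmetrisation of the form `C` vanish. -/
def CubicZero (C : Fin 2 → Fin 2 → Fin 2 → ℂ) : Prop :=
  C 0 0 0 = 0 ∧ C 0 0 1 + C 0 1 0 + C 1 0 0 = 0 ∧ C 0 1 1 + C 1 0 1 + C 1 1 0 = 0 ∧ C 1 1 1 = 0

theorem CubicZero.cubic_eq_zero {C : Fin 2 → Fin 2 → Fin 2 → ℂ} (h : CubicZero C) (a : Fin 2 → A) :
    cubic C a = 0 := by
  obtain ⟨h1, h2, h3, h4⟩ := h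
  rw [cubic_eq, h1, h2, h3, h4]
  simp

theorem cubicZero_of_forall {C : Fin 2 → Fin 2 → Fin 2 → ℂ} (h : ∀ U : Fin 2 → ℂ, cubic C U = 0) :
    CubicZero C := by
  have h1 := h ![1, 0]
  have h2 := h ![0, 1]
  have h3 := h ![1, 1]
  have h4 := h ![1, -1]
  simp only [cubic_eq, smul_eq_mul, Matrix.cons_val_zero, Matrix.cons_val_one] at h1 h2 h3 h4
  norm_num at h1 h2 h3 h4
  refine ⟨h1, ?_, ?_, h2⟩
  · linear_combination (h3 - h4) / 2 - h2
  · linear_combination (h3 + h4) / 2 - h1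

/-- For `v` linearly independent and `E ≠ 0`, the linear functional on `S^• M ⊗ N` which maps
`p(v) ⊗ E` to `p(U)`. -/
def evalForm (v : Fin 2 → M) (E : N) (U : Fin 2 → ℂ) :
    SymmetricAlgebra ℂ M ⊗[ℂ] N →ₗ[ℂ] ℂ :=
  (TensorProduct.lid ℂ ℂ).toLinearMap ∘ₗ
    TensorProduct.map (SymmetricAlgebra.lift (∑ i, U i • dualFamily v i)).toLinearMap (unitDual E)

theorem evalForm_cubic {v : Fin 2 → M} (hv : LinearIndependent ℂ v) {E : N} (hE : E ≠ 0)
    (U : Fin 2 → ℂ) (C : Fin 2 → Fin 2 → Fin 2 → ℂ) :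
    evalForm v E U (cubic C (fun i => SymmetricAlgebra.ι ℂ M (v i)) ⊗ₜ E) = cubic C U := by
  have h : ∀ i, (∑ k, U k • dualFamily v k) (v i) = U i := fun i => by
    simp only [LinearMap.sum_apply, LinearMap.smul_apply, dualFamily_apply hv]
    simp
  simp only [evalForm, LinearMap.comp_apply, LinearEquiv.coe_coe, TensorProduct.map_tmul,
    TensorProduct.lid_tmul, AlgHom.toLinearMap_apply, map_cubic, SymmetricAlgebra.lift_ι_apply,
    unitDual_self hE, h, smul_eq_mul, mul_one]

theorem cubicZero_of_tmul_eq_zero {v : Fin 2 → M} (hv : LinearIndependent ℂ v) {E : N} (hE : E ≠ 0)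
    {C : Fin 2 → Fin 2 → Fin 2 → ℂ}
    (h : cubic C (fun i => SymmetricAlgebra.ι ℂ M (v i)) ⊗ₜ[ℂ] E = 0) : CubicZero C :=
  cubicZero_of_forall fun U => by rw [← evalForm_cubic hv hE, h, map_zero]

/-- For `v` linearly independent and `E ≠ 0`, the linear functionals on `M ⊗ N` which are dual to
the `v i ⊗ E`. -/
def coordForm (v : Fin 2 → M) (E : N) (i : Fin 2) : M ⊗[ℂ] N →ₗ[ℂ] ℂ :=
  (TensorProduct.lid ℂ ℂ).toLinearMap ∘ₗ TensorProduct.map (dualFamily v i) (unitDual E)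

theorem coordForm_sum {v : Fin 2 → M} (hv : LinearIndependent ℂ v) {E : N} (hE : E ≠ 0)
    (T : Fin 2 → ℂ) (i : Fin 2) :
    coordForm v E i (∑ j, T j • (v j ⊗ₜ[ℂ] E)) = T i := by
  fin_cases i <;> simp [coordForm, dualFamily_apply hv, unitDual_self hE]

end LinearAlgebra

section Lead

variable {X : Type} [FunctionSpace X] {x : X} {u : Fin 2 → X → ℂ} {θ θ' : X → ℂ}

theorem IsParamAt.linearIndependent (hX : IsSmoothSurface X) (hu : IsParamAt u x) :
    LinearIndependent ℂ fun i => dAt (u i) x :=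
  Fintype.linearIndependent_iff.2 fun _ hg i => congrFun (hu.eq_zero_of_sum_dAt hX hg) i

/-- The differentials of the functions `u`, as elements of the symmetric algebra of the cotangent
space. -/
abbrev symD (u : Fin 2 → X → ℂ) (x : X) (i : Fin 2) : SymmetricAlgebra ℂ (CotSpace x) :=
  SymmetricAlgebra.ι ℂ (CotSpace x) (dAt (u i) x)

/-- The function `θ` belongs to `𝔪_x³`, and `v ∈ S³(𝔪_x/𝔪_x²)` is its class modulo `𝔪_x⁴`; this is
expressed by means of the parameters `u`. -/
def HasLead (u : Fin 2 → X → ℂ) (x : X) (θ : X → ℂ) (v : SymmetricAlgebra ℂ (CotSpace x)) : Prop :=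
  ∃ C : Fin 2 → Fin 2 → Fin 2 → ℂ,
    InIdeal (fun y => θ y - cubic C fun i => u i y - u i x) x (maxIdeal x ^ 4) ∧
      v = cubic C (symD u x)

variable {v v' : SymmetricAlgebra ℂ (CotSpace x)}

theorem HasLead.congr (h : HasLead u x θ v) (e : θ =ᶠ[𝓝 x] θ') : HasLead u x θ' v := by
  obtain ⟨C, h1, h2⟩ := h
  refine ⟨C, h1.congr ?_, h2⟩
  filter_upwards [e] with y hy
  rw [hy]

theorem cubic_add {A : Type*} [CommRing A] [Algebra ℂ A] (C D : Fin 2 → Fin 2 → Fin 2 → ℂ)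
    (a : Fin 2 → A) : cubic (fun i j k => C i j k + D i j k) a = cubic C a + cubic D a := by
  simp only [cubic, add_smul, Finset.sum_add_distrib]

theorem cubic_smul {A : Type*} [CommRing A] [Algebra ℂ A] (r : ℂ)
    (C : Fin 2 → Fin 2 → Fin 2 → ℂ)
    (a : Fin 2 → A) : cubic (fun i j k => r * C i j k) a = r • cubic C a := by
  simp only [cubic, mul_smul, Finset.smul_sum]

theorem HasLead.add (h : HasLead u x θ v) (h' : HasLead u x θ' v') :
    HasLead u x (fun y => θ y + θ' y) (v + v') := by
  obtain ⟨C, h1, h2⟩ := h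
  obtain ⟨D, h3, h4⟩ := h'
  refine ⟨fun i j k => C i j k + D i j k, (h1.add h3).congr (Eventually.of_forall fun y => ?_), ?_⟩
  · simp only [cubic_add]
    ring
  · rw [cubic_add, h2, h4]

theorem HasLead.const_mul (r : ℂ) (h : HasLead u x θ v) :
    HasLead u x (fun y => r * θ y) (r • v) := by
  obtain ⟨C, h1, h2⟩ := h
  refine ⟨fun i j k => r * C i j k, (h1.const_mul r).congr (Eventually.of_forall fun y => ?_), ?_⟩
  · simp only [cubic_smul, smul_eq_mul]
    ring
  · rw [cubic_smul, h2]

theorem HasLead.zero : HasLead u x (fun _ => 0) 0 := by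
  refine ⟨fun _ _ _ => 0, inIdeal_zero.congr (Eventually.of_forall fun y => ?_), ?_⟩ <;>
    simp [cubic]

theorem HasLead.sum {ι : Type*} (s : Finset ι) {θ : ι → X → ℂ}
    {v : ι → SymmetricAlgebra ℂ (CotSpace x)} (h : ∀ i ∈ s, HasLead u x (θ i) (v i)) :
    HasLead u x (fun y => ∑ i ∈ s, θ i y) (∑ i ∈ s, v i) := by
  classical
  induction s using Finset.induction_on with
  | empty => simpa using HasLead.zero
  | insert a s ha ih =>
    simp only [Finset.sum_insert ha]
    exact (h a (Finset.mem_insert_self _ _)).add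
      (ih fun i hi => h i (Finset.mem_insert_of_mem hi))

/-- The class in `S³` is well defined: monomials of degree three in the parameters are linearly
independent modulo `𝔪⁴`. -/
theorem HasLead.unique (hX : IsSmoothSurface X) (hu : IsParamAt u x) (h : HasLead u x θ v)
    (h' : HasLead u x θ v') : v = v' := by
  obtain ⟨C, h1, h2⟩ := h.add (h'.const_mul (-1))
  have h3 := hu.coeff_eq_zero hX 3 (fun d => if d = 3 then C 0 0 0 else if d = 2 then
    C 0 0 1 + C 0 1 0 + C 1 0 0 else if d = 1 then C 0 1 1 + C 1 0 1 + C 1 1 0 else C 1 1 1) (by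
    refine h1.neg.congr (Eventually.of_forall fun y => ?_)
    simp only [cubic_eq, Finset.sum_range_succ, smul_eq_mul]
    norm_num
    ring)
  have h4 : CubicZero C := by
    refine ⟨?_, ?_, ?_, ?_⟩
    · simpa using h3 3 le_rfl
    · simpa using h3 2 (by norm_num)
    · simpa using h3 1 (by norm_num)
    · simpa using h3 0 (by norm_num)
  rw [h4.cubic_eq_zero] at h2
  rw [← sub_eq_zero, ← h2]
  module

/-- Products of three functions vanishing at `x` have the product of their differentials as
class in `S³`. -/
theorem hasLead_mul (hu : IsParamAt u x) {f α g h : X → ℂ} (hf : IsRegularAt f x)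
    (hα : InIdeal α x (maxIdeal x)) (hg : InIdeal g x (maxIdeal x))
    (hh : InIdeal h x (maxIdeal x)) :
    HasLead u x (fun y => f y * (α y * g y * h y))
      (f x • (SymmetricAlgebra.ι ℂ (CotSpace x) (dAt α x) *
        SymmetricAlgebra.ι ℂ (CotSpace x) (dAt g x) *
        SymmetricAlgebra.ι ℂ (CotSpace x) (dAt h x))) := by
  have key : ∀ α : X → ℂ, InIdeal α x (maxIdeal x) → ∃ C : Fin 2 → ℂ,
      dAt α x = ∑ i, C i • dAt (u i) x ∧
      InIdeal (fun y => α y - ∑ i, C i * (u i y - u i x)) x (maxIdeal x ^ 2) := by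
    intro α hα
    obtain ⟨C, h1, h2⟩ := hu.exists_coeff hα.1
    refine ⟨C, h1, h2.congr (Eventually.of_forall fun y => ?_)⟩
    dsimp only
    rw [(inIdeal_maxIdeal.1 hα).2, sub_zero]
  obtain ⟨A, hA, hA'⟩ := key α hα
  obtain ⟨B, hB, hB'⟩ := key g hg
  obtain ⟨C, hC, hC'⟩ := key h hh
  have hl : ∀ D : Fin 2 → ℂ, InIdeal (fun y => ∑ i, D i * (u i y - u i x)) x (maxIdeal x) :=
    fun D => InIdeal.sum _ fun i _ => InIdeal.const_mul _
      (inIdeal_maxIdeal.2 ⟨hu.isRegularAt_sub i, sub_self _⟩)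
  have hf' : InIdeal (fun y => f y - f x) x (maxIdeal x) :=
    inIdeal_maxIdeal.2 ⟨hf.sub (isRegularAt_const _), sub_self _⟩
  refine ⟨fun i j k => f x * (A i * (B j * C k)), ?_, ?_⟩
  · have e1 : maxIdeal x ^ 4 = maxIdeal x * (maxIdeal x * maxIdeal x * maxIdeal x) := by ring
    have e2 : maxIdeal x ^ 4 = maxIdeal x ^ 2 * maxIdeal x * maxIdeal x := by ring
    have e3 : maxIdeal x ^ 4 = maxIdeal x * maxIdeal x ^ 2 * maxIdeal x := by ring
    have e4 : maxIdeal x ^ 4 = maxIdeal x * maxIdeal x * maxIdeal x ^ 2 := by ring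
    have t1 := hf'.mul ((hα.mul hg).mul hh)
    have t2 := ((hA'.mul hg).mul hh).const_mul (f x)
    have t3 := (((hl A).mul hB').mul hh).const_mul (f x)
    have t4 := (((hl A).mul (hl B)).mul hC').const_mul (f x)
    rw [← e1] at t1
    rw [← e2] at t2
    rw [← e3] at t3
    rw [← e4] at t4
    refine (((t1.add t2).add t3).add t4).congr (Eventually.of_forall fun y => ?_)
    simp only [cubic, Fin.sum_univ_two, smul_eq_mul]
    ring
  · rw [hA, hB, hC]
    simp only [cubic, Fin.sum_univ_two, map_add, map_smul, Algebra.smul_def, map_mul]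
    ring

theorem hasLead_cubic (hu : IsParamAt u x) {H : Fin 2 → Fin 2 → Fin 2 → X → ℂ}
    (hH : ∀ i j k, IsRegularAt (H i j k) x) :
    HasLead u x (fun y => cubic (fun i j k => H i j k y) fun i => u i y - u i x)
      (cubic (fun i j k => H i j k x) (symD u x)) := by
  have hd : ∀ i, dAt (fun y => u i y - u i x) x = dAt (u i) x := fun i => by
    rw [dAt_sub (hu.1 i) (isRegularAt_const _), dAt_const, sub_zero]
  have hm : ∀ i, InIdeal (fun y => u i y - u i x) x (maxIdeal x) := fun i =>
    inIdeal_maxIdeal.2 ⟨hu.isRegularAt_sub i, sub_self _⟩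
  have := HasLead.sum Finset.univ fun i _ => HasLead.sum Finset.univ fun j _ =>
    HasLead.sum Finset.univ fun k _ => hasLead_mul hu (hH i j k) (hm i) (hm j) (hm k)
  simp only [hd] at this
  exact this

open Classical in
/-- The class of `θ ∈ 𝔪_x³` in `S³(𝔪_x/𝔪_x²)`. -/
def lead (u : Fin 2 → X → ℂ) (x : X) (θ : X → ℂ) : SymmetricAlgebra ℂ (CotSpace x) :=
  if h : ∃ v, HasLead u x θ v then h.choose else 0

theorem HasLead.lead_eq (hX : IsSmoothSurface X) (hu : IsParamAt u x) (h : HasLead u x θ v) :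
    lead u x θ = v := by
  have h' : ∃ v, HasLead u x θ v := ⟨v, h⟩
  rw [lead, dif_pos h']
  exact h'.choose_spec.unique hX hu h

end Lead

/-! ### Points of `X^{m+3}` and the ideals of the diagonals -/

section Points

variable {X : Type} {m : ℕ}

/-- The point `(x₁, x₂, x₃, z)` as a triple. -/
def Triple.ofPow (q : Pow X (m + 3)) : Triple X m :=
  ⟨q 0, q 1, q 2, fun i => q i.succ.succ.succ⟩

theorem Triple.toPow_ofPow (q : Pow X (m + 3)) : (Triple.ofPow q).toPow = q := by
  funext i
  refine Fin.cases rfl (fun i => Fin.cases rfl (fun i => Fin.cases rfl (fun i => rfl) i) i) i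

/-- The coordinates `(x, w, z)` of the point `(x, x, w, z)`. -/
def DiagPt.ofPow (q : Pow X (m + 3)) : DiagPt X m := ⟨q 0, q 2, fun i => q i.succ.succ.succ⟩

theorem DiagPt.toPow_ofPow {q : Pow X (m + 3)} (h : q 0 = q 1) : (DiagPt.ofPow q).toPow = q := by
  refine Eq.trans ?_ (Triple.toPow_ofPow q)
  simp only [DiagPt.toPow, DiagPt.ofPow, Triple.ofPow, h]

/-- The map which exchanges the second and the third point. -/
def swapPow (q : Pow X (m + 3)) : Pow X (m + 3) :=
  Triple.toPow ⟨q 0, q 2, q 1, fun i => q i.succ.succ.succ⟩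

theorem swapPow_swapPow (q : Pow X (m + 3)) : swapPow (swapPow q) = q := Triple.toPow_ofPow q

theorem toSym_swapPow (q : Pow X (m + 3)) : toSym (swapPow q) = toSym q :=
  (toSym_swap _ _ _ _).trans (congrArg toSym (Triple.toPow_ofPow q))

theorem swapPow_eq_self {q : Pow X (m + 3)} (h : q 1 = q 2) : swapPow q = q := by
  refine Eq.trans ?_ (Triple.toPow_ofPow q)
  simp only [Triple.ofPow, swapPow, h]

/-- The map induced by a permutation of the points `4, …, n`. -/
def permPow (σ : Equiv.Perm (Fin m)) (q : Pow X (m + 3)) : Pow X (m + 3) :=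
  Triple.toPow ⟨q 0, q 1, q 2, fun i => q (σ i).succ.succ.succ⟩

theorem toSym_permPow (σ : Equiv.Perm (Fin m)) (q : Pow X (m + 3)) :
    toSym (permPow σ q) = toSym q :=
  (toSym_perm _ _ _ _ σ).trans (congrArg toSym (Triple.toPow_ofPow q))

variable [FunctionSpace X]

theorem eventually_comap_triple {P : Pow X (m + 3)} {C : Triple X m → Prop} :
    (∀ᶠ q in comap Triple.toPow (𝓝 P), C q) ↔ ∀ᶠ Q in 𝓝 P, C (Triple.ofPow Q) := by
  rw [eventually_comap]
  refine eventually_congr (Eventually.of_forall fun Q => ⟨fun h => h _ (Triple.toPow_ofPow Q), ?_⟩)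
  rintro h q rfl
  exact h

theorem eventually_comap_diag {P : Pow X (m + 3)} {C : DiagPt X m → Prop} :
    (∀ᶠ q in comap DiagPt.toPow (𝓝 P), C q) ↔
      ∀ᶠ Q in 𝓝 P, Q 0 = Q 1 → C (DiagPt.ofPow Q) := by
  rw [eventually_comap]
  refine eventually_congr (Eventually.of_forall fun Q =>
    ⟨fun h hQ => h _ (DiagPt.toPow_ofPow hQ), ?_⟩)
  rintro h q rfl
  exact h rfl

theorem comap_toPow_inf {Pt : Type} (φ : Pt → Pow X (m + 3)) (p : Pt) :
    comap φ (𝓝 (φ p)) ⊓ comap (fun p => toSym (φ p)) (𝓝 (toSym (φ p))) = comap φ (𝓝 (φ p)) := by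
  refine inf_eq_left.2 ?_
  rw [← map_le_iff_le_comap]
  exact (continuous_toSym.continuousAt.tendsto (x := φ p)).comp tendsto_comap

theorem eventually_mem_opens {U : Opens (SymPow X (m + 3))} {P : Pow X (m + 3)}
    (h : toSym P ∈ U) : ∀ᶠ Q in 𝓝 P, toSym Q ∈ U :=
  continuous_toSym.continuousAt (U.isOpen.mem_nhds h)

theorem isMorphismAt_toPow {Y : Type} [FunctionSpace Y] (hY : HasInverses Y) {y : Y}
    {f g h : Y → X} {z : Y → Fin m → X} (hf : IsMorphismAt f y) (hg : IsMorphismAt g y)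
    (hh : IsMorphismAt h y) (hz : ∀ i, IsMorphismAt (fun y => z y i) y) :
    IsMorphismAt (fun y => Triple.toPow ⟨f y, g y, h y, z y⟩) y := by
  refine isMorphismAt_pow hY fun i => ?_
  refine Fin.cases hf (fun i => Fin.cases hg (fun i => Fin.cases hh (fun i => hz i) i) i) i

theorem isMorphismAt_swapPow (q : Pow X (m + 3)) : IsMorphismAt swapPow q :=
  isMorphismAt_toPow (hasInverses_pow _) (isMorphismAt_proj 0 q) (isMorphismAt_proj 2 q)
    (isMorphismAt_proj 1 q) fun _ => isMorphismAt_proj _ q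

theorem isMorphismAt_permPow (σ : Equiv.Perm (Fin m)) (q : Pow X (m + 3)) :
    IsMorphismAt (permPow σ) q :=
  isMorphismAt_toPow (hasInverses_pow _) (isMorphismAt_proj 0 q) (isMorphismAt_proj 1 q)
    (isMorphismAt_proj 2 q) fun _ => isMorphismAt_proj _ q

theorem isMorphismAt_second (hX : HasInverses X) (a x w : X) (z : Fin m → X) :
    IsMorphismAt (fun y => Triple.toPow ⟨a, y, w, z⟩) x :=
  isMorphismAt_toPow hX (isMorphismAt_const _ _) (isMorphismAt_id _) (isMorphismAt_const _ _)
    fun _ => isMorphismAt_const _ _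

theorem isMorphismAt_third (hX : HasInverses X) (a b x : X) (z : Fin m → X) :
    IsMorphismAt (fun y => Triple.toPow ⟨a, b, y, z⟩) x :=
  isMorphismAt_toPow hX (isMorphismAt_const _ _) (isMorphismAt_const _ _) (isMorphismAt_id _)
    fun _ => isMorphismAt_const _ _

end Points

section DiagIdeal

variable {X : Type} {n : ℕ} {i j : Fin n} {p : Pow X n} {f : Pow X n → ℂ}
  {u : Fin 2 → X → ℂ}

/-- The functions `q ↦ u k (q j) - u k (q i)`. -/
def coordDiff (u : Fin 2 → X → ℂ) (i j : Fin n) (k : Fin 2) (q : Pow X n) : ℂ :=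
  u k (q j) - u k (q i)

theorem coordDiff_of_eq (k : Fin 2) {q : Pow X n} (h : q i = q j) : coordDiff u i j k q = 0 := by
  rw [coordDiff, h, sub_self]

variable [FunctionSpace X]

theorem inIdeal_diagIdeal : InIdeal f p (diagIdeal i j p) ↔
    IsRegularAt f p ∧ ∀ᶠ q in 𝓝 p, q i = q j → f q = 0 := by
  constructor
  · rintro ⟨h, g, e, hg⟩
    refine ⟨h, ?_⟩
    filter_upwards [hg, Germ.coe_eq.1 e] with q h1 h2 h3
    rw [h2, h1 h3]
  · rintro ⟨h, hf⟩
    exact ⟨h, f, rfl, hf⟩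

theorem eventually_ne (hXq : IsQuasiProjective X) (h : p i ≠ p j) : ∀ᶠ q in 𝓝 p, q i ≠ q j := by
  obtain ⟨c, hc⟩ := exists_chart hXq (Set.finite_range (p : Fin n → X))
  have hp : InChart c n p := fun i => hc ⟨i, rfl⟩
  have h1 : c.y (p i) ≠ c.y (p j) := fun e => h (c.injective _ (hp i) _ (hp j) e)
  obtain ⟨k, hk⟩ := Function.ne_iff.1 h1
  have h2 : IsRegularAt (fun q : Pow X n => c.y (q i) k - c.y (q j) k) p :=
    ((isMorphismAt_proj i p).comp _ (c.regular k _ (hp i))).sub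
      ((isMorphismAt_proj j p).comp _ (c.regular k _ (hp j)))
  filter_upwards [(hasInverses_pow n _ _ h2 (sub_ne_zero.2 hk)).1] with q hq e
  exact hq (by rw [e, sub_self])

theorem diagIdeal_eq_top (hXq : IsQuasiProjective X) (h : p i ≠ p j) : diagIdeal i j p = ⊤ := by
  rw [Ideal.eq_top_iff_one]
  refine (inIdeal_diagIdeal (f := fun _ => 1).2 ⟨isRegularAt_const _, ?_⟩).2
  filter_upwards [eventually_ne hXq h] with q hq e
  exact absurd e hq

theorem inIdeal_diagIdeal_pow_of_ne (hXq : IsQuasiProjective X) (h : p i ≠ p j) (l : ℕ) :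
    InIdeal f p (diagIdeal i j p ^ l) ↔ IsRegularAt f p := by
  rw [diagIdeal_eq_top hXq h, Ideal.top_pow, inIdeal_top]

theorem isRegularAt_coordDiff (hu : ∀ k, IsRegularAt (u k) (p i)) (hu' : ∀ k, IsRegularAt (u k) (p j))
    (k : Fin 2) : IsRegularAt (coordDiff u i j k) p :=
  ((isMorphismAt_proj j p).comp _ (hu' k)).sub ((isMorphismAt_proj i p).comp _ (hu k))

theorem inIdeal_coordDiff (hu : ∀ k, IsRegularAt (u k) (p i)) (hu' : ∀ k, IsRegularAt (u k) (p j))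
    (k : Fin 2) : InIdeal (coordDiff u i j k) p (diagIdeal i j p) :=
  inIdeal_diagIdeal.2
    ⟨isRegularAt_coordDiff hu hu' k, Eventually.of_forall fun _ h => coordDiff_of_eq k h⟩

/-- The square of the ideal of a diagonal is generated by the products of the differences of local
parameters. -/
theorem inIdeal_diagIdeal_sq_iff (hX : HasInverses X) (hXq : IsQuasiProjective X)
    (hij : p i = p j) (hu : IsParamAt u (p i)) :
    InIdeal f p (diagIdeal i j p ^ 2) ↔ ∃ R : Fin 2 → Fin 2 → Pow X n → ℂ,
      (∀ k l, IsRegularAt (R k l) p) ∧ f =ᶠ[𝓝 p] fun q =>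
        ∑ k, ∑ l, coordDiff u i j k q * coordDiff u i j l q * R k l q := by
  have hu' : ∀ k, IsRegularAt (u k) (p j) := hij ▸ hu.1
  constructor
  · intro h
    rw [pow_two] at h
    refine InIdeal.mul_induction (C := fun f => ∃ R : Fin 2 → Fin 2 → Pow X n → ℂ,
      (∀ k l, IsRegularAt (R k l) p) ∧ f =ᶠ[𝓝 p] fun q =>
        ∑ k, ∑ l, coordDiff u i j k q * coordDiff u i j l q * R k l q) h ?_ ?_ ?_
    · rintro f g e ⟨R, hR, h⟩
      exact ⟨R, hR, e.symm.trans h⟩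
    · intro a b ha hb
      obtain ⟨A, hA, eA⟩ := inSpan_diag hX hXq hij hu ha.1 (inIdeal_diagIdeal.1 ha).2
      obtain ⟨B, hB, eB⟩ := inSpan_diag hX hXq hij hu hb.1 (inIdeal_diagIdeal.1 hb).2
      refine ⟨fun k l q => A k q * B l q, fun k l => (hA k).mul (hB l), ?_⟩
      filter_upwards [eA, eB] with q h1 h2
      rw [h1, h2]
      simp only [Fin.sum_univ_two, coordDiff]
      ring
    · rintro a b - - ⟨R, hR, eR⟩ ⟨S, hS, eS⟩
      refine ⟨fun k l q => R k l q + S k l q, fun k l => (hR k l).add (hS k l), ?_⟩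
      filter_upwards [eR, eS] with q h1 h2
      rw [h1, h2]
      simp only [Fin.sum_univ_two]
      ring
  · rintro ⟨R, hR, e⟩
    refine InIdeal.congr (InIdeal.sum Finset.univ fun k _ => InIdeal.sum Finset.univ fun l _ => ?_)
      e.symm
    refine InIdeal.mul_right ?_ (hR k l)
    rw [pow_two]
    exact (inIdeal_coordDiff hu.1 hu' k).mul (inIdeal_coordDiff hu.1 hu' l)

/-- Pull-back of the square of an ideal. -/
theorem InIdeal.comp_sq {Y Z : Type} [FunctionSpace Y] [FunctionSpace Z] {φ : Y → Z} {y : Y}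
    (hφ : IsMorphismAt φ y) {J : Ideal (stalk (φ y))} {K : Ideal (stalk y)}
    (hJ : ∀ g, InIdeal g (φ y) J → InIdeal (fun y => g (φ y)) y K) {g : Z → ℂ}
    (hg : InIdeal g (φ y) (J ^ 2)) : InIdeal (fun y => g (φ y)) y (K ^ 2) := by
  rw [pow_two] at hg ⊢
  refine InIdeal.mul_induction (C := fun g => InIdeal (fun y => g (φ y)) y (K * K)) hg ?_ ?_ ?_
  · intro f g e h
    exact h.congr (hφ.continuousAt.eventually e)
  · exact fun a b ha hb => (hJ a ha).mul (hJ b hb)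
  · exact fun a b _ _ ha hb => ha.add hb

end DiagIdeal

/-! ### Functions with prescribed differential along a diagonal -/

section Factor

variable {X : Type} [FunctionSpace X] {m : ℕ} {p : Pow X (m + 3)} {F : Pow X (m + 3) → ℂ}
  {u : Fin 2 → X → ℂ}

/-- A function which vanishes on `Δ₁₂` and is in the square of the ideal of `Δ₂₃` is in the
product of the ideal of `Δ₁₂` with that square. -/
theorem exists_factor (hX : HasInverses X) (hXq : IsQuasiProjective X) (h01 : p 0 = p 1)
    (h12 : p 1 = p 2) (hu : IsParamAt u (p 0)) (h0 : ∀ᶠ q in 𝓝 p, q 0 = q 1 → F q = 0)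
    (hF : InIdeal F p (diagIdeal 1 2 p ^ 2)) :
    ∃ R : Fin 2 → Fin 2 → Fin 2 → Pow X (m + 3) → ℂ, (∀ i j k, IsRegularAt (R i j k) p) ∧
      F =ᶠ[𝓝 p] fun q => ∑ i, ∑ j, ∑ k,
        coordDiff u 0 1 i q * (coordDiff u 1 2 j q * coordDiff u 1 2 k q) * R i j k q := by
  have hu1 : IsParamAt u (p 1) := h01 ▸ hu
  obtain ⟨N, hN, e⟩ := (inIdeal_diagIdeal_sq_iff hX hXq h12 hu1).1 hF
  -- `ρ` projects to `Δ₁₂`, where `F` vanishes; hence `∑ W_j W_k N_jk(ρ q) = 0`, and the coefficient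
  -- `N_jk(q)` may be replaced by `N_jk(q) - N_jk(ρ q)`, which vanishes on `Δ₁₂`
  let ρ : Pow X (m + 3) → Pow X (m + 3) := fun q =>
    Triple.toPow ⟨q 1, q 1, q 2, fun i => q i.succ.succ.succ⟩
  have hρ : IsMorphismAt ρ p := isMorphismAt_toPow (hasInverses_pow _) (isMorphismAt_proj 1 p)
    (isMorphismAt_proj 1 p) (isMorphismAt_proj 2 p) fun _ => isMorphismAt_proj _ p
  have hρp : ρ p = p := by
    refine Eq.trans ?_ (Triple.toPow_ofPow p)
    simp only [ρ, Triple.ofPow, h01]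
  have hNρ : ∀ j k, IsRegularAt (fun q => N j k (ρ q)) p := fun j k =>
    hρ.comp _ (hρp.symm ▸ hN j k)
  have h1 : ∀ j k, InSpan (fun i (q : Pow X (m + 3)) => u i (q 1) - u i (q 0))
      (fun q => N j k q - N j k (ρ q)) p := by
    intro j k
    refine inSpan_diag hX hXq h01 hu ((hN j k).sub (hNρ j k)) (Eventually.of_forall fun q hq => ?_)
    have : ρ q = q := by
      refine Eq.trans ?_ (Triple.toPow_ofPow q)
      simp only [ρ, Triple.ofPow, hq]
    rw [this, sub_self]
  choose r hr er using h1
  refine ⟨fun i j k => r j k i, fun i j k => hr j k i, ?_⟩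
  have e2 := hρ.continuousAt.eventually (hρp.symm ▸ h0)
  have e3 := hρ.continuousAt.eventually (hρp.symm ▸ e)
  filter_upwards [e, e2, e3, er 0 0, er 0 1, er 1 0, er 1 1] with q e e2 e3 e00 e01 e10 e11
  have e4 : (0 : ℂ) = ∑ j, ∑ k, coordDiff u 1 2 j q * coordDiff u 1 2 k q * N j k (ρ q) :=
    (e2 rfl).symm.trans e3
  simp only [Fin.sum_univ_two] at e e4 e00 e01 e10 e11 ⊢
  have e00' := eq_add_of_sub_eq e00
  have e01' := eq_add_of_sub_eq e01
  have e10' := eq_add_of_sub_eq e10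
  have e11' := eq_add_of_sub_eq e11
  rw [e, e00', e01', e10', e11']
  simp only [coordDiff] at e4 ⊢
  linear_combination (-1) * e4

/-- A symmetric function which vanishes on the diagonal vanishes there to second order. -/
theorem inIdeal_sq_of_swap (hX : HasInverses X) (hXq : IsQuasiProjective X) (h12 : p 1 = p 2)
    (hu : IsParamAt u (p 1)) (hF : IsRegularAt F p) (h0 : ∀ᶠ q in 𝓝 p, q 1 = q 2 → F q = 0)
    (hs : ∀ᶠ q in 𝓝 p, F (swapPow q) = F q) : InIdeal F p (diagIdeal 1 2 p ^ 2) := by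
  obtain ⟨N, hN, e⟩ := inSpan_diag hX hXq h12 hu hF h0
  have hσ := isMorphismAt_swapPow p
  have hp : swapPow p = p := swapPow_eq_self h12
  have hu2 : ∀ k, IsRegularAt (u k) (p 2) := h12 ▸ hu.1
  have h1 : ∀ k, InIdeal (fun q => N k q - N k (swapPow q)) p (diagIdeal 1 2 p) := fun k =>
    inIdeal_diagIdeal.2 ⟨(hN k).sub (hσ.comp _ (hp.symm ▸ hN k)),
      Eventually.of_forall fun q hq => by rw [swapPow_eq_self hq, sub_self]⟩
  -- the swap changes the sign of the differences `W_k`, so the symmetric function `F = ∑ W_k N_k` is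
  -- also `∑ W_k (N_k - N_k ∘ swap) / 2`
  have h2 : InIdeal (fun q => ∑ k, (1 / 2) * (coordDiff u 1 2 k q *
      (N k q - N k (swapPow q)))) p (diagIdeal 1 2 p ^ 2) := by
    refine InIdeal.sum _ fun k _ => InIdeal.const_mul _ ?_
    rw [pow_two]
    exact (inIdeal_coordDiff hu.1 hu2 k).mul (h1 k)
  refine h2.congr ?_
  filter_upwards [e, hs, hσ.continuousAt.eventually (hp.symm ▸ e)] with q h1 h2 h3
  have h4 : F (swapPow q) = ∑ k, N k (swapPow q) * (u k (q 1) - u k (q 2)) := h3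
  rw [h2] at h4
  simp only [Fin.sum_univ_two, coordDiff] at h1 h4 ⊢
  linear_combination (-1 / 2) * h1 - (1 / 2) * h4

end Factor

section Lift

variable {X : Type} {m : ℕ}

/-- The last `m` points. -/
abbrev tail (q : Pow X (m + 3)) : Fin m → X := fun i => q i.succ.succ.succ

theorem toPow_second {q : Pow X (m + 3)} (h : q 0 = q 1) : Triple.toPow ⟨q 0, q 0, q 2, tail q⟩ = q := by
  conv_lhs => rw [show (⟨q 0, q 0, q 2, tail q⟩ : Triple X m) = Triple.ofPow q by
    simp only [Triple.ofPow, ← h]]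
  exact Triple.toPow_ofPow q

theorem toPow_third {q : Pow X (m + 3)} (h : q 0 = q 2) : Triple.toPow ⟨q 0, q 1, q 0, tail q⟩ = q := by
  conv_lhs => rw [show (⟨q 0, q 1, q 0, tail q⟩ : Triple X m) = Triple.ofPow q by
    simp only [Triple.ofPow, ← h]]
  exact Triple.toPow_ofPow q

variable [FunctionSpace X] {D : ∀ q : Pow X (m + 3), CotSpace (q 0)}
  {F G : Pow X (m + 3) → ℂ} {p q : Pow X (m + 3)} {u : Fin 2 → X → ℂ}

/-- At the point `q`, the function `F` vanishes on the diagonals, its differential in the second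
variable along `Δ₁₂` is `D`, and its differential in the third variable along `Δ₁₃` is `0`. -/
structure IsLift (D : ∀ q : Pow X (m + 3), CotSpace (q 0)) (F : Pow X (m + 3) → ℂ)
    (q : Pow X (m + 3)) : Prop where
  regular : IsRegularAt F q
  zero : q 0 = q 1 ∨ q 0 = q 2 ∨ q 1 = q 2 → F q = 0
  d₂ : q 0 = q 1 → dAt (fun y => F (Triple.toPow ⟨q 0, y, q 2, tail q⟩)) (q 0) = D q
  d₃ : q 0 = q 2 → dAt (fun y => F (Triple.toPow ⟨q 0, q 1, y, tail q⟩)) (q 0) = 0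

theorem IsRegularAt.second (hX : HasInverses X) (h : q 0 = q 1) (hF : IsRegularAt F q) :
    IsRegularAt (fun y => F (Triple.toPow ⟨q 0, y, q 2, tail q⟩)) (q 0) :=
  (isMorphismAt_second hX _ _ _ _).comp F ((toPow_second h).symm ▸ hF)

theorem IsRegularAt.third (hX : HasInverses X) (h : q 0 = q 2) (hF : IsRegularAt F q) :
    IsRegularAt (fun y => F (Triple.toPow ⟨q 0, q 1, y, tail q⟩)) (q 0) :=
  (isMorphismAt_third hX _ _ _ _).comp F ((toPow_third h).symm ▸ hF)

/-- Off the diagonal `Δ₁₂` the condition is empty. -/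
theorem eventually_isLift_of_ne (hXq : IsQuasiProjective X) (h : p 0 ≠ p 1) :
    ∀ᶠ q in 𝓝 p, IsLift D (fun _ => 0) q := by
  filter_upwards [eventually_ne hXq h] with q hq
  exact ⟨isRegularAt_const _, fun _ => rfl, fun e => absurd e hq, fun _ => dAt_const _⟩

theorem IsParamAt.dAt_sum_mul {x : X} (hu : IsParamAt u x) {g : Fin 2 → X → ℂ}
    (hg : ∀ i, IsRegularAt (g i) x) :
    dAt (fun y => ∑ i, g i y * (u i y - u i x)) x = ∑ i, g i x • dAt (u i) x :=
  hu.dAt_eq hg (Eventually.of_forall fun y => by simp)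

/-- Near a point of `Δ₁₂` which is off the other two diagonals. -/
theorem eventually_isLift_of_ne_third (hX : HasInverses X) (hXq : IsQuasiProjective X)
    (h01 : p 0 = p 1) (h02 : p 0 ≠ p 2)
    (hu : IsParamAt u (p 0)) {T : Fin 2 → Pow X (m + 3) → ℂ} (hT : ∀ i, IsRegularAt (T i) p)
    (hD : ∀ᶠ q in 𝓝 p, q 0 = q 1 → D q = ∑ i, T i q • dAt (u i) (q 0)) :
    ∀ᶠ q in 𝓝 p, IsLift D (fun q => ∑ i, T i q * coordDiff u 0 1 i q) q := by
  have hu1 : IsParamAt u (p 1) := h01 ▸ hu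
  have hreg : IsRegularAt (fun q => ∑ i, T i q * coordDiff u 0 1 i q) p :=
    IsRegularAt.sum _ fun i _ => (hT i).mul (isRegularAt_coordDiff hu.1 hu1.1 i)
  filter_upwards [hreg.eventually, hD, eventually_ne hXq h02,
    eventually_ne hXq (show p 1 ≠ p 2 from h01 ▸ h02), eventually_all.2 fun i => (hT i).eventually,
    (isMorphismAt_proj 0 p).continuousAt.eventually (hu.eventually hX hXq)]
    with q h1 h2 h3 h4 h5 h6
  refine ⟨h1, ?_, fun h => ?_, fun h => absurd h h3⟩
  · rintro (h | h | h)
    · exact Finset.sum_eq_zero fun i _ => by rw [coordDiff_of_eq i h, mul_zero]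
    · exact absurd h h3
    · exact absurd h h4
  · refine (h6.dAt_sum_mul fun i => (h5 i).second hX h).trans ?_
    simp only [toPow_second h]
    exact (h2 h).symm

/-- Near a point of the small diagonal `x₁ = x₂ = x₃`: a correction term, which is available because
the symmetrisation of the leading form of `D` vanishes, makes the function vanish on `Δ₂₃`. -/
theorem eventually_isLift_of_eq (hX : HasInverses X) (hXq : IsQuasiProjective X)
    (h01 : p 0 = p 1) (h02 : p 0 = p 2)
    (hu : IsParamAt u (p 0)) {H : Fin 2 → Fin 2 → Fin 2 → Pow X (m + 3) → ℂ}
    (hH : ∀ i j k, IsRegularAt (H i j k) p)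
    (hD : ∀ᶠ q in 𝓝 p, q 0 = q 1 → D q =
      ∑ i, (∑ j, ∑ k, coordDiff u 0 2 j q * coordDiff u 0 2 k q * H i j k q) • dAt (u i) (q 0))
    (hC : ∀ᶠ q in 𝓝 p, q 0 = q 2 → CubicZero fun i j k => H i j k q) :
    ∃ F, ∀ᶠ q in 𝓝 p, IsLift D F q := by
  have hu1 : IsParamAt u (p 1) := h01 ▸ hu
  have hu2 : IsParamAt u (p 2) := h02 ▸ hu
  have hU : ∀ i, IsRegularAt (coordDiff u 0 1 i : Pow X (m + 3) → ℂ) p :=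
    isRegularAt_coordDiff hu.1 hu1.1
  have hV : ∀ i, IsRegularAt (coordDiff u 0 2 i : Pow X (m + 3) → ℂ) p :=
    isRegularAt_coordDiff hu.1 hu2.1
  -- the coefficients of the symmetrised cubic form, which vanish on `Δ₁₃`
  let c0 := H 0 0 0
  let c1 := fun q => H 0 0 1 q + H 0 1 0 q + H 1 0 0 q
  let c2 := fun q => H 0 1 1 q + H 1 0 1 q + H 1 1 0 q
  let c3 := H 1 1 1
  let T : Fin 2 → Pow X (m + 3) → ℂ := fun i q =>
    ∑ j, ∑ k, coordDiff u 0 2 j q * coordDiff u 0 2 k q * H i j k q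
  have hT : ∀ i, IsRegularAt (T i) p := fun i => IsRegularAt.sum _ fun j _ =>
    IsRegularAt.sum _ fun k _ => ((hV j).mul (hV k)).mul (hH i j k)
  have hc0 : IsRegularAt c0 p := hH 0 0 0
  have hc1 : IsRegularAt c1 p := ((hH 0 0 1).add (hH 0 1 0)).add (hH 1 0 0)
  have hc2 : IsRegularAt c2 p := ((hH 0 1 1).add (hH 1 0 1)).add (hH 1 1 0)
  have hc3 : IsRegularAt c3 p := hH 1 1 1
  -- the coefficients of the `coordDiff u 0 1 i` in the function to be constructed
  let K : Fin 2 → Pow X (m + 3) → ℂ := ![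
    fun q => T 0 q - (coordDiff u 0 1 0 q * (coordDiff u 0 2 0 q * c0 q) +
      coordDiff u 0 1 0 q * (coordDiff u 0 2 1 q * c1 q) +
      coordDiff u 0 1 1 q * (coordDiff u 0 2 1 q * c2 q)),
    fun q => T 1 q - coordDiff u 0 1 1 q * (coordDiff u 0 2 1 q * c3 q)]
  have hK : ∀ i, IsRegularAt (K i) p := by
    intro i
    fin_cases i
    · exact (hT 0).sub ((((hU 0).mul ((hV 0).mul hc0)).add ((hU 0).mul ((hV 1).mul hc1))).add
        ((hU 1).mul ((hV 1).mul hc2)))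
    · exact (hT 1).sub ((hU 1).mul ((hV 1).mul hc3))
  -- the coefficients of the `coordDiff u 0 2 i`
  let J : Fin 2 → Pow X (m + 3) → ℂ := fun k q =>
    ∑ i, coordDiff u 0 1 i q * ∑ j, coordDiff u 0 2 j q * H i j k q -
      (![fun q => coordDiff u 0 1 0 q ^ 2 * c0 q, fun q => coordDiff u 0 1 0 q ^ 2 * c1 q +
        coordDiff u 0 1 0 q * coordDiff u 0 1 1 q * c2 q + coordDiff u 0 1 1 q ^ 2 * c3 q] :
        Fin 2 → Pow X (m + 3) → ℂ) k q
  have hJ : ∀ k, IsRegularAt (J k) p := by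
    intro k
    refine IsRegularAt.sub (IsRegularAt.sum _ fun i _ => (hU i).mul
      (IsRegularAt.sum _ fun j _ => (hV j).mul (hH i j k))) ?_
    fin_cases k
    · exact ((hU 0).pow 2).mul hc0
    · exact ((((hU 0).pow 2).mul hc1).add (((hU 0).mul (hU 1)).mul hc2)).add
        (((hU 1).pow 2).mul hc3)
  let F : Pow X (m + 3) → ℂ := fun q => ∑ i, K i q * coordDiff u 0 1 i q
  have hFJ : ∀ q, F q = ∑ k, J k q * coordDiff u 0 2 k q := by
    intro q
    simp only [F, K, J, T, Fin.sum_univ_two, Matrix.cons_val_zero, Matrix.cons_val_one]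
    ring
  have hF : IsRegularAt F p := IsRegularAt.sum _ fun i _ => (hK i).mul (hU i)
  refine ⟨F, ?_⟩
  filter_upwards [hF.eventually, hD, hC, eventually_all.2 fun i => (hK i).eventually,
    eventually_all.2 fun i => (hJ i).eventually,
    (isMorphismAt_proj 0 p).continuousAt.eventually (hu.eventually hX hXq)]
    with q h1 h2 h3 h4 h5 h6
  refine ⟨h1, ?_, fun h => ?_, fun h => ?_⟩
  · rintro (h | h | h)
    · exact Finset.sum_eq_zero fun i _ => by rw [coordDiff_of_eq i h, mul_zero]
    · rw [hFJ]
      exact Finset.sum_eq_zero fun i _ => by rw [coordDiff_of_eq i h, mul_zero]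
    · have e : ∀ i, coordDiff u 0 1 i q = coordDiff u 0 2 i q := fun i => by
        simp only [coordDiff, h]
      simp only [F, K, T, Fin.sum_univ_two, Matrix.cons_val_zero, Matrix.cons_val_one, e, c0, c1,
        c2, c3]
      ring
  · refine (h6.dAt_sum_mul fun i => (h4 i).second hX h).trans ?_
    simp only [toPow_second h]
    rw [h2 h]
    refine Finset.sum_congr rfl fun i _ => ?_
    congr 1
    fin_cases i <;> simp [K, T, coordDiff_of_eq _ h]
  · rw [show (fun y => F (Triple.toPow ⟨q 0, q 1, y, tail q⟩)) = fun y => _ from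
      funext fun y => hFJ _]
    refine (h6.dAt_sum_mul fun i => (h5 i).third hX h).trans ?_
    simp only [toPow_third h]
    obtain ⟨z0, z1, z2, z3⟩ := h3 h
    refine Finset.sum_eq_zero fun i _ => ?_
    have : J i q = 0 := by
      fin_cases i <;> simp [J, coordDiff_of_eq _ h, c0, c1, c2, c3, z0, z1, z2, z3]
    rw [this, zero_smul]

end Lift

/-! ### Gluing over a neighbourhood in the symmetric power -/

section Gluing

variable {X : Type} [FunctionSpace X] {n : ℕ} {c : Chart X}

/-- A partition of unity `∑ a_p b_p = 1` over a neighbourhood of `t ∈ S^n X`, indexed by the fibre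
of `X^n → S^n X` over `t`. The term with index `p` is supported in a given neighbourhood `O p` of
`p`, and the functions `f p i` which are regular at `p` become regular everywhere after
multiplication by `b_p`. -/
theorem exists_partition {t : SymPow X n} (hc : ∀ p : Pow X n, toSym p = t → InChart c n p)
    {ι : Type} [Fintype ι] {O : Pow X n → Set (Pow X n)} (hO : ∀ p, toSym p = t → O p ∈ 𝓝 p)
    {f : Pow X n → ι → Pow X n → ℂ} (hf : ∀ p, toSym p = t → ∀ i, IsRegularAt (f p i) p) :
    ∃ (P : Finset (Pow X n)) (a b : Pow X n → Pow X n → ℂ) (k : Pow X n → ι → Pow X n → ℂ),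
      (∀ p ∈ P, toSym p = t) ∧ ∀ᶠ t' in 𝓝 t, ∀ q, toSym q = t' → InChart c n q ∧
        ∑ p ∈ P, a p q * b p q = 1 ∧ ∀ p ∈ P, IsRegularAt (a p) q ∧ IsRegularAt (b p) q ∧
          (∀ i, IsRegularAt (k p i) q ∧ k p i q = b p q * f p i q) ∧
          (a p q = 0 → b p q = 0) ∧ (a p q ≠ 0 → q ∈ O p) := by
  classical
  have hP := finite_toSym_fibre (X := X) t
  have h1 : ∀ p, ∃ h : Pow X n → ℂ, toSym p = t → h ∈ polyAlg c n ∧ h p ≠ 0 ∧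
      (∀ p', toSym p' = t → p' ≠ p → h p' = 0) ∧ (∀ q, InChart c n q → h q ≠ 0 → q ∈ O p) ∧
      ∀ i, ∃ g ∈ polyAlg c n, ∀ q, InChart c n q → g q = h q * f p i q := by
    intro p
    by_cases hp : toSym p = t
    · obtain ⟨h, h1⟩ := exists_clear_denominators hP hc (hc p hp) (hO p hp) (hf p hp)
      exact ⟨h, fun _ => h1⟩
    · exact ⟨0, fun h => absurd h hp⟩
  choose h hh using h1
  have h2 : ∀ p i, ∃ g : Pow X n → ℂ, toSym p = t →
      g ∈ polyAlg c n ∧ ∀ q, InChart c n q → g q = h p q * f p i q := by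
    intro p i
    by_cases hp : toSym p = t
    · obtain ⟨g, hg⟩ := (hh p hp).2.2.2.2 i
      exact ⟨g, fun _ => hg⟩
    · exact ⟨0, fun h => absurd h hp⟩
  choose g hg using h2
  -- `h p` is a bump function at `p`; then `a_p = h_p` and `b_p = h_p / ∑ h_p²`
  let S : Pow X n → ℂ := fun q => ∑ p ∈ hP.toFinset, h p q * h p q
  have hreg : ∀ p, toSym p = t → ∀ q, InChart c n q → IsRegularAt (h p) q := fun p hp q hq =>
    isRegularAt_of_mem_polyAlg (hh p hp).1 hq
  have hS : ∀ q, InChart c n q → IsRegularAt S q := fun q hq =>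
    IsRegularAt.sum _ fun p hp => (hreg p (hP.mem_toFinset.1 hp) q hq).mul
      (hreg p (hP.mem_toFinset.1 hp) q hq)
  have hS0 : ∀ p, toSym p = t → S p ≠ 0 := by
    intro p hp
    have : S p = h p p * h p p := by
      refine Finset.sum_eq_single p (fun p' hp' hne => ?_) fun hn =>
        absurd (hP.mem_toFinset.2 hp) hn
      rw [(hh p' (hP.mem_toFinset.1 hp')).2.2.1 p hp hne.symm, mul_zero]
    rw [this]
    exact mul_ne_zero (hh p hp).2.1 (hh p hp).2.1
  refine ⟨hP.toFinset, h, fun p q => h p q * (S q)⁻¹, fun p i q => g p i q * (S q)⁻¹,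
    fun p hp => hP.mem_toFinset.1 hp, eventually_nhds_symPow fun p hp => ?_⟩
  filter_upwards [(hc p hp).eventually, (hasInverses_pow n S p (hS p (hc p hp)) (hS0 p hp)).1]
    with q hq hSq
  have hinv := (hasInverses_pow n S q (hS q hq) hSq).2
  refine ⟨hq, ?_, fun p' hp' => ?_⟩
  · simp only [← mul_assoc, ← Finset.sum_mul]
    exact mul_inv_cancel₀ hSq
  · have hp' := hP.mem_toFinset.1 hp'
    refine ⟨hreg p' hp' q hq, (hreg p' hp' q hq).mul hinv, fun i =>
      ⟨(isRegularAt_of_mem_polyAlg (hg p' i hp').1 hq).mul hinv, ?_⟩, fun h0 => ?_,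
      (hh p' hp').2.2.2.1 q hq⟩
    · rw [(hg p' i hp').2 q hq]
      ring
    · rw [h0, zero_mul]

end Gluing

section LiftGluing

variable {X : Type} {m : ℕ} {F : Pow X (m + 3) → ℂ}

/-- The average over the permutations of `4, …, n` of the symmetrisation in the second and the third
variable. -/
def symmetrize (F : Pow X (m + 3) → ℂ) (q : Pow X (m + 3)) : ℂ :=
  (Fintype.card (Equiv.Perm (Fin m)) : ℂ)⁻¹ *
    ∑ σ : Equiv.Perm (Fin m), (F (permPow σ q) + F (permPow σ (swapPow q)))

theorem symmetrize_swapPow (q : Pow X (m + 3)) : symmetrize F (swapPow q) = symmetrize F q := by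
  simp only [symmetrize, swapPow_swapPow, add_comm]

theorem permPow_permPow (σ τ : Equiv.Perm (Fin m)) (q : Pow X (m + 3)) :
    permPow τ (permPow σ q) = permPow (σ * τ) q := rfl

theorem swapPow_permPow (σ : Equiv.Perm (Fin m)) (q : Pow X (m + 3)) :
    swapPow (permPow σ q) = permPow σ (swapPow q) := rfl

theorem symmetrize_permPow (σ : Equiv.Perm (Fin m)) (q : Pow X (m + 3)) :
    symmetrize F (permPow σ q) = symmetrize F q := by
  have h : ∀ τ, F (permPow τ (permPow σ q)) + F (permPow τ (swapPow (permPow σ q))) =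
      F (permPow (σ * τ) q) + F (permPow (σ * τ) (swapPow q)) := fun τ => by
    rw [permPow_permPow, swapPow_permPow, permPow_permPow]
  rw [symmetrize, symmetrize, Finset.sum_congr rfl fun τ _ => h τ,
    Fintype.sum_equiv (Equiv.mulLeft σ)
      (fun τ => F (permPow (σ * τ) q) + F (permPow (σ * τ) (swapPow q)))
      (fun τ => F (permPow τ q) + F (permPow τ (swapPow q))) fun τ => rfl]

variable [FunctionSpace X] {D : ∀ q : Pow X (m + 3), CotSpace (q 0)}

theorem exists_chart_fibre (hXq : IsQuasiProjective X) {n : ℕ} (t : SymPow X n) :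
    ∃ c : Chart X, ∀ p : Pow X n, toSym p = t → InChart c n p := by
  obtain ⟨c, hc⟩ := exists_chart hXq
    ((finite_toSym_fibre (X := X) t).biUnion fun p _ => Set.finite_range (p : Fin n → X))
  exact ⟨c, fun p hp i => hc (Set.mem_biUnion (show p ∈ {p | toSym p = t} from hp) ⟨i, rfl⟩)⟩

/-- A property of the points of the fibres near `t` holds near these points. -/
theorem eventually_eventually_symPow {n : ℕ} {t : SymPow X n} {C : Pow X n → Prop}
    (h : ∀ᶠ t' in 𝓝 t, ∀ q, toSym q = t' → C q) :
    ∀ᶠ t' in 𝓝 t, ∀ q, toSym q = t' → C q ∧ ∀ᶠ q' in 𝓝 q, C q' := by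
  filter_upwards [h.eventually_nhds, h] with t' h1 h2 q hq
  refine ⟨h2 q hq, ?_⟩
  subst hq
  filter_upwards [continuous_toSym.continuousAt.eventually h1] with q' hq'
  exact hq' q' rfl

/-- Local lifts at the points of a fibre `{p}` are glued to `∑ a_p b_p f_p`. As the lifts `f_p` vanish
on the diagonals, the differential of this sum is the combination of those of the `f_p` with
coefficients `a_p b_p`, whose sum is `1`. -/
theorem exists_isLift (hX : HasInverses X) (hXq : IsQuasiProjective X) {t : SymPow X (m + 3)}
    (h : ∀ p, toSym p = t → ∃ F, ∀ᶠ q in 𝓝 p, IsLift D F q) :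
    ∃ F, ∀ᶠ t' in 𝓝 t, ∀ q, toSym q = t' → IsLift D F q := by
  obtain ⟨c, hc⟩ := exists_chart_fibre hXq t
  have h' : ∀ p, ∃ F, toSym p = t → ∀ᶠ q in 𝓝 p, IsLift D F q := by
    intro p
    by_cases hp : toSym p = t
    · obtain ⟨F, hF⟩ := h p hp
      exact ⟨F, fun _ => hF⟩
    · exact ⟨0, fun e => absurd e hp⟩
  choose f hf using h'
  obtain ⟨P, a, b, k, hP, hev⟩ := exists_partition (c := c) hc (ι := Unit)
    (O := fun p => {q | IsLift D (f p) q}) hf (f := fun p _ => f p)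
    fun p hp _ => (hf p hp).self_of_nhds.regular
  refine ⟨fun q => ∑ p ∈ P, a p q * k p () q, ?_⟩
  filter_upwards [eventually_eventually_symPow hev] with t' ht' q hq
  obtain ⟨⟨-, hsum, hq⟩, hnear⟩ := ht' q hq
  -- Leibniz' rule for the restriction along `φ`: where `f p` vanishes only its own
  -- differential survives; where `a p` vanishes `b p` does too
  have hk : ∀ p ∈ P, ∀ φ : X → Pow X (m + 3), φ (q 0) = q → IsMorphismAt φ (q 0) → f p q = 0 ∨ a p q = 0 →
      dAt (fun y => a p (φ y) * k p () (φ y)) (q 0) =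
        (a p q * b p q) • dAt (fun y => f p (φ y)) (q 0) ∨ a p q = 0 ∧
      dAt (fun y => a p (φ y) * k p () (φ y)) (q 0) = 0 := by
    intro p hp φ hφ hφm h0
    obtain ⟨ha, hb, hk, hab, hO⟩ := hq p hp
    have hmor : ∀ g, IsRegularAt g q → IsRegularAt (fun y => g (φ y)) (q 0) :=
      fun g hg => hφm.comp g (hφ.symm ▸ hg)
    have e1 := dAt_mul (hmor _ ha) (hmor _ (hk ()).1)
    simp only [hφ] at e1
    by_cases hz : a p q = 0
    · right
      refine ⟨hz, ?_⟩
      rw [e1, (hk ()).2, hab hz, hz, zero_mul, zero_smul, zero_smul, add_zero]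
    · left
      have hf0 := h0.resolve_right hz
      have e2 : (fun y => k p () (φ y)) =ᶠ[𝓝 (q 0)] fun y => b p (φ y) * f p (φ y) := by
        filter_upwards [hφm.continuousAt.eventually (hφ.symm ▸ hnear)] with y hy
        exact ((hy.2.2 p hp).2.2.1 ()).2
      have e3 := dAt_mul (hmor _ hb) (hmor _ (hO hz).regular)
      simp only [hφ] at e3
      rw [e1, (hk ()).2, hf0, mul_zero, zero_smul, zero_add, dAt_congr e2, e3, hf0, zero_smul,
        zero_add, mul_smul]
  refine ⟨IsRegularAt.sum _ fun p hp => (hq p hp).1.mul ((hq p hp).2.2.1 ()).1, fun hz => ?_,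
    fun h => ?_, fun h => ?_⟩
  · refine Finset.sum_eq_zero fun p hp => ?_
    obtain ⟨ha, hb, hk, hab, hO⟩ := hq p hp
    by_cases h0 : a p q = 0
    · rw [h0, zero_mul]
    · rw [(hk ()).2, (hO h0).zero hz, mul_zero, mul_zero]
  · have hreg : ∀ g, IsRegularAt g q →
        IsRegularAt (fun y => g (Triple.toPow ⟨q 0, y, q 2, tail q⟩)) (q 0) :=
      fun g hg => hg.second hX h
    rw [dAt_sum _ fun p hp => hreg _ ((hq p hp).1.mul ((hq p hp).2.2.1 ()).1)]
    have e : D q = ∑ p ∈ P, (a p q * b p q) • D q := by rw [← Finset.sum_smul, hsum, one_smul]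
    rw [e]
    refine Finset.sum_congr rfl fun p hp => ?_
    obtain ⟨ha, hb, -, hab, hO⟩ := hq p hp
    have h0 : f p q = 0 ∨ a p q = 0 := by
      by_cases h0 : a p q = 0
      exacts [Or.inr h0, Or.inl ((hO h0).zero (Or.inl h))]
    rcases hk p hp (fun y => Triple.toPow ⟨q 0, y, q 2, tail q⟩) (toPow_second h)
      (isMorphismAt_second hX _ _ _ _) h0 with h1 | ⟨h1, h2⟩
    · by_cases h2 : a p q = 0
      · rw [h1, h2, zero_mul, zero_smul, zero_smul]
      · rw [h1, (hO h2).d₂ h]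
    · rw [h2, h1, zero_mul, zero_smul]
  · have hreg : ∀ g, IsRegularAt g q →
        IsRegularAt (fun y => g (Triple.toPow ⟨q 0, q 1, y, tail q⟩)) (q 0) :=
      fun g hg => hg.third hX h
    rw [dAt_sum _ fun p hp => hreg _ ((hq p hp).1.mul ((hq p hp).2.2.1 ()).1)]
    refine Finset.sum_eq_zero fun p hp => ?_
    obtain ⟨ha, hb, -, hab, hO⟩ := hq p hp
    have h0 : f p q = 0 ∨ a p q = 0 := by
      by_cases h0 : a p q = 0
      exacts [Or.inr h0, Or.inl ((hO h0).zero (Or.inr (Or.inl h)))]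
    rcases hk p hp (fun y => Triple.toPow ⟨q 0, q 1, y, tail q⟩) (toPow_third h)
      (isMorphismAt_third hX _ _ _ _) h0 with h1 | ⟨h1, h2⟩
    · by_cases h2 : a p q = 0
      · rw [h1, h2, zero_mul, zero_smul]
      · rw [h1, (hO h2).d₃ h, smul_zero]
    · exact h2

/-- The symmetrisation has differential `D` along `Δ₁₂`: the two terms of the symmetrisation
contribute the differential in the second and in the third variable. -/
theorem isLift_symmetrize (hX : HasInverses X) {q : Pow X (m + 3)}
    (h : ∀ q', toSym q' = toSym q → IsLift D F q')
    (hD : q 0 = q 1 → ∀ σ, D (permPow σ q) = D q) :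
    IsRegularAt (symmetrize F) q ∧
      (q 0 = q 1 ∨ q 0 = q 2 ∨ q 1 = q 2 → symmetrize F q = 0) ∧
      (q 0 = q 1 →
        dAt (fun y => symmetrize F (Triple.toPow ⟨q 0, y, q 2, tail q⟩)) (q 0) = D q) := by
  have h1 : ∀ σ, IsLift D F (permPow σ q) := fun σ => h _ (toSym_permPow σ q)
  have h2 : ∀ σ, IsLift D F (permPow σ (swapPow q)) := fun σ =>
    h _ ((toSym_permPow σ _).trans (toSym_swapPow q))
  have hr1 : ∀ σ, IsRegularAt (fun q => F (permPow σ q)) q := fun σ =>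
    (isMorphismAt_permPow σ q).comp F (h1 σ).regular
  have hr2 : ∀ σ, IsRegularAt (fun q => F (permPow σ (swapPow q))) q := fun σ =>
    ((isMorphismAt_permPow σ _).trans (isMorphismAt_swapPow q)).comp F (h2 σ).regular
  refine ⟨IsRegularAt.const_mul _ (IsRegularAt.sum _ fun σ _ => (hr1 σ).add (hr2 σ)), fun h0 => ?_, fun h0 => ?_⟩
  · have h0' : q 0 = q 2 ∨ q 0 = q 1 ∨ q 2 = q 1 := by
      rcases h0 with h0 | h0 | h0
      exacts [Or.inr (Or.inl h0), Or.inl h0, Or.inr (Or.inr h0.symm)]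
    rw [symmetrize, Finset.sum_eq_zero, mul_zero]
    intro σ _
    rw [(h1 σ).zero h0, (h2 σ).zero h0', add_zero]
  · have e1 : ∀ σ, dAt (fun y => F (permPow σ (Triple.toPow ⟨q 0, y, q 2, tail q⟩))) (q 0) =
        D q := fun σ => ((h1 σ).d₂ h0).trans (hD h0 σ)
    have e2 : ∀ σ, dAt (fun y => F (permPow σ (swapPow (Triple.toPow ⟨q 0, y, q 2, tail q⟩))))
        (q 0) = 0 := fun σ => (h2 σ).d₃ h0
    have r1 : ∀ σ, IsRegularAt (fun y => F (permPow σ (Triple.toPow ⟨q 0, y, q 2, tail q⟩)))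
        (q 0) := fun σ =>
      IsRegularAt.second (F := fun q => F (permPow σ q)) hX h0 (hr1 σ)
    have r2 : ∀ σ, IsRegularAt (fun y => F (permPow σ (swapPow
        (Triple.toPow ⟨q 0, y, q 2, tail q⟩)))) (q 0) := fun σ =>
      IsRegularAt.second (F := fun q => F (permPow σ (swapPow q))) hX h0 (hr2 σ)
    have e3 : ∀ σ, dAt (fun y => F (permPow σ (Triple.toPow ⟨q 0, y, q 2, tail q⟩)) +
        F (permPow σ (swapPow (Triple.toPow ⟨q 0, y, q 2, tail q⟩)))) (q 0) = D q := fun σ => by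
      rw [dAt_add (r1 σ) (r2 σ), e1, e2, add_zero]
    simp only [symmetrize]
    rw [dAt_const_mul _ (IsRegularAt.sum _ fun σ _ => (r1 σ).add (r2 σ)),
      dAt_sum _ fun σ _ => (r1 σ).add (r2 σ)]
    simp only [e3, Finset.sum_const, Finset.card_univ]
    rw [← Nat.cast_smul_eq_nsmul ℂ, smul_smul, inv_mul_cancel₀ card_perm_ne_zero, one_smul]

end LiftGluing

/-! ### Sections of `𝓛^{2,1,1}(-lΔ)` in a frame -/

theorem smul_tmul_four {M₁ M₂ M₃ M₄ : Type*} [AddCommGroup M₁] [AddCommGroup M₂] [AddCommGroup M₃]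
    [AddCommGroup M₄] [Module ℂ M₁] [Module ℂ M₂] [Module ℂ M₃] [Module ℂ M₄] (A B C D : ℂ)
    (a : M₁) (b : M₂) (c : M₃) (d : M₄) :
    ((A • a) ⊗ₜ[ℂ] (B • b)) ⊗ₜ[ℂ] ((C • c) ⊗ₜ[ℂ] (D • d)) =
      (A * B * (C * D)) • ((a ⊗ₜ b) ⊗ₜ (c ⊗ₜ d)) := by
  simp only [TensorProduct.smul_tmul_smul]

section SectionsL

variable {X : Type} [FunctionSpace X] {L : LineBundle X} {m l : ℕ} {e : ∀ x, L.Fib x}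
  {U : Opens (SymPow X (m + 3))}

theorem IsFrameAt.eventually (hX : HasInverses X) {x : X} (h : IsFrameAt L e x) :
    ∀ᶠ y in 𝓝 x, IsFrameAt L e y := eventually_isFrameAt hX h.isRegularSectionAt h.1

/-- The frame `e²(x₁) e(x₂) e(x₃)` of `L^{(2,1,1)}`. -/
def frameL (e : ∀ x, L.Fib x) (q : Triple X m) : FibL L m q :=
  (e q.x₁ ⊗ₜ e q.x₁) ⊗ₜ (e q.x₂ ⊗ₜ e q.x₃)

theorem frameL_ne_zero {q : Triple X m} (h₁ : e q.x₁ ≠ 0) (h₂ : e q.x₂ ≠ 0) (h₃ : e q.x₃ ≠ 0) :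
    frameL e q ≠ 0 :=
  tmul_ne_zero_of_ne_zero (tmul_ne_zero_of_ne_zero h₁ h₁) (tmul_ne_zero_of_ne_zero h₂ h₃)

/-- The section `e` is a frame near the first three points of `q`. -/
def IsFrame₃ (e : ∀ x, L.Fib x) (q : Triple X m) : Prop :=
  IsFrameAt L e q.x₁ ∧ IsFrameAt L e q.x₂ ∧ IsFrameAt L e q.x₃

theorem IsFrame₃.ne_zero {q : Triple X m} (h : IsFrame₃ e q) : frameL e q ≠ 0 :=
  frameL_ne_zero h.1.1 h.2.1.1 h.2.2.1

theorem IsFrame₃.eventually (hX : HasInverses X) {p : Triple X m} (h : IsFrame₃ e p) :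
    ∀ᶠ q in 𝓝 p.toPow, IsFrame₃ e (Triple.ofPow q) := by
  filter_upwards [(isMorphismAt_proj 0 p.toPow).continuousAt.eventually (h.1.eventually hX),
    (isMorphismAt_proj 1 p.toPow).continuousAt.eventually (h.2.1.eventually hX),
    (isMorphismAt_proj 2 p.toPow).continuousAt.eventually (h.2.2.eventually hX)] with q h1 h2 h3
  exact ⟨h1, h2, h3⟩

/-- The coordinate of the section `s` of `L^{(2,1,1)}` with respect to the frame. -/
def coordL (e : ∀ x, L.Fib x) (s : ∀ p : {p : Triple X m // toSym p.toPow ∈ U}, FibL L m p.1)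
    (q : Pow X (m + 3)) : ℂ :=
  open Classical in
  if h : toSym (Triple.ofPow q).toPow ∈ U then
    unitDual (frameL e (Triple.ofPow q)) (s ⟨Triple.ofPow q, h⟩) else 0

theorem coordL_of_eq {s : ∀ p : {p : Triple X m // toSym p.toPow ∈ U}, FibL L m p.1}
    {p : Triple X m} (hp : IsFrame₃ e p) {h : toSym p.toPow ∈ U} {c : ℂ}
    (hs : s ⟨p, h⟩ = c • frameL e p) : coordL e s p.toPow = c := by
  have : coordL e s p.toPow = unitDual (frameL e p) (s ⟨p, h⟩) := dif_pos h
  rw [this, hs, map_smul, unitDual_self hp.ne_zero, smul_eq_mul, mul_one]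

/-- The local sections of `L^{(2,1,1)} ⊗ ⋂ I_{Δ_ij}^l` are the multiples of the frame by functions in
the ideal. -/
theorem exists_coord_of_mem_span_genL {p : Triple X m} (hp : IsFrame₃ e p)
    {t : ∀ q, FibL L m q} (ht : t ∈ Submodule.span ℂ (genL L m l p)) :
    ∃ F, InIdeal F p.toPow (tripleIdeal l p.toPow) ∧
      ∀ᶠ q in 𝓝 p.toPow, t (Triple.ofPow q) = F q • frameL e (Triple.ofPow q) := by
  induction ht using Submodule.span_induction with
  | mem t ht =>
    obtain ⟨f, a, b, c, d, hf, ha, hb, hc, hd, rfl⟩ := ht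
    obtain ⟨A, hA, eA⟩ := (hp.1.2 a).1 ha
    obtain ⟨B, hB, eB⟩ := (hp.1.2 b).1 hb
    obtain ⟨C, hC, eC⟩ := (hp.2.1.2 c).1 hc
    obtain ⟨D, hD, eD⟩ := (hp.2.2.2 d).1 hd
    have h0 := isMorphismAt_proj 0 p.toPow
    have h1 := isMorphismAt_proj 1 p.toPow
    have h2 := isMorphismAt_proj 2 p.toPow
    refine ⟨fun q => f q * (A (q 0) * B (q 0) * (C (q 1) * D (q 2))), hf.mul_right
      (((h0.comp A hA).mul (h0.comp B hB)).mul ((h1.comp C hC).mul (h2.comp D hD))), ?_⟩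
    filter_upwards [h0.continuousAt.eventually eA, h0.continuousAt.eventually eB,
      h1.continuousAt.eventually eC, h2.continuousAt.eventually eD] with q
      (eA : a (Triple.ofPow q).x₁ = A (q 0) • e (Triple.ofPow q).x₁)
      (eB : b (Triple.ofPow q).x₁ = B (q 0) • e (Triple.ofPow q).x₁)
      (eC : c (Triple.ofPow q).x₂ = C (q 1) • e (Triple.ofPow q).x₂)
      (eD : d (Triple.ofPow q).x₃ = D (q 2) • e (Triple.ofPow q).x₃)
    have h3 := congrArg f (Triple.toPow_ofPow q)
    generalize Triple.ofPow q = r at *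
    rw [eA, eB, eC, eD, smul_tmul_four, smul_smul, h3]
    rfl
  | zero => exact ⟨fun _ => 0, inIdeal_zero, Eventually.of_forall fun q => (zero_smul _ _).symm⟩
  | add t t' _ _ h h' =>
    obtain ⟨F, hF, e1⟩ := h
    obtain ⟨G, hG, e2⟩ := h'
    refine ⟨fun q => F q + G q, hF.add hG, ?_⟩
    filter_upwards [e1, e2] with q h1 h2
    rw [Pi.add_apply, h1, h2, add_smul]
  | smul c t _ h =>
    obtain ⟨F, hF, e1⟩ := h
    refine ⟨fun q => c * F q, hF.const_mul c, ?_⟩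
    filter_upwards [e1] with q h1
    rw [Pi.smul_apply, h1, mul_smul]

variable {s : ∀ p : {p : Triple X m // toSym p.toPow ∈ U}, FibL L m p.1}

/-- The coordinate of a section is in the ideal, and determines the section. -/
theorem coordL_spec (hX : HasInverses X)
    (hs : s ∈ localSec (fun p : Triple X m => toSym p.toPow)
      (fun p => comap Triple.toPow (𝓝 p.toPow)) (genL L m l) U)
    {p : Triple X m} (hpU : toSym p.toPow ∈ U) (hp : IsFrame₃ e p) :
    InIdeal (coordL e s) p.toPow (tripleIdeal l p.toPow) ∧
      s ⟨p, hpU⟩ = coordL e s p.toPow • frameL e p := by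
  obtain ⟨t, ht, h1⟩ := hs p hpU
  rw [comap_toPow_inf Triple.toPow p, eventually_comap_triple] at h1
  obtain ⟨F, hF, h2⟩ := exists_coord_of_mem_span_genL hp ht
  have h3 : ∀ᶠ q in 𝓝 p.toPow, F q = coordL e s q := by
    filter_upwards [h1, h2, hp.eventually hX, eventually_mem_opens hpU] with q h1 h2 h3 h4
    have h5 : toSym (Triple.ofPow q).toPow ∈ U := by rwa [Triple.toPow_ofPow]
    have h6 := coordL_of_eq (s := s) h3 (h := h5) ((h1 h5).trans h2)
    rw [Triple.toPow_ofPow] at h6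
    exact h6.symm
  refine ⟨hF.congr h3, ?_⟩
  have h4 := h1.self_of_nhds hpU
  have h5 := h2.self_of_nhds
  rw [h3.self_of_nhds] at h5
  exact h4.trans h5

/-- Multiples of frames by functions in the ideals are sections. -/
theorem mem_localSec_genL (h : ∀ p : Triple X m, toSym p.toPow ∈ U →
    ∃ (e : ∀ x, L.Fib x) (F : Pow X (m + 3) → ℂ), IsFrame₃ e p ∧
      InIdeal F p.toPow (tripleIdeal l p.toPow) ∧
        ∀ᶠ q in 𝓝 p.toPow, ∀ h, s ⟨Triple.ofPow q, h⟩ = F q • frameL e (Triple.ofPow q)) :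
    s ∈ localSec (fun p : Triple X m => toSym p.toPow)
      (fun p => comap Triple.toPow (𝓝 p.toPow)) (genL L m l) U := by
  intro p hp
  obtain ⟨e, F, h1, h2, h3⟩ := h p hp
  refine ⟨_, Submodule.subset_span ⟨F, e, e, e, e, h2, h1.1.isRegularSectionAt,
    h1.1.isRegularSectionAt, h1.2.1.isRegularSectionAt, h1.2.2.isRegularSectionAt, rfl⟩, ?_⟩
  rw [comap_toPow_inf Triple.toPow p, eventually_comap_triple]
  filter_upwards [h3] with q hq h
  rw [hq, Triple.toPow_ofPow]
  rfl

theorem mem_localSec_of_coordL (hX : HasInverses X)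
    (hs : s ∈ localSec (fun p : Triple X m => toSym p.toPow)
      (fun p => comap Triple.toPow (𝓝 p.toPow)) (genL L m 1) U)
    (hF : ∀ p : Triple X m, toSym p.toPow ∈ U → ∃ e : ∀ x, L.Fib x, IsFrame₃ e p ∧
      InIdeal (coordL e s) p.toPow (tripleIdeal l p.toPow)) :
    s ∈ localSec (fun p : Triple X m => toSym p.toPow)
      (fun p => comap Triple.toPow (𝓝 p.toPow)) (genL L m l) U := by
  refine mem_localSec_genL fun p hp => ?_
  obtain ⟨e, he, h⟩ := hF p hp
  refine ⟨e, coordL e s, he, h, ?_⟩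
  filter_upwards [he.eventually hX] with q hq h
  exact (coordL_spec hX hs h hq).2.trans
    (congrArg (fun q' => coordL e s q' • frameL e (Triple.ofPow q)) (Triple.toPow_ofPow q))

theorem coordL_permPow (hs : s ∈ invL L m U) (σ : Equiv.Perm (Fin m)) (q : Pow X (m + 3)) :
    coordL e s (permPow σ q) = coordL e s q := by
  by_cases h : toSym (Triple.ofPow q).toPow ∈ U
  · have h' : toSym (Triple.ofPow (permPow σ q)).toPow ∈ U := by
      rwa [Triple.toPow_ofPow, toSym_permPow, ← Triple.toPow_ofPow q]
    rw [coordL, coordL, dif_pos h, dif_pos h']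
    exact congrArg (unitDual (frameL e (Triple.ofPow q)))
      (hs.2 (q 0) (q 1) (q 2) (fun i => q i.succ.succ.succ) σ h h')
  · have h' : toSym (Triple.ofPow (permPow σ q)).toPow ∉ U := by
      rwa [Triple.toPow_ofPow, toSym_permPow, ← Triple.toPow_ofPow q]
    rw [coordL, coordL, dif_neg h, dif_neg h']

/-- The coordinate of an invariant section is symmetric in `x₂`, `x₃`, since the frame is. -/
theorem coordL_swapPow (hX : HasInverses X)
    (hs : s ∈ (localSec (fun p : Triple X m => toSym p.toPow)
      (fun p => comap Triple.toPow (𝓝 p.toPow)) (genL L m l) U ⊓ invL L m U))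
    {q : Pow X (m + 3)} (hq : toSym q ∈ U) (he : IsFrame₃ e (Triple.ofPow q)) :
    coordL e s (swapPow q) = coordL e s q := by
  have h : toSym (Triple.ofPow q).toPow ∈ U := by rwa [Triple.toPow_ofPow]
  have h' : toSym (Triple.toPow ⟨q 0, q 2, q 1, fun i => q i.succ.succ.succ⟩) ∈ U := by
    have := (toSym_swapPow q).symm ▸ hq
    exact this
  refine coordL_of_eq (p := ⟨q 0, q 2, q 1, fun i => q i.succ.succ.succ⟩) (h := h')
    ⟨he.1, he.2.2, he.2.1⟩ ?_
  have h1 := (coordL_spec hX hs.1 h he).2.trans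
    (congrArg (fun q' => coordL e s q' • frameL e (Triple.ofPow q)) (Triple.toPow_ofPow q))
  have h2 := hs.2.1 (q 0) (q 1) (q 2) (fun i => q i.succ.succ.succ) h h'
  exact (h2.trans (congrArg _ h1)).trans
    (LinearMap.map_smul _ (coordL e s q) (frameL e (Triple.ofPow q)))

end SectionsL

/-! ### The differential of a section -/

section SectionsK

variable {X : Type} [FunctionSpace X] {L : LineBundle X} {m l : ℕ} {e : ∀ x, L.Fib x}
  {U : Opens (SymPow X (m + 3))}

/-- The frame `e³(x) e(w)` of `L³_{12} ⊗ p₃^*L`. -/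
def frameK (e : ∀ x, L.Fib x) (q : DiagPt X m) :
    (L.Fib q.x ⊗[ℂ] L.Fib q.x) ⊗[ℂ] (L.Fib q.x ⊗[ℂ] L.Fib q.w) :=
  (e q.x ⊗ₜ e q.x) ⊗ₜ (e q.x ⊗ₜ e q.w)

/-- The section `e` is a frame near the points `x` and `w` of `(x, x, w, z)`. -/
def IsFrame₂ (e : ∀ x, L.Fib x) (q : DiagPt X m) : Prop := IsFrameAt L e q.x ∧ IsFrameAt L e q.w

theorem IsFrame₂.ne_zero {q : DiagPt X m} (h : IsFrame₂ e q) : frameK e q ≠ 0 :=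
  tmul_ne_zero_of_ne_zero (tmul_ne_zero_of_ne_zero h.1.1 h.1.1)
    (tmul_ne_zero_of_ne_zero h.1.1 h.2.1)

theorem IsFrame₂.isFrame₃ {q : DiagPt X m} (h : IsFrame₂ e q) :
    IsFrame₃ e (⟨q.x, q.x, q.w, q.z⟩ : Triple X m) := ⟨h.1, h.1, h.2⟩

theorem IsFrame₂.eventually (hX : HasInverses X) {p : DiagPt X m} (h : IsFrame₂ e p) :
    ∀ᶠ q in 𝓝 p.toPow, IsFrame₂ e (DiagPt.ofPow q) := by
  filter_upwards [(isMorphismAt_proj 0 p.toPow).continuousAt.eventually (h.1.eventually hX),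
    (isMorphismAt_proj 2 p.toPow).continuousAt.eventually (h.2.eventually hX)] with q h1 h2
  exact ⟨h1, h2⟩

theorem exists_isFrame₂ (hX : HasInverses X) (hXq : IsQuasiProjective X) (q : DiagPt X m) :
    ∃ e : ∀ x, L.Fib x, IsFrame₂ e q := by
  obtain ⟨e, he⟩ := exists_frame_of_finite (L := L) hX hXq (Set.toFinite {q.x, q.w})
  exact ⟨e, (he q.x (by simp)).self_of_nhds, (he q.w (by simp)).self_of_nhds⟩

variable (L) in
open Classical in
/-- A frame near the points `x` and `w` of `(x, x, w, z)`. -/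
def diagFrame (q : DiagPt X m) : ∀ y, L.Fib y :=
  if h : ∃ e : ∀ x, L.Fib x, IsFrame₂ e q then h.choose else 0

theorem isFrame₂_diagFrame (hX : HasInverses X) (hXq : IsQuasiProjective X) (q : DiagPt X m) :
    IsFrame₂ (diagFrame L q) q := by
  have h := exists_isFrame₂ (L := L) hX hXq q
  rw [diagFrame, dif_pos h]
  exact h.choose_spec

/-- The differential `d¹_Δ` on families: if `F` is the coordinate of `s` with respect to a frame,
the value at `(x, x, w, z)` is `d_x(F(x, ·, w, z))` times the frame. -/
def deltaFam (s : ∀ p : {p : Triple X m // toSym p.toPow ∈ U}, FibL L m p.1) :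
    ∀ p : {p : DiagPt X m // toSym p.toPow ∈ U}, FibK L m p.1 := fun p =>
  dAt (fun y => coordL (diagFrame L p.1) s (Triple.toPow ⟨p.1.x, y, p.1.w, p.1.z⟩)) p.1.x ⊗ₜ
    frameK (diagFrame L p.1) p.1

variable {s s' : ∀ p : {p : Triple X m // toSym p.toPow ∈ U}, FibL L m p.1}

/-- The value of `d¹_Δ` computed from an arbitrary local expression `∑ f_k a_k b_k c_k d_k`. The
coordinate in a frame differs from this by factors whose derivatives do not contribute, since the
`f_k` vanish on `Δ₁₂`. -/
theorem deltaFam_eq (hX : HasInverses X) (hXq : IsQuasiProjective X) {p : DiagPt X m}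
    (hp : toSym p.toPow ∈ U) {ι : Type} [Fintype ι] (f : ι → Pow X (m + 3) → ℂ)
    (a b c d : ι → ∀ y, L.Fib y)
    (hf : ∀ k, InIdeal (f k) p.toPow (diagIdeal 0 1 p.toPow))
    (hr : ∀ k, L.IsRegularSectionAt (a k) p.x ∧ L.IsRegularSectionAt (b k) p.x ∧
      L.IsRegularSectionAt (c k) p.x ∧ L.IsRegularSectionAt (d k) p.w)
    (hs : ∀ᶠ q : Triple X m in comap Triple.toPow (𝓝 p.toPow),
      ∀ hq : toSym q.toPow ∈ U, s ⟨q, hq⟩ =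
        ∑ k, f k q.toPow • ((a k q.x₁ ⊗ₜ b k q.x₁) ⊗ₜ (c k q.x₂ ⊗ₜ d k q.x₃))) :
    deltaFam s ⟨p, hp⟩ = ∑ k, dAt (fun y => f k (Triple.toPow ⟨p.x, y, p.w, p.z⟩)) p.x ⊗ₜ[ℂ]
      ((a k p.x ⊗ₜ[ℂ] b k p.x) ⊗ₜ[ℂ] (c k p.x ⊗ₜ[ℂ] d k p.w)) := by
  have he := isFrame₂_diagFrame (L := L) hX hXq p
  set e := diagFrame L p
  choose A hA eA using fun k => (he.1.2 (a k)).1 (hr k).1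
  choose B hB eB using fun k => (he.1.2 (b k)).1 (hr k).2.1
  choose C hC eC using fun k => (he.1.2 (c k)).1 (hr k).2.2.1
  choose D hD eD using fun k => (he.2.2 (d k)).1 (hr k).2.2.2
  let φ : X → Pow X (m + 3) := fun y => Triple.toPow ⟨p.x, y, p.w, p.z⟩
  have hφ : IsMorphismAt φ p.x := isMorphismAt_second hX _ _ _ _
  have h1 : (fun y => coordL e s (φ y)) =ᶠ[𝓝 p.x] fun y =>
      ∑ k, (A k p.x * B k p.x * D k p.w) * (f k (φ y) * C k y) := by
    rw [eventually_comap_triple] at hs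
    filter_upwards [hφ.continuousAt.eventually hs, hφ.continuousAt.eventually
      (eventually_mem_opens hp), eventually_all.2 eC, he.1.eventually hX] with y h1 h2 h3 h4
    refine coordL_of_eq (h := h2) ⟨he.1, h4, he.2⟩ ((h1 h2).trans ?_)
    rw [Finset.sum_smul]
    refine Finset.sum_congr rfl fun k _ => ?_
    change f k (φ y) • ((a k p.x ⊗ₜ[ℂ] b k p.x) ⊗ₜ[ℂ] (c k y ⊗ₜ[ℂ] d k p.w)) = _
    rw [(eA k).self_of_nhds, (eB k).self_of_nhds, h3 k, (eD k).self_of_nhds, smul_tmul_four,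
      smul_smul]
    refine congrArg (· • frameL e (⟨p.x, y, p.w, p.z⟩ : Triple X m)) ?_
    ring
  have hfr : ∀ k, IsRegularAt (fun y => f k (φ y)) p.x := fun k => hφ.comp _ (hf k).1
  change dAt (fun y => coordL e s (φ y)) p.x ⊗ₜ frameK e p = _
  rw [dAt_congr h1, dAt_sum _ fun k _ => IsRegularAt.const_mul _ ((hfr k).mul (hC k)),
    TensorProduct.sum_tmul]
  refine Finset.sum_congr rfl fun k _ => ?_
  have h0 : f k (φ p.x) = 0 := (inIdeal_diagIdeal.1 (hf k)).2.self_of_nhds rfl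
  rw [dAt_const_mul _ ((hfr k).mul (hC k)), dAt_mul (hfr k) (hC k), h0, zero_smul, add_zero,
    (eA k).self_of_nhds, (eB k).self_of_nhds, (eC k).self_of_nhds, (eD k).self_of_nhds,
    smul_tmul_four, smul_smul, TensorProduct.smul_tmul]
  refine congrArg (fun r : ℂ => dAt (fun y => f k (φ y)) p.x ⊗ₜ[ℂ] (r • frameK e p)) ?_
  ring

/-- The differential computed in an arbitrary frame. -/
theorem deltaFam_of_frame (hX : HasInverses X) (hXq : IsQuasiProjective X) {p : DiagPt X m}
    (hp : toSym p.toPow ∈ U) (he : IsFrame₂ e p)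
    (hs : s ∈ localSec (fun p : Triple X m => toSym p.toPow)
      (fun p => comap Triple.toPow (𝓝 p.toPow)) (genL L m 1) U) :
    deltaFam s ⟨p, hp⟩ =
      dAt (fun y => coordL e s (Triple.toPow ⟨p.x, y, p.w, p.z⟩)) p.x ⊗ₜ frameK e p := by
  have h1 := (coordL_spec hX hs (p := ⟨p.x, p.x, p.w, p.z⟩) hp he.isFrame₃).1
  rw [deltaFam_eq hX hXq hp (ι := Unit) (fun _ => coordL e s) (fun _ => e) (fun _ => e)
    (fun _ => e) (fun _ => e)]
  · simp only [Finset.univ_unique, Finset.sum_singleton]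
    rfl
  · intro _
    exact h1.mono (inf_le_left.trans (inf_le_left.trans (pow_one _).le))
  · intro _
    exact ⟨he.1.isRegularSectionAt, he.1.isRegularSectionAt, he.1.isRegularSectionAt,
      he.2.isRegularSectionAt⟩
  · rw [eventually_comap_triple]
    filter_upwards [IsFrame₃.eventually hX (p := ⟨p.x, p.x, p.w, p.z⟩) he.isFrame₃] with q hq h
    simp only [Finset.univ_unique, Finset.sum_singleton]
    exact (coordL_spec hX hs h hq).2

/-- Sums of products of functions in the ideal, differentials and the frame are sections. -/
theorem mem_localSec_genK {τ : ∀ p : {p : DiagPt X m // toSym p.toPow ∈ U}, FibK L m p.1}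
    (h : ∀ p : DiagPt X m, toSym p.toPow ∈ U → ∃ (ι : Type) (_ : Fintype ι)
      (f : ι → Pow X (m + 3) → ℂ) (α : ι → X → ℂ) (e : ∀ x, L.Fib x), IsFrame₂ e p ∧
        (∀ k, InIdeal (f k) p.toPow (diagIdeal 1 2 p.toPow ^ l)) ∧ (∀ k, IsRegularAt (α k) p.x) ∧
        ∀ᶠ q : DiagPt X m in comap DiagPt.toPow (𝓝 p.toPow), ∀ hq,
          τ ⟨q, hq⟩ = ∑ k, f k q.toPow • (dAt (α k) q.x ⊗ₜ frameK e q)) :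
    τ ∈ localSec (fun p : DiagPt X m => toSym p.toPow)
      (fun p => comap DiagPt.toPow (𝓝 p.toPow)) (genK L m l) U := by
  intro p hp
  obtain ⟨ι, _, f, α, e, he, hf, hα, hτ⟩ := h p hp
  refine ⟨∑ k, fun q => f k q.toPow • (dAt (α k) q.x ⊗ₜ frameK e q),
    Submodule.sum_mem _ fun k _ => Submodule.subset_span ⟨f k, α k, e, e, e, e, hf k, hα k,
      he.1.isRegularSectionAt, he.1.isRegularSectionAt, he.1.isRegularSectionAt,
      he.2.isRegularSectionAt, rfl⟩, ?_⟩
  rw [comap_toPow_inf DiagPt.toPow p]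
  filter_upwards [hτ] with q hq h
  rw [hq h, Finset.sum_apply]

variable {u : Fin 2 → X → ℂ} {F : Pow X (m + 3) → ℂ} {p : Pow X (m + 3)}

/-- A function which vanishes on `Δ₁₂`, `Δ₂₃` and is symmetric in the second and the third variable
is a combination of the `u i (x₂) - u i (x₁)` with coefficients in the square of the ideal of
`Δ₂₃`. -/
theorem exists_factor_of_swap (hX : HasInverses X) (hXq : IsQuasiProjective X) (h01 : p 0 = p 1)
    (hu : IsParamAt u (p 0)) (hF : IsRegularAt F p)
    (h0 : ∀ᶠ q in 𝓝 p, q 0 = q 1 ∨ q 1 = q 2 → F q = 0)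
    (hs : ∀ᶠ q in 𝓝 p, F (swapPow q) = F q) :
    ∃ K : Fin 2 → Pow X (m + 3) → ℂ, (∀ i, InIdeal (K i) p (diagIdeal 1 2 p ^ 2)) ∧
      F =ᶠ[𝓝 p] fun q => ∑ i, K i q * coordDiff u 0 1 i q := by
  have h0' : ∀ᶠ q in 𝓝 p, q 0 = q 1 → F q = 0 := h0.mono fun q h h' => h (Or.inl h')
  by_cases h12 : p 1 = p 2
  · have hu1 : IsParamAt u (p 1) := h01 ▸ hu
    have hu2 : ∀ k, IsRegularAt (u k) (p 2) := h12 ▸ hu1.1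
    obtain ⟨R, hR, eR⟩ := exists_factor hX hXq h01 h12 hu h0'
      (inIdeal_sq_of_swap hX hXq h12 hu1 hF (h0.mono fun q h h' => h (Or.inr h')) hs)
    refine ⟨fun i q => ∑ j, ∑ k, coordDiff u 1 2 j q * coordDiff u 1 2 k q * R i j k q,
      fun i => InIdeal.sum _ fun j _ => InIdeal.sum _ fun k _ => InIdeal.mul_right ?_ (hR i j k),
      eR.trans (Eventually.of_forall fun q => ?_)⟩
    · rw [pow_two]
      exact (inIdeal_coordDiff hu1.1 hu2 j).mul (inIdeal_coordDiff hu1.1 hu2 k)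
    · simp only [Fin.sum_univ_two]
      ring
  · obtain ⟨K, hK, eK⟩ := inSpan_diag hX hXq h01 hu hF h0'
    exact ⟨K, fun i => (inIdeal_diagIdeal_pow_of_ne hXq h12 2).2 (hK i), eK⟩

theorem deltaFam_of_factor (hX : HasInverses X) (hXq : IsQuasiProjective X) {p : DiagPt X m}
    (hp : toSym p.toPow ∈ U) (he : IsFrame₂ e p)
    (hs : s ∈ localSec (fun p : Triple X m => toSym p.toPow)
      (fun p => comap Triple.toPow (𝓝 p.toPow)) (genL L m 1) U)
    (hu : IsParamAt u p.x) {K : Fin 2 → Pow X (m + 3) → ℂ} (hK : ∀ i, IsRegularAt (K i) p.toPow)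
    (e1 : coordL e s =ᶠ[𝓝 p.toPow] fun q => ∑ i, K i q * coordDiff u 0 1 i q) :
    deltaFam s ⟨p, hp⟩ = ∑ i, K i p.toPow • (dAt (u i) p.x ⊗ₜ frameK e p) := by
  have hφ : IsMorphismAt (fun y => Triple.toPow ⟨p.x, y, p.w, p.z⟩) p.x :=
    isMorphismAt_second hX _ _ _ _
  rw [deltaFam_of_frame hX hXq hp he hs, dAt_congr (hφ.continuousAt.eventually e1)]
  have h1 := hu.dAt_sum_mul (g := fun i y => K i (Triple.toPow ⟨p.x, y, p.w, p.z⟩))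
    fun i => hφ.comp _ (hK i)
  refine (congrArg (· ⊗ₜ[ℂ] frameK e p) h1).trans ?_
  rw [TensorProduct.sum_tmul]
  rfl

theorem eventually_coordL_eq_zero (hX : HasInverses X)
    (hs : s ∈ localSec (fun p : Triple X m => toSym p.toPow)
      (fun p => comap Triple.toPow (𝓝 p.toPow)) (genL L m 1) U) {p : Triple X m}
    (hp : toSym p.toPow ∈ U) (he : IsFrame₃ e p) : IsRegularAt (coordL e s) p.toPow ∧
      ∀ᶠ q in 𝓝 p.toPow, q 0 = q 1 ∨ q 0 = q 2 ∨ q 1 = q 2 → coordL e s q = 0 := by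
  obtain ⟨h, -⟩ := coordL_spec hX hs hp he
  simp only [tripleIdeal, pow_one, inIdeal_inf, inIdeal_diagIdeal] at h
  refine ⟨h.1.1.1, ?_⟩
  filter_upwards [h.1.1.2, h.1.2.2, h.2.2] with q h1 h2 h3
  rintro (h | h | h)
  exacts [h1 h, h2 h, h3 h]

theorem exists_factor_coordL (hX : HasInverses X) (hXq : IsQuasiProjective X) {p : DiagPt X m}
    (hp : toSym p.toPow ∈ U) (he : IsFrame₂ e p)
    (hs : s ∈ (localSec (fun p : Triple X m => toSym p.toPow)
      (fun p => comap Triple.toPow (𝓝 p.toPow)) (genL L m 1) U ⊓ invL L m U))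
    (hu : IsParamAt u p.x) : ∃ K : Fin 2 → Pow X (m + 3) → ℂ,
      (∀ i, InIdeal (K i) p.toPow (diagIdeal 1 2 p.toPow ^ 2)) ∧
      coordL e s =ᶠ[𝓝 p.toPow] fun q => ∑ i, K i q * coordDiff u 0 1 i q := by
  obtain ⟨h1, h2⟩ := eventually_coordL_eq_zero hX hs.1 (p := ⟨p.x, p.x, p.w, p.z⟩) hp he.isFrame₃
  refine exists_factor_of_swap hX hXq rfl hu h1 (h2.mono fun q h h' => h ?_) ?_
  · rcases h' with h' | h'
    exacts [Or.inl h', Or.inr (Or.inr h')]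
  · filter_upwards [eventually_mem_opens hp,
      IsFrame₃.eventually hX (p := ⟨p.x, p.x, p.w, p.z⟩) he.isFrame₃] with q h3 h4
    exact coordL_swapPow hX hs h3 h4

/-- The differential in terms of the factors `K_i` of the coordinate function. -/
theorem exists_deltaFam_eq (hX : HasInverses X) (hXq : IsQuasiProjective X) {p : DiagPt X m}
    (hp : toSym p.toPow ∈ U) (he : IsFrame₂ e p)
    (hs : s ∈ (localSec (fun p : Triple X m => toSym p.toPow)
      (fun p => comap Triple.toPow (𝓝 p.toPow)) (genL L m 1) U ⊓ invL L m U))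
    (hu : IsParamAt u p.x) : ∃ K : Fin 2 → Pow X (m + 3) → ℂ,
      (∀ i, InIdeal (K i) p.toPow (diagIdeal 1 2 p.toPow ^ 2)) ∧
      (coordL e s =ᶠ[𝓝 p.toPow] fun q => ∑ i, K i q * coordDiff u 0 1 i q) ∧
      ∀ᶠ q : DiagPt X m in comap DiagPt.toPow (𝓝 p.toPow), ∀ hq,
        deltaFam s ⟨q, hq⟩ = ∑ i, K i q.toPow • (dAt (u i) q.x ⊗ₜ frameK e q) := by
  obtain ⟨K, hK, e1⟩ := exists_factor_coordL hX hXq hp he hs hu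
  refine ⟨K, hK, e1, ?_⟩
  rw [eventually_comap_diag]
  filter_upwards [e1.eventually_nhds, he.eventually hX,
    eventually_all.2 fun i => (hK i).1.eventually, (isMorphismAt_proj 0
      p.toPow).continuousAt.eventually (hu.eventually hX hXq)] with q h1 h2 h3 h4 h5 h6
  have h7 := DiagPt.toPow_ofPow h5
  exact deltaFam_of_factor hX hXq h6 h2 hs.1 h4 (h7.symm ▸ h3) (h7.symm ▸ h1)

theorem deltaFam_mem (hX : HasInverses X) (hXq : IsQuasiProjective X) (hXs : IsSmoothSurface X)
    (hs : s ∈ (sheafL L m 1).sec U) : deltaFam s ∈ (sheafK L m 2).sec U := by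
  refine ⟨mem_localSec_genK fun p hp => ?_, fun x w z σ h h' => ?_⟩
  · obtain ⟨e, he⟩ := exists_isFrame₂ (L := L) hX hXq p
    obtain ⟨c, hc⟩ := exists_chart hXq (Set.finite_singleton p.x)
    obtain ⟨u, -, hu⟩ := exists_isParamAt hXs (hc rfl)
    obtain ⟨K, hK, -, e1⟩ := exists_deltaFam_eq hX hXq hp he hs hu
    exact ⟨Fin 2, inferInstance, K, u, e, he, hK, hu.1, e1⟩
  · have he := isFrame₂_diagFrame (L := L) hX hXq ⟨x, w, z⟩
    rw [deltaFam_of_frame hX hXq h he hs.1, deltaFam_of_frame hX hXq h' (e := diagFrame L ⟨x, w, z⟩)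
      he hs.1]
    refine congrArg (· ⊗ₜ[ℂ] frameK (diagFrame L ⟨x, w, z⟩) ⟨x, w, z⟩)
      (congrArg (dAt · x) (funext fun y => ?_))
    exact coordL_permPow hs.2 σ (Triple.toPow ⟨x, y, w, z⟩)

end SectionsK

/-! ### The inclusion and exactness at `𝓛^{2,1,1}(-Δ)` -/

section Inclusion

variable {S : Type} [FunctionSpace S] {Pt : Type} {proj : Pt → S} {Fib : Pt → Type}
  [∀ p, AddCommGroup (Fib p)] [∀ p, Module ℂ (Fib p)]
  (sec₁ sec₂ : ∀ U : Opens S, Submodule ℂ (∀ p : {p // proj p ∈ U}, Fib p.1))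
  (r₁ : ∀ {U V : Opens S} (h : V ≤ U), ∀ s ∈ sec₁ U, restrictFamily h s ∈ sec₁ V)
  (g₁ : ∀ (U : Opens S) (s : ∀ p : {p // proj p ∈ U}, Fib p.1),
    (∀ t ∈ U, ∃ (V : Opens S) (h : V ≤ U), t ∈ V ∧ restrictFamily h s ∈ sec₁ V) → s ∈ sec₁ U)
  (r₂ : ∀ {U V : Opens S} (h : V ≤ U), ∀ s ∈ sec₂ U, restrictFamily h s ∈ sec₂ V)
  (g₂ : ∀ (U : Opens S) (s : ∀ p : {p // proj p ∈ U}, Fib p.1),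
    (∀ t ∈ U, ∃ (V : Opens S) (h : V ≤ U), t ∈ V ∧ restrictFamily h s ∈ sec₂ V) → s ∈ sec₂ U)
  (h : ∀ U, ∀ s ∈ sec₁ U, s ∈ sec₂ U)

/-- The inclusion of two sheaves of families in the same fibres. -/
def homOfLE : SectionSheaf.Hom
    { Pt := Pt, proj := proj, Fib := Fib, sec := sec₁, res_mem := r₁, glue := g₁ }
    { Pt := Pt, proj := proj, Fib := Fib, sec := sec₂, res_mem := r₂, glue := g₂ } where
  app U :=
    { toFun s := ⟨s.1, h U s.1 s.2⟩
      map_add' _ _ := rfl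
      map_smul' _ _ := rfl }
  app_res _ _ := rfl
  app_smul _ _ _ _ _ h := h

theorem homOfLE_app {U : Opens S} (s : sec₁ U) :
    ((homOfLE sec₁ sec₂ r₁ g₁ r₂ g₂ h).app U s).1 = s.1 := rfl

theorem homOfLE_isInjective : (homOfLE sec₁ sec₂ r₁ g₁ r₂ g₂ h).IsInjective :=
  fun U _ _ e => Subtype.ext (congrArg (fun t : sec₂ U => t.1) e)

theorem homOfLE_locallyInImage {U : Opens S} (s : sec₂ U) :
    (homOfLE sec₁ sec₂ r₁ g₁ r₂ g₂ h).LocallyInImage s ↔ ∀ t ∈ U, ∃ (V : Opens S) (hVU : V ≤ U),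
      t ∈ V ∧ restrictFamily hVU s.1 ∈ sec₁ V := by
  refine forall₂_congr fun t _ => exists_congr fun V => exists_congr fun hVU =>
    and_congr_right fun _ => ⟨?_, fun hs => ⟨⟨_, hs⟩, rfl⟩⟩
  rintro ⟨r, hr⟩
  have h2 : r.1 = restrictFamily hVU s.1 := congrArg Subtype.val hr
  exact h2 ▸ r.2

end Inclusion

section Kernel

variable {X : Type} [FunctionSpace X] {L : LineBundle X} {m l : ℕ} {e : ∀ x, L.Fib x}
  {U V : Opens (SymPow X (m + 3))}
  {s s' : ∀ p : {p : Triple X m // toSym p.toPow ∈ U}, FibL L m p.1}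

theorem mem_sec_one_of_mem_sec_two (hs : s ∈ (sheafL L m 2).sec U) :
    s ∈ (sheafL L m 1).sec U := by
  obtain ⟨h1, h2⟩ := hs
  refine ⟨fun p hp => ?_, h2⟩
  obtain ⟨t, ht, e⟩ := h1 p hp
  refine ⟨t, Submodule.span_mono ?_ ht, e⟩
  rintro _ ⟨f, a, b, c, d, hf, h⟩
  have hle : ∀ J : Ideal (stalk p.toPow), J ^ 2 ≤ J ^ 1 := fun J =>
    Ideal.pow_le_pow_right one_le_two
  exact ⟨f, a, b, c, d, hf.mono (inf_le_inf (inf_le_inf (hle _) (hle _)) (hle _)), h⟩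

variable (L m) in
/-- The inclusion `𝓛^{2,1,1}(-2Δ) ⊆ 𝓛^{2,1,1}(-Δ)`. -/
def inclusionHom : SectionSheaf.Hom (sheafL L m 2) (sheafL L m 1) :=
  homOfLE (fun U => (sheafL L m 2).sec U) (fun U => (sheafL L m 1).sec U)
    (sheafL L m 2).res_mem (sheafL L m 2).glue (sheafL L m 1).res_mem (sheafL L m 1).glue
    fun _ _ => mem_sec_one_of_mem_sec_two

theorem inclusionHom_locallyInImage (s : (sheafL L m 1).sec U) :
    (inclusionHom L m).LocallyInImage s ↔ ∀ t ∈ U, ∃ (V : Opens (SymPow X (m + 3))) (hVU : V ≤ U),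
      t ∈ V ∧ restrictFamily (Fib := FibL L m) hVU s.1 ∈ (sheafL L m 2).sec V :=
  homOfLE_locallyInImage (fun U => (sheafL L m 2).sec U) (fun U => (sheafL L m 1).sec U)
    (sheafL L m 2).res_mem (sheafL L m 2).glue (sheafL L m 1).res_mem (sheafL L m 1).glue
    (fun _ _ => mem_sec_one_of_mem_sec_two) s

theorem isInclusion_inclusionHom : IsInclusion (inclusionHom L m) := fun _ s =>
  homOfLE_app (fun U => (sheafL L m 2).sec U) (fun U => (sheafL L m 1).sec U)
    (sheafL L m 2).res_mem (sheafL L m 2).glue (sheafL L m 1).res_mem (sheafL L m 1).glue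
    (fun _ _ => mem_sec_one_of_mem_sec_two) s

theorem isInjective_inclusionHom : (inclusionHom L m).IsInjective :=
  homOfLE_isInjective (fun U => (sheafL L m 2).sec U) (fun U => (sheafL L m 1).sec U)
    (sheafL L m 2).res_mem (sheafL L m 2).glue (sheafL L m 1).res_mem (sheafL L m 1).glue
    (fun _ _ => mem_sec_one_of_mem_sec_two)

theorem exists_isFrame₃ (hX : HasInverses X) (hXq : IsQuasiProjective X) (q : Triple X m) :
    ∃ e : ∀ x, L.Fib x, IsFrame₃ e q := by
  obtain ⟨e, he⟩ := exists_frame_of_finite (L := L) hX hXq (Set.toFinite {q.x₁, q.x₂, q.x₃})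
  exact ⟨e, (he q.x₁ (by simp)).self_of_nhds, (he q.x₂ (by simp)).self_of_nhds,
    (he q.x₃ (by simp)).self_of_nhds⟩

theorem exists_isParamAt_of_smooth (hXq : IsQuasiProjective X) (hXs : IsSmoothSurface X) (x : X) :
    ∃ u, IsParamAt u x := by
  obtain ⟨c, hc⟩ := exists_chart hXq (Set.finite_singleton x)
  obtain ⟨u, -, hu⟩ := exists_isParamAt hXs (hc rfl)
  exact ⟨u, hu⟩

theorem coordL_add (q : Pow X (m + 3)) : coordL e (s + s') q = coordL e s q + coordL e s' q := by
  by_cases h : toSym (Triple.ofPow q).toPow ∈ U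
  · simp only [coordL, dif_pos h, Pi.add_apply, map_add]
  · simp only [coordL, dif_neg h, add_zero]

theorem coordL_const_smul (r : ℂ) (q : Pow X (m + 3)) :
    coordL e (r • s) q = r * coordL e s q := by
  by_cases h : toSym (Triple.ofPow q).toPow ∈ U
  · simp only [coordL, dif_pos h, Pi.smul_apply, map_smul, smul_eq_mul]
  · simp only [coordL, dif_neg h, mul_zero]

theorem coordL_smulFun (f : SymPow X (m + 3) → ℂ) (q : Pow X (m + 3)) :
    coordL e ((sheafL L m l).smulFun U f s) q = f (toSym q) * coordL e s q := by
  by_cases h : toSym (Triple.ofPow q).toPow ∈ U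
  · have h1 : coordL e ((sheafL L m l).smulFun U f s) q =
      unitDual (frameL e (Triple.ofPow q)) (f (toSym (Triple.ofPow q).toPow) •
        s ⟨Triple.ofPow q, h⟩) := dif_pos h
    have h2 : coordL e s q = unitDual (frameL e (Triple.ofPow q)) (s ⟨Triple.ofPow q, h⟩) :=
      dif_pos h
    rw [h1, h2, map_smul, smul_eq_mul, Triple.toPow_ofPow]
  · have h1 : coordL e ((sheafL L m l).smulFun U f s) q = 0 := dif_neg h
    have h2 : coordL e s q = 0 := dif_neg h
    rw [h1, h2, mul_zero]

theorem coordL_restrictFamily (hVU : V ≤ U) {q : Pow X (m + 3)} (hq : toSym q ∈ V) :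
    coordL e (restrictFamily (Fib := FibL L m) hVU s) q = coordL e s q := by
  have h : toSym (Triple.ofPow q).toPow ∈ V := by rwa [Triple.toPow_ofPow]
  have h1 : coordL e (restrictFamily (Fib := FibL L m) hVU s) q =
    unitDual (frameL e (Triple.ofPow q)) (s ⟨Triple.ofPow q, hVU h⟩) := dif_pos h
  have h2 : coordL e s q = unitDual (frameL e (Triple.ofPow q)) (s ⟨Triple.ofPow q, hVU h⟩) :=
    dif_pos (hVU h)
  rw [h1, h2]

theorem isRegularAt_coordL_second (hX : HasInverses X) {p : DiagPt X m}
    (hp : toSym p.toPow ∈ U) (he : IsFrame₂ e p) (hs : s ∈ (sheafL L m 1).sec U) :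
    IsRegularAt (fun y => coordL e s (Triple.toPow ⟨p.x, y, p.w, p.z⟩)) p.x :=
  (isMorphismAt_second hX _ _ _ _).comp _
    (eventually_coordL_eq_zero hX hs.1 (p := ⟨p.x, p.x, p.w, p.z⟩) hp he.isFrame₃).1

theorem coordL_diag (hX : HasInverses X) {p : DiagPt X m}
    (hp : toSym p.toPow ∈ U) (he : IsFrame₂ e p) (hs : s ∈ (sheafL L m 1).sec U) :
    coordL e s (Triple.toPow ⟨p.x, p.x, p.w, p.z⟩) = 0 :=
  (eventually_coordL_eq_zero hX hs.1 (p := ⟨p.x, p.x, p.w, p.z⟩) hp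
    he.isFrame₃).2.self_of_nhds (Or.inl rfl)

theorem deltaFam_add (hX : HasInverses X) (hXq : IsQuasiProjective X)
    (hs : s ∈ (sheafL L m 1).sec U) (hs' : s' ∈ (sheafL L m 1).sec U) :
    deltaFam (s + s') = deltaFam s + deltaFam s' := by
  funext ⟨p, hp⟩
  have he := isFrame₂_diagFrame (L := L) hX hXq p
  rw [Pi.add_apply]
  simp only [deltaFam, coordL_add]
  rw [dAt_add (isRegularAt_coordL_second hX hp he hs) (isRegularAt_coordL_second hX hp he hs'),
    TensorProduct.add_tmul]

theorem deltaFam_const_smul (hX : HasInverses X) (hXq : IsQuasiProjective X)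
    (hs : s ∈ (sheafL L m 1).sec U) (r : ℂ) : deltaFam (r • s) = r • deltaFam s := by
  funext ⟨p, hp⟩
  have he := isFrame₂_diagFrame (L := L) hX hXq p
  rw [Pi.smul_apply]
  simp only [deltaFam, coordL_const_smul]
  rw [dAt_const_mul _ (isRegularAt_coordL_second hX hp he hs), TensorProduct.smul_tmul']

theorem deltaFam_smulFun (hX : HasInverses X) (hXq : IsQuasiProjective X)
    (hs : s ∈ (sheafL L m 1).sec U) {f : SymPow X (m + 3) → ℂ} (hf : IsRegularOn f U) :
    deltaFam ((sheafL L m 1).smulFun U f s) = (sheafK L m 2).smulFun U f (deltaFam s) := by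
  funext ⟨p, hp⟩
  have he := isFrame₂_diagFrame (L := L) hX hXq p
  change _ = f (toSym p.toPow) • deltaFam s ⟨p, hp⟩
  have hfr : IsRegularAt (fun y => f (toSym (Triple.toPow ⟨p.x, y, p.w, p.z⟩))) p.x :=
    ((isMorphismAt_toSym _).trans (isMorphismAt_second hX _ _ _ _)).comp f (hf _ hp)
  simp only [deltaFam, coordL_smulFun]
  rw [dAt_mul hfr (isRegularAt_coordL_second hX hp he hs), coordL_diag hX hp he hs, zero_smul,
    zero_add, TensorProduct.smul_tmul']
  rfl

theorem deltaFam_restrictFamily (hX : HasInverses X) (hVU : V ≤ U) :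
    deltaFam (restrictFamily (Fib := FibL L m) hVU s) =
      restrictFamily (Fib := FibK L m) hVU (deltaFam s) := by
  funext ⟨p, hp⟩
  refine congrArg (· ⊗ₜ[ℂ] frameK (diagFrame L p) p) (dAt_congr ?_)
  filter_upwards [(isMorphismAt_second hX p.x p.x p.w p.z).continuousAt.eventually
    (eventually_mem_opens hp)] with y hy
  exact coordL_restrictFamily hVU hy

/-- The differential `d¹_Δ`. -/
def deltaHom (hX : HasInverses X) (hXq : IsQuasiProjective X) (hXs : IsSmoothSurface X)
    (L : LineBundle X) (m : ℕ) : SectionSheaf.Hom (sheafL L m 1) (sheafK L m 2) where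
  app U :=
    { toFun s := ⟨deltaFam s.1, deltaFam_mem hX hXq hXs s.2⟩
      map_add' s s' := Subtype.ext (deltaFam_add hX hXq s.2 s'.2)
      map_smul' r s := Subtype.ext (deltaFam_const_smul hX hXq s.2 r) }
  app_res h _ := Subtype.ext (deltaFam_restrictFamily hX h)
  app_smul U f hf s s' h := by
    change deltaFam s'.1 = _
    rw [h]
    exact deltaFam_smulFun hX hXq s.2 hf

theorem isDiagDifferential_deltaHom (hX : HasInverses X) (hXq : IsQuasiProjective X)
    (hXs : IsSmoothSurface X) : IsDiagDifferential (deltaHom hX hXq hXs L m) :=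
  fun _ _ x w z h _ f a b c d hf hr hs =>
    deltaFam_eq hX hXq (p := ⟨x, w, z⟩) h f a b c d hf hr hs

/-- If the differential of `s` vanishes, its coordinate vanishes to second order on `Δ₁₂`. -/
theorem coordL_mem_sq_of_deltaFam_eq_zero (hX : HasInverses X) (hXq : IsQuasiProjective X)
    (hXs : IsSmoothSurface X) (hs : s ∈ (sheafL L m 1).sec U) (h0 : deltaFam s = 0)
    {p : Pow X (m + 3)} (hp : toSym p ∈ U) (he : IsFrame₃ e (Triple.ofPow p)) :
    InIdeal (coordL e s) p (diagIdeal 0 1 p ^ 2) := by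
  have hp' : toSym (Triple.ofPow p).toPow ∈ U := by rwa [Triple.toPow_ofPow]
  have hreg : IsRegularAt (coordL e s) p := by
    have := (eventually_coordL_eq_zero hX hs.1 hp' he).1
    rwa [Triple.toPow_ofPow] at this
  by_cases h01 : p 0 = p 1
  · have hpd := DiagPt.toPow_ofPow h01
    have hpU : toSym (DiagPt.ofPow p).toPow ∈ U := by rwa [hpd]
    have he2 : IsFrame₂ e (DiagPt.ofPow p) := ⟨he.1, he.2.2⟩
    obtain ⟨u, hu⟩ := exists_isParamAt_of_smooth hXq hXs (p 0)
    have hu1 : IsParamAt u (p 1) := h01 ▸ hu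
    obtain ⟨K, hK, e1⟩ := exists_factor_coordL hX hXq hpU he2 hs hu
    rw [hpd] at hK e1
    have hK0 : ∀ i, InIdeal (K i) p (diagIdeal 0 1 p) := by
      refine fun i => inIdeal_diagIdeal.2 ⟨(hK i).1, ?_⟩
      have he2' := he2.eventually hX
      rw [hpd] at he2'
      filter_upwards [e1.eventually_nhds, he2', eventually_mem_opens hp,
        eventually_all.2 fun i => (hK i).1.eventually, (isMorphismAt_proj 0
          p).continuousAt.eventually (hu.eventually hX hXq)] with q h1 h2 h3 h4 h5 h6
      have h7 := DiagPt.toPow_ofPow h6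
      have h8 := deltaFam_of_factor hX hXq (p := DiagPt.ofPow q) (by rwa [h7]) h2 hs.1 h5
        (h7.symm ▸ h4) (h7.symm ▸ h1)
      rw [h0] at h8
      have h8' : (0 : FibK L m (DiagPt.ofPow q)) = _ := h8.trans (congrArg (fun q' =>
        ∑ i, K i q' • (dAt (u i) (DiagPt.ofPow q).x ⊗ₜ[ℂ] frameK e (DiagPt.ofPow q))) h7)
      have h9 := coordForm_sum (h5.linearIndependent hXs) h2.ne_zero (fun i => K i q) i
      rw [← h9]
      exact (congrArg (coordForm _ _ i) h8'.symm).trans (map_zero _)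
    refine InIdeal.congr (InIdeal.sum Finset.univ fun i _ => ?_) e1.symm
    rw [pow_two]
    exact (hK0 i).mul (inIdeal_coordDiff hu.1 hu1.1 i)
  · exact (inIdeal_diagIdeal_pow_of_ne hXq h01 2).2 hreg

/-- The kernel of `d¹_Δ`: the coordinate of `s` vanishes to second order on `Δ₁₂` as its differential
is zero, on `Δ₁₃` by symmetry, and on `Δ₂₃` because it is symmetric. -/
theorem mem_sec_two_of_deltaFam_eq_zero (hX : HasInverses X) (hXq : IsQuasiProjective X)
    (hXs : IsSmoothSurface X) (hs : s ∈ (sheafL L m 1).sec U) (h0 : deltaFam s = 0) :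
    s ∈ (sheafL L m 2).sec U := by
  refine ⟨mem_localSec_of_coordL hX hs.1 fun p hp => ?_, hs.2⟩
  obtain ⟨e, he⟩ := exists_isFrame₃ (L := L) hX hXq p
  obtain ⟨hreg, hzero⟩ := eventually_coordL_eq_zero hX hs.1 hp he
  have hswap : ∀ᶠ q in 𝓝 p.toPow, coordL e s (swapPow q) = coordL e s q := by
    filter_upwards [eventually_mem_opens hp, he.eventually hX] with q h1 h2
    exact coordL_swapPow hX hs h1 h2
  refine ⟨e, he, inIdeal_inf.2 ⟨inIdeal_inf.2 ⟨?_, ?_⟩, ?_⟩⟩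
  · exact coordL_mem_sq_of_deltaFam_eq_zero hX hXq hXs hs h0 hp he
  · have h1 := coordL_mem_sq_of_deltaFam_eq_zero hX hXq hXs hs h0 (e := e) (p := swapPow p.toPow)
      (by rwa [toSym_swapPow]) ⟨he.1, he.2.2, he.2.1⟩
    refine (InIdeal.comp_sq (isMorphismAt_swapPow _) (fun g hg => ?_) h1).congr hswap
    rw [inIdeal_diagIdeal] at hg ⊢
    refine ⟨(isMorphismAt_swapPow _).comp g hg.1, ?_⟩
    filter_upwards [(isMorphismAt_swapPow _).continuousAt.eventually hg.2] with q hq h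
    exact hq h
  · by_cases h12 : p.toPow 1 = p.toPow 2
    · obtain ⟨u, hu⟩ := exists_isParamAt_of_smooth hXq hXs (p.toPow 1)
      exact inIdeal_sq_of_swap hX hXq h12 hu hreg
        (hzero.mono fun q h h' => h (Or.inr (Or.inr h'))) hswap
    · exact (inIdeal_diagIdeal_pow_of_ne hXq h12 2).2 hreg

theorem deltaFam_eq_zero_of_mem_sec_two (hX : HasInverses X) (hXq : IsQuasiProjective X)
    (hs : s ∈ (sheafL L m 2).sec U) : deltaFam s = 0 := by
  funext ⟨p, hp⟩
  have he := isFrame₂_diagFrame (L := L) hX hXq p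
  have h1 := (coordL_spec hX hs.1 (p := ⟨p.x, p.x, p.w, p.z⟩) hp he.isFrame₃).1
  have h2 : InIdeal (fun y => coordL (diagFrame L p) s (Triple.toPow ⟨p.x, y, p.w, p.z⟩)) p.x
      (maxIdeal p.x ^ 2) := by
    refine InIdeal.comp_sq (isMorphismAt_second hX _ _ _ _) (fun g hg => ?_)
      (h1.mono (inf_le_left.trans inf_le_left))
    rw [inIdeal_diagIdeal] at hg
    exact inIdeal_maxIdeal.2 ⟨(isMorphismAt_second hX _ _ _ _).comp g hg.1,
      hg.2.self_of_nhds rfl⟩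
  change dAt _ _ ⊗ₜ _ = _
  rw [dAt_eq_zero_of_inIdeal h2, TensorProduct.zero_tmul]
  rfl

theorem isExactAt_inclusionHom (hX : HasInverses X) (hXq : IsQuasiProjective X)
    (hXs : IsSmoothSurface X) :
    SectionSheaf.IsExactAt (inclusionHom L m) (deltaHom hX hXq hXs L m) := by
  intro U s
  refine Iff.trans ?_ (inclusionHom_locallyInImage s).symm
  constructor
  · intro h t ht
    have h0 : deltaFam s.1 = 0 := congrArg Subtype.val h
    exact ⟨U, le_rfl, ht, mem_sec_two_of_deltaFam_eq_zero hX hXq hXs s.2 h0⟩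
  · intro h
    refine Subtype.ext (funext fun ⟨p, hp⟩ => ?_)
    obtain ⟨V, hVU, hV, hs⟩ := h _ hp
    have h1 := deltaFam_eq_zero_of_mem_sec_two hX hXq hs
    exact congrFun ((deltaFam_restrictFamily hX hVU).symm.trans h1) ⟨p, hV⟩

end Kernel

/-! ### The symmetrised second order differential -/

section Psi

variable {X : Type} [FunctionSpace X] {L : LineBundle X} {m l : ℕ} {e : ∀ x, L.Fib x}
  {U V : Opens (SymPow X (m + 3))} {u : Fin 2 → X → ℂ} {x : X} {z : Fin m → X}
  {τ τ' : ∀ p : {p : DiagPt X m // toSym p.toPow ∈ U}, FibK L m p.1}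

open Classical in
/-- For `τ = ∑ T_i • (du_i ⊗ e³(x) e(w))` the function `w ↦ ∑ (u_i(w) - u_i(x)) T_i(x, w, z)`. -/
def psiTheta (u : Fin 2 → X → ℂ) (e : ∀ x, L.Fib x)
    (τ : ∀ p : {p : DiagPt X m // toSym p.toPow ∈ U}, FibK L m p.1) (x : X) (z : Fin m → X)
    (y : X) : ℂ :=
  if h : toSym (DiagPt.toPow ⟨x, y, z⟩) ∈ U then
    ∑ i, (u i y - u i x) * coordForm (fun i => dAt (u i) x)
      (frameK e (⟨x, y, z⟩ : DiagPt X m)) i (τ ⟨⟨x, y, z⟩, h⟩)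
  else 0

theorem psiTheta_comp_perm (hτ : τ ∈ invK L m U) (σ : Equiv.Perm (Fin m)) :
    psiTheta u e τ x (fun i => z (σ i)) = psiTheta u e τ x z := by
  funext y
  have hσ : toSym (DiagPt.toPow ⟨x, y, fun i => z (σ i)⟩) = toSym (DiagPt.toPow ⟨x, y, z⟩) :=
    toSym_perm x x y z σ
  by_cases h : toSym (DiagPt.toPow ⟨x, y, z⟩) ∈ U
  · have h' : toSym (DiagPt.toPow ⟨x, y, fun i => z (σ i)⟩) ∈ U := hσ ▸ h
    rw [psiTheta, psiTheta, dif_pos h, dif_pos h']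
    exact Finset.sum_congr rfl fun i _ => congrArg (fun t => (u i y - u i x) *
      coordForm (fun i => dAt (u i) x) (frameK e (⟨x, y, z⟩ : DiagPt X m)) i t) (hτ x y z σ h h')
  · have h' : toSym (DiagPt.toPow ⟨x, y, fun i => z (σ i)⟩) ∉ U := fun hh => h (hσ ▸ hh)
    rw [psiTheta, psiTheta, dif_neg h, dif_neg h']

theorem psiTheta_of_eq (hXs : IsSmoothSurface X) (hu : IsParamAt u x) {y : X}
    (he : IsFrame₂ e (⟨x, y, z⟩ : DiagPt X m)) (h : toSym (DiagPt.toPow ⟨x, y, z⟩) ∈ U)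
    {T : Fin 2 → ℂ}
    (hτ : τ ⟨⟨x, y, z⟩, h⟩ = ∑ i, T i • (dAt (u i) x ⊗ₜ frameK e (⟨x, y, z⟩ : DiagPt X m))) :
    psiTheta u e τ x z y = ∑ i, (u i y - u i x) * T i := by
  rw [psiTheta, dif_pos h]
  refine Finset.sum_congr rfl fun i _ => ?_
  rw [hτ]
  exact congrArg (_ * ·) (coordForm_sum (hu.linearIndependent hXs) he.ne_zero T i)

/-- The frame `e⁴(x)` of `L⁴`. -/
def frameW (e : ∀ x, L.Fib x) (x : X) :
    (L.Fib x ⊗[ℂ] L.Fib x) ⊗[ℂ] (L.Fib x ⊗[ℂ] L.Fib x) :=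
  (e x ⊗ₜ e x) ⊗ₜ (e x ⊗ₜ e x)

theorem IsFrameAt.frameW_ne_zero (h : IsFrameAt L e x) : frameW e x ≠ 0 :=
  tmul_ne_zero_of_ne_zero (tmul_ne_zero_of_ne_zero h.1 h.1) (tmul_ne_zero_of_ne_zero h.1 h.1)

theorem isMorphismAt_diag_third (hX : HasInverses X) :
    IsMorphismAt (fun y => DiagPt.toPow ⟨x, y, z⟩) x :=
  isMorphismAt_third hX x x x z

/-- The leading form of `psiTheta` computed from an arbitrary local expression of `τ`, with other
frames and other functions than the `u i`. -/
theorem exists_hasLead_psiTheta (hX : HasInverses X) (hXs : IsSmoothSurface X)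
    (hu : IsParamAt u x) (he : IsFrameAt L e x) (hx : toSym (DiagPt.toPow ⟨x, x, z⟩) ∈ U)
    {ι : Type} [Fintype ι] (f g h : ι → Pow X (m + 3) → ℂ) (α : ι → X → ℂ)
    (a b c d : ι → ∀ y, L.Fib y)
    (hf : ∀ k, IsRegularAt (f k) (DiagPt.toPow ⟨x, x, z⟩) ∧
      InIdeal (g k) (DiagPt.toPow ⟨x, x, z⟩) (diagIdeal 1 2 (DiagPt.toPow ⟨x, x, z⟩)) ∧
      InIdeal (h k) (DiagPt.toPow ⟨x, x, z⟩) (diagIdeal 1 2 (DiagPt.toPow ⟨x, x, z⟩)))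
    (hr : ∀ k, IsRegularAt (α k) x ∧ L.IsRegularSectionAt (a k) x ∧
      L.IsRegularSectionAt (b k) x ∧ L.IsRegularSectionAt (c k) x ∧
      L.IsRegularSectionAt (d k) x)
    (hs : ∀ᶠ q : DiagPt X m in comap DiagPt.toPow (𝓝 (DiagPt.toPow ⟨x, x, z⟩)),
      ∀ hq : toSym q.toPow ∈ U, τ ⟨q, hq⟩ =
        ∑ k, (f k q.toPow * g k q.toPow * h k q.toPow) •
          (dAt (α k) q.x ⊗ₜ ((a k q.x ⊗ₜ b k q.x) ⊗ₜ (c k q.x ⊗ₜ d k q.w)))) :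
    ∃ v, HasLead u x (psiTheta u e τ x z) v ∧ v ⊗ₜ[ℂ] frameW e x =
      ∑ k, f k (DiagPt.toPow ⟨x, x, z⟩) •
        ((SymmetricAlgebra.ι ℂ (CotSpace x) (dAt (α k) x) *
            SymmetricAlgebra.ι ℂ (CotSpace x)
              (dAt (fun y => g k (DiagPt.toPow ⟨x, y, z⟩)) x) *
            SymmetricAlgebra.ι ℂ (CotSpace x)
              (dAt (fun y => h k (DiagPt.toPow ⟨x, y, z⟩)) x)) ⊗ₜ[ℂ]
          ((a k x ⊗ₜ[ℂ] b k x) ⊗ₜ[ℂ] (c k x ⊗ₜ[ℂ] d k x))) := by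
  choose A hA eA using fun k => (he.2 (a k)).1 (hr k).2.1
  choose B hB eB using fun k => (he.2 (b k)).1 (hr k).2.2.1
  choose C hC eC using fun k => (he.2 (c k)).1 (hr k).2.2.2.1
  choose D hD eD using fun k => (he.2 (d k)).1 (hr k).2.2.2.2
  choose κ hκ using fun k => (hu.exists_coeff (hr k).1)
  have hφ : IsMorphismAt (fun y => DiagPt.toPow ⟨x, y, z⟩) x := isMorphismAt_diag_third hX
  have hα : ∀ k, dAt (fun y => ∑ i, κ k i * (u i y - u i x)) x = dAt (α k) x := fun k => by
    rw [hu.dAt_sum_mul (g := fun i _ => κ k i) fun i => isRegularAt_const _, (hκ k).1]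
  have hα' : ∀ k, InIdeal (fun y => ∑ i, κ k i * (u i y - u i x)) x (maxIdeal x) := fun k =>
    InIdeal.sum _ fun i _ => InIdeal.const_mul _
      (inIdeal_maxIdeal.2 ⟨hu.isRegularAt_sub i, sub_self _⟩)
  have hd : ∀ F, InIdeal F (DiagPt.toPow ⟨x, x, z⟩) (diagIdeal 1 2 (DiagPt.toPow ⟨x, x, z⟩)) →
      InIdeal (fun y => F (DiagPt.toPow ⟨x, y, z⟩)) x (maxIdeal x) := fun F hF =>
    inIdeal_maxIdeal.2 ⟨hφ.comp _ hF.1, (inIdeal_diagIdeal.1 hF).2.self_of_nhds rfl⟩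
  have hl := HasLead.sum Finset.univ fun k _ => hasLead_mul hu
    ((hφ.comp _ (hf k).1).mul ((isRegularAt_const (A k x * B k x * C k x)).mul (hD k)))
    (hα' k) (hd _ (hf k).2.1) (hd _ (hf k).2.2)
  refine ⟨_, hl.congr ?_, ?_⟩
  · rw [eventually_comap_diag] at hs
    filter_upwards [hφ.continuousAt.eventually hs, hφ.continuousAt.eventually
      (eventually_mem_opens hx), eventually_all.2 eD, he.eventually hX] with y h1 h2 h3 h4
    have h5 := h1 rfl h2
    rw [psiTheta_of_eq hXs hu (e := e) (T := fun i => ∑ k, (f k (DiagPt.toPow ⟨x, y, z⟩) *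
      g k (DiagPt.toPow ⟨x, y, z⟩) * h k (DiagPt.toPow ⟨x, y, z⟩)) * (κ k i *
        (A k x * B k x * (C k x * D k y)))) ⟨he, h4⟩ h2]
    · simp only [Finset.mul_sum, Finset.sum_mul]
      rw [Finset.sum_comm]
      refine Finset.sum_congr rfl fun i _ => Finset.sum_congr rfl fun k _ => ?_
      ring
    · refine h5.trans ?_
      simp only [Finset.sum_smul]
      rw [Finset.sum_comm]
      refine Finset.sum_congr rfl fun k _ => ?_
      have h6 : ∀ r : ℂ, r • (dAt (α k) x ⊗ₜ[ℂ] ((a k x ⊗ₜ[ℂ] b k x) ⊗ₜ[ℂ] (c k x ⊗ₜ[ℂ] d k y))) =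
          ∑ i, (r * (κ k i * (A k x * B k x * (C k x * D k y)))) •
            (dAt (u i) x ⊗ₜ[ℂ] frameK e (⟨x, y, z⟩ : DiagPt X m)) := fun r => by
        rw [(eA k).self_of_nhds, (eB k).self_of_nhds, (eC k).self_of_nhds, h3 k, smul_tmul_four,
          (hκ k).1, TensorProduct.sum_tmul, Finset.smul_sum]
        refine Finset.sum_congr rfl fun i _ => ?_
        rw [TensorProduct.smul_tmul_smul, smul_smul]
        rfl
      exact h6 _
  · rw [TensorProduct.sum_tmul]
    refine Finset.sum_congr rfl fun k _ => ?_
    rw [hα, (eA k).self_of_nhds, (eB k).self_of_nhds, (eC k).self_of_nhds, (eD k).self_of_nhds,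
      smul_tmul_four, TensorProduct.tmul_smul, ← TensorProduct.smul_tmul', smul_smul]
    refine congrArg (· • _) ?_
    ring

open Classical in
/-- Parameters at the point `x`. -/
def paramAt (x : X) : Fin 2 → X → ℂ := if h : ∃ u, IsParamAt u x then h.choose else 0

theorem isParamAt_paramAt (hXq : IsQuasiProjective X) (hXs : IsSmoothSurface X) (x : X) :
    IsParamAt (paramAt x) x := by
  have h := exists_isParamAt_of_smooth hXq hXs x
  rw [paramAt, dif_pos h]
  exact h.choose_spec

/-- The symmetrised second order differential on families: for
`τ = ∑ T_i • (du_i ⊗ e³(x) e(w))` the value at `(x, π(z))` is the leading form of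
`w ↦ ∑ (u_i(w) - u_i(x)) T_i(x, w, z)` times the frame. -/
def psiFam (τ : ∀ p : {p : DiagPt X m // toSym p.toPow ∈ U}, FibK L m p.1) :
    ∀ p : {p : ProdVar X (SymPow X m) // w₃ p ∈ U}, FibW L m p.1 := fun p =>
  lead (paramAt p.1.fst) p.1.fst (psiTheta (paramAt p.1.fst)
    (diagFrame L (⟨p.1.fst, p.1.fst, symLift p.1.snd⟩ : DiagPt X m)) τ p.1.fst
      (symLift p.1.snd)) ⊗ₜ
    frameW (diagFrame L (⟨p.1.fst, p.1.fst, symLift p.1.snd⟩ : DiagPt X m)) p.1.fst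

/-- The value of `ψ` computed from an arbitrary local expression of `τ`; in particular it does not
depend on the frame, the parameters and the lift of the cycle used in the definition. -/
theorem psiFam_eq (hX : HasInverses X) (hXq : IsQuasiProjective X) (hXs : IsSmoothSurface X)
    (hτ : τ ∈ invK L m U) (hx : toSym (DiagPt.toPow ⟨x, x, z⟩) ∈ U)
    (hx' : w₃ ⟨x, toSym z⟩ ∈ U)
    {ι : Type} [Fintype ι] (f g h : ι → Pow X (m + 3) → ℂ) (α : ι → X → ℂ)
    (a b c d : ι → ∀ y, L.Fib y)
    (hf : ∀ k, IsRegularAt (f k) (DiagPt.toPow ⟨x, x, z⟩) ∧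
      InIdeal (g k) (DiagPt.toPow ⟨x, x, z⟩) (diagIdeal 1 2 (DiagPt.toPow ⟨x, x, z⟩)) ∧
      InIdeal (h k) (DiagPt.toPow ⟨x, x, z⟩) (diagIdeal 1 2 (DiagPt.toPow ⟨x, x, z⟩)))
    (hr : ∀ k, IsRegularAt (α k) x ∧ L.IsRegularSectionAt (a k) x ∧
      L.IsRegularSectionAt (b k) x ∧ L.IsRegularSectionAt (c k) x ∧
      L.IsRegularSectionAt (d k) x)
    (hs : ∀ᶠ q : DiagPt X m in comap DiagPt.toPow (𝓝 (DiagPt.toPow ⟨x, x, z⟩)),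
      ∀ hq : toSym q.toPow ∈ U, τ ⟨q, hq⟩ =
        ∑ k, (f k q.toPow * g k q.toPow * h k q.toPow) •
          (dAt (α k) q.x ⊗ₜ ((a k q.x ⊗ₜ b k q.x) ⊗ₜ (c k q.x ⊗ₜ d k q.w)))) :
    psiFam τ ⟨⟨x, toSym z⟩, hx'⟩ =
      ∑ k, f k (DiagPt.toPow ⟨x, x, z⟩) •
        ((SymmetricAlgebra.ι ℂ (CotSpace x) (dAt (α k) x) *
            SymmetricAlgebra.ι ℂ (CotSpace x)
              (dAt (fun y => g k (DiagPt.toPow ⟨x, y, z⟩)) x) *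
            SymmetricAlgebra.ι ℂ (CotSpace x)
              (dAt (fun y => h k (DiagPt.toPow ⟨x, y, z⟩)) x)) ⊗ₜ[ℂ]
          ((a k x ⊗ₜ[ℂ] b k x) ⊗ₜ[ℂ] (c k x ⊗ₜ[ℂ] d k x))) := by
  have hu := isParamAt_paramAt hXq hXs x
  have he := (isFrame₂_diagFrame (L := L) hX hXq
    (⟨x, x, symLift (toSym z)⟩ : DiagPt X m)).1
  obtain ⟨v, hv, e1⟩ := exists_hasLead_psiTheta hX hXs hu he hx f g h α a b c d hf hr hs
  refine Eq.trans ?_ e1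
  obtain ⟨σ, hσ⟩ := toSym_eq_iff.1 (toSym_symLift (toSym (z : Pow X m))).symm
  have h2 : psiTheta (paramAt x) (diagFrame L (⟨x, x, symLift (toSym z)⟩ : DiagPt X m)) τ x
      (symLift (toSym z)) = psiTheta (paramAt x)
        (diagFrame L (⟨x, x, symLift (toSym z)⟩ : DiagPt X m)) τ x z :=
    (congrArg (psiTheta (paramAt x) (diagFrame L (⟨x, x, symLift (toSym z)⟩ : DiagPt X m)) τ x)
      hσ).trans (psiTheta_comp_perm hτ σ)
  have h3 := hv.lead_eq hXs hu
  rw [← h2] at h3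
  exact congrArg (· ⊗ₜ[ℂ] frameW (diagFrame L (⟨x, x, symLift (toSym z)⟩ : DiagPt X m)) x) h3

end Psi

/-! ### Normal forms of sections of `𝒦¹_{(1)(1)}(-lΔ)` -/

section NormalForm

variable {X : Type} [FunctionSpace X] {L : LineBundle X} {m l : ℕ} {e : ∀ x, L.Fib x}
  {U V : Opens (SymPow X (m + 3))} {u : Fin 2 → X → ℂ} {x : X} {z : Fin m → X}
  {τ τ' : ∀ p : {p : DiagPt X m // toSym p.toPow ∈ U}, FibK L m p.1}

/-- The `du_i` generate the sheaf of differentials. -/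
theorem IsParamAt.exists_dAt_eq (hX : HasInverses X) (hXq : IsQuasiProjective X)
    (hu : IsParamAt u x) {α : X → ℂ} (hα : IsRegularAt α x) :
    ∃ κ : Fin 2 → X → ℂ, (∀ i, IsRegularAt (κ i) x) ∧
      ∀ᶠ y in 𝓝 x, dAt α y = ∑ i, κ i y • dAt (u i) y := by
  -- `α(y') - α(y) = ∑ R_i(y, y') (u_i(y') - u_i(y))` near the diagonal of `X × X`, and
  -- `κ_i(y) = R_i(y, y)`
  let p : Pow X 2 := fun _ => x
  obtain ⟨R, hR, e⟩ := inSpan_diag hX hXq (p := p) (i := 0) (j := 1) rfl hu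
    (f := fun q => α (q 1) - α (q 0))
    (((isMorphismAt_proj 1 p).comp α hα).sub ((isMorphismAt_proj 0 p).comp α hα))
    (Eventually.of_forall fun q h => by rw [h, sub_self])
  let φ : X → X → Pow X 2 := fun y y' i => if i = 0 then y else y'
  have hφ : ∀ y : X, IsMorphismAt (φ y) y := fun y => isMorphismAt_pow hX fun i => by
    by_cases hi : i = 0
    · simpa [φ, hi] using isMorphismAt_const y y
    · simpa [φ, hi] using isMorphismAt_id y
  let δ : X → Pow X 2 := fun y _ => y
  have hδ : IsMorphismAt δ x := isMorphismAt_pow hX fun i => isMorphismAt_id x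
  have hy : ∀ y, φ y y = δ y := fun y => funext fun i => ite_self _
  refine ⟨fun i y => R i (δ y), fun i => hδ.comp _ (hR i), ?_⟩
  filter_upwards [hu.eventually hX hXq, hδ.continuousAt.eventually (Eventually.eventually_nhds e),
    hδ.continuousAt.eventually (eventually_all.2 fun i => (hR i).eventually)] with y h1 h2 h3
  have h4 : ∀ i, IsRegularAt (fun y' => R i (φ y y')) y := fun i =>
    (hφ y).comp _ (by rw [hy]; exact h3 i)
  have h5 := h1.dAt_eq h4 (f := α) ((hφ y).continuousAt.eventually (by
    rw [hy]
    exact h2))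
  simp only [hy] at h5
  exact h5

/-- The local sections of `(Ω¹ ⊗ L³)_{12} ⊗ p₃^*L ⊗ I_{Δ₂₃}^l` are the combinations of the
`du_i ⊗ e³(x) e(w)` with coefficients in the ideal. -/
theorem exists_coord_of_mem_span_genK (hX : HasInverses X) (hXq : IsQuasiProjective X)
    {p : DiagPt X m} (hp : IsFrame₂ e p) (hu : IsParamAt u p.x)
    {t : ∀ q, FibK L m q} (ht : t ∈ Submodule.span ℂ (genK L m l p)) :
    ∃ T : Fin 2 → Pow X (m + 3) → ℂ,
      (∀ i, InIdeal (T i) p.toPow (diagIdeal 1 2 p.toPow ^ l)) ∧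
      ∀ᶠ q : DiagPt X m in comap DiagPt.toPow (𝓝 p.toPow),
        t q = ∑ i, T i q.toPow • (dAt (u i) q.x ⊗ₜ frameK e q) := by
  have h0 : Tendsto (fun q : DiagPt X m => q.x) (comap DiagPt.toPow (𝓝 p.toPow)) (𝓝 p.x) :=
    (isMorphismAt_proj 0 p.toPow).continuousAt.tendsto.comp tendsto_comap
  have h2 : Tendsto (fun q : DiagPt X m => q.w) (comap DiagPt.toPow (𝓝 p.toPow)) (𝓝 p.w) :=
    (isMorphismAt_proj 2 p.toPow).continuousAt.tendsto.comp tendsto_comap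
  induction ht using Submodule.span_induction with
  | mem t ht =>
    obtain ⟨f, α, a, b, c, d, hf, hα, ha, hb, hc, hd, rfl⟩ := ht
    obtain ⟨A, hA, eA⟩ := (hp.1.2 a).1 ha
    obtain ⟨B, hB, eB⟩ := (hp.1.2 b).1 hb
    obtain ⟨C, hC, eC⟩ := (hp.1.2 c).1 hc
    obtain ⟨D, hD, eD⟩ := (hp.2.2 d).1 hd
    obtain ⟨κ, hκ, eκ⟩ := hu.exists_dAt_eq hX hXq hα
    refine ⟨fun i q => f q * (κ i (q 0) * (A (q 0) * B (q 0) * (C (q 0) * D (q 2)))),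
      fun i => hf.mul_right ?_, ?_⟩
    · have r0 : ∀ {g : X → ℂ}, IsRegularAt g p.x → IsRegularAt (fun q => g (q 0)) p.toPow :=
        fun hg => (isMorphismAt_proj 0 p.toPow).comp _ hg
      have r2 : IsRegularAt (fun q => D (q 2)) p.toPow := (isMorphismAt_proj 2 p.toPow).comp _ hD
      exact (r0 (hκ i)).mul (((r0 hA).mul (r0 hB)).mul ((r0 hC).mul r2))
    · filter_upwards [h0.eventually eA, h0.eventually eB, h0.eventually eC, h2.eventually eD,
        h0.eventually eκ] with q a1 a2 a3 a4 a5
      change f q.toPow • (dAt α q.x ⊗ₜ[ℂ] ((a q.x ⊗ₜ[ℂ] b q.x) ⊗ₜ[ℂ] (c q.x ⊗ₜ[ℂ] d q.w))) = _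
      rw [a1, a2, a3, a4, a5, smul_tmul_four, TensorProduct.sum_tmul, Finset.smul_sum]
      refine Finset.sum_congr rfl fun i _ => ?_
      rw [TensorProduct.smul_tmul_smul, smul_smul]
      rfl
  | zero =>
    refine ⟨fun _ _ => 0, fun _ => inIdeal_zero, Eventually.of_forall fun q => ?_⟩
    simp
  | add t t' _ _ h h' =>
    obtain ⟨T, hT, h1⟩ := h
    obtain ⟨T', hT', h1'⟩ := h'
    refine ⟨fun i q => T i q + T' i q, fun i => (hT i).add (hT' i), ?_⟩
    filter_upwards [h1, h1'] with q e1 e2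
    simp only [Pi.add_apply, e1, e2, add_smul, Finset.sum_add_distrib]
  | smul r t _ h =>
    obtain ⟨T, hT, h1⟩ := h
    refine ⟨fun i q => r * T i q, fun i => (hT i).const_mul r, ?_⟩
    filter_upwards [h1] with q e1
    simp only [Pi.smul_apply, e1, Finset.smul_sum, smul_smul]

theorem exists_coord_of_mem_sec_sheafK (hX : HasInverses X) (hXq : IsQuasiProjective X)
    (hτ : τ ∈ (sheafK L m l).sec U) {p : DiagPt X m} (hpU : toSym p.toPow ∈ U)
    (hp : IsFrame₂ e p) (hu : IsParamAt u p.x) :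
    ∃ T : Fin 2 → Pow X (m + 3) → ℂ,
      (∀ i, InIdeal (T i) p.toPow (diagIdeal 1 2 p.toPow ^ l)) ∧
      ∀ᶠ q : DiagPt X m in comap DiagPt.toPow (𝓝 p.toPow), ∀ hq,
        τ ⟨q, hq⟩ = ∑ i, T i q.toPow • (dAt (u i) q.x ⊗ₜ frameK e q) := by
  obtain ⟨t, ht, e1⟩ := hτ.1 p hpU
  rw [comap_toPow_inf] at e1
  obtain ⟨T, hT, e2⟩ := exists_coord_of_mem_span_genK hX hXq hp hu ht
  refine ⟨T, hT, ?_⟩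
  filter_upwards [e1, e2] with q h1 h2 hq
  rw [h1 hq, h2]

/-- The families `τ` given near the point `(x, x, x, z)` by
`∑ W_j W_k H_ijk • (du_i ⊗ e³(x) e(w))`, where `W_j = u_j(w) - u_j(x)`. -/
def IsCubicAt (u : Fin 2 → X → ℂ) (e : ∀ x, L.Fib x)
    (τ : ∀ p : {p : DiagPt X m // toSym p.toPow ∈ U}, FibK L m p.1)
    (H : Fin 2 → Fin 2 → Fin 2 → Pow X (m + 3) → ℂ) (P : Pow X (m + 3)) : Prop :=
  (∀ i j k, IsRegularAt (H i j k) P) ∧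
    ∀ᶠ q : DiagPt X m in comap DiagPt.toPow (𝓝 P), ∀ hq,
      τ ⟨q, hq⟩ = ∑ i, (∑ j, ∑ k, coordDiff u 1 2 j q.toPow * coordDiff u 1 2 k q.toPow *
        H i j k q.toPow) • (dAt (u i) q.x ⊗ₜ frameK e q)

theorem exists_isCubicAt (hX : HasInverses X) (hXq : IsQuasiProjective X)
    (hτ : τ ∈ (sheafK L m 2).sec U) (hpU : toSym (DiagPt.toPow ⟨x, x, z⟩) ∈ U)
    (hp : IsFrameAt L e x) (hu : IsParamAt u x) :
    ∃ H, IsCubicAt u e τ H (DiagPt.toPow ⟨x, x, z⟩) := by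
  obtain ⟨T, hT, e1⟩ := exists_coord_of_mem_sec_sheafK hX hXq hτ hpU (e := e) ⟨hp, hp⟩ hu
  choose R hR e2 using fun i => (inIdeal_diagIdeal_sq_iff hX hXq
    (p := DiagPt.toPow ⟨x, x, z⟩) (i := 1) (j := 2) rfl hu).1 (hT i)
  refine ⟨R, hR, ?_⟩
  filter_upwards [e1, tendsto_comap.eventually (eventually_all.2 e2)] with q h1 h2 hq
  rw [h1 hq]
  exact Finset.sum_congr rfl fun i _ => by rw [h2 i]

/-- For a section in normal form, the value of `ψ` is the cubic form of the coefficients. -/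
theorem psiFam_of_isCubicAt (hX : HasInverses X) (hXq : IsQuasiProjective X)
    (hXs : IsSmoothSurface X) (hτ : τ ∈ invK L m U) (hx : toSym (DiagPt.toPow ⟨x, x, z⟩) ∈ U)
    (hx' : w₃ ⟨x, toSym z⟩ ∈ U) (he : IsFrameAt L e x) (hu : IsParamAt u x)
    {H : Fin 2 → Fin 2 → Fin 2 → Pow X (m + 3) → ℂ}
    (hH : IsCubicAt u e τ H (DiagPt.toPow ⟨x, x, z⟩)) :
    psiFam τ ⟨⟨x, toSym z⟩, hx'⟩ =
      cubic (fun i j k => H i j k (DiagPt.toPow ⟨x, x, z⟩)) (symD u x) ⊗ₜ[ℂ] frameW e x := by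
  have hr := he.isRegularSectionAt
  have hW : ∀ j, InIdeal (coordDiff u 1 2 j) (DiagPt.toPow ⟨x, x, z⟩)
      (diagIdeal 1 2 (DiagPt.toPow ⟨x, x, z⟩)) := fun j =>
    inIdeal_coordDiff (p := DiagPt.toPow ⟨x, x, z⟩) hu.1 hu.1 j
  rw [psiFam_eq hX hXq hXs hτ hx hx' (ι := Fin 2 × Fin 2 × Fin 2) (fun k => H k.1 k.2.1 k.2.2)
    (fun k => coordDiff u 1 2 k.2.1) (fun k => coordDiff u 1 2 k.2.2) (fun k => u k.1)
    (fun _ => e) (fun _ => e) (fun _ => e) (fun _ => e)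
    (fun k => ⟨hH.1 _ _ _, hW _, hW _⟩) (fun k => ⟨hu.1 _, hr, hr, hr, hr⟩)]
  · have hd : ∀ j, dAt (fun y => coordDiff u 1 2 j (DiagPt.toPow (⟨x, y, z⟩ : DiagPt X m))) x =
        dAt (u j) x := fun j => by
      change dAt (fun y => u j y - u j x) x = _
      rw [dAt_sub (hu.1 j) (isRegularAt_const _), dAt_const, sub_zero]
    simp only [hd, cubic, Fintype.sum_prod_type, TensorProduct.sum_tmul]
    rfl
  · filter_upwards [hH.2] with q h hq
    rw [h hq]
    simp only [Fintype.sum_prod_type, Finset.sum_smul]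
    refine Finset.sum_congr rfl fun i _ => Finset.sum_congr rfl fun j _ =>
      Finset.sum_congr rfl fun k _ => congrArg (· • _) ?_
    ring

end NormalForm

/-! ### The morphism `ψ` -/

section PsiHom

variable {X : Type} [FunctionSpace X] {L : LineBundle X} {m : ℕ} {e : ∀ x, L.Fib x}
  {U V : Opens (SymPow X (m + 3))} {u : Fin 2 → X → ℂ} {x : X} {z : Fin m → X}
  {τ τ' : ∀ p : {p : DiagPt X m // toSym p.toPow ∈ U}, FibK L m p.1}
  {H H' : Fin 2 → Fin 2 → Fin 2 → Pow X (m + 3) → ℂ} {P : Pow X (m + 3)}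

theorem IsCubicAt.eventually (h : IsCubicAt u e τ H P) : ∀ᶠ Q in 𝓝 P, IsCubicAt u e τ H Q := by
  have h2 := h.2
  rw [eventually_comap_diag] at h2
  filter_upwards [eventually_all.2 fun i => eventually_all.2 fun j => eventually_all.2 fun k =>
    (h.1 i j k).eventually, h2.eventually_nhds] with Q h3 h4
  exact ⟨h3, eventually_comap_diag.2 h4⟩

theorem IsCubicAt.add (h : IsCubicAt u e τ H P) (h' : IsCubicAt u e τ' H' P) :
    IsCubicAt u e (τ + τ') (fun i j k q => H i j k q + H' i j k q) P := by
  refine ⟨fun i j k => (h.1 i j k).add (h'.1 i j k), ?_⟩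
  filter_upwards [h.2, h'.2] with q h1 h2 hq
  rw [Pi.add_apply, h1, h2]
  simp only [mul_add, Finset.sum_add_distrib, add_smul]

theorem IsCubicAt.smul {f : SymPow X (m + 3) → ℂ} (hf : IsRegularAt (fun q => f (toSym q)) P)
    (h : IsCubicAt u e τ H P) {τ' : ∀ p : {p : DiagPt X m // toSym p.toPow ∈ U}, FibK L m p.1}
    (hτ' : ∀ p, τ' p = f (toSym p.1.toPow) • τ p) :
    IsCubicAt u e τ' (fun i j k q => f (toSym q) * H i j k q) P := by
  refine ⟨fun i j k => hf.mul (h.1 i j k), ?_⟩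
  filter_upwards [h.2] with q h1 hq
  rw [hτ', h1]
  simp only [Finset.smul_sum, smul_smul, Finset.mul_sum]
  refine Finset.sum_congr rfl fun i _ => congrArg (· • _) (Finset.sum_congr rfl fun j _ =>
    Finset.sum_congr rfl fun k _ => ?_)
  ring

theorem IsCubicAt.restrictFamily (hVU : V ≤ U) (h : IsCubicAt u e τ H P) :
    IsCubicAt u e (restrictFamily (Fib := FibK L m) hVU τ : ∀ p : {p : DiagPt X m //
      toSym p.toPow ∈ V}, FibK L m p.1) H P := by
  refine ⟨h.1, ?_⟩
  filter_upwards [h.2] with q h1 hq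
  exact h1 (hVU hq)

/-- The normal form at `(x, x, x, z)` of a section of `𝒦¹_{(1)(1)}(-2Δ)`, and of its image. -/
theorem exists_psiFam_eq (hX : HasInverses X) (hXq : IsQuasiProjective X)
    (hXs : IsSmoothSurface X) (hτ : τ ∈ (sheafK L m 2).sec U) (hx' : w₃ ⟨x, toSym z⟩ ∈ U)
    (he : IsFrameAt L e x) (hu : IsParamAt u x) :
    ∃ H, IsCubicAt u e τ H (DiagPt.toPow ⟨x, x, z⟩) ∧
      ∀ {V : Opens (SymPow X (m + 3))} (h : w₃ ⟨x, toSym z⟩ ∈ V)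
        {τ' : ∀ p : {p : DiagPt X m // toSym p.toPow ∈ V}, FibK L m p.1} {H'},
        τ' ∈ invK L m V → IsCubicAt u e τ' H' (DiagPt.toPow ⟨x, x, z⟩) →
        psiFam τ' ⟨⟨x, toSym z⟩, h⟩ = cubic (fun i j k => H' i j k (DiagPt.toPow ⟨x, x, z⟩))
          (symD u x) ⊗ₜ[ℂ] frameW e x := by
  obtain ⟨H, hH⟩ := exists_isCubicAt hX hXq hτ (w₃_toSym x z ▸ hx') he hu
  exact ⟨H, hH, fun h _ _ hτ' hH' =>
    psiFam_of_isCubicAt hX hXq hXs hτ' (w₃_toSym x z ▸ h) h he hu hH'⟩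

theorem psiFam_add (hX : HasInverses X) (hXq : IsQuasiProjective X) (hXs : IsSmoothSurface X)
    (hτ : τ ∈ (sheafK L m 2).sec U) (hτ' : τ' ∈ (sheafK L m 2).sec U) :
    psiFam (τ + τ') = psiFam τ + psiFam τ' := by
  funext ⟨⟨x, t⟩, hx⟩
  obtain ⟨z, rfl⟩ := toSym_surjective t
  obtain ⟨e, he⟩ := exists_isFrameAt (L := L) x
  obtain ⟨u, hu⟩ := exists_isParamAt_of_smooth hXq hXs x
  obtain ⟨H, hH, h1⟩ := exists_psiFam_eq hX hXq hXs hτ hx he.self_of_nhds hu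
  obtain ⟨H', hH', -⟩ := exists_psiFam_eq hX hXq hXs hτ' hx he.self_of_nhds hu
  rw [Pi.add_apply, h1 hx hτ.2 hH, h1 hx hτ'.2 hH', h1 hx (add_mem hτ.2 hτ'.2) (hH.add hH'),
    ← TensorProduct.add_tmul]
  exact congrArg (· ⊗ₜ[ℂ] _) (cubic_add _ _ _)

theorem psiFam_smul (hX : HasInverses X) (hXq : IsQuasiProjective X) (hXs : IsSmoothSurface X)
    (hτ : τ ∈ (sheafK L m 2).sec U) {f : SymPow X (m + 3) → ℂ} (hf : IsRegularOn f U)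
    (hτ' : τ' ∈ invK L m U) (hf' : ∀ p, τ' p = f (toSym p.1.toPow) • τ p)
    (p : {p : ProdVar X (SymPow X m) // w₃ p ∈ U}) :
    psiFam τ' p = f (w₃ p.1) • psiFam τ p := by
  obtain ⟨⟨x, t⟩, hx⟩ := p
  obtain ⟨z, rfl⟩ := toSym_surjective t
  obtain ⟨e, he⟩ := exists_isFrameAt (L := L) x
  obtain ⟨u, hu⟩ := exists_isParamAt_of_smooth hXq hXs x
  obtain ⟨H, hH, h1⟩ := exists_psiFam_eq hX hXq hXs hτ hx he.self_of_nhds hu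
  have hr : IsRegularAt (fun q => f (toSym q)) (DiagPt.toPow ⟨x, x, z⟩) :=
    (isMorphismAt_toSym _).comp f (hf _ (w₃_toSym x z ▸ hx))
  rw [h1 hx hτ.2 hH, h1 hx hτ' (hH.smul hr hf'), TensorProduct.smul_tmul']
  refine congrArg (· ⊗ₜ[ℂ] _) ((cubic_smul _ _ _).trans ?_)
  exact congrArg (fun t => f t • _) (w₃_toSym x z).symm

theorem psiFam_const_smul (hX : HasInverses X) (hXq : IsQuasiProjective X)
    (hXs : IsSmoothSurface X) (hτ : τ ∈ (sheafK L m 2).sec U) (r : ℂ) :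
    psiFam (r • τ) = r • psiFam τ :=
  funext fun p => psiFam_smul hX hXq hXs hτ (f := fun _ => r) (fun _ _ => isRegularAt_const r)
    ((invK L m U).smul_mem r hτ.2) (fun _ => rfl) p

theorem psiFam_restrictFamily (hX : HasInverses X) (hXq : IsQuasiProjective X)
    (hXs : IsSmoothSurface X) (hVU : V ≤ U) (hτ : τ ∈ (sheafK L m 2).sec U) :
    psiFam (restrictFamily (Fib := FibK L m) hVU τ) =
      restrictFamily (Fib := FibW L m) hVU (psiFam τ) := by
  funext ⟨⟨x, t⟩, hx⟩
  obtain ⟨z, rfl⟩ := toSym_surjective t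
  obtain ⟨e, he⟩ := exists_isFrameAt (L := L) x
  obtain ⟨u, hu⟩ := exists_isParamAt_of_smooth hXq hXs x
  obtain ⟨H, hH, h1⟩ := exists_psiFam_eq hX hXq hXs hτ (hVU hx) he.self_of_nhds hu
  exact (h1 hx ((sheafK L m 2).res_mem hVU τ hτ).2 (hH.restrictFamily hVU)).trans
    (h1 (hVU hx) hτ.2 hH).symm

/-- A cubic form in two variables is determined by its values at `(1, 0)`, `(0, 1)`, `(1, 1)` and
`(1, -1)`. -/
theorem cubic_eq_eval {A : Type*} [CommRing A] [Algebra ℂ A] (C : Fin 2 → Fin 2 → Fin 2 → ℂ)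
    (a : Fin 2 → A) :
    cubic C a = cubic C ![(1 : ℂ), 0] • (a 0 * a 0 * a 0) +
      ((cubic C ![(1 : ℂ), 1] - cubic C ![(1 : ℂ), -1]) / 2 - cubic C ![(0 : ℂ), 1]) •
        (a 0 * a 0 * a 1) +
      ((cubic C ![(1 : ℂ), 1] + cubic C ![(1 : ℂ), -1]) / 2 - cubic C ![(1 : ℂ), 0]) •
        (a 0 * a 1 * a 1) + cubic C ![(0 : ℂ), 1] • (a 1 * a 1 * a 1) := by
  have h2 : algebraMap ℂ A 2⁻¹ * 2 = 1 := by
    rw [← map_ofNat (algebraMap ℂ A) 2, ← map_mul]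
    norm_num
  have e1 : (cubic C ![(1 : ℂ), 1] - cubic C ![(1 : ℂ), -1]) / 2 - cubic C ![(0 : ℂ), 1] =
      C 0 0 1 + C 0 1 0 + C 1 0 0 := by
    simp only [cubic_eq, smul_eq_mul, Matrix.cons_val_zero, Matrix.cons_val_one]
    ring
  have e2 : (cubic C ![(1 : ℂ), 1] + cubic C ![(1 : ℂ), -1]) / 2 - cubic C ![(1 : ℂ), 0] =
      C 0 1 1 + C 1 0 1 + C 1 1 0 := by
    simp only [cubic_eq, smul_eq_mul, Matrix.cons_val_zero, Matrix.cons_val_one]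
    ring
  have e3 : cubic C ![(1 : ℂ), 0] = C 0 0 0 := by
    simp [cubic_eq]
  have e4 : cubic C ![(0 : ℂ), 1] = C 1 1 1 := by
    simp [cubic_eq]
  rw [e1, e2, e3, e4, cubic_eq]
  simp only [pow_succ, pow_zero, one_mul, mul_assoc]

/-- The point `(x, x, x, z)` for `(x, z) ∈ X^{m+1}`. -/
def thickDiag {X : Type} {m : ℕ} (Q : Pow X (m + 1)) : Pow X (m + 3) :=
  DiagPt.toPow ⟨Q 0, Q 0, reindex Fin.succ Q⟩

theorem isMorphismAt_thickDiag (Q : Pow X (m + 1)) : IsMorphismAt thickDiag Q :=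
  isMorphismAt_toPow (hasInverses_pow _) (isMorphismAt_proj 0 Q) (isMorphismAt_proj 0 Q)
    (isMorphismAt_proj 0 Q) fun i => isMorphismAt_proj i.succ Q

theorem w₃_headTail {X : Type} {m : ℕ} (Q : Pow X (m + 1)) : w₃ (headTail Q) = toSym (thickDiag Q) :=
  w₃_toSym _ _

/-- The coefficients of the cubic form `ψ(τ)` are regular functions on `X × S^m X`: they are
combinations of its values at four vectors, which are well defined functions on `X × S^m X` with
regular pull-back to `X^{m+1}`. -/
theorem psiFam_mem (hX : HasInverses X) (hXq : IsQuasiProjective X)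
    (hXs : IsSmoothSurface X) (hτ : τ ∈ (sheafK L m 2).sec U) :
    psiFam τ ∈ (sheafW L m).sec U := by
  classical
  intro p hp
  obtain ⟨e, he⟩ := exists_isFrameAt (L := L) p.fst
  obtain ⟨u, hu⟩ := exists_isParamAt_of_smooth hXq hXs p.fst
  -- the value of the cubic form `ψ(τ)` on a vector with coordinates `w`
  let E : (Fin 2 → ℂ) → ProdVar X (SymPow X m) → ℂ := fun w q =>
    if h : w₃ q ∈ U then evalForm (fun i => dAt (u i) q.fst) (frameW e q.fst) w (psiFam τ ⟨q, h⟩)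
    else 0
  have key : ∀ Q : Pow X (m + 1), headTail Q = p → ∃ H : Fin 2 → Fin 2 → Fin 2 →
      Pow X (m + 3) → ℂ, (∀ i j k, IsRegularAt (H i j k) (thickDiag Q)) ∧ ∀ᶠ Q' in 𝓝 Q,
        (∀ h, psiFam τ ⟨headTail Q', h⟩ =
          cubic (fun i j k => H i j k (thickDiag Q')) (symD u (Q' 0)) ⊗ₜ[ℂ] frameW e (Q' 0)) ∧
        (∀ w, E w (headTail Q') = cubic (fun i j k => H i j k (thickDiag Q')) w) := by
    rintro Q rfl
    obtain ⟨H, hH⟩ := exists_isCubicAt hX hXq hτ (x := Q 0) (z := reindex Fin.succ Q)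
      (w₃_headTail Q ▸ hp) he.self_of_nhds hu
    refine ⟨H, hH.1, ?_⟩
    filter_upwards [(isMorphismAt_thickDiag Q).continuousAt.eventually hH.eventually,
      (isMorphismAt_proj 0 Q).continuousAt.eventually (hu.eventually hX hXq),
      (isMorphismAt_proj 0 Q).continuousAt.eventually he,
      (isMorphismAt_thickDiag Q).continuousAt.eventually
        (eventually_mem_opens (w₃_headTail Q ▸ hp))] with Q' h1 h2 h3 h4
    have h5 : ∀ h, psiFam τ ⟨headTail Q', h⟩ =
        cubic (fun i j k => H i j k (thickDiag Q')) (symD u (Q' 0)) ⊗ₜ[ℂ] frameW e (Q' 0) :=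
      fun h => psiFam_of_isCubicAt hX hXq hXs hτ.2 (w₃_headTail Q' ▸ h) h h3 h2 h1
    refine ⟨h5, fun w => ?_⟩
    have h6 : w₃ (headTail Q') ∈ U := (w₃_headTail Q').symm ▸ h4
    change (if h : w₃ (headTail Q') ∈ U then _ else _) = _
    rw [dif_pos h6]
    exact (congrArg _ (h5 h6)).trans
      (evalForm_cubic (h2.linearIndependent hXs) h3.frameW_ne_zero w _)
  have hE : ∀ w, IsRegularAt (E w) p := fun w => isRegularAt_of_headTail hXq fun Q hQ => by
    obtain ⟨H, hH, h1⟩ := key Q hQ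
    refine IsRegularAt.congr (f := fun Q' => cubic (fun i j k => H i j k (thickDiag Q')) w) ?_
      (h1.mono fun Q' h => (h.2 w).symm)
    exact IsRegularAt.sum _ fun i _ => IsRegularAt.sum _ fun j _ => IsRegularAt.sum _ fun k _ =>
      ((isMorphismAt_thickDiag Q).comp _ (hH i j k)).mul (isRegularAt_const _)
  have hr := he.self_of_nhds.isRegularSectionAt
  have hgen : ∀ (f : ProdVar X (SymPow X m) → ℂ) (i j k : Fin 2), IsRegularAt f p →
      (fun q : ProdVar X (SymPow X m) => f q • ((symD u q.fst i * symD u q.fst j *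
        symD u q.fst k) ⊗ₜ[ℂ] frameW e q.fst)) ∈ Submodule.span ℂ (genW L m p) :=
    fun f i j k hf => Submodule.subset_span ⟨f, u i, u j, u k, e, e, e, e, hf, hu.1 i, hu.1 j,
      hu.1 k, hr, hr, hr, hr, rfl⟩
  refine ⟨_, add_mem (add_mem (add_mem (hgen (E ![1, 0]) 0 0 0 (hE _))
    (hgen (fun q => 2⁻¹ * (E ![1, 1] q - E ![1, -1] q) - E ![0, 1] q) 0 0 1
      ((IsRegularAt.const_mul _ ((hE _).sub (hE _))).sub (hE _))))
    (hgen (fun q => 2⁻¹ * (E ![1, 1] q + E ![1, -1] q) - E ![1, 0] q) 0 1 1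
      ((IsRegularAt.const_mul _ ((hE _).add (hE _))).sub (hE _))))
    (hgen (E ![0, 1]) 1 1 1 (hE _)), Eventually.filter_mono inf_le_left ?_⟩
  filter_upwards [eventually_nhds_prodVar hXq (C := fun Q' =>
    (∃ C, (∀ h, psiFam τ ⟨headTail Q', h⟩ = cubic C (symD u (Q' 0)) ⊗ₜ[ℂ] frameW e (Q' 0)) ∧
        ∀ w, E w (headTail Q') = cubic C w)) fun Q hQ => by
      obtain ⟨H, -, h1⟩ := key Q hQ
      exact h1.mono fun Q' h => ⟨_, h⟩] with q hq h
  obtain ⟨Q, rfl⟩ := headTail_surjective q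
  obtain ⟨C, h1, h2⟩ := hq Q rfl
  rw [h1 h, cubic_eq_eval]
  simp only [Pi.add_apply, h2, TensorProduct.add_tmul, ← TensorProduct.smul_tmul', div_eq_inv_mul]
  rfl

variable (L m) in
/-- The symmetrised second order differential. -/
def psiHom (hX : HasInverses X) (hXq : IsQuasiProjective X) (hXs : IsSmoothSurface X) :
    SectionSheaf.Hom (sheafK L m 2) (sheafW L m) where
  app _ :=
    { toFun := fun τ => ⟨psiFam τ.1, psiFam_mem hX hXq hXs τ.2⟩
      map_add' := fun τ τ' => Subtype.ext (psiFam_add hX hXq hXs τ.2 τ'.2)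
      map_smul' := fun r τ => Subtype.ext (psiFam_const_smul hX hXq hXs τ.2 r) }
  app_res h τ := Subtype.ext (psiFam_restrictFamily hX hXq hXs h τ.2)
  app_smul _ _ hf τ τ' h := funext fun p =>
    psiFam_smul hX hXq hXs τ.2 hf τ'.2.2 (fun p => congrFun h p) p

theorem isSymSecondDifferential_psiHom (hX : HasInverses X) (hXq : IsQuasiProjective X)
    (hXs : IsSmoothSurface X) : IsSymSecondDifferential (psiHom L m hX hXq hXs) :=
  fun _ τ x z hx _ f g h α a b c d hf hr hs =>
    psiFam_eq hX hXq hXs τ.2.2 (w₃_toSym x z ▸ hx) hx f g h α a b c d hf hr hs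

end PsiHom

/-! ### The kernel of `ψ` -/

section ExactK

variable {X : Type} [FunctionSpace X] {L : LineBundle X} {m : ℕ} {e : ∀ x, L.Fib x}
  {U V : Opens (SymPow X (m + 3))} {u : Fin 2 → X → ℂ} {x : X} {z : Fin m → X}
  {τ : ∀ p : {p : DiagPt X m // toSym p.toPow ∈ U}, FibK L m p.1}

/-- The coordinate of `s` is `∑ U_i W_j W_k R_ijk` near a point `P` of the triple diagonal, with
`U_i = u_i(x₂) - u_i(x₁)` and `W_j = u_j(x₃) - u_j(x₂)`, and the value of `ψ(d¹_Δ(s))` is the cubic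
form with coefficients `R(P)`. The restriction to `x₁ = x₃`, where the coordinate vanishes, is the
function `∑ U_i U_j U_k R_ijk`, whence this form is zero. -/
theorem psiFam_deltaFam (hX : HasInverses X) (hXq : IsQuasiProjective X)
    (hXs : IsSmoothSurface X)
    {s : ∀ p : {p : Triple X m // toSym p.toPow ∈ U}, FibL L m p.1}
    (hs : s ∈ (sheafL L m 1).sec U) : psiFam (deltaFam s) = 0 := by
  funext ⟨⟨x, t⟩, hx⟩
  obtain ⟨z, rfl⟩ := toSym_surjective t
  have hx' : toSym (DiagPt.toPow ⟨x, x, z⟩) ∈ U := w₃_toSym x z ▸ hx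
  obtain ⟨e, he⟩ := exists_isFrameAt (L := L) x
  obtain ⟨u, hu⟩ := exists_isParamAt_of_smooth hXq hXs x
  have he' : IsFrame₂ e (⟨x, x, z⟩ : DiagPt X m) := ⟨he.self_of_nhds, he.self_of_nhds⟩
  obtain ⟨K, hK, e1, e2⟩ := exists_deltaFam_eq hX hXq hx' he' hs hu
  choose R hR e3 using fun i => (inIdeal_diagIdeal_sq_iff hX hXq
    (p := DiagPt.toPow ⟨x, x, z⟩) (i := 1) (j := 2) rfl hu).1 (hK i)
  have hc : IsCubicAt u e (deltaFam s) R (DiagPt.toPow ⟨x, x, z⟩) := by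
    refine ⟨hR, ?_⟩
    filter_upwards [e2, tendsto_comap.eventually (eventually_all.2 e3)] with q h1 h2 hq
    rw [h1 hq]
    exact Finset.sum_congr rfl fun i _ => by rw [h2 i]
  have hφ := isMorphismAt_second hX x x x z
  have h0 := (eventually_coordL_eq_zero hX hs.1 (p := ⟨x, x, x, z⟩) hx' he'.isFrame₃).2
  have hl := hasLead_cubic hu (H := fun i j k y => R i j k (Triple.toPow ⟨x, y, x, z⟩))
    fun i j k => hφ.comp _ (hR i j k)
  have hz : cubic (fun i j k => R i j k (Triple.toPow ⟨x, x, x, z⟩)) (symD u x) = 0 := by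
    refine hl.unique hXs hu (HasLead.zero.congr ?_)
    filter_upwards [hφ.continuousAt.eventually h0, hφ.continuousAt.eventually e1,
      hφ.continuousAt.eventually (eventually_all.2 e3)] with y h1 h2 h3
    rw [h1 (Or.inr (Or.inl rfl))] at h2
    refine h2.trans ?_
    simp only [h3]
    simp only [cubic, Finset.sum_mul, smul_eq_mul]
    refine Finset.sum_congr rfl fun i _ => Finset.sum_congr rfl fun j _ =>
      Finset.sum_congr rfl fun k _ => ?_
    change (u j x - u j y) * (u k x - u k y) * _ * (u i y - u i x) = _
    ring
  rw [psiFam_of_isCubicAt hX hXq hXs (deltaFam_mem hX hXq hXs hs).2 hx' hx he.self_of_nhds hu hc]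
  exact (congrArg (· ⊗ₜ[ℂ] frameW e x) hz).trans (TensorProduct.zero_tmul _ _)

/-- The contraction `M ⊗ N → M` with a linear functional which maps `E` to `1`. -/
def contract {M N : Type*} [AddCommGroup M] [Module ℂ M] [AddCommGroup N] [Module ℂ N] (E : N) :
    M ⊗[ℂ] N →ₗ[ℂ] M :=
  (TensorProduct.rid ℂ M).toLinearMap ∘ₗ TensorProduct.map LinearMap.id (unitDual E)

theorem contract_sum {M N : Type*} [AddCommGroup M] [Module ℂ M] [AddCommGroup N] [Module ℂ N]
    {E : N} (hE : E ≠ 0) (T : Fin 2 → ℂ) (v : Fin 2 → M) :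
    contract E (∑ i, T i • (v i ⊗ₜ[ℂ] E)) = ∑ i, T i • v i := by
  simp [contract, unitDual_self hE]

open Classical in
/-- The value at `(x, x, w, z)` of the section `τ` as a cotangent vector at `x`, in terms of the
frame `e`. -/
def formK (e : ∀ x, L.Fib x)
    (τ : ∀ p : {p : DiagPt X m // toSym p.toPow ∈ U}, FibK L m p.1) (p : DiagPt X m) :
    CotSpace p.x :=
  if h : toSym p.toPow ∈ U then contract (frameK e p) (τ ⟨p, h⟩) else 0

theorem formK_of_eq {p : DiagPt X m} (hp : IsFrame₂ e p) (h : toSym p.toPow ∈ U) {T : Fin 2 → ℂ}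
    (hτ : τ ⟨p, h⟩ = ∑ i, T i • (dAt (u i) p.x ⊗ₜ frameK e p)) :
    formK e τ p = ∑ i, T i • dAt (u i) p.x := by
  rw [formK, dif_pos h, hτ]
  exact contract_sum hp.ne_zero T _

theorem formK_tmul_frameK (hX : HasInverses X) (hXq : IsQuasiProjective X)
    (hXs : IsSmoothSurface X) (hτ : τ ∈ (sheafK L m 2).sec U) {p : DiagPt X m}
    (hp : toSym p.toPow ∈ U) (he : IsFrame₂ e p) :
    formK e τ p ⊗ₜ[ℂ] frameK e p = τ ⟨p, hp⟩ := by
  obtain ⟨u, hu⟩ := exists_isParamAt_of_smooth hXq hXs p.x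
  obtain ⟨T, -, h1⟩ := exists_coord_of_mem_sec_sheafK hX hXq hτ hp he hu
  rw [eventually_comap_diag] at h1
  have h2 : τ ⟨p, hp⟩ = ∑ i, T i p.toPow • (dAt (u i) p.x ⊗ₜ frameK e p) :=
    h1.self_of_nhds rfl hp
  rw [formK_of_eq he hp h2, h2, TensorProduct.sum_tmul]
  rfl

theorem formK_comp_perm (hτ : τ ∈ invK L m U) (x w : X) (z : Fin m → X)
    (σ : Equiv.Perm (Fin m)) :
    formK e τ ⟨x, w, fun i => z (σ i)⟩ = formK e τ ⟨x, w, z⟩ := by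
  have h1 : toSym (DiagPt.toPow ⟨x, w, fun i => z (σ i)⟩) = toSym (DiagPt.toPow ⟨x, w, z⟩) :=
    toSym_perm x x w z σ
  by_cases h : toSym (DiagPt.toPow ⟨x, w, z⟩) ∈ U
  · have h' : toSym (DiagPt.toPow ⟨x, w, fun i => z (σ i)⟩) ∈ U := h1 ▸ h
    rw [formK, formK, dif_pos h, dif_pos h']
    exact congrArg (contract (frameK e (⟨x, w, z⟩ : DiagPt X m))) (hτ x w z σ h h')
  · have h' : toSym (DiagPt.toPow ⟨x, w, fun i => z (σ i)⟩) ∉ U := fun hh => h (h1 ▸ hh)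
    rw [formK, formK, dif_neg h, dif_neg h']

/-- A section of the kernel of `ψ` is locally, on `X^{m+3}`, the differential of a function. -/
theorem exists_isLift_of_psiFam_eq_zero (hX : HasInverses X) (hXq : IsQuasiProjective X)
    (hXs : IsSmoothSurface X) (hτ : τ ∈ (sheafK L m 2).sec U) (h0 : psiFam τ = 0)
    {p : Pow X (m + 3)} (hp : toSym p ∈ U) (he : ∀ i, IsFrameAt L e (p i)) :
    ∃ F, ∀ᶠ q in 𝓝 p, IsLift (fun q => formK e τ (DiagPt.ofPow q)) F q := by
  by_cases h01 : p 0 = p 1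
  swap
  · exact ⟨_, eventually_isLift_of_ne hXq h01⟩
  have hpd := DiagPt.toPow_ofPow h01
  obtain ⟨u, hu⟩ := exists_isParamAt_of_smooth hXq hXs (p 0)
  have he' : IsFrame₂ e (DiagPt.ofPow p) := ⟨he 0, he 2⟩
  have hp' : toSym (DiagPt.ofPow p).toPow ∈ U := hpd.symm ▸ hp
  have hfr := he'.eventually hX
  rw [hpd] at hfr
  by_cases h02 : p 0 = p 2
  swap
  · obtain ⟨T, hT, e1⟩ := exists_coord_of_mem_sec_sheafK hX hXq hτ hp' he' hu
    rw [hpd] at e1 hT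
    rw [eventually_comap_diag] at e1
    refine ⟨_, eventually_isLift_of_ne_third hX hXq h01 h02 hu (fun i => (hT i).1) ?_⟩
    filter_upwards [e1, hfr, eventually_mem_opens hp] with q h1 h2 h3 h4
    have h5 := DiagPt.toPow_ofPow h4
    have h6 := formK_of_eq h2 (h5.symm ▸ h3) (h1 h4 (h5.symm ▸ h3))
    rw [h5] at h6
    exact h6
  · have hpt : DiagPt.toPow ⟨p 0, p 0, tail p⟩ = p := by
      conv_rhs => rw [← hpd]
      exact congrArg (fun w => DiagPt.toPow (⟨p 0, w, tail p⟩ : DiagPt X m)) h02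
    obtain ⟨H, hH⟩ := exists_isCubicAt hX hXq hτ (x := p 0) (z := tail p) (hpt.symm ▸ hp) (he 0) hu
    rw [hpt] at hH
    -- the coefficients only matter on `Δ₁₂`
    let ρ : Pow X (m + 3) → Pow X (m + 3) := fun q => (DiagPt.ofPow q).toPow
    have hρ : IsMorphismAt ρ p := isMorphismAt_toPow (hasInverses_pow _) (isMorphismAt_proj 0 p)
      (isMorphismAt_proj 0 p) (isMorphismAt_proj 2 p) fun i => isMorphismAt_proj _ p
    have hρp : ρ p = p := hpd
    refine eventually_isLift_of_eq hX hXq h01 h02 hu (H := fun i j k q => H i j k (ρ q))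
      (fun i j k => hρ.comp _ (hρp.symm ▸ hH.1 i j k)) ?_ ?_
    · have e1 := hH.2
      rw [eventually_comap_diag] at e1
      filter_upwards [e1, hfr, eventually_mem_opens hp] with q h1 h2 h3 h4
      have h5 := DiagPt.toPow_ofPow h4
      have h6 := formK_of_eq h2 (h5.symm ▸ h3) (h1 h4 (h5.symm ▸ h3))
      have h7 : ∀ j, coordDiff u 1 2 j (DiagPt.ofPow q).toPow = coordDiff u 0 2 j q := fun j => rfl
      simp only [h7] at h6
      exact h6
    · have h1 := hρ.continuousAt.eventually (p := fun Q => IsCubicAt u e τ H Q)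
        (hρp.symm ▸ hH.eventually)
      filter_upwards [h1, hfr, (isMorphismAt_proj 0 p).continuousAt.eventually
        (hu.eventually hX hXq), hρ.continuousAt.eventually (p := fun Q => toSym Q ∈ U)
          (hρp.symm ▸ eventually_mem_opens hp)] with q h2 h3 h4 h5 h6
      have h7 : ρ q = DiagPt.toPow ⟨q 0, q 0, tail q⟩ :=
        congrArg (fun w => DiagPt.toPow (⟨q 0, w, tail q⟩ : DiagPt X m)) h6.symm
      rw [h7] at h2 h5
      have h8 : w₃ ⟨q 0, toSym (tail q : Pow X m)⟩ ∈ U := (w₃_toSym _ _).symm ▸ h5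
      have h9 := psiFam_of_isCubicAt hX hXq hXs hτ.2 h5 h8 h3.1 h4 h2
      rw [h0] at h9
      rw [h7]
      exact cubicZero_of_tmul_eq_zero (h4.linearIndependent hXs) h3.1.frameW_ne_zero h9.symm

end ExactK

section GlueK

variable {X : Type} [FunctionSpace X] {L : LineBundle X} {m : ℕ} {e : ∀ x, L.Fib x}
  {U V : Opens (SymPow X (m + 3))}
  {τ : ∀ p : {p : DiagPt X m // toSym p.toPow ∈ U}, FibK L m p.1}

theorem exists_frame_fibre (hX : HasInverses X) (hXq : IsQuasiProjective X) {n : ℕ}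
    (t : SymPow X n) : ∃ e : ∀ x, L.Fib x, ∀ᶠ t' in 𝓝 t, ∀ q : Pow X n, toSym q = t' →
      ∀ i, IsFrameAt L e (q i) := by
  obtain ⟨e, he⟩ := exists_frame_of_finite (L := L) hX hXq
    (Set.finite_iUnion fun i => (finite_toSym_fibre t).image fun q : Pow X n => q i)
  refine ⟨e, eventually_nhds_symPow fun p hp => eventually_all.2 fun i => ?_⟩
  exact (isMorphismAt_proj i p).continuousAt.eventually
    (he _ (Set.mem_iUnion.2 ⟨i, p, hp, rfl⟩))

theorem exists_opens_of_eventually {S : Type} [FunctionSpace S] {U : Opens S} {t : S} (ht : t ∈ U)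
    {C : S → Prop} (h : ∀ᶠ t' in 𝓝 t, C t') :
    ∃ V : Opens S, V ≤ U ∧ t ∈ V ∧ ∀ t' ∈ V, C t' := by
  obtain ⟨V, hV, hVo, htV⟩ := mem_nhds_iff.1 h
  exact ⟨⟨V, hVo⟩ ⊓ U, inf_le_right, ⟨htV, ht⟩, fun t' ht' => hV ht'.1⟩

/-- A function which is symmetric and vanishes on the diagonals, times a frame, is a section of
`𝓛^{2,1,1}(-Δ)`. -/
theorem smul_frameL_mem {G : Pow X (m + 3) → ℂ}
    (hG : ∀ q, toSym q ∈ V → IsRegularAt G q ∧ (q 0 = q 1 ∨ q 0 = q 2 ∨ q 1 = q 2 → G q = 0))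
    (he : ∀ q : Pow X (m + 3), toSym q ∈ V → ∀ i, IsFrameAt L e (q i))
    (h1 : ∀ q, G (swapPow q) = G q) (h2 : ∀ σ q, G (permPow σ q) = G q) :
    (fun p : {p : Triple X m // toSym p.toPow ∈ V} => G p.1.toPow • frameL e p.1) ∈
      (sheafL L m 1).sec V := by
  refine ⟨mem_localSec_genL fun p hp => ⟨e, G, ⟨he _ hp 0, he _ hp 1, he _ hp 2⟩, ?_, ?_⟩, ?_, ?_⟩
  · have h3 : ∀ᶠ q in 𝓝 p.toPow, q 0 = q 1 ∨ q 0 = q 2 ∨ q 1 = q 2 → G q = 0 := by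
      filter_upwards [eventually_mem_opens hp] with q hq using (hG q hq).2
    simp only [tripleIdeal, pow_one, inIdeal_inf, inIdeal_diagIdeal]
    have h4 := (hG _ hp).1
    exact ⟨⟨⟨h4, h3.mono fun q h h' => h (Or.inl h')⟩,
      ⟨h4, h3.mono fun q h h' => h (Or.inr (Or.inl h'))⟩⟩,
      ⟨h4, h3.mono fun q h h' => h (Or.inr (Or.inr h'))⟩⟩
  · refine Eventually.of_forall fun q h => ?_
    exact congrArg (fun q' => G q' • frameL e (Triple.ofPow q)) (Triple.toPow_ofPow q)
  · intro x₁ x₂ x₃ z h h'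
    change G (Triple.toPow ⟨x₁, x₃, x₂, z⟩) • frameL e (⟨x₁, x₃, x₂, z⟩ : Triple X m) =
      LinearMap.lTensor _ _ (G (Triple.toPow ⟨x₁, x₂, x₃, z⟩) •
        frameL e (⟨x₁, x₂, x₃, z⟩ : Triple X m))
    rw [map_smul, ← h1 (Triple.toPow ⟨x₁, x₂, x₃, z⟩)]
    rfl
  · intro x₁ x₂ x₃ z σ h h'
    exact congrArg (· • frameL e (⟨x₁, x₂, x₃, z⟩ : Triple X m))
      (h2 σ (Triple.toPow ⟨x₁, x₂, x₃, z⟩))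

/-- The value of `d¹_Δ` on a function times a frame. -/
theorem deltaFam_smul_frameL (hX : HasInverses X) (hXq : IsQuasiProjective X)
    {G : Pow X (m + 3) → ℂ} {s : ∀ p : {p : Triple X m // toSym p.toPow ∈ V}, FibL L m p.1}
    (hs : s ∈ (sheafL L m 1).sec V) (hsG : ∀ p, s p = G p.1.toPow • frameL e p.1)
    (he : ∀ q : Pow X (m + 3), toSym q ∈ V → ∀ i, IsFrameAt L e (q i))
    {p : DiagPt X m} (hp : toSym p.toPow ∈ V) :
    deltaFam s ⟨p, hp⟩ = dAt (fun y => G (Triple.toPow ⟨p.x, y, p.w, p.z⟩)) p.x ⊗ₜ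
      frameK e p := by
  rw [deltaFam_of_frame hX hXq hp (e := e) ⟨he _ hp 0, he _ hp 2⟩ hs.1]
  refine congrArg (· ⊗ₜ[ℂ] frameK e p) (dAt_congr ?_)
  have h1 := (isMorphismAt_second hX p.x p.x p.w p.z).continuousAt.eventually
    (eventually_mem_opens hp)
  filter_upwards [h1] with y hy
  have h2 : IsFrame₃ e (⟨p.x, y, p.w, p.z⟩ : Triple X m) := ⟨he _ hy 0, he _ hy 1, he _ hy 2⟩
  exact coordL_of_eq h2 (h := hy) (hsG _)

/-- The local lifts of `τ` are glued along the fibre of `π` and symmetrised. -/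
theorem exists_deltaFam_eq_of_psiFam_eq_zero (hX : HasInverses X) (hXq : IsQuasiProjective X)
    (hXs : IsSmoothSurface X) (hτ : τ ∈ (sheafK L m 2).sec U) (h0 : psiFam τ = 0)
    {t : SymPow X (m + 3)} (ht : t ∈ U) :
    ∃ (V : Opens (SymPow X (m + 3))) (hVU : V ≤ U), t ∈ V ∧ ∃ s ∈ (sheafL L m 1).sec V,
      deltaFam s = restrictFamily (Fib := FibK L m) hVU τ := by
  obtain ⟨e, he⟩ := exists_frame_fibre (L := L) hX hXq t
  obtain ⟨F, hF⟩ := exists_isLift hX hXq (D := fun q => formK e τ (DiagPt.ofPow q)) (t := t)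
    fun p hp => exists_isLift_of_psiFam_eq_zero hX hXq hXs hτ h0 (hp ▸ ht)
      fun i => he.self_of_nhds p hp i
  obtain ⟨V, hVU, htV, hV⟩ := exists_opens_of_eventually ht (he.and hF)
  have he' : ∀ q : Pow X (m + 3), toSym q ∈ V → ∀ i, IsFrameAt L e (q i) :=
    fun q hq => (hV _ hq).1 q rfl
  have hG : ∀ q : Pow X (m + 3), toSym q ∈ V → _ := fun q hq =>
    isLift_symmetrize hX (fun q' hq' => (hV _ hq).2 q' hq') fun _ σ =>
      formK_comp_perm hτ.2 (q 0) (q 2) (tail q) σ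
  have hs := smul_frameL_mem (L := L) (fun q hq => ⟨(hG q hq).1, (hG q hq).2.1⟩) he'
    symmetrize_swapPow symmetrize_permPow
  refine ⟨V, hVU, htV, _, hs, ?_⟩
  funext ⟨p, hp⟩
  rw [deltaFam_smul_frameL hX hXq hs (fun _ => rfl) he' hp]
  have h3 : dAt (fun y => symmetrize F (Triple.toPow ⟨p.x, y, p.w, p.z⟩)) p.x = formK e τ p :=
    (hG _ hp).2.2 rfl
  rw [h3]
  exact formK_tmul_frameK hX hXq hXs hτ (hVU hp) ⟨he' _ hp 0, he' _ hp 2⟩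

theorem isExactAt_deltaHom (hX : HasInverses X) (hXq : IsQuasiProjective X)
    (hXs : IsSmoothSurface X) :
    SectionSheaf.IsExactAt (deltaHom hX hXq hXs L m) (psiHom L m hX hXq hXs) := by
  intro U τ
  constructor
  · intro h t ht
    obtain ⟨V, hVU, htV, s, hs, e1⟩ := exists_deltaFam_eq_of_psiFam_eq_zero hX hXq hXs τ.2
      (congrArg Subtype.val h) ht
    exact ⟨V, hVU, htV, ⟨s, hs⟩, Subtype.ext e1⟩
  · intro h
    refine Subtype.ext (funext fun p => ?_)
    obtain ⟨V, hVU, htV, s, e1⟩ := h _ p.2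
    have e2 : deltaFam s.1 = restrictFamily (Fib := FibK L m) hVU τ.1 := congrArg Subtype.val e1
    have e3 := (psiFam_restrictFamily hX hXq hXs hVU τ.2).symm.trans
      ((congrArg psiFam e2).symm.trans (psiFam_deltaFam hX hXq hXs s.2))
    exact congrFun e3 ⟨p.1, htV⟩

end GlueK

/-! ### Surjectivity of `ψ` -/

section Surjective

variable {X : Type} [FunctionSpace X] {L : LineBundle X} {m : ℕ} {e : ∀ x, L.Fib x}
  {U V : Opens (SymPow X (m + 3))} {u : Fin 2 → X → ℂ}
  {ω : ∀ p : {p : ProdVar X (SymPow X m) // w₃ p ∈ U}, FibW L m p.1}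

theorem continuousAt_w₃ (hXq : IsQuasiProjective X) (p : ProdVar X (SymPow X m)) :
    ContinuousAt w₃ p := by
  refine tendsto_nhds.2 fun O hO hp => ?_
  have h := eventually_nhds_prodVar hXq (P := p) (C := fun Q : Pow X (m + 1) =>
    toSym (thickDiag Q) ∈ O) fun Q hQ => (isMorphismAt_thickDiag Q).continuousAt.eventually
      ((isMorphismAt_toSym _).continuousAt.eventually (hO.mem_nhds (by
        rw [← w₃_headTail, hQ]
        exact hp)))
  filter_upwards [h] with q hq
  obtain ⟨Q, rfl⟩ := headTail_surjective q
  exact Set.mem_preimage.2 ((w₃_headTail Q).symm ▸ hq Q rfl)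

theorem prod_sum_eq_cubic {A : Type*} [CommRing A] [Algebra ℂ A] (κ κ' κ'' : Fin 2 → ℂ)
    (a : Fin 2 → A) : (∑ i, κ i • a i) * (∑ i, κ' i • a i) * (∑ i, κ'' i • a i) =
      cubic (fun i j k => κ i * κ' j * κ'' k) a := by
  simp only [cubic, Fin.sum_univ_two, Algebra.smul_def, map_mul]
  ring

/-- The local sections of `(S³Ω¹ ⊗ L⁴) ⊠ 𝒪` are the cubic forms in the `du_i` with regular
coefficients, times the frame. -/
theorem exists_coord_of_mem_span_genW (hX : HasInverses X) (hXq : IsQuasiProjective X)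
    {p : ProdVar X (SymPow X m)} (hp : IsFrameAt L e p.fst) (hu : IsParamAt u p.fst)
    {t : ∀ q, FibW L m q} (ht : t ∈ Submodule.span ℂ (genW L m p)) :
    ∃ C : Fin 2 → Fin 2 → Fin 2 → ProdVar X (SymPow X m) → ℂ,
      (∀ i j k, IsRegularAt (C i j k) p) ∧
      ∀ᶠ q in 𝓝 p, t q = cubic (fun i j k => C i j k q) (symD u q.fst) ⊗ₜ frameW e q.fst := by
  have h0 := (isMorphismAt_fst p).continuousAt
  induction ht using Submodule.span_induction with
  | mem t ht =>
    obtain ⟨f, α, β, γ, a, b, c, d, hf, hα, hβ, hγ, ha, hb, hc, hd, rfl⟩ := ht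
    obtain ⟨A, hA, eA⟩ := (hp.2 a).1 ha
    obtain ⟨B, hB, eB⟩ := (hp.2 b).1 hb
    obtain ⟨C, hC, eC⟩ := (hp.2 c).1 hc
    obtain ⟨D, hD, eD⟩ := (hp.2 d).1 hd
    obtain ⟨κ, hκ, eκ⟩ := hu.exists_dAt_eq hX hXq hα
    obtain ⟨κ', hκ', eκ'⟩ := hu.exists_dAt_eq hX hXq hβ
    obtain ⟨κ'', hκ'', eκ''⟩ := hu.exists_dAt_eq hX hXq hγ
    have r0 : ∀ {g : X → ℂ}, IsRegularAt g p.fst →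
        IsRegularAt (fun q : ProdVar X (SymPow X m) => g q.fst) p :=
      fun hg => (isMorphismAt_fst p).comp _ hg
    refine ⟨fun i j k q => (f q * (A q.fst * B q.fst * (C q.fst * D q.fst))) *
      (κ i q.fst * κ' j q.fst * κ'' k q.fst), fun i j k => (hf.mul (((r0 hA).mul (r0 hB)).mul
        ((r0 hC).mul (r0 hD)))).mul (((r0 (hκ i)).mul (r0 (hκ' j))).mul (r0 (hκ'' k))), ?_⟩
    filter_upwards [h0.eventually eA, h0.eventually eB, h0.eventually eC, h0.eventually eD,
      h0.eventually eκ, h0.eventually eκ', h0.eventually eκ''] with q a1 a2 a3 a4 a5 a6 a7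
    have h1 := cubic_smul (f q * (A q.fst * B q.fst * (C q.fst * D q.fst)))
      (fun i j k => κ i q.fst * κ' j q.fst * κ'' k q.fst) (symD u q.fst)
    rw [a1, a2, a3, a4, a5, a6, a7, smul_tmul_four, h1, ← prod_sum_eq_cubic,
      TensorProduct.tmul_smul, smul_smul, TensorProduct.smul_tmul']
    simp only [map_sum, map_smul]
    rfl
  | zero =>
    refine ⟨fun _ _ _ _ => 0, fun _ _ _ => isRegularAt_const _, Eventually.of_forall fun q => ?_⟩
    simp [cubic]
  | add t t' _ _ h h' =>
    obtain ⟨T, hT, h1⟩ := h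
    obtain ⟨T', hT', h1'⟩ := h'
    refine ⟨fun i j k q => T i j k q + T' i j k q, fun i j k => (hT i j k).add (hT' i j k), ?_⟩
    filter_upwards [h1, h1'] with q e1 e2
    rw [Pi.add_apply, e1, e2, ← TensorProduct.add_tmul]
    exact congrArg (· ⊗ₜ[ℂ] _) (cubic_add _ _ _).symm
  | smul r t _ h =>
    obtain ⟨T, hT, h1⟩ := h
    refine ⟨fun i j k q => r * T i j k q, fun i j k => (hT i j k).const_mul r, ?_⟩
    filter_upwards [h1] with q e1
    rw [Pi.smul_apply, e1, TensorProduct.smul_tmul']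
    exact congrArg (· ⊗ₜ[ℂ] _) (cubic_smul _ _ _).symm

/-- The point `(x₁, π(z))` for `(x₁, x₂, x₃, z) ∈ X^{m+3}`. -/
def headPoint {X : Type} {m : ℕ} (q : Pow X (m + 3)) : ProdVar X (SymPow X m) :=
  ⟨q 0, toSym (tail q : Pow X m)⟩

theorem isMorphismAt_headPoint (q : Pow X (m + 3)) : IsMorphismAt headPoint q :=
  isMorphismAt_prodVar (hasInverses_pow _) (isMorphismAt_proj 0 q)
    ((isMorphismAt_toSym _).trans (isMorphismAt_reindex (fun i => i.succ.succ.succ) q))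

/-- On the triple diagonal near the point `p` of `X^{m+3}`, the section `ω` is a cubic form with
regular coefficients. -/
theorem exists_cubic_eq (hX : HasInverses X) (hXq : IsQuasiProjective X)
    (hXs : IsSmoothSurface X) {c : Chart X} (hω : ω ∈ (sheafW L m).sec U) {p : Pow X (m + 3)}
    (hp : toSym p ∈ U) (hc : p 0 ∈ c.V) (he : IsFrameAt L e (p 0)) :
    ∃ (u : Fin 2 → X → ℂ) (f : Fin 2 → Fin 2 → Fin 2 → Pow X (m + 3) → ℂ),
      (∀ i, ∀ x ∈ c.V, IsRegularAt (u i) x) ∧ (∀ i j k, IsRegularAt (f i j k) p) ∧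
      ∀ᶠ q in 𝓝 p, q 0 = q 1 → q 1 = q 2 → ∀ h : w₃ (headPoint q) ∈ U,
        ω ⟨headPoint q, h⟩ =
          cubic (fun i j k => f i j k q) (symD u (q 0)) ⊗ₜ[ℂ] frameW e (q 0) := by
  by_cases h01 : p 0 = p 1
  swap
  · refine ⟨0, 0, fun _ _ _ => isRegularAt_const 0, fun _ _ _ => isRegularAt_const 0, ?_⟩
    filter_upwards [eventually_ne hXq h01] with q h h' using absurd h' h
  by_cases h12 : p 1 = p 2
  swap
  · refine ⟨0, 0, fun _ _ _ => isRegularAt_const 0, fun _ _ _ => isRegularAt_const 0, ?_⟩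
    filter_upwards [eventually_ne hXq h12] with q h _ h' using absurd h' h
  obtain ⟨u, hu, hup⟩ := exists_isParamAt hXs hc
  have hpt : DiagPt.toPow ⟨p 0, p 0, tail p⟩ = p := by
    conv_rhs => rw [← DiagPt.toPow_ofPow h01]
    exact congrArg (fun w => DiagPt.toPow (⟨p 0, w, tail p⟩ : DiagPt X m)) (h01.trans h12)
  have hpU : w₃ (headPoint p) ∈ U := by
    have h1 : w₃ (headPoint p) = toSym (DiagPt.toPow ⟨p 0, p 0, tail p⟩) := w₃_toSym _ _
    rw [h1, hpt]
    exact hp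
  obtain ⟨t, ht, e1⟩ := hω (headPoint p) hpU
  rw [inf_of_le_left (tendsto_iff_comap.1 (continuousAt_w₃ hXq (headPoint p)).tendsto)] at e1
  obtain ⟨C, hC, e2⟩ := exists_coord_of_mem_span_genW hX hXq (p := headPoint p) he hup ht
  refine ⟨u, fun i j k q => C i j k (headPoint q), hu, fun i j k =>
    (isMorphismAt_headPoint p).comp _ (hC i j k), ?_⟩
  filter_upwards [(isMorphismAt_headPoint p).continuousAt.eventually (e1.and e2)] with q h1 _ _ h
  exact (h1.1 h).trans h1.2

end Surjective

section SurjectiveGlue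

variable {X : Type} [FunctionSpace X] {L : LineBundle X} {m : ℕ} {e : ∀ x, L.Fib x}
  {U V : Opens (SymPow X (m + 3))}
  {ω : ∀ p : {p : ProdVar X (SymPow X m) // w₃ p ∈ U}, FibW L m p.1}

/-- The family `∑ f_k g_k h_k • (dα_k ⊗ e³(x) e(w))`. -/
def formSum {κ : Type} [Fintype κ] (e : ∀ x, L.Fib x) (f g h : κ → Pow X (m + 3) → ℂ)
    (α : κ → X → ℂ) (V : Opens (SymPow X (m + 3))) :
    ∀ p : {p : DiagPt X m // toSym p.toPow ∈ V}, FibK L m p.1 := fun p =>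
  ∑ k, (f k p.1.toPow * g k p.1.toPow * h k p.1.toPow) • (dAt (α k) p.1.x ⊗ₜ frameK e p.1)

/-- If `g_k`, `h_k` vanish on `Δ₂₃`, the family is a section of `𝒦¹_{(1)(1)}(-2Δ)`. -/
theorem formSum_mem {κ : Type} [Fintype κ] {f g h : κ → Pow X (m + 3) → ℂ} {α : κ → X → ℂ}
    (he : ∀ q : Pow X (m + 3), toSym q ∈ V → ∀ i, IsFrameAt L e (q i))
    (hf : ∀ q : Pow X (m + 3), toSym q ∈ V → q 0 = q 1 → ∀ k, IsRegularAt (f k) q ∧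
      InIdeal (g k) q (diagIdeal 1 2 q) ∧ InIdeal (h k) q (diagIdeal 1 2 q))
    (hα : ∀ q : Pow X (m + 3), toSym q ∈ V → ∀ k, IsRegularAt (α k) (q 0))
    (hinv : formSum e f g h α V ∈ invK L m V) :
    formSum e f g h α V ∈ (sheafK L m 2).sec V := by
  refine ⟨mem_localSec_genK fun p hp => ⟨κ, inferInstance,
    fun k q => f k q * g k q * h k q, α, e, ⟨he _ hp 0, he _ hp 2⟩, fun k => ?_, hα _ hp, ?_⟩, hinv⟩
  · obtain ⟨h1, h2, h3⟩ := hf _ hp rfl k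
    refine (((h2.mul h3).mono (pow_two _).ge).mul_left h1).congr (Eventually.of_forall fun q => ?_)
    exact (mul_assoc _ _ _).symm
  · exact Eventually.of_forall fun q hq => rfl

theorem psiFam_formSum (hX : HasInverses X) (hXq : IsQuasiProjective X) (hXs : IsSmoothSurface X)
    {κ : Type} [Fintype κ] {f g h : κ → Pow X (m + 3) → ℂ} {α : κ → X → ℂ}
    (he : ∀ q : Pow X (m + 3), toSym q ∈ V → ∀ i, IsFrameAt L e (q i))
    (hf : ∀ q : Pow X (m + 3), toSym q ∈ V → q 0 = q 1 → ∀ k, IsRegularAt (f k) q ∧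
      InIdeal (g k) q (diagIdeal 1 2 q) ∧ InIdeal (h k) q (diagIdeal 1 2 q))
    (hα : ∀ q : Pow X (m + 3), toSym q ∈ V → ∀ k, IsRegularAt (α k) (q 0))
    (hinv : formSum e f g h α V ∈ invK L m V) {x : X} {z : Fin m → X}
    (hx : w₃ ⟨x, toSym z⟩ ∈ V) :
    psiFam (formSum e f g h α V) ⟨⟨x, toSym z⟩, hx⟩ =
      ∑ k, f k (DiagPt.toPow ⟨x, x, z⟩) •
        ((SymmetricAlgebra.ι ℂ (CotSpace x) (dAt (α k) x) *
            SymmetricAlgebra.ι ℂ (CotSpace x)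
              (dAt (fun y => g k (DiagPt.toPow ⟨x, y, z⟩)) x) *
            SymmetricAlgebra.ι ℂ (CotSpace x)
              (dAt (fun y => h k (DiagPt.toPow ⟨x, y, z⟩)) x)) ⊗ₜ[ℂ] frameW e x) := by
  have hx' : toSym (DiagPt.toPow ⟨x, x, z⟩) ∈ V := w₃_toSym x z ▸ hx
  have hr := (he _ hx' 0).isRegularSectionAt
  exact psiFam_eq hX hXq hXs hinv hx' hx f g h α (fun _ => e) (fun _ => e) (fun _ => e)
    (fun _ => e) (hf _ hx' rfl) (fun k => ⟨hα _ hx' k, hr, hr, hr, hr⟩)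
    (Eventually.of_forall fun q hq => rfl)

theorem congr_snd {x : X} {t t' : SymPow X m} (h : t = t') (hx : w₃ ⟨x, t⟩ ∈ U)
    (hx' : w₃ ⟨x, t'⟩ ∈ U) : ω ⟨⟨x, t⟩, hx⟩ = ω ⟨⟨x, t'⟩, hx'⟩ := by
  subst h
  rfl

/-- Local surjectivity of `ψ`. Near each point `p` of the fibre, `ω = ∑ f_ijk du_i du_j du_k`, and the
preimage is the average over the permutations of the last `m` points of the sum over `p` of the
`a_p b_p f_ijk W_j W_k du_i`, where the parameters `u` depend on `p`. The image of this average at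
`(x, π(z))` is `ω` times the average of `∑ a_p b_p = 1`. -/
theorem exists_psiFam_eq_restrictFamily (hX : HasInverses X) (hXq : IsQuasiProjective X)
    (hXs : IsSmoothSurface X) (hω : ω ∈ (sheafW L m).sec U) {t : SymPow X (m + 3)} (ht : t ∈ U) :
    ∃ (V : Opens (SymPow X (m + 3))) (hVU : V ≤ U), t ∈ V ∧ ∃ τ ∈ (sheafK L m 2).sec V,
      psiFam τ = restrictFamily (Fib := FibW L m) hVU ω := by
  obtain ⟨e, he⟩ := exists_frame_fibre (L := L) hX hXq t
  obtain ⟨c, hc⟩ := exists_chart_fibre hXq t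
  have h1 : ∀ p : Pow X (m + 3), ∃ (u : Fin 2 → X → ℂ)
      (f : Fin 2 → Fin 2 → Fin 2 → Pow X (m + 3) → ℂ), toSym p = t →
      (∀ i, ∀ x ∈ c.V, IsRegularAt (u i) x) ∧ (∀ i j k, IsRegularAt (f i j k) p) ∧
      ∀ᶠ q in 𝓝 p, q 0 = q 1 → q 1 = q 2 → ∀ h : w₃ (headPoint q) ∈ U,
        ω ⟨headPoint q, h⟩ =
          cubic (fun i j k => f i j k q) (symD u (q 0)) ⊗ₜ[ℂ] frameW e (q 0) := fun p => by
    by_cases hp : toSym p = t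
    · obtain ⟨u, f, h⟩ := exists_cubic_eq hX hXq hXs hω (hp ▸ ht) (hc p hp 0)
        (he.self_of_nhds p hp 0)
      exact ⟨u, f, fun _ => h⟩
    · exact ⟨0, 0, fun h => absurd h hp⟩
  choose u f huf using h1
  obtain ⟨P, a, b, k, hP, hV⟩ := exists_partition hc (fun p hp => (huf p hp).2.2)
    (ι := Fin 2 × Fin 2 × Fin 2) (f := fun p i => f p i.1 i.2.1 i.2.2)
    fun p hp i => (huf p hp).2.1 _ _ _
  obtain ⟨V, hVU, htV, hV⟩ := exists_opens_of_eventually ht (he.and hV)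
  have he' : ∀ q : Pow X (m + 3), toSym q ∈ V → ∀ i, IsFrameAt L e (q i) :=
    fun q hq => (hV _ hq).1 q rfl
  replace hV := fun (q : Pow X (m + 3)) (hq : toSym q ∈ V) => (hV _ hq).2 q rfl
  let N : ℂ := (Fintype.card (Equiv.Perm (Fin m)) : ℂ)⁻¹
  let F : Equiv.Perm (Fin m) × P × Fin 2 × Fin 2 × Fin 2 → Pow X (m + 3) → ℂ := fun κ q =>
    N * (a κ.2.1 (permPow κ.1 q) * k κ.2.1 κ.2.2 (permPow κ.1 q))
  let G₁ : Equiv.Perm (Fin m) × P × Fin 2 × Fin 2 × Fin 2 → Pow X (m + 3) → ℂ := fun κ =>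
    coordDiff (u κ.2.1) 1 2 κ.2.2.2.1
  let G₂ : Equiv.Perm (Fin m) × P × Fin 2 × Fin 2 × Fin 2 → Pow X (m + 3) → ℂ := fun κ =>
    coordDiff (u κ.2.1) 1 2 κ.2.2.2.2
  let α : Equiv.Perm (Fin m) × P × Fin 2 × Fin 2 × Fin 2 → X → ℂ := fun κ => u κ.2.1 κ.2.2.1
  have hu : ∀ p : P, ∀ i, ∀ x ∈ c.V, IsRegularAt (u p i) x := fun p => (huf p (hP p p.2)).1
  have hW : ∀ q : Pow X (m + 3), toSym q ∈ V → ∀ (p : P) j,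
      InIdeal (coordDiff (u p) 1 2 j) q (diagIdeal 1 2 q) := fun q hq p j =>
    inIdeal_coordDiff (fun k => hu p k _ ((hV q hq).1 1)) (fun k => hu p k _ ((hV q hq).1 2)) j
  have hF : ∀ q : Pow X (m + 3), toSym q ∈ V → q 0 = q 1 → ∀ κ, IsRegularAt (F κ) q ∧
      InIdeal (G₁ κ) q (diagIdeal 1 2 q) ∧ InIdeal (G₂ κ) q (diagIdeal 1 2 q) := by
    intro q hq _ κ
    have h1 := (hV (permPow κ.1 q) ((toSym_permPow κ.1 q).symm ▸ hq)).2.2 κ.2.1 κ.2.1.2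
    have hσ := isMorphismAt_permPow κ.1 q
    exact ⟨((hσ.comp _ h1.1).mul (hσ.comp _ (h1.2.2.1 κ.2.2).1)).const_mul N, hW q hq _ _,
      hW q hq _ _⟩
  have hα : ∀ q : Pow X (m + 3), toSym q ∈ V → ∀ κ, IsRegularAt (α κ) (q 0) := fun q hq κ =>
    hu _ _ _ ((hV q hq).1 0)
  have hinv : formSum e F G₁ G₂ α V ∈ invK L m V := by
    intro x w z σ h h'
    refine Fintype.sum_equiv ((Equiv.mulLeft σ).prodCongr (Equiv.refl _)) _ _ fun κ => ?_
    rfl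
  refine ⟨V, hVU, htV, _, formSum_mem he' hF hα hinv, ?_⟩
  funext ⟨⟨x, t'⟩, hx⟩
  obtain ⟨z, rfl⟩ : ∃ z : Fin m → X, toSym (z : Pow X m) = t' := toSym_surjective t'
  rw [psiFam_formSum hX hXq hXs he' hF hα hinv hx]
  have hx' : toSym (DiagPt.toPow ⟨x, x, z⟩) ∈ V := w₃_toSym x z ▸ hx
  have hd : ∀ (p : P) j, dAt (fun y => coordDiff (u p) 1 2 j
      (DiagPt.toPow (⟨x, y, z⟩ : DiagPt X m))) x = dAt (u p j) x := fun p j => by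
    change dAt (fun y => u p j y - u p j x) x = _
    rw [dAt_sub (hu p j x ((hV _ hx').1 0)) (isRegularAt_const _), dAt_const, sub_zero]
  have hsum : ∀ (σ : Equiv.Perm (Fin m)) (p : P), ∑ i : Fin 2 × Fin 2 × Fin 2,
      (N * (a p (permPow σ (DiagPt.toPow ⟨x, x, z⟩)) *
        k p i (permPow σ (DiagPt.toPow ⟨x, x, z⟩)))) •
        ((symD (u p) x i.1 * symD (u p) x i.2.1 * symD (u p) x i.2.2) ⊗ₜ[ℂ] frameW e x) =
      (N * (a p (permPow σ (DiagPt.toPow ⟨x, x, z⟩)) * b p (permPow σ (DiagPt.toPow ⟨x, x, z⟩)))) •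
        ω ⟨⟨x, toSym z⟩, hVU hx⟩ := by
    intro σ p
    have hq : toSym (permPow σ (DiagPt.toPow ⟨x, x, z⟩)) ∈ V := (toSym_permPow σ _).symm ▸ hx'
    obtain ⟨-, -, h3, h4, h5⟩ := (hV _ hq).2.2 p p.2
    -- where `a p ≠ 0` the expression of `ω` with the coefficients `f p` is valid
    by_cases h0 : a p (permPow σ (DiagPt.toPow ⟨x, x, z⟩)) = 0
    · simp [h0]
    have h6 : toSym (z : Pow X m) = toSym (fun i => z (σ i) : Pow X m) :=
      toSym_eq_iff.2 ⟨σ, rfl⟩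
    have h7 : w₃ ⟨x, toSym (fun i => z (σ i) : Pow X m)⟩ ∈ U := h6 ▸ hVU hx
    have h8 : ω ⟨⟨x, toSym z⟩, hVU hx⟩ = cubic (fun i j k =>
        f p i j k (permPow σ (DiagPt.toPow ⟨x, x, z⟩))) (symD (u p) x) ⊗ₜ[ℂ] frameW e x :=
      (congr_snd (ω := ω) h6 (hVU hx) h7).trans (h5 h0 rfl rfl h7)
    rw [h8]
    simp only [cubic, Fintype.sum_prod_type, TensorProduct.sum_tmul, Finset.smul_sum,
      ← TensorProduct.smul_tmul', smul_smul]
    refine Finset.sum_congr rfl fun i _ => Finset.sum_congr rfl fun j _ =>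
      Finset.sum_congr rfl fun l _ => congrArg (· • _) ?_
    rw [(h3 (i, j, l)).2]
    ring
  have hN : N * Fintype.card (Equiv.Perm (Fin m)) = 1 := inv_mul_cancel₀ card_perm_ne_zero
  have h9 : ∑ σ : Equiv.Perm (Fin m), ∑ p : P, ∑ i : Fin 2 × Fin 2 × Fin 2,
      (N * (a p (permPow σ (DiagPt.toPow ⟨x, x, z⟩)) *
        k p i (permPow σ (DiagPt.toPow ⟨x, x, z⟩)))) •
        ((symD (u p) x i.1 * symD (u p) x i.2.1 * symD (u p) x i.2.2) ⊗ₜ[ℂ] frameW e x) =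
      ω ⟨⟨x, toSym z⟩, hVU hx⟩ := by
    simp only [hsum, ← Finset.sum_smul, ← Finset.mul_sum]
    have h10 : ∀ σ : Equiv.Perm (Fin m), ∑ p : P, a p (permPow σ (DiagPt.toPow ⟨x, x, z⟩)) *
        b p (permPow σ (DiagPt.toPow ⟨x, x, z⟩)) = 1 := fun σ => by
      have hq : toSym (permPow σ (DiagPt.toPow ⟨x, x, z⟩)) ∈ V := (toSym_permPow σ _).symm ▸ hx'
      rw [← (hV _ hq).2.1]
      exact Finset.sum_coe_sort P fun p => a p _ * b p _
    simp only [h10, Finset.sum_const, Finset.card_univ, nsmul_eq_mul, mul_one, hN, one_smul]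
  refine Eq.trans ?_ h9
  rw [Fintype.sum_prod_type]
  refine Finset.sum_congr rfl fun σ _ => ?_
  rw [Fintype.sum_prod_type]
  refine Finset.sum_congr rfl fun p _ => Finset.sum_congr rfl fun i _ => ?_
  simp only [G₁, G₂, hd]
  rfl

theorem isSurjective_psiHom (hX : HasInverses X) (hXq : IsQuasiProjective X)
    (hXs : IsSmoothSurface X) : (psiHom L m hX hXq hXs).IsSurjective := by
  intro U ω t ht
  obtain ⟨V, hVU, htV, τ, hτ, e1⟩ := exists_psiFam_eq_restrictFamily hX hXq hXs ω.2 ht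
  exact ⟨V, hVU, htV, ⟨τ, hτ⟩, Subtype.ext e1⟩

end SurjectiveGlue

/-! ### Multiplication by functions -/

section Modules

variable {S : Type} [FunctionSpace S] {Pt : Type} {proj : Pt → S} {N : Pt → Filter Pt}
  {Fib : Pt → Type} [∀ p, AddCommGroup (Fib p)] [∀ p, Module ℂ (Fib p)]
  {gen : Pt → Set (∀ q, Fib q)}

/-- Sections are stable under multiplication by functions which preserve the generators. -/
theorem smul_mem_localSec {U : Opens S} {s : ∀ p : {p // proj p ∈ U}, Fib p.1}
    (hs : s ∈ localSec proj N gen U) {g : Pt → ℂ}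
    (hg : ∀ p, proj p ∈ U → ∀ t ∈ gen p, (fun q => g q • t q) ∈ gen p) :
    (fun p => g p.1 • s p) ∈ localSec proj N gen U := by
  intro p hp
  obtain ⟨t, ht, e⟩ := hs p hp
  let M : (∀ q, Fib q) →ₗ[ℂ] ∀ q, Fib q :=
    { toFun := fun t q => g q • t q
      map_add' := fun t t' => funext fun q => smul_add _ _ _
      map_smul' := fun r t => funext fun q => smul_comm _ _ _ }
  have h : Submodule.map M (Submodule.span ℂ (gen p)) ≤ Submodule.span ℂ (gen p) :=
    Submodule.map_span_le M _ _ |>.2 fun t ht => Submodule.subset_span (hg p hp t ht)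
  refine ⟨M t, h ⟨t, ht, rfl⟩, ?_⟩
  filter_upwards [e] with q hq hqU
  rw [hq hqU]
  rfl

variable {X : Type} [FunctionSpace X] {L : LineBundle X} {m : ℕ} {U : Opens (SymPow X (m + 3))}

theorem smul_mem_invL {s : ∀ p : {p : Triple X m // toSym p.toPow ∈ U}, FibL L m p.1}
    (hs : s ∈ invL L m U) (f : SymPow X (m + 3) → ℂ) :
    (fun p => f (toSym p.1.toPow) • s p) ∈ invL L m U := by
  refine ⟨fun x₁ x₂ x₃ z h h' => ?_, fun x₁ x₂ x₃ z σ h h' => ?_⟩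
  · have h1 : f (toSym (Triple.toPow ⟨x₁, x₃, x₂, z⟩)) = f (toSym (Triple.toPow ⟨x₁, x₂, x₃, z⟩)) :=
      congrArg f (toSym_swap x₁ x₂ x₃ z)
    change f (toSym (Triple.toPow ⟨x₁, x₃, x₂, z⟩)) • s ⟨⟨x₁, x₃, x₂, z⟩, h'⟩ =
      LinearMap.lTensor _ _
        (f (toSym (Triple.toPow ⟨x₁, x₂, x₃, z⟩)) • s ⟨⟨x₁, x₂, x₃, z⟩, h⟩)
    rw [map_smul, h1, hs.1 x₁ x₂ x₃ z h h']
  · have h1 : f (toSym (Triple.toPow ⟨x₁, x₂, x₃, fun i => z (σ i)⟩)) =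
      f (toSym (Triple.toPow ⟨x₁, x₂, x₃, z⟩)) := congrArg f (toSym_perm x₁ x₂ x₃ z σ)
    exact congrArg₂ (fun (r : ℂ) (v : FibL L m ⟨x₁, x₂, x₃, z⟩) => r • v) h1
      (hs.2 x₁ x₂ x₃ z σ h h')

theorem smul_mem_invK {s : ∀ p : {p : DiagPt X m // toSym p.toPow ∈ U}, FibK L m p.1}
    (hs : s ∈ invK L m U) (f : SymPow X (m + 3) → ℂ) :
    (fun p => f (toSym p.1.toPow) • s p) ∈ invK L m U := by
  intro x w z σ h h'
  have h1 : f (toSym (DiagPt.toPow ⟨x, w, fun i => z (σ i)⟩)) =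
    f (toSym (DiagPt.toPow ⟨x, w, z⟩)) := congrArg f (toSym_perm x x w z σ)
  exact congrArg₂ (fun (r : ℂ) (v : FibK L m ⟨x, w, z⟩) => r • v) h1 (hs x w z σ h h')

variable (L m)

theorem isOModule_sheafL (l : ℕ) : (sheafL L m l).IsOModule := by
  intro U f hf s hs
  refine ⟨smul_mem_localSec hs.1 (g := fun p : Triple X m => f (toSym p.toPow)) ?_,
    smul_mem_invL hs.2 f⟩
  rintro p hp _ ⟨F, a, b, c, d, hF, ha, hb, hc, hd, rfl⟩
  exact ⟨fun q => f (toSym q) * F q, a, b, c, d,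
    hF.mul_left ((isMorphismAt_toSym _).comp f (hf _ hp)), ha, hb, hc, hd,
    funext fun q => smul_smul _ _ _⟩

theorem isOModule_sheafK (l : ℕ) : (sheafK L m l).IsOModule := by
  intro U f hf s hs
  refine ⟨smul_mem_localSec hs.1 (g := fun p : DiagPt X m => f (toSym p.toPow)) ?_,
    smul_mem_invK hs.2 f⟩
  rintro p hp _ ⟨F, α, a, b, c, d, hF, hα, ha, hb, hc, hd, rfl⟩
  exact ⟨fun q => f (toSym q) * F q, α, a, b, c, d,
    hF.mul_left ((isMorphismAt_toSym _).comp f (hf _ hp)), hα, ha, hb, hc, hd,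
    funext fun q => smul_smul _ _ _⟩

theorem isOModule_sheafW (hXq : IsQuasiProjective X) : (sheafW L m).IsOModule := by
  intro U f hf s hs
  refine smul_mem_localSec hs (g := fun p : ProdVar X (SymPow X m) => f (w₃ p)) ?_
  rintro p hp _ ⟨F, α, β, γ, a, b, c, d, hF, hα, hβ, hγ, ha, hb, hc, hd, rfl⟩
  have h1 : IsRegularAt (fun p => f (w₃ p)) p := isRegularAt_of_headTail hXq fun Q hQ => by
    subst hQ
    simp only [w₃_headTail]
    exact (isMorphismAt_thickDiag Q).comp (fun q => f (toSym q))
      ((isMorphismAt_toSym _).comp f (hf _ (w₃_headTail Q ▸ hp)))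
  exact ⟨fun q => f (w₃ q) * F q, α, β, γ, a, b, c, d, h1.mul hF, hα, hβ, hγ, ha, hb, hc, hd,
    funext fun q => smul_smul _ _ _⟩

end Modules

end ClassicalVariety

open ClassicalVariety

theorem mainTheorem11 {X : Type} [FunctionSpace X] (hX : IsQuasiProjective X)
    (hX' : IsSmoothSurface X) (L : LineBundle X) (m : ℕ) :
    ((sheafL L m 2).IsOModule ∧ (sheafL L m 1).IsOModule ∧ (sheafK L m 2).IsOModule ∧
      (sheafW L m).IsOModule) ∧
    ∃ (ι : SectionSheaf.Hom (sheafL L m 2) (sheafL L m 1))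
      (δ : SectionSheaf.Hom (sheafL L m 1) (sheafK L m 2))
      (ψ : SectionSheaf.Hom (sheafK L m 2) (sheafW L m)),
      IsInclusion ι ∧ IsDiagDifferential δ ∧ IsSymSecondDifferential ψ ∧
      ι.IsInjective ∧ SectionSheaf.IsExactAt ι δ ∧ SectionSheaf.IsExactAt δ ψ ∧
      ψ.IsSurjective := by
  have hinv : HasInverses X := hasInverses_of_isLocalRing fun x => (hX' x).1.toIsLocalRing
  exact ⟨⟨isOModule_sheafL L m 2, isOModule_sheafL L m 1, isOModule_sheafK L m 2,
    isOModule_sheafW L m hX⟩, inclusionHom L m, deltaHom hinv hX hX' L m, psiHom L m hinv hX hX',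
    isInclusion_inclusionHom, isDiagDifferential_deltaHom hinv hX hX',
    isSymSecondDifferential_psiHom hinv hX hX', isInjective_inclusionHom,
    isExactAt_inclusionHom hinv hX hX', isExactAt_deltaHom hinv hX hX',
    isSurjective_psiHom hinv hX hX'⟩
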